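/- **Setting.** Let $d\ge 0$, let $\mathbf n=(n_1,\dots,n_d)$ be a vector of positive integers, $N=\prod_{k=1}^d n_k$ (so $N=1$ if $d=0$), and $q\ge 2$. A word of size $\mathbf n$ is an array $w=(w_{\mathbf p})$ of size $n_1\times\dots\times n_d$ with entries in $\Sigma=\{1,\dots,q\}$ (a $0$-dimensional word is a symbol). The group $Z_{\mathbf n}=\mathbb Z_{n_1}\times\dots\times\mathbb Z_{n_d}$ acts by translations, $(\langle w\rangle_r)_{\mathbf p}=w_{\mathbf p+r}$; a necklace is an orbit, and $\mathcal N_q^{\mathbf n}$ is the set of necklaces. Translations $g$ (with $0\le g_k<n_k$) are ordered by the index $\sum_k g_k\prod_{j<k}n_j$. The $j$-th slice $w_j$ of $w$ is the $(d-1)$-dimensional word obtained by fixing the last coordinate to be $j$. Words are ordered recursively: $0$-dimensional words are ordered as symbols, and for $d\ge1$, if $j$ is the smallest index with $w_j\ne u_j$, then $w<u$ if and only if either $\langle w_j\rangle<\langle u_j\rangle$, or $\langle w_j\rangle=\langle u_j\rangle$ and the smallest translation taking $w_j$ to $\langle w_j\rangle$ has smaller index than the smallest translation taking $u_j$ to $\langle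 u_j\rangle$. Here $\langle v\rangle$ denotes the smallest translate of $v$; the smallest word in a necklace is its canonical representation. Necklaces are ordered by their canonical representations, and the $i$-th necklace, $0\le i<|\mathcal N_q^{\mathbf n}|$, is the one with exactly $i$ smaller necklaces. **Model.** Programs (with assignments, conditionals and while loops) run on a random access machine; every arithmetic operation ($+$, truncated $-$, $\times$, integer division), memory access, assignment and test costs one step, and all values that occur must be smaller than $\big((d+2)\,q^{N}\big)^{C}$, i.e. have $O(\log (d+2)+N\log q)$ bits. **Theorem.** There are a program $P$ and a constant $C$ such that for all $d$, $\mathbf n$, $q\ge2$ and $0\le i<|\mathcal N_q^{\mathbf n}|$, the program $P$, started on the input $(d,\mathbf n,q,i)$, halts and outputs (as an array of $N$ symbols) the canonical representation of the $i$-th necklace in $\mathcal N_q^{\mathbf n}$, with the above bound on the values. Its number $t$ of steps satisfies $$t\le C\cdot N^{6(d+1)}\cdot(\log_2 q)^d\quad\text{if } N\ge2,$$ and in every case (also if $N=1$) $t\le C\,(d+1)\,N^{6(d+1)}(\log_2 q)^d$. In particular, the $i$-th necklace in $\mathcal N_q^{\mathbf n}$ can be unranked in time $O\big(N^{6(d+1)}\log^d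 q\big)$. -/

import Mathlib

/-! ## Multidimensional words and necklaces -/

namespace MDWord

/-- Positions in an array of size `n = (n 0, …, n (d-1))`, counted from `0`.
Since addition in `Fin m` is modulo `m`, this is also the set `Z_n` of translations. -/
abbrev Pos {d : ℕ} (n : Fin d → ℕ) : Type := ∀ k, Fin (n k)

/-- `d`-dimensional words of size `n` over the alphabet `{1, …, q}`; the symbol `s` is
represented by the element `s - 1` of `Fin q`. -/
abbrev Word {d : ℕ} (n : Fin d → ℕ) (q : ℕ) : Type := Pos n → Fin q

/-- The translation `⟨w⟩_r`, with symbol `w_(p + r)` at position `p`. -/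
def translate {d : ℕ} {n : Fin d → ℕ} {q : ℕ} (r : Pos n) (w : Word n q) : Word n q :=
  fun p => w (p + r)

/-- The index `∑ k, g k * ∏_(j < k) n j` of a translation (or position). -/
def posIndex {d : ℕ} {n : Fin d → ℕ} (g : Pos n) : ℕ :=
  ∑ k, (g k : ℕ) * ∏ j ∈ Finset.Iio k, n j

/-- The index of the smallest translation `g` with `⟨u⟩_g = s`. -/
noncomputable def transIndex {d : ℕ} {n : Fin d → ℕ} {q : ℕ} (u s : Word n q) : ℕ :=
  sInf {m | ∃ g : Pos n, translate g u = s ∧ posIndex g = m}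

/-- The `j`-th slice: the last coordinate is fixed to be `j`. -/
def slice {d : ℕ} {n : Fin (d + 1) → ℕ} {q : ℕ} (w : Word n q) (j : Fin (n (Fin.last d))) :
    Word (fun k : Fin d => n k.castSucc) q :=
  fun p => w (Fin.snoc (α := fun k => Fin (n k)) p j)

/-- The smallest element of the set `S` for the strict order `R`
(the default `a` is returned only if there is none). -/
noncomputable def least {α : Type} (R : α → α → Prop) (S : Set α) (a : α) : α :=
  @Classical.epsilon α ⟨a⟩ fun c => c ∈ S ∧ ∀ x ∈ S, x ≠ c → R c x

/-- The smallest translate of `w` for the strict order `R`. -/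
noncomputable def canonWith {d : ℕ} {n : Fin d → ℕ} {q : ℕ} (R : Word n q → Word n q → Prop)
    (w : Word n q) : Word n q :=
  least R {v | ∃ r, translate r w = v} w

/-- The strict order on words of size `n`. In dimension `0` it is the order of the symbols.
In dimension `d + 1`, at the first index `j` at which the slices differ, the canonical
representations of the two slices are compared, and, if these agree, the indices of the smallest
translations that take the slices to their canonical representation. -/
def lt : {d : ℕ} → {n : Fin d → ℕ} → {q : ℕ} → Word n q → Word n q → Prop
  | 0, _, _, w, u => w (fun k => k.elim0) < u (fun k => k.elim0)
  | _ + 1, _, _, w, u =>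
      ∃ j, (∀ i < j, slice w i = slice u i) ∧ slice w j ≠ slice u j ∧
        (lt (canonWith lt (slice w j)) (canonWith lt (slice u j)) ∨
          canonWith lt (slice w j) = canonWith lt (slice u j) ∧
            transIndex (slice w j) (canonWith lt (slice w j)) <
              transIndex (slice u j) (canonWith lt (slice u j)))

/-- Words are equivalent if they are translates of each other. -/
def translationSetoid {d : ℕ} (n : Fin d → ℕ) [∀ k, NeZero (n k)] (q : ℕ) :
    Setoid (Word n q) where
  r u v := ∃ r, translate r u = v
  iseqv :=
    { refl := fun u => ⟨0, funext fun p => congrArg u (funext fun k => add_zero (p k))⟩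
      symm := by
        rintro u v ⟨r, rfl⟩
        exact ⟨-r, funext fun p => congrArg u (funext fun k => neg_add_cancel_right (p k) (r k))⟩
      trans := by
        rintro u v w ⟨r, rfl⟩ ⟨s, rfl⟩
        exact ⟨s + r, funext fun p => congrArg u
          (funext fun k => (add_assoc (p k) (s k) (r k)).symm)⟩ }

/-- The set of necklaces of size `n` over an alphabet of size `q`. -/
def Necklace {d : ℕ} (n : Fin d → ℕ) [∀ k, NeZero (n k)] (q : ℕ) : Type :=
  Quotient (translationSetoid n q)

/-- The canonical representation of a necklace: the smallest word in the class. -/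
noncomputable def Necklace.canon {d : ℕ} {n : Fin d → ℕ} [∀ k, NeZero (n k)] {q : ℕ}
    (x : Necklace n q) : Word n q :=
  least lt {v | Quotient.mk (translationSetoid n q) v = x} (Quotient.out x)

/-- The rank of a necklace: the number of necklaces with a smaller canonical representation. -/
noncomputable def Necklace.rank {d : ℕ} {n : Fin d → ℕ} [∀ k, NeZero (n k)] {q : ℕ}
    (x : Necklace n q) : ℕ :=
  Nat.card {y : Necklace n q // lt y.canon x.canon}

end MDWord

/-! ## Random access machine programs with unit-cost operations on bounded integers

A program is a finite structured command. It works on scalar variables and on finitely many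
arrays, both named by numbers that are fixed in the program; array cells are addressed by computed
values. Every literal, variable access, array access, arithmetic operation, assignment and test
costs one step. All values must stay below the bound `W`. -/

namespace RAM

/-- Arithmetic operations on natural numbers: sum, truncated difference, product, and quotient
rounded down. -/
inductive Op
  | plus
  | minus
  | times
  | quot

def Op.eval : Op → ℕ → ℕ → ℕ
  | .plus, a, b => a + b
  | .minus, a, b => a - b
  | .times, a, b => a * b
  | .quot, a, b => a / b

inductive Expr
  | lit (k : ℕ)
  | var (x : ℕ)
  | read (a : ℕ) (e : Expr)
  | bin (o : Op) (e f : Expr)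

inductive Cmd
  | skip
  | assign (x : ℕ) (e : Expr)
  | write (a : ℕ) (e f : Expr)
  | seq (c c' : Cmd)
  | cond (e : Expr) (c c' : Cmd)
  | loop (e : Expr) (c : Cmd)

/-- The scalar variables and the arrays. -/
structure State where
  var : ℕ → ℕ
  arr : ℕ → ℕ → ℕ

def Expr.eval (σ : State) : Expr → ℕ
  | .lit k => k
  | .var x => σ.var x
  | .read a e => σ.arr a (e.eval σ)
  | .bin o e f => o.eval (e.eval σ) (f.eval σ)

/-- The number of operations needed to evaluate an expression. -/
def Expr.cost : Expr → ℕ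
  | .lit _ => 1
  | .var _ => 1
  | .read _ e => e.cost + 1
  | .bin _ e f => e.cost + f.cost + 1

/-- All values that occur in the evaluation of an expression are less than `W`. -/
def Expr.Fits (W : ℕ) (σ : State) : Expr → Prop
  | .lit k => k < W
  | .var x => σ.var x < W
  | .read a e => e.Fits W σ ∧ σ.arr a (e.eval σ) < W
  | .bin o e f => e.Fits W σ ∧ f.Fits W σ ∧ o.eval (e.eval σ) (f.eval σ) < W

/-- `Exec W c σ t σ'`: started in the state `σ`, the command `c` halts in the state `σ'` after `t`
steps, and all values that occur are less than `W`. Tests and loop guards are true if nonzero. -/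
inductive Exec (W : ℕ) : Cmd → State → ℕ → State → Prop
  | skip (σ : State) : Exec W .skip σ 1 σ
  | assign (σ : State) (x : ℕ) (e : Expr) (he : e.Fits W σ) :
      Exec W (.assign x e) σ (e.cost + 1)
        { σ with var := Function.update σ.var x (e.eval σ) }
  | write (σ : State) (a : ℕ) (e f : Expr) (he : e.Fits W σ) (hf : f.Fits W σ) :
      Exec W (.write a e f) σ (e.cost + f.cost + 1)
        { σ with
          arr := Function.update σ.arr a (Function.update (σ.arr a) (e.eval σ) (f.eval σ)) }
  | seq {c c' : Cmd} {σ σ' σ'' : State} {t t' : ℕ} (h : Exec W c σ t σ')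
      (h' : Exec W c' σ' t' σ'') : Exec W (.seq c c') σ (t + t') σ''
  | cond_true {e : Expr} {c c' : Cmd} {σ σ' : State} {t : ℕ} (hf : e.Fits W σ)
      (he : e.eval σ ≠ 0) (h : Exec W c σ t σ') : Exec W (.cond e c c') σ (e.cost + 1 + t) σ'
  | cond_false {e : Expr} {c c' : Cmd} {σ σ' : State} {t : ℕ} (hf : e.Fits W σ)
      (he : e.eval σ = 0) (h : Exec W c' σ t σ') : Exec W (.cond e c c') σ (e.cost + 1 + t) σ'
  | loop_true {e : Expr} {c : Cmd} {σ σ' σ'' : State} {t t' : ℕ} (hf : e.Fits W σ)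
      (he : e.eval σ ≠ 0) (h : Exec W c σ t σ') (h' : Exec W (.loop e c) σ' t' σ'') :
      Exec W (.loop e c) σ (e.cost + 1 + t + t') σ''
  | loop_false {e : Expr} {c : Cmd} {σ : State} (hf : e.Fits W σ) (he : e.eval σ = 0) :
      Exec W (.loop e c) σ (e.cost + 1) σ

end RAM

namespace MDWord

/-- The input of the unranking problem: `d`, `q` and `i` are in the variables `0`, `1`, `2`, the
size `n` is in the first `d` cells of the array `0`, and everything else is `0`. -/
def unrankInput {d : ℕ} (n : Fin d → ℕ) (q i : ℕ) : RAM.State where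
  var x := if x = 0 then d else if x = 1 then q else if x = 2 then i else 0
  arr a j := if h : a = 0 ∧ j < d then n ⟨j, h.2⟩ else 0

/-- The array `1` holds the word `w`: the cell with the index of the position `p` contains the
symbol `w_p` of `{1, …, q}`. -/
def IsOutput {d : ℕ} {n : Fin d → ℕ} {q : ℕ} (σ : RAM.State) (w : Word n q) : Prop :=
  ∀ p : Pos n, σ.arr 1 (posIndex p) = (w p : ℕ) + 1

end MDWord

/-! Unranking is reduced to counting. Let `x` be the wanted necklace, `w` its canonical
representation and `J` the number of necklaces above `x`. If `U` consists of all necklaces above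
some bound, then `x` lies in `U` exactly if `U` contains more than `J` necklaces
(`canon_notMem_iff`), so every question whether `w` lies above a bound is answered by a count. The
order is recursive: `w` is determined, slice after slice, by the canonical representation of the
slice and by the index of the smallest translation leading to it. The canonical representation is
found by recursion on the dimension, down to single symbols, which are found by binary search. The
index is then obtained by counting how many bounds `v + 1` the slice respects. A bound in a low
dimension is lifted to the full dimension by `chain`; `Foci.mem_chain_zero` and
`Foci.mem_chain_above` say that the lifted bound asks about `w` what the original one asks about the
symbol or the index.

The count rests on three ideas. By Burnside (`sum_card_fixed`) it suffices to count, for each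
translation `g`, the words of an upward closed set that are fixed by `g`. Since the canonical
representation is the smallest translate, a word lies in `next f s Θ` exactly if all its translates
exceed the bound (`mem_next_iff`). When a word is read as a periodic sequence of slices, this
restricts the letter that may follow each occurrence of a translate of an initial segment of the
rows of `f` (`mem_next_iff_good`), and an automaton of Aho–Corasick type checks it, with these
translated segments as states. Finally, with `p` the gcd of the length and the last coordinate of
`g`, a word fixed by `g` is determined by `p` of its slices: it repeats after `p` slices up to a
translation `γ`, and its slices are fixed by a second translation. Such words correspond to walks of
length `p` from a state `x` to its translate by `γ` (`ncard_good`).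

The alphabet of slices is exponentially large, so letters cannot be tried one by one. Those that
exceed all bounds active in a state lead back to the empty state. Because upward closed sets of
necklaces form a chain, their number is a single entry of the table of fixed-word counts one
dimension lower. The remaining allowed letters are translates of few rows of `f` (`walks_succ`,
`Lev.eval_bulkCount`). So the table in dimension `k` yields the one in dimension `k + 1`
(`Lev.eval_level`), and sets too large to store are compared through their cardinalities
(`UpOrb.mem_iff_card`).

For the machine, the algorithm is written in a small language in which loops are cut off at powers
of `M = N(d + 1)` and stored values at a cap. Time and size bounds are then read off the syntax
(`Term.comp_spec`, `Prog.comp_spec`) and correctness is a separate argument about values. The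
running time is of order `M ^ 10 * Nat.size q`, which the claimed bound absorbs when `N ≥ 2`; an
array with a single cell is handled directly. -/

namespace RAM

/-! ### Machine states and a language of pure terms -/

/-- The state with the variable `x` set to `v`. -/
def State.set (σ : State) (x v : ℕ) : State := { σ with var := Function.update σ.var x v }

/-- The state with the cell `i` of the array `a` set to `v`. -/
def State.put (σ : State) (a i v : ℕ) : State :=
  { σ with arr := Function.update σ.arr a (Function.update (σ.arr a) i v) }

@[simp] theorem State.set_var (σ : State) (x v y : ℕ) :
    (σ.set x v).var y = if y = x then v else σ.var y := by
  simp [State.set, Function.update_apply]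

@[simp] theorem State.set_arr (σ : State) (x v : ℕ) : (σ.set x v).arr = σ.arr := rfl

@[simp] theorem State.put_var (σ : State) (a i v : ℕ) : (σ.put a i v).var = σ.var := rfl

@[simp] theorem State.put_arr (σ : State) (a i v b : ℕ) :
    (σ.put a i v).arr b = if b = a then Function.update (σ.arr a) i v else σ.arr b := by
  simp [State.put, Function.update_apply]

/-- Pure expressions with bounded sums `∑ x < e, f`, local variables and local tables. The ranges
of sums and tables are cut off at the value of the variable `4` (for tables, a power of it), and
the values of local variables and table cells are cut off at the value of the variable `5`. -/
inductive Term
  | lit (k : ℕ)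
  | var (x : ℕ)
  | read (a : ℕ) (e : Term)
  | bin (o : Op) (e f : Term)
  | sum (x : ℕ) (e f : Term)
  | bind (x : ℕ) (e f : Term)
  | tab (a c x : ℕ) (e v f : Term)

/-- The cells `0, …, m - 1` of the array `a` are filled one after the other with the values
of `g`, which may depend on the cells filled before. -/
def fill (a x : ℕ) (g : State → ℕ) (σ : State) : ℕ → State
  | 0 => σ
  | i + 1 => (fill a x g σ i).put a i (min (g ((fill a x g σ i).set x i)) (σ.var 5))

/-- The minima with the variables `4` and `5` make cost and size of every term computable from its
syntax alone. That no cutoff takes effect is proved only where a concrete term is evaluated.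
Bindings and tables are visible only in the subterm `f`, as the semantics is a function of the
state. -/
def Term.eval : Term → State → ℕ
  | .lit k, _ => k
  | .var x, σ => σ.var x
  | .read a e, σ => σ.arr a (e.eval σ)
  | .bin o e f, σ => o.eval (e.eval σ) (f.eval σ)
  | .sum x e f, σ => ∑ i ∈ Finset.range (min (e.eval σ) (σ.var 4)), f.eval (σ.set x i)
  | .bind x e f, σ => f.eval (σ.set x (min (e.eval σ) (σ.var 5)))
  | .tab a c x e v f, σ =>
      f.eval (fill a x v.eval σ (min (e.eval σ) (σ.var 4 ^ c)))

/-- Names of variables are below `100`, names of arrays below `50`, and the variables `0` to `5`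
are not bound. -/
def Term.wf : Term → Bool
  | .lit _ => true
  | .var x => x < 100
  | .read a e => a < 50 && e.wf
  | .bin _ e f => e.wf && f.wf
  | .sum x e f => 6 ≤ x && x < 100 && e.wf && f.wf
  | .bind x e f => 6 ≤ x && x < 100 && e.wf && f.wf
  | .tab a c x e v f => a < 50 && c ≤ 3 && 6 ≤ x && x < 100 && e.wf && v.wf && f.wf

/-- The exponent in the bound on the values. -/
def Term.deg : Term → ℕ
  | .lit k => k + 1
  | .var _ => 1
  | .read _ e => e.deg
  | .bin _ e f => e.deg + f.deg
  | .sum _ e f => e.deg + f.deg + 3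
  | .bind _ e f => e.deg + f.deg + 3
  | .tab _ _ _ e v f => e.deg + v.deg + f.deg + 3

/-- The nesting depth of loops. -/
def Term.dep : Term → ℕ
  | .lit _ => 0
  | .var _ => 0
  | .read _ e => e.dep
  | .bin _ e f => max e.dep f.dep
  | .sum _ e f => max e.dep (1 + f.dep)
  | .bind _ e f => max e.dep f.dep
  | .tab _ c _ e v f => max e.dep (max (c + v.dep) f.dep)

/-- The constant factor in the bound on the number of steps. -/
def Term.cst : Term → ℕ
  | .lit _ => 2
  | .var _ => 2
  | .read _ e => e.cst + 3
  | .bin _ e f => e.cst + f.cst + 4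
  | .sum _ e f => e.cst + f.cst + 50
  | .bind _ e f => e.cst + f.cst + 50
  | .tab _ _ _ e v f => e.cst + v.cst + f.cst + 100

theorem Term.deg_pos (e : Term) : 1 ≤ e.deg := by
  induction e <;> simp only [Term.deg] <;> omega

/-- All values in the state are less than `B`, and the variable `4` has the value `M`. -/
structure Bdd (B M : ℕ) (σ : State) : Prop where
  var_lt : ∀ x, σ.var x < B
  arr_lt : ∀ a i, σ.arr a i < B
  eq : σ.var 4 = M

theorem Bdd.set {B M : ℕ} {σ : State} (h : Bdd B M σ) {x v : ℕ} (hx : 6 ≤ x) (hv : v < B) :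
    Bdd B M (σ.set x v) := by
  refine ⟨fun y => ?_, h.arr_lt, ?_⟩
  · rw [State.set_var]; split_ifs
    exacts [hv, h.var_lt y]
  · rw [State.set_var, if_neg (by omega)]; exact h.eq

theorem Bdd.put {B M : ℕ} {σ : State} (h : Bdd B M σ) {a i v : ℕ} (hv : v < B) :
    Bdd B M (σ.put a i v) := by
  refine ⟨h.var_lt, fun b j => ?_, h.eq⟩
  rw [State.put_arr]; split_ifs
  · rw [Function.update_apply]; split_ifs
    exacts [hv, h.arr_lt a j]
  · exact h.arr_lt b j

@[simp] theorem fill_var (a x : ℕ) (g : State → ℕ) (σ : State) (m : ℕ) :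
    (fill a x g σ m).var = σ.var := by
  induction m with
  | zero => rfl
  | succ m ih => simpa [fill] using ih

theorem Bdd.fill {B M : ℕ} {σ : State} (h : Bdd B M σ) (a x : ℕ) (g : State → ℕ) (m : ℕ) :
    Bdd B M (fill a x g σ m) := by
  induction m with
  | zero => exact h
  | succ m ih => exact ih.put (lt_of_le_of_lt (min_le_right _ _) (h.var_lt 5))

theorem op_lt {B m n a b : ℕ} (o : Op) (ha : a < B ^ m)
    (hb : b < B ^ n) : o.eval a b < B ^ (m + n) := by
  have h3 : B ^ m ≤ B ^ m * B ^ n := Nat.le_mul_of_pos_right _ (by omega)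
  rw [pow_add]
  cases o <;> simp only [Op.eval]
  · nlinarith
  · omega
  · exact Nat.mul_lt_mul'' ha hb
  · exact lt_of_le_of_lt (Nat.div_le_self _ _) (by omega)

/-- Because bound variables and table cells are cut off, every subterm is evaluated in a state with
values below `B`. A sum has fewer than `B` summands, which costs one more factor `B`. -/
theorem Term.eval_lt {B M : ℕ} (hB : 2 ≤ B) (hMB : M ^ 3 < B) (e : Term)
    (hwf : e.wf = true) : ∀ σ, Bdd B M σ → e.eval σ < B ^ e.deg := by
  have hM1 : M < B := lt_of_le_of_lt (Nat.le_self_pow (by omega) M) hMB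
  induction e with
  | lit k =>
    exact fun σ h => (Nat.lt_pow_self (by omega : 1 < B)).trans
      (Nat.pow_lt_pow_right (by omega) (Nat.lt_succ_self k))
  | var x => intro σ h; simpa [Term.eval, Term.deg] using h.var_lt x
  | read a e ih =>
    intro σ h
    have := e.deg_pos
    exact (h.arr_lt _ _).trans_le (Nat.le_self_pow (by simp only [Term.deg]; omega) B)
  | bin o e f ihe ihf =>
    simp only [Term.wf, Bool.and_eq_true] at hwf
    exact fun σ h => op_lt o (ihe hwf.1 σ h) (ihf hwf.2 σ h)
  | sum x e f ihe ihf =>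
    simp only [Term.wf, Bool.and_eq_true, decide_eq_true_eq] at hwf
    intro σ h
    simp only [Term.eval, Term.deg]
    calc _ ≤ ∑ i ∈ Finset.range (min (e.eval σ) (σ.var 4)), B ^ f.deg :=
          Finset.sum_le_sum fun i hi => (ihf hwf.2 _ (h.set hwf.1.1.1 (by
            have := Finset.mem_range.1 hi; rw [h.eq] at this; omega))).le
      _ = (min (e.eval σ) (σ.var 4)) * B ^ f.deg := by simp
      _ < B * B ^ f.deg := Nat.mul_lt_mul_of_pos_right (by rw [h.eq]; omega) (by positivity)
      _ = B ^ (f.deg + 1) := by ring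
      _ ≤ _ := Nat.pow_le_pow_right (by omega) (by omega)
  | bind x e f ihe ihf =>
    simp only [Term.wf, Bool.and_eq_true, decide_eq_true_eq] at hwf
    intro σ h
    exact (ihf hwf.2 _ (h.set hwf.1.1.1 ((min_le_right _ _).trans_lt (h.var_lt 5)))).trans_le
      (Nat.pow_le_pow_right (by omega) (by simp only [Term.deg]; omega))
  | tab a c x e v f ihe ihv ihf =>
    simp only [Term.wf, Bool.and_eq_true, decide_eq_true_eq] at hwf
    intro σ h
    exact (ihf hwf.2 _ (h.fill a x v.eval _)).trans_le
      (Nat.pow_le_pow_right (by omega) (by simp only [Term.deg]; omega))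

/-! ### Compilation of terms to machine commands -/

/-- The power `M ^ c` of the variable `4`. -/
def powExpr : ℕ → Expr
  | 0 => .lit 1
  | c + 1 => .bin .times (powExpr c) (.var 4)

/-- `x := min x e` -/
def cut (x : ℕ) (e : Expr) : Cmd := .assign x (.bin .minus (.var x) (.bin .minus (.var x) e))

/-- Evaluates a term into the variable `m`. The variables from `m` on and the arrays from `F` on
are used as scratch memory; everything else is left unchanged. -/
def Term.comp : Term → ℕ → ℕ → Cmd
  | .lit k, m, _ => .assign m (.lit k)
  | .var x, m, _ => .assign m (.var x)
  | .read a e, m, F => .seq (e.comp m F) (.assign m (.read a (.var m)))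
  | .bin o e f, m, F =>
      .seq (e.comp m F) (.seq (f.comp (m + 1) F) (.assign m (.bin o (.var m) (.var (m + 1)))))
  | .sum x e f, m, F =>
      .seq (e.comp m F) <| .seq (cut m (.var 4)) <| .seq (.assign (m + 1) (.lit 0)) <|
      .seq (.assign (m + 2) (.lit 0)) <| .seq (.assign (m + 3) (.var x)) <|
      .seq (.loop (.bin .minus (.var m) (.var (m + 1)))
        (.seq (.assign x (.var (m + 1))) <| .seq (f.comp (m + 4) F) <|
          .seq (.assign (m + 2) (.bin .plus (.var (m + 2)) (.var (m + 4))))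
            (.assign (m + 1) (.bin .plus (.var (m + 1)) (.lit 1))))) <|
      .seq (.assign x (.var (m + 3))) (.assign m (.var (m + 2)))
  | .bind x e f, m, F =>
      .seq (e.comp m F) <| .seq (cut m (.var 5)) <| .seq (.assign (m + 1) (.var x)) <|
      .seq (.assign x (.var m)) <| .seq (f.comp (m + 2) F) <|
      .seq (.assign x (.var (m + 1))) (.assign m (.var (m + 2)))
  | .tab a c x e v f, m, F =>
      .seq (e.comp m F) <| .seq (cut m (powExpr c)) <| .seq (.assign (m + 1) (.lit 0)) <|
      .seq (.assign (m + 2) (.var x)) <|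
      .seq (.loop (.bin .minus (.var m) (.var (m + 1)))
        (.seq (.assign x (.var (m + 1))) <| .seq (v.comp (m + 3) (F + 1)) <|
          .seq (cut (m + 3) (.var 5)) <|
          .seq (.write F (.var (m + 1)) (.read a (.var (m + 1)))) <|
          .seq (.write a (.var (m + 1)) (.var (m + 3)))
            (.assign (m + 1) (.bin .plus (.var (m + 1)) (.lit 1))))) <|
      .seq (.assign x (.var (m + 2))) <| .seq (f.comp (m + 3) (F + 1)) <|
      .seq (.assign (m + 1) (.lit 0)) <|
      .seq (.loop (.bin .minus (.var m) (.var (m + 1)))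
        (.seq (.write a (.var (m + 1)) (.read F (.var (m + 1))))
            (.assign (m + 1) (.bin .plus (.var (m + 1)) (.lit 1)))))
      (.assign m (.var (m + 3)))

/-- Induction on the number of remaining rounds. A test of the guard `r - i` costs four steps, hence
`T + 4` per round and `4` for the last test. -/
theorem exec_counter {W : ℕ} {body : Cmd} {m r T : ℕ} (hr : r < W) (I : ℕ → State → Prop)
    (step : ∀ i < r, ∀ τ : State, I i τ → τ.var m = r → τ.var (m + 1) = i →
      ∃ t τ', Exec W body τ t τ' ∧ t ≤ T ∧ τ'.var m = r ∧ τ'.var (m + 1) = i + 1 ∧ I (i + 1) τ')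
    (τ : State) (h0 : I 0 τ) (hm : τ.var m = r) (hm1 : τ.var (m + 1) = 0) :
    ∃ t τ', Exec W (.loop (.bin .minus (.var m) (.var (m + 1))) body) τ t τ' ∧
      t ≤ r * (T + 4) + 4 ∧ τ'.var m = r ∧ I r τ' := by
  suffices H : ∀ j i τ, i + j = r → I i τ → τ.var m = r → τ.var (m + 1) = i →
      ∃ t τ', Exec W (.loop (.bin .minus (.var m) (.var (m + 1))) body) τ t τ' ∧
        t ≤ j * (T + 4) + 4 ∧ τ'.var m = r ∧ I r τ' from H r 0 τ (by omega) h0 hm hm1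
  intro j
  induction j with
  | zero =>
    intro i τ hi hI hm hm1
    obtain rfl : i = r := by omega
    refine ⟨_, τ, Exec.loop_false ?_ ?_, by simp [Expr.cost], hm, hI⟩
    · simp [Expr.Fits, Expr.eval, Op.eval, hm, hm1]; omega
    · simp [Expr.eval, Op.eval, hm, hm1]
  | succ j ih =>
    intro i τ hi hI hm hm1
    obtain ⟨t, τ', h1, h2, h3, h4, h5⟩ := step i (by omega) τ hI hm hm1
    obtain ⟨t', τ'', g1, g2, g3, g4⟩ := ih (i + 1) τ' (by omega) h5 h3 h4
    refine ⟨_, τ'', Exec.loop_true ?_ ?_ h1 g1, ?_, g3, g4⟩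
    · simp [Expr.Fits, Expr.eval, Op.eval, hm, hm1]; omega
    · simp [Expr.eval, Op.eval, hm, hm1]; omega
    · simp only [Expr.cost]; nlinarith

theorem exec_assign {W : ℕ} {τ : State} {x : ℕ} {e : Expr} {v : ℕ} (hv : e.eval τ = v)
    (he : e.Fits W τ) : Exec W (.assign x e) τ (e.cost + 1) (τ.set x v) :=
  hv ▸ Exec.assign τ x e he

theorem exec_write {W : ℕ} {τ : State} {a : ℕ} {e f : Expr} {i v : ℕ} (hi : e.eval τ = i)
    (hv : f.eval τ = v) (he : e.Fits W τ) (hf : f.Fits W τ) :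
    Exec W (.write a e f) τ (e.cost + f.cost + 1) (τ.put a i v) :=
  hv ▸ hi ▸ Exec.write τ a e f he hf

theorem exec_cut {W : ℕ} {τ : State} {x : ℕ} {e : Expr} {v u : ℕ} (hx : τ.var x = u)
    (hv : e.eval τ = v) (he : e.Fits W τ) (hxW : u < W) :
    Exec W (cut x e) τ (e.cost + 5) (τ.set x (min u v)) := by
  have h : (Expr.bin .minus (.var x) (.bin .minus (.var x) e)).cost + 1 = e.cost + 5 := by
    simp only [Expr.cost]; omega
  rw [← h]
  refine exec_assign (v := min u v) ?_ ?_
  -- With truncated subtraction, `u - (u - v) = min u v`.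
  · simp only [Expr.eval, Op.eval, hv, hx]; omega
  · simp only [Expr.Fits, Expr.eval, Op.eval, hv, hx]
    exact ⟨hxW, ⟨hxW, he, by omega⟩, by omega⟩

theorem powExpr_eval (τ : State) (c : ℕ) : (powExpr c).eval τ = τ.var 4 ^ c := by
  induction c with
  | zero => rfl
  | succ c ih => simp [powExpr, Expr.eval, Op.eval, ih, pow_succ]

theorem powExpr_cost (c : ℕ) : (powExpr c).cost = 2 * c + 1 := by
  induction c with
  | zero => rfl
  | succ c ih => simp [powExpr, Expr.cost, ih]; omega

theorem powExpr_fits {W : ℕ} {τ : State} (c : ℕ) (h1 : 1 ≤ τ.var 4) (hW : 1 < W)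
    (h : τ.var 4 ^ c < W) : (powExpr c).Fits W τ := by
  induction c with
  | zero => simpa [powExpr, Expr.Fits] using hW
  | succ c ih =>
    have h2 : τ.var 4 ^ c ≤ τ.var 4 ^ (c + 1) := Nat.pow_le_pow_right h1 (by omega)
    refine ⟨ih (h2.trans_lt h), ?_, ?_⟩
    · exact (Nat.le_self_pow (by omega : c + 1 ≠ 0) _).trans_lt h
    · simpa [Expr.eval, Op.eval, powExpr_eval, pow_succ] using h

/-- Agreement on the variables and arrays that occur in terms. -/
structure Agree (σ τ : State) : Prop where
  var : ∀ x < 100, τ.var x = σ.var x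
  arr : ∀ a < 50, τ.arr a = σ.arr a

/-- The variables below `m` and the arrays below `F` are the same. -/
structure Frame (m F : ℕ) (τ τ' : State) : Prop where
  var : ∀ x < m, τ'.var x = τ.var x
  arr : ∀ a < F, τ'.arr a = τ.arr a

end RAM

/-! ### Correctness and cost of compiled terms -/

namespace RAM

/-- The compiled term computes the value of the term within the bounds on time and values. -/
def Term.Spec (B M W : ℕ) (e : Term) : Prop :=
  e.wf = true → B ^ e.deg ≤ W → ∀ m F, 100 ≤ m → 50 ≤ F → ∀ σ τ, Bdd B M σ →
    Agree σ τ → ∃ t τ', Exec W (e.comp m F) τ t τ' ∧ t ≤ e.cst * M ^ e.dep ∧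
      τ'.var m = e.eval σ ∧ Frame m F τ τ'

theorem Term.Spec.lit {k B M W : ℕ} (hB : 2 ≤ B) (hMB : M ^ 3 < B) :
    (.lit k : Term).Spec B M W := by
  intro hwf hW m F hm hF σ τ hσ hA
  have := Term.eval_lt hB hMB _ hwf σ hσ
  refine ⟨_, _, exec_assign (v := k) rfl (this.trans_le hW), ?_, by simp [Term.eval], ?_⟩
  · simp [Term.cst, Term.dep, Expr.cost]
  · exact ⟨fun x hx => by rw [State.set_var, if_neg (by omega)], fun a ha => rfl⟩

theorem Term.Spec.var {x B M W : ℕ} : (.var x : Term).Spec B M W := by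
  intro hwf hW
  have hBW : B ≤ W := (Nat.le_self_pow (by have := Term.deg_pos (.var x); omega) B).trans hW
  intro m F hm hF σ τ hσ hA
  simp only [Term.wf, decide_eq_true_eq] at hwf
  have h1 := hA.var x hwf
  refine ⟨_, _, exec_assign (v := σ.var x) (by simpa [Expr.eval] using h1) ?_, ?_,
    by simp [Term.eval], ?_⟩
  · simp only [Expr.Fits, h1]; exact (hσ.var_lt x).trans_le hBW
  · simp [Term.cst, Term.dep, Expr.cost]
  · exact ⟨fun x hx => by rw [State.set_var, if_neg (by omega)], fun a ha => rfl⟩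

theorem Term.Spec.read {a : ℕ} {e : Term}
    {B M W : ℕ} (hB : 2 ≤ B) (hMB : M ^ 3 < B) (hM : 1 ≤ M)
    (ih : e.Spec B M W) : (.read a e : Term).Spec B M W := by
  intro hwf hW
  have hP : ∀ k, 1 ≤ M ^ k := fun k => Nat.one_le_pow _ _ hM
  have hBW : B ≤ W := (Nat.le_self_pow (by have := Term.deg_pos (.read a e); omega) B).trans hW
  intro m F hm hF σ τ hσ hA
  simp only [Term.wf, Bool.and_eq_true, decide_eq_true_eq] at hwf
  obtain ⟨t, τ1, E1, b1, v1, f1⟩ := ih hwf.2 hW m F hm hF σ τ hσ hA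
  have h1 : τ1.arr a = σ.arr a := (f1.arr a (by omega)).trans (hA.arr a hwf.1)
  have h2 := Term.eval_lt hB hMB _ hwf.2 σ hσ
  refine ⟨_, _, E1.seq (exec_assign (v := σ.arr a (e.eval σ)) ?_ ?_), ?_, by simp [Term.eval],
    ?_⟩
  · simp [Expr.eval, v1, h1]
  · simp only [Expr.Fits, Expr.eval, v1, h1]
    exact ⟨h2.trans_le hW, (hσ.arr_lt _ _).trans_le hBW⟩
  · simp only [Term.cst, Term.dep, Expr.cost]; have := hP e.dep; nlinarith
  · exact ⟨fun x hx => by rw [State.set_var, if_neg (by omega), f1.var x hx], f1.arr⟩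

theorem Term.Spec.bin {o : Op} {e f : Term}
    {B M W : ℕ} (hB : 2 ≤ B) (hMB : M ^ 3 < B) (hM : 1 ≤ M)
    (ihe : e.Spec B M W) (ihf : f.Spec B M W) : (.bin o e f : Term).Spec B M W := by
  intro hwf hW
  have hP : ∀ k, 1 ≤ M ^ k := fun k => Nat.one_le_pow _ _ hM
  have hPm : ∀ {j k}, j ≤ k → M ^ j ≤ M ^ k := fun h => Nat.pow_le_pow_right hM h
  intro m F hm hF σ τ hσ hA
  have hlt := (Term.eval_lt hB hMB _ hwf σ hσ).trans_le hW
  simp only [Term.wf, Bool.and_eq_true] at hwf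
  simp only [Term.deg] at hW
  have hWe : B ^ e.deg ≤ W := (Nat.pow_le_pow_right (by omega) (by omega)).trans hW
  have hWf : B ^ f.deg ≤ W := (Nat.pow_le_pow_right (by omega) (by omega)).trans hW
  obtain ⟨t, τ1, E1, b1, v1, f1⟩ := ihe hwf.1 hWe m F hm hF σ τ hσ hA
  have hA1 : Agree σ τ1 := ⟨fun x hx => (f1.var x (by omega)).trans (hA.var x hx),
    fun a ha => (f1.arr a (by omega)).trans (hA.arr a ha)⟩
  obtain ⟨t', τ2, E2, b2, v2, f2⟩ := ihf hwf.2 hWf (m + 1) F (by omega) hF σ τ1 hσ hA1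
  have h2 : τ2.var m = e.eval σ := (f2.var m (by omega)).trans v1
  refine ⟨_, _, E1.seq (E2.seq (exec_assign (v := o.eval (e.eval σ) (f.eval σ)) ?_ ?_)), ?_,
    by simp [Term.eval], ?_⟩
  · simp [Expr.eval, h2, v2]
  · simp only [Expr.Fits, Expr.eval, h2, v2]
    exact ⟨(Term.eval_lt hB hMB _ hwf.1 σ hσ).trans_le hWe,
      (Term.eval_lt hB hMB _ hwf.2 σ hσ).trans_le hWf, hlt⟩
  · simp only [Term.cst, Term.dep, Expr.cost]
    have h3 := Nat.mul_le_mul_left e.cst (hPm (le_max_left e.dep f.dep))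
    have h4 := Nat.mul_le_mul_left f.cst (hPm (le_max_right e.dep f.dep))
    have := hP (max e.dep f.dep)
    nlinarith
  · exact ⟨fun x hx => by
      rw [State.set_var, if_neg (by omega), f2.var x (by omega), f1.var x hx],
      fun a ha => (f2.arr a ha).trans (f1.arr a ha)⟩

/-- The variable `x` has been set to `v`. -/
structure Upd (x v : ℕ) (τ τ' : State) : Prop where
  self : τ'.var x = v
  var : ∀ y, y ≠ x → τ'.var y = τ.var y
  arr : ∀ a, τ'.arr a = τ.arr a

theorem exec_upd {W : ℕ} {τ : State} (x : ℕ) {e : Expr} (v : ℕ) (hv : e.eval τ = v)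
    (he : e.Fits W τ) : ∃ τ', Exec W (.assign x e) τ (e.cost + 1) τ' ∧ Upd x v τ τ' :=
  ⟨_, exec_assign hv he, by simp, fun y hy => by simp [hy], fun a => rfl⟩

theorem exec_cut_upd {W : ℕ} {τ : State} {x : ℕ} {e : Expr} {u : ℕ} (v : ℕ) (hx : τ.var x = u)
    (hv : e.eval τ = v) (he : e.Fits W τ) (hxW : u < W) :
    ∃ τ', Exec W (cut x e) τ (e.cost + 5) τ' ∧ Upd x (min u v) τ τ' :=
  ⟨_, exec_cut hx hv he hxW, by simp, fun y hy => by simp [hy], fun a => rfl⟩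

theorem Agree.set {σ τ τ' : State} (h : Agree σ τ) {x v : ℕ} (hu : Upd x v τ τ') :
    Agree (σ.set x v) τ' := by
  refine ⟨fun y hy => ?_, fun a ha => (hu.arr a).trans (h.arr a ha)⟩
  rw [State.set_var]
  split_ifs with hyx
  · rw [hyx, hu.self]
  · rw [hu.var y hyx, h.var y hy]

theorem Agree.frame {σ τ τ' : State} {m F : ℕ} (h : Agree σ τ) (hf : Frame m F τ τ')
    (hm : 100 ≤ m) (hF : 50 ≤ F) : Agree σ τ' :=
  ⟨fun x hx => (hf.var x (by omega)).trans (h.var x hx),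
    fun a ha => (hf.arr a (by omega)).trans (h.arr a ha)⟩

theorem Frame.trans {τ τ' τ'' : State} {m F m' F' : ℕ} (h : Frame m F τ τ')
    (h' : Frame m' F' τ' τ'') (hm : m ≤ m') (hF : F ≤ F') : Frame m F τ τ'' :=
  ⟨fun x hx => (h'.var x (by omega)).trans (h.var x hx),
    fun a ha => (h'.arr a (by omega)).trans (h.arr a ha)⟩

theorem Upd.frame {τ τ' : State} {x v m : ℕ} (h : Upd x v τ τ') (hm : m ≤ x) (F : ℕ) :
    Frame m F τ τ' :=
  ⟨fun y hy => h.var y (by omega), fun a _ => h.arr a⟩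

/-- The loop that evaluates a sum. -/
theorem exec_sum_loop {B M W : ℕ} (hBW : B ≤ W) {x : ℕ}
    {f : Term} (hx6 : 6 ≤ x) (hx : x < 100) (hwf : f.wf = true)
    (hWf : B ^ f.deg ≤ W) (ihf : f.Spec B M W) {m F r : ℕ} (hm : 100 ≤ m) (hF : 50 ≤ F)
    (hrB : r < B) (σ τ : State) (hσ : Bdd B M σ) (hA : Agree σ τ)
    (hlt : ∑ j ∈ Finset.range r, f.eval (σ.set x j) < W)
    (h0 : τ.var m = r) (h1 : τ.var (m + 1) = 0) (h2 : τ.var (m + 2) = 0)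
    (h3 : τ.var (m + 3) = σ.var x) :
    ∃ t τ', Exec W (.loop (.bin .minus (.var m) (.var (m + 1)))
        (.seq (.assign x (.var (m + 1))) <| .seq (f.comp (m + 4) F) <|
          .seq (.assign (m + 2) (.bin .plus (.var (m + 2)) (.var (m + 4))))
            (.assign (m + 1) (.bin .plus (.var (m + 1)) (.lit 1))))) τ t τ' ∧
      t ≤ r * (f.cst * M ^ f.dep + 20 + 4) + 4 ∧ (∀ y < m, y ≠ x → τ'.var y = τ.var y) ∧
        (∀ a < F, τ'.arr a = τ.arr a) ∧
        τ'.var (m + 2) = ∑ j ∈ Finset.range r, f.eval (σ.set x j) ∧ τ'.var (m + 3) = σ.var x := by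
  refine (exec_counter (W := W) (m := m) (r := r) (T := f.cst * M ^ f.dep + 20) (by omega)
    (fun i τ' => (∀ y < m, y ≠ x → τ'.var y = τ.var y) ∧ (∀ a < F, τ'.arr a = τ.arr a) ∧
        τ'.var (m + 2) = ∑ j ∈ Finset.range i, f.eval (σ.set x j) ∧ τ'.var (m + 3) = σ.var x)
    ?_ τ ⟨fun _ _ _ => rfl, fun _ _ => rfl, by simp [h2], h3⟩ h0 h1).imp
    fun t h => h.imp fun τ' h => ⟨h.1, h.2.1, h.2.2.2⟩
  rintro i hi τ1 ⟨I1, I2, I3, I4⟩ hm0 hm1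
  obtain ⟨τ2, E2, U2⟩ := exec_upd (W := W) (τ := τ1) x (e := .var (m + 1)) i hm1
    (by simp only [Expr.Fits]; omega)
  have hA2 : Agree (σ.set x i) τ2 := by
    refine ⟨fun y hy => ?_, fun a ha =>
      (U2.arr a).trans ((I2 a (by omega)).trans (hA.arr a ha))⟩
    rw [State.set_var]
    split_ifs with h
    · rw [h, U2.self]
    · rw [U2.var y h, I1 y (by omega) h, hA.var y hy]
  obtain ⟨t3, τ3, E3, c3, w3, g3⟩ := ihf hwf hWf (m + 4) F (by omega) hF _ _
    (hσ.set hx6 (hi.trans hrB)) hA2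
  have k2 : τ3.var (m + 2) = ∑ j ∈ Finset.range i, f.eval (σ.set x j) := by
    rw [g3.var _ (by omega), U2.var _ (by omega), I3]
  have k1 : τ3.var (m + 1) = i := by rw [g3.var _ (by omega), U2.var _ (by omega), hm1]
  -- A partial sum is at most the final sum, which is known to be below `W`, so the accumulator
  -- never overflows.
  have hle : ∑ j ∈ Finset.range (i + 1), f.eval (σ.set x j)
      ≤ ∑ j ∈ Finset.range r, f.eval (σ.set x j) :=
    Finset.sum_le_sum_of_subset (Finset.range_mono hi)
  rw [Finset.sum_range_succ] at hle
  obtain ⟨τ4, E4, U4⟩ := exec_upd (W := W) (τ := τ3) (m + 2)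
    (e := .bin .plus (.var (m + 2)) (.var (m + 4)))
    (∑ j ∈ Finset.range (i + 1), f.eval (σ.set x j))
    (by rw [Finset.sum_range_succ]; simp only [Expr.eval, Op.eval, k2, w3])
    (by simp only [Expr.eval, Op.eval, k2, w3, Expr.Fits]; omega)
  have k4 : τ4.var (m + 1) = i := by rw [U4.var _ (by omega), k1]
  obtain ⟨τ5, E5, U5⟩ := exec_upd (W := W) (τ := τ4) (m + 1)
    (e := .bin .plus (.var (m + 1)) (.lit 1)) (i + 1)
    (by simp only [Expr.eval, Op.eval, k4])
    (by simp only [Expr.eval, Op.eval, k4, Expr.Fits]; omega)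
  refine ⟨_, _, E2.seq (E3.seq (E4.seq E5)), ?_, ?_, U5.self, ?_, ?_, ?_, ?_⟩
  · simp only [Expr.cost]; omega
  · rw [U5.var _ (by omega), U4.var _ (by omega), g3.var _ (by omega), U2.var _ (by omega), hm0]
  · intro y hy hyx
    rw [U5.var _ (by omega), U4.var _ (by omega), g3.var _ (by omega), U2.var _ hyx, I1 y hy hyx]
  · intro a ha
    rw [U5.arr, U4.arr, g3.arr a ha, U2.arr, I2 a ha]
  · rw [U5.var _ (by omega), U4.self]
  · rw [U5.var _ (by omega), U4.var _ (by omega), g3.var _ (by omega), U2.var _ (by omega), I4]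

/-- Register `m` holds the number of rounds, `m + 1` the counter, `m + 2` the partial sum and `m +
3` the old value of `x`, which is put back at the end; the summand is computed from `m + 4` on. -/
theorem Term.Spec.sum {x : ℕ} {e f : Term}
    {B M W : ℕ} (hB : 2 ≤ B) (hMB : M ^ 3 < B) (hM : 1 ≤ M)
    (ihe : e.Spec B M W) (ihf : f.Spec B M W) : (Term.sum x e f).Spec B M W := by
  intro hwf hW
  have hM1 : M < B := lt_of_le_of_lt (Nat.le_self_pow (by omega) M) hMB
  have hP : ∀ k, 1 ≤ M ^ k := fun k => Nat.one_le_pow _ _ hM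
  have hPm : ∀ {j k}, j ≤ k → M ^ j ≤ M ^ k := fun h => Nat.pow_le_pow_right hM h
  have hBW : B ≤ W :=
    (Nat.le_self_pow (by have := (Term.sum x e f).deg_pos; omega) B).trans hW
  intro m F hm hF σ τ hσ hA
  have hlt := (Term.eval_lt hB hMB _ hwf σ hσ).trans_le hW
  simp only [Term.wf, Bool.and_eq_true, decide_eq_true_eq] at hwf
  obtain ⟨⟨⟨hx6, hx⟩, hwe⟩, hwf⟩ := hwf
  simp only [Term.deg] at hW
  have hWe : B ^ e.deg ≤ W := (Nat.pow_le_pow_right (by omega) (by omega)).trans hW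
  have hWf : B ^ f.deg ≤ W := (Nat.pow_le_pow_right (by omega) (by omega)).trans hW
  obtain ⟨t, τ1, E1, b1, v1, f1⟩ := ihe hwe hWe m F hm hF σ τ hσ hA
  have hA1 := hA.frame f1 hm hF
  have h4 : τ1.var 4 = M := by rw [hA1.var 4 (by omega), hσ.eq]
  have hσx := (hσ.var_lt x).trans_le hBW
  have hev : (Term.sum x e f).eval σ
      = ∑ i ∈ Finset.range (min (e.eval σ) M), f.eval (σ.set x i) := by
    simp only [Term.eval, hσ.eq]
  rw [hev] at hlt
  obtain ⟨τ2, E2, U2⟩ := exec_cut_upd (W := W) (τ := τ1) (x := m) (e := .var 4) M v1 h4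
    (by simp only [Expr.Fits, h4]; omega) ((Term.eval_lt hB hMB _ hwe σ hσ).trans_le hWe)
  have hrB : min (e.eval σ) M < B := lt_of_le_of_lt (min_le_right _ _) hM1
  have hrM : min (e.eval σ) M ≤ M := min_le_right _ _
  generalize min (e.eval σ) M = r at *
  obtain ⟨τ3, E3, U3⟩ := exec_upd (W := W) (τ := τ2) (m + 1) (e := .lit 0) 0 rfl
    (by simp only [Expr.Fits]; omega)
  obtain ⟨τ4, E4, U4⟩ := exec_upd (W := W) (τ := τ3) (m + 2) (e := .lit 0) 0 rfl
    (by simp only [Expr.Fits]; omega)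
  have g4 : Frame m F τ1 τ4 := ((U2.frame le_rfl F).trans (U3.frame (by omega) F) le_rfl
    le_rfl).trans (U4.frame (by omega) F) le_rfl le_rfl
  have hx4 : τ4.var x = σ.var x := (hA1.frame g4 hm hF).var x hx
  obtain ⟨τ5, E5, U5⟩ := exec_upd (W := W) (τ := τ4) (m + 3) (e := .var x) (σ.var x) hx4
    (by simp only [Expr.Fits, hx4]; exact hσx)
  have g5 := (f1.trans g4 le_rfl le_rfl).trans (U5.frame (by omega) F) le_rfl le_rfl
  obtain ⟨t6, τ6, E6, b6, I1, I2, I3, I4⟩ := exec_sum_loop hBW hx6 hx hwf hWf ihf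
    hm hF hrB σ τ5 hσ (hA.frame g5 hm hF) hlt
    (by rw [U5.var _ (by omega), U4.var _ (by omega), U3.var _ (by omega), U2.self])
    (by rw [U5.var _ (by omega), U4.var _ (by omega), U3.self])
    (by rw [U5.var _ (by omega), U4.self]) U5.self
  obtain ⟨τ7, E7, U7⟩ := exec_upd (W := W) (τ := τ6) x (e := .var (m + 3)) _ I4
    (by simp only [Expr.Fits, I4]; exact hσx)
  have k7 := (U7.var (m + 2) (by omega)).trans I3
  obtain ⟨τ8, E8, U8⟩ := exec_upd (W := W) (τ := τ7) m (e := .var (m + 2)) _ k7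
    (by simp only [Expr.Fits, k7]; exact hlt)
  refine ⟨_, _, E1.seq (E2.seq (E3.seq (E4.seq (E5.seq (E6.seq (E7.seq E8)))))), ?_, ?_, ?_⟩
  · simp only [Term.cst, Term.dep, Expr.cost]
    have h3 := Nat.mul_le_mul_left e.cst (hPm (le_max_left e.dep (1 + f.dep)))
    have h4 := hPm (le_max_right e.dep (1 + f.dep))
    have h5 : r * (f.cst * M ^ f.dep + 20 + 4) ≤ (f.cst + 24) * M ^ (1 + f.dep) := by
      calc r * (f.cst * M ^ f.dep + 20 + 4) ≤ M * (f.cst * M ^ f.dep + 24 * M ^ f.dep) := by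
            refine Nat.mul_le_mul hrM ?_
            have := hP f.dep; omega
        _ = _ := by ring
    have h6 := Nat.mul_le_mul_left (f.cst + 24) h4
    have := hP (max e.dep (1 + f.dep))
    linarith
  · rw [hev, U8.self]
  · refine ⟨fun y hy => ?_, fun a ha => ?_⟩
    · rw [U8.var _ (by omega)]
      by_cases h : y = x
      · rw [h, U7.self, hA.var x hx]
      · rw [U7.var _ h, I1 y hy h, g5.var y hy]
    · rw [U8.arr, U7.arr, I2 a ha, g5.arr a ha]

theorem Term.Spec.bind {x : ℕ} {e f : Term}
    {B M W : ℕ} (hB : 2 ≤ B) (hMB : M ^ 3 < B) (hM : 1 ≤ M)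
    (ihe : e.Spec B M W) (ihf : f.Spec B M W) : (.bind x e f : Term).Spec B M W := by
  intro hwf hW
  have hP : ∀ k, 1 ≤ M ^ k := fun k => Nat.one_le_pow _ _ hM
  have hPm : ∀ {j k}, j ≤ k → M ^ j ≤ M ^ k := fun h => Nat.pow_le_pow_right hM h
  have hBW : B ≤ W := (Nat.le_self_pow (by have := Term.deg_pos (.bind x e f); omega) B).trans hW
  intro m F hm hF σ τ hσ hA
  have hlt := (Term.eval_lt hB hMB _ hwf σ hσ).trans_le hW
  simp only [Term.wf, Bool.and_eq_true, decide_eq_true_eq] at hwf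
  obtain ⟨⟨⟨hx6, hx⟩, hwe⟩, hwf⟩ := hwf
  simp only [Term.deg] at hW
  have hWe : B ^ e.deg ≤ W := (Nat.pow_le_pow_right (by omega) (by omega)).trans hW
  have hWf : B ^ f.deg ≤ W := (Nat.pow_le_pow_right (by omega) (by omega)).trans hW
  obtain ⟨t, τ1, E1, b1, v1, f1⟩ := ihe hwe hWe m F hm hF σ τ hσ hA
  have h5 : τ1.var 5 = σ.var 5 := by rw [f1.var 5 (by omega), hA.var 5 (by omega)]
  have hσx := (hσ.var_lt x).trans_le hBW
  set u := min (e.eval σ) (σ.var 5) with hu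
  have huB : u < B := lt_of_le_of_lt (min_le_right _ _) (hσ.var_lt 5)
  obtain ⟨τ2, E2, U2⟩ := exec_cut_upd (W := W) (τ := τ1) (x := m) (e := .var 5) (σ.var 5) v1 h5
    (by simp only [Expr.Fits, h5]; exact (hσ.var_lt 5).trans_le hBW)
    ((Term.eval_lt hB hMB _ hwe σ hσ).trans_le hWe)
  rw [← hu] at U2
  have hA2 := hA.frame (f1.trans (U2.frame le_rfl F) le_rfl le_rfl) hm hF
  have k3 : τ2.var x = σ.var x := hA2.var x hx
  obtain ⟨τ3, E3, U3⟩ := exec_upd (W := W) (τ := τ2) (m + 1) (e := .var x) _ k3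
    (by simp only [Expr.Fits, k3]; exact hσx)
  have k4 : τ3.var m = u := by rw [U3.var _ (by omega), U2.self]
  obtain ⟨τ4, E4, U4⟩ := exec_upd (W := W) (τ := τ3) x (e := .var m) _ k4
    (by simp only [Expr.Fits, k4]; omega)
  obtain ⟨t5, τ5, E5, b5, v5, f5⟩ := ihf hwf hWf (m + 2) F (by omega) hF _ _
    (hσ.set hx6 huB) ((hA2.frame (U3.frame (m := m) (by omega) F) hm hF).set U4)
  have k6 : τ5.var (m + 1) = σ.var x := by
    rw [f5.var (m + 1) (by omega), U4.var _ (by omega), U3.self]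
  obtain ⟨τ6, E6, U6⟩ := exec_upd (W := W) (τ := τ5) x (e := .var (m + 1)) _ k6
    (by simp only [Expr.Fits, k6]; exact hσx)
  have k7 : τ6.var (m + 2) = (Term.bind x e f).eval σ := by
    rw [U6.var _ (by omega), v5]; rfl
  obtain ⟨τ7, E7, U7⟩ := exec_upd (W := W) (τ := τ6) m (e := .var (m + 2)) _ k7
    (by simp only [Expr.Fits, k7]; exact hlt)
  refine ⟨_, _, E1.seq (E2.seq (E3.seq (E4.seq (E5.seq (E6.seq E7))))), ?_, U7.self, ?_⟩
  · simp only [Term.cst, Term.dep, Expr.cost]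
    have h3 := Nat.mul_le_mul_left e.cst (hPm (le_max_left e.dep f.dep))
    have h4 := Nat.mul_le_mul_left f.cst (hPm (le_max_right e.dep f.dep))
    have := hP (max e.dep f.dep)
    linarith
  · refine ⟨fun y hy => ?_, fun a ha => ?_⟩
    · rw [U7.var _ (by omega)]
      by_cases h : y = x
      · rw [h, U6.self, hA.var x hx]
      · rw [U6.var _ h, f5.var y (by omega), U4.var _ h, U3.var _ (by omega), U2.var _ (by omega),
          f1.var y hy]
    · rw [U7.arr, U6.arr, f5.arr a ha, U4.arr, U3.arr, U2.arr, f1.arr a ha]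

theorem fill_arr_ne (a x : ℕ) (g : State → ℕ) (σ : State) (m : ℕ) {b : ℕ} (hb : b ≠ a) :
    (fill a x g σ m).arr b = σ.arr b := by
  induction m with
  | zero => rfl
  | succ m ih => simp [fill, hb, ih]

theorem fill_arr (a x : ℕ) (g : State → ℕ) (σ : State) (m i : ℕ) :
    (fill a x g σ m).arr a i =
      if i < m then min (g ((fill a x g σ i).set x i)) (σ.var 5) else σ.arr a i := by
  induction m with
  | zero => simp [fill]
  | succ m ih =>
    simp only [fill, State.put_arr, if_true, Function.update_apply, ih]
    split_ifs <;> first | omega | rfl | (subst_vars; rfl)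

/-- The write of a cell. -/
structure Wrt (a i v : ℕ) (τ τ' : State) : Prop where
  var : ∀ x, τ'.var x = τ.var x
  self : ∀ j, τ'.arr a j = if j = i then v else τ.arr a j
  arr : ∀ b, b ≠ a → τ'.arr b = τ.arr b

theorem exec_wrt {W : ℕ} {τ : State} {a : ℕ} {e f : Expr} (i v : ℕ) (hi : e.eval τ = i)
    (hv : f.eval τ = v) (he : e.Fits W τ) (hf : f.Fits W τ) :
    ∃ τ', Exec W (.write a e f) τ (e.cost + f.cost + 1) τ' ∧ Wrt a i v τ τ' :=
  ⟨_, exec_write hi hv he hf, fun x => rfl, fun j => by simp [Function.update_apply],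
    fun b hb => by simp [hb]⟩

/-- The loop that fills a table. -/
theorem exec_tab_loop {B M W : ℕ} (hB : 2 ≤ B) (hMB : M ^ 3 < B) (hBW : B ≤ W) {a x : ℕ}
    {v : Term} (ha : a < 50) (hx6 : 6 ≤ x) (hx : x < 100) (hwf : v.wf = true)
    (hWv : B ^ v.deg ≤ W) (ihv : v.Spec B M W) {m F r : ℕ} (hm : 100 ≤ m) (hF : 50 ≤ F)
    (hrB : r < B) (σ τ : State) (hσ : Bdd B M σ) (hA : Agree σ τ)
    (h0 : τ.var m = r) (h1 : τ.var (m + 1) = 0) (h3 : τ.var (m + 2) = σ.var x) :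
    ∃ t τ', Exec W (.loop (.bin .minus (.var m) (.var (m + 1)))
        (.seq (.assign x (.var (m + 1))) <| .seq (v.comp (m + 3) (F + 1)) <|
          .seq (cut (m + 3) (.var 5)) <|
          .seq (.write F (.var (m + 1)) (.read a (.var (m + 1)))) <|
          .seq (.write a (.var (m + 1)) (.var (m + 3)))
            (.assign (m + 1) (.bin .plus (.var (m + 1)) (.lit 1))))) τ t τ' ∧
      t ≤ r * (v.cst * M ^ v.dep + 30 + 4) + 4 ∧ τ'.var m = r ∧
      (∀ y < m, y ≠ x → τ'.var y = τ.var y) ∧ (∀ b < F, b ≠ a → τ'.arr b = τ.arr b) ∧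
      τ'.arr a = (fill a x v.eval σ r).arr a ∧ (∀ j < r, τ'.arr F j = σ.arr a j) ∧
      τ'.var (m + 2) = σ.var x := by
  refine exec_counter (W := W) (m := m) (r := r) (T := v.cst * M ^ v.dep + 30) (by omega)
    (fun i τ' => (∀ y < m, y ≠ x → τ'.var y = τ.var y) ∧
      (∀ b < F, b ≠ a → τ'.arr b = τ.arr b) ∧
      τ'.arr a = (fill a x v.eval σ i).arr a ∧ (∀ j < i, τ'.arr F j = σ.arr a j) ∧
      τ'.var (m + 2) = σ.var x)
    ?_ τ ⟨fun _ _ _ => rfl, fun _ _ _ => rfl, hA.arr a ha, by simp, h3⟩ h0 h1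
  rintro i hi τ1 ⟨I1, I2, I3, I4, I5⟩ hm0 hm1
  obtain ⟨τ2, E2, U2⟩ := exec_upd (W := W) (τ := τ1) x (e := .var (m + 1)) i hm1
    (by simp only [Expr.Fits]; omega)
  have hA2 : Agree ((fill a x v.eval σ i).set x i) τ2 := by
    refine ⟨fun y hy => ?_, fun b hb => (U2.arr b).trans ?_⟩
    · rw [State.set_var]
      split_ifs with h
      · rw [h, U2.self]
      · rw [U2.var y h, I1 y (by omega) h, hA.var y hy, fill_var]
    · by_cases h : b = a
      · rw [h, I3]; rfl
      · rw [I2 b (by omega) h, hA.arr b hb]; exact (fill_arr_ne a x v.eval σ i h).symm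
  obtain ⟨t3, τ3, E3, c3, w3, g3⟩ := ihv hwf hWv (m + 3) (F + 1) (by omega) (by omega) _ _
    ((hσ.fill a x v.eval i).set hx6 (hi.trans hrB)) hA2
  have hlt := (Term.eval_lt hB hMB v hwf _
    ((hσ.fill a x v.eval i).set hx6 (hi.trans hrB))).trans_le hWv
  have k5 : τ3.var 5 = σ.var 5 := by
    rw [g3.var 5 (by omega), hA2.var 5 (by omega), State.set_var, if_neg (by omega), fill_var]
  have hcB := hσ.var_lt 5
  obtain ⟨τ4, E4, U4⟩ := exec_cut_upd (W := W) (τ := τ3) (x := m + 3) (e := .var 5) (σ.var 5)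
    w3 k5 (by simp only [Expr.Fits, k5]; omega) hlt
  have k1 : τ4.var (m + 1) = i := by
    rw [U4.var _ (by omega), g3.var _ (by omega), U2.var _ (by omega), hm1]
  have k6 : ∀ j, τ4.arr a j = (fill a x v.eval σ i).arr a j := fun j => by
    rw [U4.arr, g3.arr _ (by omega), U2.arr, I3]
  -- Only the cells before `i` have been overwritten, so the value saved in the array `F` is the
  -- original one.
  have k7 : τ4.arr a i = σ.arr a i := by rw [k6, fill_arr, if_neg (by omega)]
  obtain ⟨τ5, E5, U5⟩ := exec_wrt (W := W) (τ := τ4) (a := F) (e := .var (m + 1))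
    (f := .read a (.var (m + 1))) i (σ.arr a i) k1 (by simp only [Expr.eval, k1, k7])
    (by simp only [Expr.Fits]; omega)
    (by simp only [Expr.Fits, Expr.eval, k1, k7]; exact ⟨by omega, (hσ.arr_lt a i).trans_le hBW⟩)
  have k8 : τ5.var (m + 1) = i := (U5.var _).trans k1
  have k9 := (U5.var (m + 3)).trans U4.self
  obtain ⟨τ6, E6, U6⟩ := exec_wrt (W := W) (τ := τ5) (a := a) (e := .var (m + 1))
    (f := .var (m + 3)) i _ k8 k9 (by simp only [Expr.Fits]; omega)
    (by simp only [Expr.Fits]; omega)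
  have k10 : τ6.var (m + 1) = i := (U6.var _).trans k8
  obtain ⟨τ7, E7, U7⟩ := exec_upd (W := W) (τ := τ6) (m + 1)
    (e := .bin .plus (.var (m + 1)) (.lit 1)) (i + 1)
    (by simp only [Expr.eval, Op.eval, k10])
    (by simp only [Expr.eval, Op.eval, k10, Expr.Fits]; omega)
  have V : ∀ y < m + 3, y ≠ m + 1 → y ≠ x → τ7.var y = τ1.var y := fun y h1 h2 h3 => by
    rw [U7.var _ h2, U6.var, U5.var, U4.var _ (by omega), g3.var _ (by omega), U2.var _ h3]
  refine ⟨_, _, E2.seq (E3.seq (E4.seq (E5.seq (E6.seq E7)))), ?_, ?_, U7.self, ?_, ?_, ?_, ?_, ?_⟩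
  · simp only [Expr.cost]; omega
  · rw [V m (by omega) (by omega) (by omega), hm0]
  · intro y hy hyx
    rw [V y (by omega) (by omega) hyx, I1 y hy hyx]
  · intro b hb hba
    rw [U7.arr, U6.arr b hba, U5.arr b (by omega), U4.arr, g3.arr b (by omega), U2.arr, I2 b hb hba]
  · ext j
    rw [U7.arr, U6.self, U5.arr a (by omega), k6]
    simp only [fill, State.put_arr, if_true, Function.update_apply]
  · intro j hj
    rw [U7.arr, U6.arr F (by omega), U5.self]
    split_ifs with h
    · rw [h]
    · rw [U4.arr, g3.arr _ (by omega), U2.arr, I4 j (by omega)]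
  · rw [V _ (by omega) (by omega) (by omega), I5]

/-- The loop that restores an array. -/
theorem exec_restore_loop {W : ℕ} {a : ℕ} {m F r : ℕ} (ha : a < F) (hrW : r < W) (τ : State)
    (g : ℕ → ℕ) (hF : ∀ j < r, τ.arr F j = g j) (hg : ∀ j < r, g j < W)
    (h0 : τ.var m = r) (h1 : τ.var (m + 1) = 0) :
    ∃ t τ', Exec W (.loop (.bin .minus (.var m) (.var (m + 1)))
        (.seq (.write a (.var (m + 1)) (.read F (.var (m + 1))))
            (.assign (m + 1) (.bin .plus (.var (m + 1)) (.lit 1))))) τ t τ' ∧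
      t ≤ r * (10 + 4) + 4 ∧ τ'.var m = r ∧
      (∀ y, y ≠ m + 1 → τ'.var y = τ.var y) ∧ (∀ b, b ≠ a → τ'.arr b = τ.arr b) ∧
      (∀ j, τ'.arr a j = if j < r then g j else τ.arr a j) := by
  refine exec_counter (W := W) (m := m) (r := r) (T := 10) (by omega)
    (fun i τ' => (∀ y, y ≠ m + 1 → τ'.var y = τ.var y) ∧ (∀ b, b ≠ a → τ'.arr b = τ.arr b) ∧
      (∀ j, τ'.arr a j = if j < i then g j else τ.arr a j))
    ?_ τ ⟨fun _ _ => rfl, fun _ _ => rfl, by simp⟩ h0 h1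
  rintro i hi τ1 ⟨I1, I2, I3⟩ hm0 hm1
  have k1 : τ1.arr F i = g i := by rw [I2 F (by omega), hF i hi]
  obtain ⟨τ2, E2, U2⟩ := exec_wrt (W := W) (τ := τ1) (a := a) (e := .var (m + 1))
    (f := .read F (.var (m + 1))) i (g i) hm1 (by simp only [Expr.eval, hm1, k1])
    (by simp only [Expr.Fits]; omega)
    (by simp only [Expr.Fits, Expr.eval, hm1, k1]; exact ⟨by omega, hg i hi⟩)
  have k2 : τ2.var (m + 1) = i := (U2.var _).trans hm1
  obtain ⟨τ3, E3, U3⟩ := exec_upd (W := W) (τ := τ2) (m + 1)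
    (e := .bin .plus (.var (m + 1)) (.lit 1)) (i + 1)
    (by simp only [Expr.eval, Op.eval, k2])
    (by simp only [Expr.eval, Op.eval, k2, Expr.Fits]; omega)
  refine ⟨_, _, E2.seq E3, ?_, ?_, U3.self, ?_, ?_, ?_⟩
  · simp only [Expr.cost]; omega
  · rw [U3.var _ (by omega), U2.var, hm0]
  · intro y hy
    rw [U3.var _ hy, U2.var, I1 y hy]
  · intro b hb
    rw [U3.arr, U2.arr b hb, I2 b hb]
  · intro j
    rw [U3.arr, U2.self, I3]
    split_ifs <;> first | omega | rfl | (subst_vars; rfl)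

/-- Each cell of `a` is copied to the scratch array `F` before it is overwritten, and the copies are
written back after `f` has been computed. Nested terms use scratch arrays from `F + 1` on, so the
saved contents survive. The bound `c ≤ 3` in `wf` and `M ^ 3 < B` keep the length of the table
representable. -/
theorem Term.Spec.tab {a c x : ℕ} {e v f : Term}
    {B M W : ℕ} (hB : 2 ≤ B) (hMB : M ^ 3 < B) (hM : 1 ≤ M)
    (ihe : e.Spec B M W) (ihv : v.Spec B M W)
    (ihf : f.Spec B M W) : (Term.tab a c x e v f).Spec B M W := by
  intro hwf hW
  have hP : ∀ k, 1 ≤ M ^ k := fun k => Nat.one_le_pow _ _ hM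
  have hPm : ∀ {j k}, j ≤ k → M ^ j ≤ M ^ k := fun h => Nat.pow_le_pow_right hM h
  have hBW : B ≤ W :=
    (Nat.le_self_pow (by have := (Term.tab a c x e v f).deg_pos; omega) B).trans hW
  intro m F hm hF σ τ hσ hA
  have hlt := (Term.eval_lt hB hMB _ hwf σ hσ).trans_le hW
  simp only [Term.wf, Bool.and_eq_true, decide_eq_true_eq] at hwf
  obtain ⟨⟨⟨⟨⟨⟨ha, hc⟩, hx6⟩, hx⟩, hwe⟩, hwv⟩, hwf⟩ := hwf
  simp only [Term.deg] at hW
  have hWe : B ^ e.deg ≤ W := (Nat.pow_le_pow_right (by omega) (by omega)).trans hW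
  have hWv : B ^ v.deg ≤ W := (Nat.pow_le_pow_right (by omega) (by omega)).trans hW
  have hWf : B ^ f.deg ≤ W := (Nat.pow_le_pow_right (by omega) (by omega)).trans hW
  obtain ⟨t, τ1, E1, b1, v1, f1⟩ := ihe hwe hWe m F hm hF σ τ hσ hA
  have hA1 := hA.frame f1 hm hF
  have h4 : τ1.var 4 = M := by rw [hA1.var 4 (by omega), hσ.eq]
  have hσx := (hσ.var_lt x).trans_le hBW
  have hMc : M ^ c < B := (hPm hc).trans_lt hMB
  have hev : (Term.tab a c x e v f).eval σ
      = f.eval (fill a x v.eval σ (min (e.eval σ) (M ^ c))) := by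
    simp only [Term.eval, hσ.eq]
  rw [hev] at hlt
  obtain ⟨τ2, E2, U2⟩ := exec_cut_upd (W := W) (τ := τ1) (x := m) (e := powExpr c) (M ^ c) v1
    (by rw [powExpr_eval, h4])
    (powExpr_fits c (by omega) (by omega) (by rw [h4]; omega))
    ((Term.eval_lt hB hMB _ hwe σ hσ).trans_le hWe)
  have hrM : min (e.eval σ) (M ^ c) ≤ M ^ c := min_le_right _ _
  generalize min (e.eval σ) (M ^ c) = r at *
  obtain ⟨τ3, E3, U3⟩ := exec_upd (W := W) (τ := τ2) (m + 1) (e := .lit 0) 0 rfl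
    (by simp only [Expr.Fits]; omega)
  have g3 : Frame m F τ1 τ3 := (U2.frame le_rfl F).trans (U3.frame (by omega) F) le_rfl le_rfl
  have hx3 : τ3.var x = σ.var x := (hA1.frame g3 hm hF).var x hx
  obtain ⟨τ4, E4, U4⟩ := exec_upd (W := W) (τ := τ3) (m + 2) (e := .var x) (σ.var x) hx3
    (by simp only [Expr.Fits, hx3]; exact hσx)
  have g4 := (f1.trans g3 le_rfl le_rfl).trans (U4.frame (by omega) F) le_rfl le_rfl
  obtain ⟨t5, τ5, E5, b5, I0, I1, I2, I3, I4, I5⟩ := exec_tab_loop hB hMB hBW ha hx6 hx hwv hWv ihv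
    hm hF (hrM.trans_lt hMc) σ τ4 hσ (hA.frame g4 hm hF)
    (by rw [U4.var _ (by omega), U3.var _ (by omega), U2.self])
    (by rw [U4.var _ (by omega), U3.self]) U4.self
  obtain ⟨τ6, E6, U6⟩ := exec_upd (W := W) (τ := τ5) x (e := .var (m + 2)) _ I5
    (by simp only [Expr.Fits, I5]; exact hσx)
  have V6 : ∀ y < m, τ6.var y = τ.var y := fun y hy => by
    by_cases h : y = x
    · rw [h, U6.self, hA.var x hx]
    · rw [U6.var _ h, I1 y hy h, g4.var y hy]
  have hA6 : Agree (fill a x v.eval σ r) τ6 := by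
    refine ⟨fun y hy => ?_, fun b hb => (U6.arr b).trans ?_⟩
    · rw [V6 y (by omega), hA.var y hy, fill_var]
    · by_cases h : b = a
      · rw [h, I3]
      · rw [I2 b (by omega) h, g4.arr b (by omega), hA.arr b hb, fill_arr_ne a x v.eval σ r h]
  obtain ⟨t7, τ7, E7, b7, v7, f7⟩ := ihf hwf hWf (m + 3) (F + 1) (by omega) (by omega) _ _
    (hσ.fill a x v.eval r) hA6
  obtain ⟨τ8, E8, U8⟩ := exec_upd (W := W) (τ := τ7) (m + 1) (e := .lit 0) 0 rfl
    (by simp only [Expr.Fits]; omega)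
  obtain ⟨t9, τ9, E9, b9, J0, J1, J2, J3⟩ := exec_restore_loop (W := W) (a := a) (m := m) (F := F)
    (r := r) (by omega) (by omega) τ8 (σ.arr a)
    (fun j hj => by rw [U8.arr, f7.arr F (by omega), U6.arr, I4 j hj])
    (fun j hj => (hσ.arr_lt a j).trans_le hBW)
    (by rw [U8.var _ (by omega), f7.var _ (by omega), U6.var _ (by omega), I0]) U8.self
  have k9 : τ9.var (m + 3) = f.eval (fill a x v.eval σ r) := by
    rw [J1 _ (by omega), U8.var _ (by omega), v7]
  obtain ⟨τ10, E10, U10⟩ := exec_upd (W := W) (τ := τ9) m (e := .var (m + 3)) _ k9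
    (by simp only [Expr.Fits, k9]; exact hlt)
  refine ⟨_, _, E1.seq (E2.seq (E3.seq (E4.seq (E5.seq (E6.seq (E7.seq (E8.seq (E9.seq
    E10)))))))), ?_, ?_, ?_⟩
  · simp only [Term.cst, Term.dep, Expr.cost, powExpr_cost]
    set D := max e.dep (max (c + v.dep) f.dep) with hD
    have h3 := Nat.mul_le_mul_left e.cst (hPm (show e.dep ≤ D by omega))
    have h4 := Nat.mul_le_mul_left f.cst (hPm (show f.dep ≤ D by omega))
    have h5 : r * (v.cst * M ^ v.dep + 30 + 4) ≤ (v.cst + 34) * M ^ (c + v.dep) := by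
      calc r * (v.cst * M ^ v.dep + 30 + 4) ≤ M ^ c * (v.cst * M ^ v.dep + 34 * M ^ v.dep) := by
            refine Nat.mul_le_mul hrM ?_
            have := hP v.dep; omega
        _ = _ := by rw [pow_add]; ring
    have h6 := Nat.mul_le_mul_left (v.cst + 34) (hPm (show c + v.dep ≤ D by omega))
    have h7 : r ≤ M ^ D := hrM.trans (hPm (by omega))
    have := hP D
    linarith
  · rw [hev, U10.self]
  · refine ⟨fun y hy => ?_, fun b hb => ?_⟩
    · rw [U10.var _ (by omega), J1 _ (by omega), U8.var _ (by omega), f7.var _ (by omega), V6 y hy]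
    · rw [U10.arr]
      by_cases h : b = a
      · subst h
        ext j
        rw [J3, U8.arr, f7.arr _ (by omega), U6.arr, I3, fill_arr, hA.arr b ha]
        split_ifs <;> rfl
      · rw [J2 b h, U8.arr, f7.arr _ (by omega), U6.arr, I2 b hb h, g4.arr b hb]

theorem Term.comp_spec {B M W : ℕ} (hB : 2 ≤ B) (hMB : M ^ 3 < B) (hM : 1 ≤ M) (e : Term) :
    e.Spec B M W := by
  induction e with
  | lit k => exact .lit hB hMB
  | var x => exact .var
  | read a e ih => exact .read hB hMB hM ih
  | bin o e f ihe ihf => exact .bin hB hMB hM ihe ihf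
  | sum x e f ihe ihf => exact .sum hB hMB hM ihe ihf
  | bind x e f ihe ihf => exact .bind hB hMB hM ihe ihf
  | tab a c x e v f ihe ihv ihf => exact .tab hB hMB hM ihe ihv ihf

end RAM

/-! ### Structured programs and their compilation -/

namespace RAM

/-- Structured programs over terms: assignment and writing to a cell (both with values cut off at
the value of the variable `5`), counting loops, and a loop that is repeated `Nat.size` of the
variable `1` times. -/
inductive Prog
  | asg (x : ℕ) (e : Term)
  | wr (a : ℕ) (i v : Term)
  | seq (p p' : Prog)
  | ite (e : Term) (p p' : Prog)
  | loop (x : ℕ) (e : Term) (p : Prog)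
  | logl (p : Prog)

/-- Repeats `g` with the values `0, …, m - 1` of the variable `x`. -/
def iter (x : ℕ) (g : State → State) (σ : State) : ℕ → State
  | 0 => σ
  | i + 1 => g ((iter x g σ i).set x i)

/-- Unlike terms, programs change the state permanently; only the counter of a loop is put back
afterwards. -/
def Prog.run : Prog → State → State
  | .asg x e, σ => σ.set x (min (e.eval σ) (σ.var 5))
  | .wr a i v, σ => σ.put a (i.eval σ) (min (v.eval σ) (σ.var 5))
  | .seq p p', σ => p'.run (p.run σ)
  | .ite e p p', σ => if e.eval σ ≠ 0 then p.run σ else p'.run σ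
  | .loop x e p, σ => (iter x p.run σ (min (e.eval σ) (σ.var 4))).set x (σ.var x)
  | .logl p, σ => p.run^[Nat.size (σ.var 1)] σ

def Prog.wf : Prog → Bool
  | .asg x e => 6 ≤ x && x < 100 && e.wf
  | .wr a i v => a < 50 && i.wf && v.wf
  | .seq p p' => p.wf && p'.wf
  | .ite e p p' => e.wf && p.wf && p'.wf
  | .loop x e p => 6 ≤ x && x < 100 && e.wf && p.wf
  | .logl p => p.wf

def Prog.deg : Prog → ℕ
  | .asg _ e => e.deg
  | .wr _ i v => i.deg + v.deg
  | .seq p p' => p.deg + p'.deg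
  | .ite e p p' => e.deg + p.deg + p'.deg
  | .loop _ e p => e.deg + p.deg + 3
  | .logl p => p.deg + 3

def Prog.dep : Prog → ℕ
  | .asg _ e => e.dep
  | .wr _ i v => max i.dep v.dep
  | .seq p p' => max p.dep p'.dep
  | .ite e p p' => max e.dep (max p.dep p'.dep)
  | .loop _ e p => max e.dep (1 + p.dep)
  | .logl p => p.dep

/-- The nesting depth of logarithmic loops. -/
def Prog.ldep : Prog → ℕ
  | .asg _ _ => 0
  | .wr _ _ _ => 0
  | .seq p p' => max p.ldep p'.ldep
  | .ite _ p p' => max p.ldep p'.ldep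
  | .loop _ _ p => p.ldep
  | .logl p => 1 + p.ldep

def Prog.cst : Prog → ℕ
  | .asg _ e => e.cst + 20
  | .wr _ i v => i.cst + v.cst + 20
  | .seq p p' => p.cst + p'.cst
  | .ite e p p' => e.cst + p.cst + p'.cst + 20
  | .loop _ e p => e.cst + p.cst + 50
  | .logl p => p.cst + 20

def Prog.comp : Prog → ℕ → Cmd
  | .asg x e, m => .seq (e.comp m 50) <| .seq (cut m (.var 5)) (.assign x (.var m))
  | .wr a i v, m =>
      .seq (i.comp m 50) <| .seq (v.comp (m + 1) 50) <| .seq (cut (m + 1) (.var 5))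
        (.write a (.var m) (.var (m + 1)))
  | .seq p p', m => .seq (p.comp m) (p'.comp m)
  | .ite e p p', m => .seq (e.comp m 50) (.cond (.var m) (p.comp m) (p'.comp m))
  | .loop x e p, m =>
      .seq (e.comp m 50) <| .seq (cut m (.var 4)) <| .seq (.assign (m + 1) (.lit 0)) <|
      .seq (.assign (m + 2) (.var x)) <|
      .seq (.loop (.bin .minus (.var m) (.var (m + 1)))
        (.seq (.assign x (.var (m + 1))) <| .seq (p.comp (m + 3))
            (.assign (m + 1) (.bin .plus (.var (m + 1)) (.lit 1)))))
      (.assign x (.var (m + 2)))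
  | .logl p, m =>
      .seq (.assign m (.var 1)) <|
      .loop (.var m) (.seq (p.comp (m + 1)) (.assign m (.bin .quot (.var m) (.lit 2))))

/-- The state is bounded, and the variable `1` has the value `q`. -/
def Inv (B M q : ℕ) (σ : State) : Prop := Bdd B M σ ∧ σ.var 1 = q

theorem Inv.set {B M q : ℕ} {σ : State} (h : Inv B M q σ) {x v : ℕ} (hx : 6 ≤ x) (hv : v < B) :
    Inv B M q (σ.set x v) :=
  ⟨h.1.set hx hv, by rw [State.set_var, if_neg (by omega), h.2]⟩

theorem Inv.put {B M q : ℕ} {σ : State} (h : Inv B M q σ) {a i v : ℕ} (hv : v < B) :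
    Inv B M q (σ.put a i v) := ⟨h.1.put hv, h.2⟩

theorem Inv.iter {B M q : ℕ} {σ : State} {x : ℕ} {g : State → State}
    (hx : 6 ≤ x) (h : Inv B M q σ) (hg : ∀ σ, Inv B M q σ → Inv B M q (g σ)) (m : ℕ) (hm : m ≤ B) :
    Inv B M q (iter x g σ m) := by
  induction m with
  | zero => exact h
  | succ m ih => exact hg _ ((ih (by omega)).set hx (by omega))

theorem Prog.run_inv {B M q : ℕ} (hMB : M ^ 3 < B) (p : Prog) (hwf : p.wf = true) :
    ∀ σ, Inv B M q σ → Inv B M q (p.run σ) := by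
  have hM1 : M < B := lt_of_le_of_lt (Nat.le_self_pow (by omega) M) hMB
  induction p with
  | asg x e =>
    simp only [Prog.wf, Bool.and_eq_true, decide_eq_true_eq] at hwf
    exact fun σ h => h.set hwf.1.1 (lt_of_le_of_lt (min_le_right _ _) (h.1.var_lt 5))
  | wr a i v => exact fun σ h => h.put (lt_of_le_of_lt (min_le_right _ _) (h.1.var_lt 5))
  | seq p p' ih ih' =>
    simp only [Prog.wf, Bool.and_eq_true] at hwf
    exact fun σ h => ih' hwf.2 _ (ih hwf.1 σ h)
  | ite e p p' ih ih' =>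
    simp only [Prog.wf, Bool.and_eq_true] at hwf
    intro σ h
    simp only [Prog.run]
    split_ifs
    exacts [ih hwf.1.2 σ h, ih' hwf.2 σ h]
  | loop x e p ih =>
    simp only [Prog.wf, Bool.and_eq_true, decide_eq_true_eq] at hwf
    intro σ h
    refine (h.iter hwf.1.1.1 (ih hwf.2) _ ?_).set hwf.1.1.1 (h.1.var_lt x)
    exact (min_le_right _ _).trans (by rw [h.1.eq]; omega)
  | logl p ih =>
    intro σ h
    simp only [Prog.run]
    generalize Nat.size (σ.var 1) = k
    induction k with
    | zero => exact h
    | succ k ihk => rw [Function.iterate_succ_apply']; exact ih hwf _ ihk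

/-- The compiled program simulates the program within the bounds on time and values. -/
def Prog.Spec (B M W q : ℕ) (p : Prog) : Prop :=
  p.wf = true → B ^ p.deg ≤ W → ∀ m, 100 ≤ m → ∀ σ τ, Inv B M q σ → Agree σ τ →
    ∃ t τ', Exec W (p.comp m) τ t τ' ∧ t ≤ p.cst * (M ^ p.dep * Nat.size q ^ p.ldep) ∧
      Agree (p.run σ) τ' ∧ ∀ x, 100 ≤ x → x < m → τ'.var x = τ.var x

section

variable {B M W q : ℕ}

theorem Prog.deg_pos (p : Prog) : 1 ≤ p.deg := by
  induction p <;> simp only [Prog.deg] <;>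
    first | omega | exact Term.deg_pos _ | (have := Term.deg_pos; grind)

theorem Prog.Spec.asg (hB : 2 ≤ B) (hMB : M ^ 3 < B) (hM : 1 ≤ M) (x : ℕ) (e : Term) :
    (Prog.asg x e).Spec B M W q := by
  intro hwf hW m hm σ τ hσ hA
  simp only [Prog.wf, Bool.and_eq_true, decide_eq_true_eq] at hwf
  simp only [Prog.deg] at hW
  obtain ⟨t, τ1, E1, b1, v1, f1⟩ := Term.comp_spec hB hMB hM e hwf.2 hW m 50 hm le_rfl σ τ hσ.1 hA
  have hBW : B ≤ W := (Nat.le_self_pow (by have := e.deg_pos; omega) B).trans hW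
  have hA1 := hA.frame f1 hm le_rfl
  have h5 := hA1.var 5 (by omega)
  have hlt := hσ.1.var_lt 5
  obtain ⟨τ2, E2, U2⟩ := exec_cut_upd (W := W) (τ := τ1) (x := m) (e := .var 5) (σ.var 5) v1 h5
    (by simp only [Expr.Fits, h5]; omega)
    ((Term.eval_lt hB hMB _ hwf.2 σ hσ.1).trans_le hW)
  obtain ⟨τ3, E3, U3⟩ := exec_upd (W := W) (τ := τ2) x (e := .var m) _ U2.self
    (by simp only [Expr.Fits, U2.self]; omega)
  refine ⟨_, _, E1.seq (E2.seq E3), ?_, (hA1.frame (U2.frame le_rfl 50) hm le_rfl).set U3, ?_⟩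
  · simp only [Prog.cst, Prog.dep, Prog.ldep, Expr.cost, pow_zero, mul_one]
    have : 1 ≤ M ^ e.dep := Nat.one_le_pow _ _ hM
    linarith
  · intro y hy hym
    rw [U3.var _ (by omega), U2.var _ (by omega), f1.var _ hym]

theorem Prog.Spec.wr (hB : 2 ≤ B) (hMB : M ^ 3 < B) (hM : 1 ≤ M) (a : ℕ) (i v : Term) :
    (Prog.wr a i v).Spec B M W q := by
  intro hwf hW m hm σ τ hσ hA
  simp only [Prog.wf, Bool.and_eq_true, decide_eq_true_eq] at hwf
  simp only [Prog.deg] at hW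
  have hWi : B ^ i.deg ≤ W := (Nat.pow_le_pow_right (by omega) (by omega)).trans hW
  have hWv : B ^ v.deg ≤ W := (Nat.pow_le_pow_right (by omega) (by omega)).trans hW
  obtain ⟨t, τ1, E1, b1, v1, f1⟩ :=
    Term.comp_spec hB hMB hM i hwf.1.2 hWi m 50 hm le_rfl σ τ hσ.1 hA
  have hBW : B ≤ W := (Nat.le_self_pow (by have := i.deg_pos; omega) B).trans hWi
  have hA1 := hA.frame f1 hm le_rfl
  obtain ⟨t', τ2, E2, b2, v2, f2⟩ :=
    Term.comp_spec hB hMB hM v hwf.2 hWv (m + 1) 50 (by omega) le_rfl σ τ1 hσ.1 hA1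
  have hA2 := hA1.frame f2 (by omega) le_rfl
  have h5 := hA2.var 5 (by omega)
  have hlt := hσ.1.var_lt 5
  have hlti := (Term.eval_lt hB hMB _ hwf.1.2 σ hσ.1).trans_le hWi
  obtain ⟨τ3, E3, U3⟩ := exec_cut_upd (W := W) (τ := τ2) (x := m + 1) (e := .var 5) (σ.var 5) v2 h5
    (by simp only [Expr.Fits, h5]; omega)
    ((Term.eval_lt hB hMB _ hwf.2 σ hσ.1).trans_le hWv)
  have k3 : τ3.var m = i.eval σ := by rw [U3.var _ (by omega), f2.var _ (by omega), v1]
  obtain ⟨τ4, E4, U4⟩ := exec_wrt (W := W) (τ := τ3) (a := a) (e := .var m)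
    (f := .var (m + 1)) _ _ k3 U3.self (by simp only [Expr.Fits, k3]; omega)
    (by simp only [Expr.Fits, U3.self]; omega)
  have hA3 := hA2.frame (U3.frame (m := 100) (by omega) 50) le_rfl le_rfl
  refine ⟨_, _, E1.seq (E2.seq (E3.seq E4)), ?_, ⟨fun y hy => ?_, fun b hb => ?_⟩, ?_⟩
  · simp only [Prog.cst, Prog.dep, Prog.ldep, Expr.cost, pow_zero, mul_one]
    have h3 := Nat.mul_le_mul_left i.cst
      (Nat.pow_le_pow_right hM (le_max_left i.dep v.dep))
    have h4 := Nat.mul_le_mul_left v.cst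
      (Nat.pow_le_pow_right hM (le_max_right i.dep v.dep))
    have : 1 ≤ M ^ (max i.dep v.dep) := Nat.one_le_pow _ _ hM
    linarith
  · rw [U4.var, hA3.var y hy]; rfl
  · by_cases h : b = a
    · subst h
      ext j
      rw [U4.self, hA3.arr b hb]
      simp [Prog.run, Function.update_apply]
    · rw [U4.arr b h, hA3.arr b hb]; simp [Prog.run, h]
  · intro y hy hym
    rw [U4.var, U3.var _ (by omega), f2.var _ (by omega), f1.var _ hym]

theorem Prog.Spec.seq (hMB : M ^ 3 < B) (hM : 1 ≤ M) (hq : 1 ≤ Nat.size q) {p p' : Prog}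
    (ih : p.Spec B M W q) (ih' : p'.Spec B M W q) : (Prog.seq p p').Spec B M W q := by
  intro hwf hW m hm σ τ hσ hA
  simp only [Prog.wf, Bool.and_eq_true] at hwf
  simp only [Prog.deg] at hW
  obtain ⟨t, τ1, E1, b1, A1, f1⟩ :=
    ih hwf.1 ((Nat.pow_le_pow_right (by omega) (by omega)).trans hW) m hm σ τ hσ hA
  obtain ⟨t', τ2, E2, b2, A2, f2⟩ :=
    ih' hwf.2 ((Nat.pow_le_pow_right (by omega) (by omega)).trans hW) m hm _ τ1
      (p.run_inv hMB hwf.1 σ hσ) A1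
  refine ⟨_, _, E1.seq E2, ?_, A2, fun x hx hxm => (f2 x hx hxm).trans (f1 x hx hxm)⟩
  simp only [Prog.cst, Prog.dep, Prog.ldep, add_mul]
  refine Nat.add_le_add (b1.trans ?_) (b2.trans ?_) <;> gcongr <;> simp

theorem Prog.Spec.ite (hB : 2 ≤ B) (hMB : M ^ 3 < B) (hM : 1 ≤ M) (hq : 1 ≤ Nat.size q) {e : Term}
    {p p' : Prog}
    (ih : p.Spec B M W q) (ih' : p'.Spec B M W q) : (Prog.ite e p p').Spec B M W q := by
  intro hwf hW m hm σ τ hσ hA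
  simp only [Prog.wf, Bool.and_eq_true] at hwf
  simp only [Prog.deg] at hW
  have hWe : B ^ e.deg ≤ W := (Nat.pow_le_pow_right (by omega) (by omega)).trans hW
  obtain ⟨t, τ1, E1, b1, v1, f1⟩ :=
    Term.comp_spec hB hMB hM e hwf.1.1 hWe m 50 hm le_rfl σ τ hσ.1 hA
  have hA1 := hA.frame f1 hm le_rfl
  have hlt := (Term.eval_lt hB hMB _ hwf.1.1 σ hσ.1).trans_le hWe
  have hcost : ∀ {c k j : ℕ}, k ≤ max e.dep (max p.dep p'.dep) → j ≤ max p.ldep p'.ldep →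
      c * (M ^ k * Nat.size q ^ j) ≤ c * (M ^ max e.dep (max p.dep p'.dep) *
        Nat.size q ^ max p.ldep p'.ldep) := by
    intro c k j h1 h2
    gcongr
  have hpos : 1 ≤ M ^ max e.dep (max p.dep p'.dep) * Nat.size q ^ max p.ldep p'.ldep :=
    Nat.mul_pos (Nat.one_le_pow _ _ hM) (Nat.one_le_pow _ _ hq)
  have h1 := hcost (c := e.cst) (k := e.dep) (j := 0) (by omega) (by omega)
  have h2 := hcost (c := p.cst) (k := p.dep) (j := p.ldep) (by omega) (by omega)
  have h3 := hcost (c := p'.cst) (k := p'.dep) (j := p'.ldep) (by omega) (by omega)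
  simp only [pow_zero, mul_one] at h1
  by_cases h : e.eval σ = 0
  · obtain ⟨t', τ2, E2, b2, A2, f2⟩ :=
      ih' hwf.2 ((Nat.pow_le_pow_right (by omega) (by omega)).trans hW) m hm _ τ1 hσ hA1
    refine ⟨_, _, E1.seq (Exec.cond_false (by simp only [Expr.Fits, v1]; exact hlt)
      (by simp only [Expr.eval, v1, h]) E2), ?_, ?_,
      fun x hx hxm => (f2 x hx hxm).trans (f1.var x hxm)⟩
    · simp only [Prog.cst, Prog.dep, Prog.ldep, Expr.cost]
      nlinarith
    · simpa [Prog.run, h] using A2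
  · obtain ⟨t', τ2, E2, b2, A2, f2⟩ :=
      ih hwf.1.2 ((Nat.pow_le_pow_right (by omega) (by omega)).trans hW) m hm _ τ1 hσ hA1
    refine ⟨_, _, E1.seq (Exec.cond_true (by simp only [Expr.Fits, v1]; exact hlt)
      (by simpa only [Expr.eval, v1] using h) E2), ?_, ?_,
      fun x hx hxm => (f2 x hx hxm).trans (f1.var x hxm)⟩
    · simp only [Prog.cst, Prog.dep, Prog.ldep, Expr.cost]
      nlinarith
    · simpa [Prog.run, h] using A2

theorem Prog.Spec.loop (hB : 2 ≤ B) (hMB : M ^ 3 < B) (hM : 1 ≤ M) (hq : 1 ≤ Nat.size q) {x : ℕ}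
    {e : Term} {p : Prog} (ih : p.Spec B M W q) : (Prog.loop x e p).Spec B M W q := by
  intro hwf hW m hm σ τ hσ hA
  simp only [Prog.wf, Bool.and_eq_true, decide_eq_true_eq] at hwf
  obtain ⟨⟨⟨hx6, hx⟩, hwe⟩, hwf⟩ := hwf
  simp only [Prog.deg] at hW
  have hM1 : M < B := lt_of_le_of_lt (Nat.le_self_pow (by omega) M) hMB
  have hWe : B ^ e.deg ≤ W := (Nat.pow_le_pow_right (by omega) (by omega)).trans hW
  have hWp : B ^ p.deg ≤ W := (Nat.pow_le_pow_right (by omega) (by omega)).trans hW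
  have hBW : B ≤ W := (Nat.le_self_pow (by have := e.deg_pos; omega) B).trans hWe
  obtain ⟨t, τ1, E1, b1, v1, f1⟩ :=
    Term.comp_spec hB hMB hM e hwe hWe m 50 hm le_rfl σ τ hσ.1 hA
  have hA1 := hA.frame f1 hm le_rfl
  have h4 : τ1.var 4 = M := by rw [hA1.var 4 (by omega), hσ.1.eq]
  have hσx := (hσ.1.var_lt x).trans_le hBW
  have hev : (Prog.loop x e p).run σ = (iter x p.run σ (min (e.eval σ) M)).set x (σ.var x) := by
    simp only [Prog.run, hσ.1.eq]
  obtain ⟨τ2, E2, U2⟩ := exec_cut_upd (W := W) (τ := τ1) (x := m) (e := .var 4) M v1 h4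
    (by simp only [Expr.Fits, h4]; omega) ((Term.eval_lt hB hMB _ hwe σ hσ.1).trans_le hWe)
  have hrM : min (e.eval σ) M ≤ M := min_le_right _ _
  generalize min (e.eval σ) M = r at *
  obtain ⟨τ3, E3, U3⟩ := exec_upd (W := W) (τ := τ2) (m + 1) (e := .lit 0) 0 rfl
    (by simp only [Expr.Fits]; omega)
  have g3 : Frame m 50 τ1 τ3 := (U2.frame le_rfl 50).trans (U3.frame (by omega) 50) le_rfl le_rfl
  have hx3 : τ3.var x = σ.var x := (hA1.frame g3 hm le_rfl).var x hx
  obtain ⟨τ4, E4, U4⟩ := exec_upd (W := W) (τ := τ3) (m + 2) (e := .var x) (σ.var x) hx3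
    (by simp only [Expr.Fits, hx3]; exact hσx)
  have g4 := (f1.trans g3 le_rfl le_rfl).trans (U4.frame (by omega) 50) le_rfl le_rfl
  obtain ⟨t5, τ5, E5, b5, I0, I1, I2, I3⟩ := exec_counter (W := W) (m := m) (r := r)
    (T := p.cst * (M ^ p.dep * Nat.size q ^ p.ldep) + 10) (by omega)
    (body := (.seq (.assign x (.var (m + 1))) <| .seq (p.comp (m + 3))
            (.assign (m + 1) (.bin .plus (.var (m + 1)) (.lit 1)))))
    (fun i τ' => Agree (iter x p.run σ i) τ' ∧
      (∀ y, 100 ≤ y → y < m → τ'.var y = τ.var y) ∧ τ'.var (m + 2) = σ.var x)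
    (by
      rintro i hi τ1 ⟨I1, I2, I3⟩ hm0 hm1
      obtain ⟨τ2, E2, U2⟩ := exec_upd (W := W) (τ := τ1) x (e := .var (m + 1)) i hm1
        (by simp only [Expr.Fits]; omega)
      obtain ⟨t3, τ3, E3, c3, A3, g3⟩ := ih hwf hWp (m + 3) (by omega) _ τ2
        ((hσ.iter hx6 (p.run_inv hMB hwf) i (by omega)).set hx6 (show i < B by omega)) (I1.set U2)
      have k3 : τ3.var (m + 1) = i := by
        rw [g3 _ (by omega) (by omega), U2.var _ (by omega), hm1]
      obtain ⟨τ4, E4, U4⟩ := exec_upd (W := W) (τ := τ3) (m + 1)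
        (e := .bin .plus (.var (m + 1)) (.lit 1)) (i + 1)
        (by simp only [Expr.eval, Op.eval, k3])
        (by simp only [Expr.eval, Op.eval, k3, Expr.Fits]; omega)
      refine ⟨_, _, E2.seq (E3.seq E4), ?_, ?_, U4.self,
        A3.frame (U4.frame (m := 100) (by omega) 50) le_rfl le_rfl, ?_, ?_⟩
      · simp only [Expr.cost]; omega
      · rw [U4.var _ (by omega), g3 _ (by omega) (by omega), U2.var _ (by omega), hm0]
      · intro y hy hym
        rw [U4.var _ (by omega), g3 _ (by omega) (by omega), U2.var _ (by omega), I2 y hy hym]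
      · rw [U4.var _ (by omega), g3 _ (by omega) (by omega), U2.var _ (by omega), I3])
    τ4 ⟨hA.frame g4 hm le_rfl, fun y _ hy => g4.var y hy, U4.self⟩
    (by rw [U4.var _ (by omega), U3.var _ (by omega), U2.self])
    (by rw [U4.var _ (by omega), U3.self])
  obtain ⟨τ6, E6, U6⟩ := exec_upd (W := W) (τ := τ5) x (e := .var (m + 2)) _ I3
    (by simp only [Expr.Fits, I3]; exact hσx)
  refine ⟨_, _, E1.seq (E2.seq (E3.seq (E4.seq (E5.seq E6)))), ?_, ?_, ?_⟩
  · simp only [Prog.cst, Prog.dep, Prog.ldep, Expr.cost]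
    set D := max e.dep (1 + p.dep) with hD
    have hL : 1 ≤ Nat.size q ^ p.ldep := Nat.one_le_pow _ _ hq
    have hP : 1 ≤ M ^ p.dep := Nat.one_le_pow _ _ hM
    have hPD : 1 ≤ M ^ D := Nat.one_le_pow _ _ hM
    have h3 : e.cst * M ^ e.dep ≤ e.cst * (M ^ D * Nat.size q ^ p.ldep) := by
      refine Nat.mul_le_mul_left _ ((Nat.pow_le_pow_right hM (show e.dep ≤ D by omega)).trans ?_)
      exact Nat.le_mul_of_pos_right _ hL
    have h5 : r * (p.cst * (M ^ p.dep * Nat.size q ^ p.ldep) + 10 + 4)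
        ≤ (p.cst + 14) * (M ^ D * Nat.size q ^ p.ldep) := by
      calc r * (p.cst * (M ^ p.dep * Nat.size q ^ p.ldep) + 10 + 4)
          ≤ M * (p.cst * (M ^ p.dep * Nat.size q ^ p.ldep) +
              14 * (M ^ p.dep * Nat.size q ^ p.ldep)) := by
            refine Nat.mul_le_mul hrM ?_
            have := Nat.mul_pos hP hL; omega
        _ = (p.cst + 14) * (M ^ (1 + p.dep) * Nat.size q ^ p.ldep) := by ring
        _ ≤ _ := by
            refine Nat.mul_le_mul_left _ (Nat.mul_le_mul_right _ ?_)
            exact Nat.pow_le_pow_right hM (by omega)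
    have h7 : 1 ≤ M ^ D * Nat.size q ^ p.ldep := Nat.mul_pos hPD hL
    linarith
  · rw [hev]
    exact I1.set U6
  · intro y hy hym
    rw [U6.var _ (by omega), I2 y hy hym]

/-- A register is started at `q` and halved until it is `0`. This takes exactly `Nat.size q` rounds,
since halving a positive number shortens its binary expansion by one digit; the induction is over
the content `z` of the register. -/
theorem Prog.Spec.logl (hB : 2 ≤ B) (hMB : M ^ 3 < B) (hM : 1 ≤ M)
    (hq : 1 ≤ Nat.size q) {p : Prog} (ih : p.Spec B M W q) : (Prog.logl p).Spec B M W q := by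
  intro hwf hW m hm σ τ hσ hA
  simp only [Prog.wf] at hwf
  simp only [Prog.deg] at hW
  have hWp : B ^ p.deg ≤ W := (Nat.pow_le_pow_right (by omega) (by omega)).trans hW
  have hBW : B ≤ W := (Nat.le_self_pow (by omega) B).trans hW
  have h2W : 2 < W := lt_of_lt_of_le (by nlinarith [pow_succ B 1])
    ((Nat.pow_le_pow_right (by omega) (show 2 ≤ p.deg + 3 by omega)).trans hW)
  have hqB : q < B := hσ.2 ▸ hσ.1.var_lt 1
  suffices H : ∀ z, z ≤ q → ∀ σ τ, Inv B M q σ → Agree σ τ → τ.var m = z →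
      ∃ t τ', Exec W (.loop (.var m) (.seq (p.comp (m + 1))
        (.assign m (.bin .quot (.var m) (.lit 2))))) τ t τ' ∧
        t ≤ Nat.size z * (p.cst * (M ^ p.dep * Nat.size q ^ p.ldep) + 6) + 2 ∧
        Agree (p.run^[Nat.size z] σ) τ' ∧ ∀ x, 100 ≤ x → x < m → τ'.var x = τ.var x by
    have h1 : τ.var 1 = q := by rw [hA.var 1 (by omega), hσ.2]
    obtain ⟨τ1, E1, U1⟩ := exec_upd (W := W) (τ := τ) m (e := .var 1) q h1
      (by simp only [Expr.Fits, h1]; omega)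
    obtain ⟨t, τ2, E2, b2, A2, f2⟩ := H q le_rfl σ τ1 hσ
      (hA.frame (U1.frame (m := 100) (by omega) 50) le_rfl le_rfl) U1.self
    refine ⟨_, _, E1.seq E2, ?_, ?_, fun x hx hxm => ?_⟩
    · simp only [Prog.cst, Prog.dep, Prog.ldep, Expr.cost]
      have hL : 1 ≤ Nat.size q ^ p.ldep := Nat.one_le_pow _ _ hq
      have hP : 1 ≤ M ^ p.dep := Nat.one_le_pow _ _ hM
      have h7 : 1 ≤ M ^ p.dep * Nat.size q ^ p.ldep := Nat.mul_pos hP hL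
      calc 1 + 1 + t ≤ 4 * Nat.size q + Nat.size q *
            (p.cst * (M ^ p.dep * Nat.size q ^ p.ldep) + 6) := by omega
        _ ≤ Nat.size q * (p.cst * (M ^ p.dep * Nat.size q ^ p.ldep) +
              10 * (M ^ p.dep * Nat.size q ^ p.ldep)) := by nlinarith
        _ = (p.cst + 10) * (M ^ p.dep * Nat.size q ^ (1 + p.ldep)) := by ring
        _ ≤ _ := Nat.mul_le_mul_right _ (by omega)
    · simpa only [Prog.run, hσ.2] using A2
    · rw [f2 x hx hxm, U1.var _ (by omega)]
  intro z
  induction z using Nat.strong_induction_on with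
  | _ z ihz =>
    intro hzq σ τ hσ hA hz
    by_cases h0 : z = 0
    · subst h0
      refine ⟨_, τ, Exec.loop_false (by simp only [Expr.Fits]; omega) hz,
        by simp [Expr.cost], by simpa using hA, fun _ _ _ => rfl⟩
    · obtain ⟨t1, τ1, E1, b1, A1, f1⟩ := ih hwf hWp (m + 1) (by omega) σ τ hσ hA
      have k1 : τ1.var m = z := by rw [f1 m hm (by omega), hz]
      obtain ⟨τ2, E2, U2⟩ := exec_upd (W := W) (τ := τ1) m
        (e := .bin .quot (.var m) (.lit 2)) (z / 2) (by simp only [Expr.eval, Op.eval, k1])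
        (by simp only [Expr.Fits, Expr.eval, Op.eval, k1]; omega)
      obtain ⟨t3, τ3, E3, b3, A3, f3⟩ := ihz (z / 2) (by omega) (by omega) _ τ2
        (p.run_inv hMB hwf σ hσ)
        (A1.frame (U2.frame (m := 100) (by omega) 50) le_rfl le_rfl) U2.self
      have hs : Nat.size z = Nat.size (z / 2) + 1 := by
        have := Nat.size_bit (b := z.bodd) (n := z.div2)
          (by rw [Nat.bit_bodd_div2]; exact h0)
        rwa [Nat.bit_bodd_div2, Nat.div2_val] at this
      refine ⟨_, _, Exec.loop_true (by simp only [Expr.Fits]; omega)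
        (by simp only [Expr.eval]; omega) (E1.seq E2) E3, ?_, ?_, fun x hx hxm => ?_⟩
      · simp only [Expr.cost]
        rw [hs, Nat.add_mul]
        omega
      · rw [hs, Function.iterate_succ_apply]; exact A3
      · rw [f3 x hx hxm, U2.var _ (by omega), f1 x hx (by omega)]

theorem Prog.comp_spec (hB : 2 ≤ B) (hMB : M ^ 3 < B) (hM : 1 ≤ M) (hq : 1 ≤ Nat.size q)
    (p : Prog) : p.Spec B M W q := by
  induction p with
  | asg x e => exact .asg hB hMB hM x e
  | wr a i v => exact .wr hB hMB hM a i v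
  | seq p p' ih ih' => exact .seq hMB hM hq ih ih'
  | ite e p p' ih ih' => exact .ite hB hMB hM hq ih ih'
  | loop x e p ih => exact .loop hB hMB hM hq ih
  | logl p ih => exact .logl hB hMB hM hq ih

end

end RAM

/-! ### The order on words is a strict total order -/

namespace MDWord

section least

variable {α : Type} {R : α → α → Prop}

/-- Strict total orders. -/
structure StrictTotal (R : α → α → Prop) : Prop where
  irrefl : ∀ a, ¬ R a a
  trans : ∀ a b c, R a b → R b c → R a c
  tri : ∀ a b, R a b ∨ a = b ∨ R b a

theorem StrictTotal.asymm (h : StrictTotal R) {a b : α} (hab : R a b) : ¬ R b a :=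
  fun hba => h.irrefl a (h.trans a b a hab hba)

/-- On a finite type a strict order is well-founded, so a nonempty set has a minimal element, and
totality makes it the smallest. Hence the default value in `least` plays no role. -/
theorem least_spec [Finite α] (h : StrictTotal R) {S : Set α} (hS : S.Nonempty) (a : α) :
    least R S a ∈ S ∧ ∀ x ∈ S, x ≠ least R S a → R (least R S a) x := by
  have : ∃ c, c ∈ S ∧ ∀ x ∈ S, x ≠ c → R c x := by
    have : IsTrans α R := ⟨h.trans⟩
    have : Std.Irrefl R := ⟨h.irrefl⟩
    obtain ⟨c, hc, hmin⟩ := (Finite.wellFounded_of_trans_of_irrefl R).has_min S hS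
    exact ⟨c, hc, fun x hx hxc => ((h.tri c x).resolve_right fun h =>
      h.elim (fun h => hxc h.symm) (hmin x hx))⟩
  exact Classical.epsilon_spec_aux ⟨a⟩ _ this

theorem least_eq [Finite α] (h : StrictTotal R) {S : Set α} {c : α} (hc : c ∈ S)
    (hmin : ∀ x ∈ S, x ≠ c → R c x) (a : α) : least R S a = c := by
  have h1 := least_spec h ⟨c, hc⟩ a
  by_contra hne
  exact h.asymm (hmin _ h1.1 hne) (h1.2 c hc (Ne.symm hne))

end least

section index

/-- The index is a mixed-radix expansion whose last coordinate is the most significant digit.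
Inductions on the dimension peel off this digit. -/
theorem posIndex_succ {d : ℕ} {n : Fin (d + 1) → ℕ} (g : Pos n) :
    posIndex g = posIndex (n := fun k : Fin d => n k.castSucc) (fun k => g k.castSucc) +
      (g (Fin.last d) : ℕ) * ∏ k : Fin d, n k.castSucc := by
  unfold posIndex
  rw [Fin.sum_univ_castSucc]
  congr 1
  · refine Finset.sum_congr rfl fun k _ => ?_
    rw [← Fin.map_castSuccEmb_Iio, Finset.prod_map]
    rfl
  · rw [Fin.Iio_last_eq_map, Finset.prod_map]
    rfl

theorem posIndex_lt {d : ℕ} {n : Fin d → ℕ} (g : Pos n) : posIndex g < ∏ k, n k := by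
  induction d with
  | zero => simp [posIndex]
  | succ d ih =>
    rw [posIndex_succ, Fin.prod_univ_castSucc]
    have h1 := ih (n := fun k : Fin d => n k.castSucc) (fun k => g k.castSucc)
    have h2 := (g (Fin.last d)).isLt
    calc _ < (g (Fin.last d) + 1 : ℕ) * ∏ k : Fin d, n k.castSucc := by linarith
      _ ≤ n (Fin.last d) * ∏ k : Fin d, n k.castSucc := Nat.mul_le_mul_right _ h2
      _ = _ := mul_comm _ _

theorem posIndex_injective {d : ℕ} {n : Fin d → ℕ} :
    Function.Injective (posIndex : Pos n → ℕ) := by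
  induction d with
  | zero => exact fun g h _ => funext fun k => k.elim0
  | succ d ih =>
    intro g h hgh
    rw [posIndex_succ, posIndex_succ] at hgh
    have h1 := posIndex_lt (n := fun k : Fin d => n k.castSucc) (fun k => g k.castSucc)
    have h2 := posIndex_lt (n := fun k : Fin d => n k.castSucc) (fun k => h k.castSucc)
    set P := ∏ k : Fin d, n k.castSucc
    have h3 : (g (Fin.last d) : ℕ) = h (Fin.last d) := by
      have := congrArg (· / P) hgh
      simpa [Nat.add_mul_div_right _ _ (by omega : 0 < P), Nat.div_eq_of_lt h1,
        Nat.div_eq_of_lt h2] using this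
    rw [h3] at hgh
    have h4 := ih (n := fun k : Fin d => n k.castSucc) (Nat.add_right_cancel hgh)
    funext k
    refine Fin.lastCases ?_ (fun k => ?_) k
    · exact Fin.ext h3
    · exact congrFun h4 k

end index

section action

variable {d : ℕ} {n : Fin d → ℕ} [∀ k, NeZero (n k)] {q : ℕ}

instance wordAction : AddAction (Pos n) (Word n q) where
  vadd := translate
  zero_vadd u := funext fun p => congrArg u (funext fun k => add_zero (p k))
  add_vadd g h u := funext fun p => congrArg u (funext fun k => (add_assoc (p k) (g k) (h k)).symm)

end action

/-- The canonical representation: the smallest translate. -/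
noncomputable def canon {d : ℕ} {n : Fin d → ℕ} {q : ℕ} (u : Word n q) : Word n q :=
  canonWith lt u

/-- The index of the smallest translation to the canonical representation. -/
noncomputable def trIndex {d : ℕ} {n : Fin d → ℕ} {q : ℕ} (u : Word n q) : ℕ :=
  transIndex u (canon u)

/-- The order of the slices. -/
def pre {d : ℕ} {n : Fin d → ℕ} {q : ℕ} (u v : Word n q) : Prop :=
  lt (canon u) (canon v) ∨ canon u = canon v ∧ trIndex u < trIndex v

section order

variable {d : ℕ} {n : Fin d → ℕ} [∀ k, NeZero (n k)] {q : ℕ}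

theorem canon_mem_of (h : StrictTotal (lt : Word n q → Word n q → Prop)) (u : Word n q) :
    ∃ g : Pos n, g +ᵥ u = canon u :=
  (least_spec h (S := {v | ∃ r, translate r u = v}) ⟨u, 0, zero_vadd (Pos n) u⟩ u).1

theorem trIndex_spec_of (h : StrictTotal (lt : Word n q → Word n q → Prop)) (u : Word n q) :
    (∃ g : Pos n, g +ᵥ u = canon u ∧ posIndex g = trIndex u) ∧
      ∀ g : Pos n, g +ᵥ u = canon u → trIndex u ≤ posIndex g := by
  obtain ⟨g, hg⟩ := canon_mem_of h u
  exact ⟨Nat.sInf_mem (s := {m | ∃ g : Pos n, translate g u = canon u ∧ posIndex g = m})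
    ⟨_, g, hg, rfl⟩, fun g hg => Nat.sInf_le ⟨g, hg, rfl⟩⟩

/-- Equal indices mean that the same translation `g` takes both words to the common canonical
representation, and translating by `g` is injective. This is what makes the order of the slices
antisymmetric. The hypothesis on `lt` is the induction hypothesis of `lt_strictTotal`. -/
theorem eq_of_trIndex_of (h : StrictTotal (lt : Word n q → Word n q → Prop)) {u v : Word n q}
    (hc : canon u = canon v) (ht : trIndex u = trIndex v) : u = v := by
  obtain ⟨⟨g, hg, hg'⟩, -⟩ := trIndex_spec_of h u
  obtain ⟨⟨g', hh, hh'⟩, -⟩ := trIndex_spec_of h v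
  obtain rfl : g = g' := posIndex_injective (by omega)
  exact (AddAction.injective g) (hg.trans (hc.trans hh.symm))

theorem pre_strictTotal_of (h : StrictTotal (lt : Word n q → Word n q → Prop)) :
    StrictTotal (pre : Word n q → Word n q → Prop) where
  irrefl u := by rintro (h1 | h1); exacts [h.irrefl _ h1, absurd h1.2 (lt_irrefl _)]
  trans u v w := by
    rintro (h1 | ⟨h1, h1'⟩) (h2 | ⟨h2, h2'⟩)
    · exact .inl (h.trans _ _ _ h1 h2)
    · exact .inl (h2 ▸ h1)
    · exact .inl (h1 ▸ h2)
    · exact .inr ⟨h1.trans h2, h1'.trans h2'⟩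
  tri u v := by
    rcases h.tri (canon u) (canon v) with h1 | h1 | h1
    · exact .inl (.inl h1)
    · rcases lt_trichotomy (trIndex u) (trIndex v) with h2 | h2 | h2
      · exact .inl (.inr ⟨h1, h2⟩)
      · exact .inr (.inl (eq_of_trIndex_of h h1 h2))
      · exact .inr (.inr (.inr ⟨h1.symm, h2⟩))
    · exact .inr (.inr (.inl h1))

end order

theorem eq_of_slice_eq {d : ℕ} {n : Fin (d + 1) → ℕ} {q : ℕ} {u v : Word n q}
    (h : ∀ j, slice u j = slice v j) : u = v := by
  funext p
  have := congrFun (h (p (Fin.last d))) (fun k => p k.castSucc)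
  have e : Fin.snoc (α := fun k => Fin (n k)) (fun k => p k.castSucc) (p (Fin.last d)) = p :=
    Fin.snoc_init_self p
  simpa only [slice, e] using this

theorem lt_succ_iff {d : ℕ} {n : Fin (d + 1) → ℕ} {q : ℕ} {w u : Word n q} :
    lt w u ↔ ∃ j, (∀ i < j, slice w i = slice u i) ∧ slice w j ≠ slice u j ∧
      pre (slice w j) (slice u j) := by
  rw [lt]; rfl

/-- Induction on the dimension: in dimension `d + 1` the order is lexicographic in the slices with
respect to `pre`, and `pre` is itself lexicographic in the canonical representation and the index.
-/
theorem lt_strictTotal {d : ℕ} {n : Fin d → ℕ} [∀ k, NeZero (n k)] {q : ℕ} :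
    StrictTotal (lt : Word n q → Word n q → Prop) := by
  induction d with
  | zero =>
    refine ⟨fun a => ?_, fun a b c => ?_, fun a b => ?_⟩
    · rw [lt]; exact lt_irrefl _
    · simp only [lt]; exact lt_trans
    · simp only [lt]
      rcases lt_trichotomy (a fun k => k.elim0) (b fun k => k.elim0) with h | h | h
      · exact .inl h
      · refine .inr (.inl (funext fun p => ?_))
        rwa [Subsingleton.elim p fun k => k.elim0]
      · exact .inr (.inr h)
  | succ d ih =>
    have hp := pre_strictTotal_of (ih (n := fun k : Fin d => n k.castSucc))
    refine ⟨fun a => ?_, fun a b c => ?_, fun a b => ?_⟩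
    · rw [lt_succ_iff]; rintro ⟨j, -, h, -⟩; exact h rfl
    · simp only [lt_succ_iff]
      rintro ⟨j, h1, h1', h1''⟩ ⟨i, h2, h2', h2''⟩
      rcases lt_trichotomy i j with h | rfl | h
      · exact ⟨i, fun k hk => (h1 k (hk.trans h)).trans (h2 k hk), h1 i h ▸ h2', h1 i h ▸ h2''⟩
      · have := hp.trans _ _ _ h1'' h2''
        exact ⟨i, fun k hk => (h1 k hk).trans (h2 k hk), fun e => hp.irrefl _ (e ▸ this), this⟩
      · exact ⟨j, fun k hk => (h1 k hk).trans (h2 k (hk.trans h)), h2 j h ▸ h1', h2 j h ▸ h1''⟩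
    · by_cases h : ∃ j, slice a j ≠ slice b j
      · obtain ⟨j, hj, hmin⟩ := WellFounded.has_min (wellFounded_lt (α := Fin (n (Fin.last d))))
          {j | slice a j ≠ slice b j} h
        have hmin' : ∀ i < j, slice a i = slice b i := fun i hi => by
          by_contra hne; exact hmin i hne hi
        simp only [lt_succ_iff]
        rcases hp.tri (slice a j) (slice b j) with h1 | h1 | h1
        · exact .inl ⟨j, hmin', hj, h1⟩
        · exact absurd h1 hj
        · exact .inr (.inr ⟨j, fun i hi => (hmin' i hi).symm, Ne.symm hj, h1⟩)
      · push Not at h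
        exact .inr (.inl (eq_of_slice_eq h))

section order

variable {d : ℕ} {n : Fin d → ℕ} [∀ k, NeZero (n k)] {q : ℕ}

theorem pre_strictTotal : StrictTotal (pre : Word n q → Word n q → Prop) :=
  pre_strictTotal_of lt_strictTotal

theorem canon_mem (u : Word n q) : ∃ g : Pos n, g +ᵥ u = canon u := canon_mem_of lt_strictTotal u

theorem canon_eq {u c : Word n q} (hc : ∃ g : Pos n, g +ᵥ u = c)
    (hmin : ∀ g : Pos n, g +ᵥ u ≠ c → lt c (g +ᵥ u)) : canon u = c :=
  least_eq lt_strictTotal hc (by rintro x ⟨g, rfl⟩ hx; exact hmin g hx) u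

theorem canon_le (u : Word n q) (g : Pos n) : g +ᵥ u = canon u ∨ lt (canon u) (g +ᵥ u) :=
  or_iff_not_imp_left.2 fun h => (least_spec lt_strictTotal
    (S := {v | ∃ r, translate r u = v}) ⟨u, 0, zero_vadd (Pos n) u⟩ u).2 _ ⟨g, rfl⟩ h

theorem canon_vadd (g : Pos n) (u : Word n q) : canon (g +ᵥ u) = canon u := by
  obtain ⟨h, hh⟩ := canon_mem u
  refine canon_eq ⟨h - g, by rw [vadd_vadd, sub_add_cancel, hh]⟩ fun g' hg' => ?_
  rw [vadd_vadd] at hg' ⊢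
  exact (canon_le u (g' + g)).resolve_left hg'

theorem canon_canon (u : Word n q) : canon (canon u) = canon u := by
  obtain ⟨h, hh⟩ := canon_mem u
  rw [← hh, canon_vadd, hh]

theorem canon_eq_canon_iff {u v : Word n q} :
    canon u = canon v ↔ ∃ g : Pos n, g +ᵥ u = v := by
  refine ⟨fun h => ?_, by rintro ⟨g, rfl⟩; exact (canon_vadd g u).symm⟩
  obtain ⟨a, ha⟩ := canon_mem u
  obtain ⟨b, hb⟩ := canon_mem v
  refine ⟨-b + a, ?_⟩
  rw [← vadd_vadd, ha, h, ← hb, vadd_vadd, neg_add_cancel, zero_vadd]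

theorem trIndex_spec (u : Word n q) : ∃ g : Pos n, g +ᵥ u = canon u ∧ posIndex g = trIndex u :=
  (trIndex_spec_of lt_strictTotal u).1

theorem trIndex_le {u : Word n q} {g : Pos n} (hg : g +ᵥ u = canon u) : trIndex u ≤ posIndex g :=
  (trIndex_spec_of lt_strictTotal u).2 g hg

theorem eq_of_trIndex {u v : Word n q} (hc : canon u = canon v) (ht : trIndex u = trIndex v) :
    u = v := eq_of_trIndex_of lt_strictTotal hc ht

theorem trIndex_lt (u : Word n q) : trIndex u < ∏ k, n k := by
  obtain ⟨g, -, hg⟩ := trIndex_spec u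
  exact hg ▸ posIndex_lt g

end order

end MDWord

/-! ### Upward closed sets of necklaces -/

namespace MDWord

section upset

variable {d : ℕ} {n : Fin d → ℕ} [∀ k, NeZero (n k)] {q : ℕ}

/-- Sets of words that consist of all necklaces above some bound. -/
def UpOrb (U : Set (Word n q)) : Prop :=
  ∀ u v, u ∈ U → canon u = canon v ∨ lt (canon u) (canon v) → v ∈ U

/-- Sets of words that are closed upwards for the order of slices. -/
def UpPre (Θ : Set (Word n q)) : Prop := ∀ u v, u ∈ Θ → pre u v → v ∈ Θ

/-- The words in larger necklaces. -/
def above (c : Word n q) : Set (Word n q) := {u | lt (canon c) (canon u)}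

theorem upOrb_above (c : Word n q) : UpOrb (above c) := by
  rintro u v hu (h | h)
  · simpa only [above, Set.mem_ofPred_eq, h] using hu
  · exact lt_strictTotal.trans _ _ _ hu h

theorem UpOrb.upPre {U : Set (Word n q)} (h : UpOrb U) : UpPre U := fun u v hu huv =>
  h u v hu (huv.elim .inr fun h => .inl h.1)

theorem UpOrb.vadd_mem {U : Set (Word n q)} (h : UpOrb U) {u : Word n q} (g : Pos n) :
    g +ᵥ u ∈ U ↔ u ∈ U :=
  ⟨fun hu => h _ _ hu (.inl (canon_vadd g u)), fun hu => h _ _ hu (.inl (canon_vadd g u).symm)⟩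

theorem UpOrb.canon_mem {U : Set (Word n q)} (h : UpOrb U) {u : Word n q} :
    canon u ∈ U ↔ u ∈ U :=
  ⟨fun hu => h _ _ hu (.inl (canon_canon u)), fun hu => h _ _ hu (.inl (canon_canon u).symm)⟩

/-- Both sets are final segments of the same total order of necklaces. -/
theorem UpOrb.subset_or {U V : Set (Word n q)} (hU : UpOrb U) (hV : UpOrb V) :
    U ⊆ V ∨ V ⊆ U := by
  by_contra! h
  obtain ⟨h1, h2⟩ := h
  obtain ⟨a, ha, ha'⟩ := Set.not_subset.1 h1
  obtain ⟨b, hb, hb'⟩ := Set.not_subset.1 h2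
  rcases lt_strictTotal.tri (canon a) (canon b) with h | h | h
  · exact hb' (hU a b ha (.inr h))
  · exact hb' (hU a b ha (.inl h))
  · exact ha' (hV b a hb (.inr h))

/-- As final segments form a chain, membership can be read off from cardinalities. This allows the
program to compare bounds through numbers only, without storing the sets. -/
theorem UpOrb.mem_iff_card {U : Set (Word n q)} (hU : UpOrb U) (a : Word n q) :
    a ∈ U ↔ (above a).ncard < U.ncard := by
  constructor
  · intro ha
    refine Set.ncard_lt_ncard ⟨fun u hu => hU a u ha (.inr hu), fun h => ?_⟩ (Set.toFinite _)
    exact lt_strictTotal.irrefl _ (h ha)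
  · intro h
    by_contra ha
    refine absurd (Set.ncard_le_ncard (fun u hu => ?_) (Set.toFinite (above a))) (not_le.2 h)
    rcases lt_strictTotal.tri (canon a) (canon u) with h | h | h
    · exact h
    · exact absurd (hU u a hu (.inl h.symm)) ha
    · exact absurd (hU u a hu (.inr h)) ha

theorem canon_eq_iff_card {a b : Word n q} :
    canon a = canon b ↔ (above a).ncard = (above b).ncard := by
  refine ⟨fun h => by simp only [above, h], fun h => ?_⟩
  rcases lt_strictTotal.tri (canon a) (canon b) with h1 | h1 | h1
  · have := ((upOrb_above a).mem_iff_card b).1 h1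
    omega
  · exact h1
  · have := ((upOrb_above b).mem_iff_card a).1 h1
    omega

end upset

section next

variable {d : ℕ} {n : Fin (d + 1) → ℕ} [∀ k, NeZero (n k)] {q : ℕ}

/-- The word `v` is larger than the sequence of the first `s` slices of `f`, followed by the
bound `Θ` for the slice `s`. -/
def Gt (f : Word n q) (s : Fin (n (Fin.last d))) (Θ : Set (Word (fun k : Fin d => n k.castSucc) q))
    (v : Word n q) : Prop :=
  ∃ t ≤ s, (∀ l < t, slice v l = slice f l) ∧
    ((t = s ∧ slice v s ∈ Θ) ∨ (t < s ∧ pre (slice f t) (slice v t)))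

/-- The words whose canonical representation is larger than the first `s` slices of `f`, followed
by the bound `Θ` for the slice `s`. -/
def next (f : Word n q) (s : Fin (n (Fin.last d)))
    (Θ : Set (Word (fun k : Fin d => n k.castSucc) q)) : Set (Word n q) :=
  {v | Gt f s Θ (canon v)}

variable {f : Word n q} {s : Fin (n (Fin.last d))}
  {Θ : Set (Word (fun k : Fin d => n k.castSucc) q)}

/-- If `v` first exceeds the bound at `t` and `u` first exceeds `v` at `j`, then `u` exceeds the
bound at the smaller of `t` and `j`; when they coincide, transitivity of `pre` or the closure of `Θ`
is used. -/
theorem Gt.of_lt (hΘ : UpPre Θ) {v u : Word n q} (hv : Gt f s Θ v) (h : lt v u) :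
    Gt f s Θ u := by
  obtain ⟨t, hts, h1, h2⟩ := hv
  obtain ⟨j, g1, -, g2⟩ := lt_succ_iff.1 h
  rcases lt_trichotomy j t with hjt | rfl | hjt
  · exact ⟨j, hjt.le.trans hts, fun l hl => (g1 l hl).symm.trans (h1 l (hl.trans hjt)),
      .inr ⟨hjt.trans_le hts, h1 j hjt ▸ g2⟩⟩
  · refine ⟨j, hts, fun l hl => (g1 l hl).symm.trans (h1 l hl), ?_⟩
    rcases h2 with ⟨rfl, h2⟩ | ⟨h3, h2⟩
    · exact .inl ⟨rfl, hΘ _ _ h2 g2⟩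
    · exact .inr ⟨h3, pre_strictTotal.trans _ _ _ h2 g2⟩
  · refine ⟨t, hts, fun l hl => (g1 l (hl.trans hjt)).symm.trans (h1 l hl), ?_⟩
    rcases h2 with ⟨rfl, h2⟩ | ⟨h3, h2⟩
    · exact .inl ⟨rfl, g1 t hjt ▸ h2⟩
    · exact .inr ⟨h3, g1 t hjt ▸ h2⟩

theorem upOrb_next (hΘ : UpPre Θ) : UpOrb (next f s Θ) := by
  rintro u v hu (h | h)
  · simpa only [next, Set.mem_ofPred_eq, h] using hu
  · exact Gt.of_lt hΘ hu h

/-- The canonical representation is the smallest translate and `Gt` is closed upwards. The condition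
thereby becomes one on all translates, which can be checked without knowing the canonical one. -/
theorem mem_next_iff (hΘ : UpPre Θ) {v : Word n q} :
    v ∈ next f s Θ ↔ ∀ g : Pos n, Gt f s Θ (g +ᵥ v) := by
  refine ⟨fun h g => ?_, fun h => ?_⟩
  · rcases canon_le v g with h1 | h1
    · rw [h1]; exact h
    · exact Gt.of_lt hΘ h h1
  · obtain ⟨g, hg⟩ := canon_mem v
    have := h g
    rwa [hg] at this

theorem gt_self_iff : Gt f s Θ f ↔ slice f s ∈ Θ := by
  constructor
  · rintro ⟨t, -, -, ⟨rfl, h⟩ | ⟨-, h⟩⟩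
    exacts [h, absurd h (pre_strictTotal.irrefl _)]
  · exact fun h => ⟨s, le_rfl, fun _ _ => rfl, .inl ⟨rfl, h⟩⟩

theorem self_mem_next_iff (hf : canon f = f) : f ∈ next f s Θ ↔ slice f s ∈ Θ := by
  simp only [next, Set.mem_ofPred_eq, hf, gt_self_iff]

/-- If `s` is the last index, then the bound describes the whole word, so it is the strict order
itself. -/
theorem above_eq_next (hf : canon f = f) (hs : (s : ℕ) + 1 = n (Fin.last d)) :
    above f = next f s {a | pre (slice f s) a} := by
  ext u
  simp only [above, next, Set.mem_ofPred_eq, hf, lt_succ_iff]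
  constructor
  · rintro ⟨j, h1, -, h2⟩
    have hjs : j ≤ s := by rw [Fin.le_def]; have := j.isLt; omega
    refine ⟨j, hjs, fun l hl => (h1 l hl).symm, ?_⟩
    rcases hjs.eq_or_lt with rfl | h
    exacts [.inl ⟨rfl, h2⟩, .inr ⟨h, h2⟩]
  · rintro ⟨t, -, h1, ⟨rfl, h⟩ | ⟨-, h⟩⟩
    · exact ⟨t, fun l hl => (h1 l hl).symm, fun e => pre_strictTotal.irrefl _ (e ▸ h), h⟩
    · exact ⟨t, fun l hl => (h1 l hl).symm, fun e => pre_strictTotal.irrefl _ (e ▸ h), h⟩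

end next

/-! ### Ranks of necklaces and Burnside's count -/

section necklace

variable {d : ℕ} {n : Fin d → ℕ} [∀ k, NeZero (n k)] {q : ℕ}

theorem necklace_mk_eq {u v : Word n q} :
    (Quotient.mk (translationSetoid n q) u : Necklace n q) = Quotient.mk _ v ↔
      canon u = canon v := by
  rw [canon_eq_canon_iff]
  exact Quotient.eq

theorem canon_mk (u : Word n q) : Necklace.canon (Quotient.mk (translationSetoid n q) u) = canon u := by
  refine least_eq lt_strictTotal ?_ ?_ _
  · exact necklace_mk_eq.2 (canon_canon u)
  · intro x hx hne
    obtain ⟨g, rfl⟩ := canon_eq_canon_iff.1 (necklace_mk_eq.1 (Eq.symm hx))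
    exact (canon_le u g).resolve_left hne

theorem mk_canon (x : Necklace n q) : Quotient.mk (translationSetoid n q) x.canon = x := by
  induction x using Quotient.inductionOn with
  | h u => rw [canon_mk]; exact necklace_mk_eq.2 (canon_canon u)

theorem canon_necklace_canon (x : Necklace n q) : canon x.canon = x.canon := by
  rw [← canon_mk, mk_canon]

theorem necklace_canon_injective :
    Function.Injective (Necklace.canon : Necklace n q → Word n q) := fun x y h => by
  rw [← mk_canon x, h, mk_canon]

instance : Finite (Necklace n q) := Finite.of_injective _ necklace_canon_injective

theorem rank_lt_rank {x y : Necklace n q} (h : lt x.canon y.canon) : x.rank < y.rank := by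
  refine Set.ncard_lt_ncard (s := {z : Necklace n q | lt z.canon x.canon})
    (t := {z | lt z.canon y.canon}) ⟨fun z hz => lt_strictTotal.trans _ _ _ hz h, fun h' => ?_⟩
    (Set.toFinite _)
  exact lt_strictTotal.irrefl _ (h' h)

theorem rank_add (x : Necklace n q) : x.rank + 1 + {y : Necklace n q | lt x.canon y.canon}.ncard =
    Nat.card (Necklace n q) := by
  have h1 : x.rank = {y : Necklace n q | lt y.canon x.canon}.ncard := rfl
  have hx : x ∉ {y : Necklace n q | lt y.canon x.canon} := fun h => lt_strictTotal.irrefl _ h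
  have hu : (Set.univ : Set (Necklace n q)) = insert x {y : Necklace n q | lt y.canon x.canon} ∪
      {y : Necklace n q | lt x.canon y.canon} := by
    ext y
    simp only [Set.mem_univ, Set.mem_union, Set.mem_insert_iff, Set.mem_ofPred_eq, true_iff]
    rcases lt_strictTotal.tri x.canon y.canon with h | h | h
    · exact .inr h
    · exact .inl (.inl (necklace_canon_injective h.symm))
    · exact .inl (.inr h)
  rw [h1, ← Set.ncard_insert_of_notMem hx (Set.toFinite _), ← Set.ncard_union_eq ?_
    (Set.toFinite _) (Set.toFinite _), ← hu, Set.ncard_univ]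
  rw [Set.disjoint_left]
  rintro y (rfl | hy) hy'
  · exact lt_strictTotal.irrefl _ hy'
  · exact lt_strictTotal.asymm hy hy'

/-- The rank is strictly monotone, hence an injection between finite sets of the same size. -/
theorem exists_rank_eq {i : ℕ} (hi : i < Nat.card (Necklace n q)) :
    ∃ x : Necklace n q, x.rank = i := by
  have hlt : ∀ x : Necklace n q, x.rank < Nat.card (Necklace n q) := fun x => by
    have := rank_add x; omega
  let φ : Necklace n q → Fin (Nat.card (Necklace n q)) := fun x => ⟨x.rank, hlt x⟩
  have hφ : Function.Injective φ := fun x y h => by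
    have h' : x.rank = y.rank := congrArg Fin.val h
    rcases lt_strictTotal.tri x.canon y.canon with h1 | h1 | h1
    · have := rank_lt_rank h1; omega
    · exact necklace_canon_injective h1
    · have := rank_lt_rank h1; omega
  have := (Function.Injective.bijective_of_nat_card_le hφ (by simp)).2 ⟨i, hi⟩
  exact this.imp fun x h => congrArg Fin.val h

/-- The necklaces in `U` and those above `x` are two final segments, so they are comparable; `x`
belongs to the first but never to the second. This decides all queries of the search by a count. -/
theorem canon_notMem_iff {U : Set (Word n q)} (hU : UpOrb U) (x : Necklace n q) :
    x.canon ∉ U ↔ {y : Necklace n q | y.canon ∈ U}.ncard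
      ≤ {y : Necklace n q | lt x.canon y.canon}.ncard := by
  constructor
  · refine fun hx => Set.ncard_le_ncard (fun y hy => ?_) (Set.toFinite _)
    have hy : y.canon ∈ U := hy
    rcases lt_strictTotal.tri x.canon y.canon with h | h | h
    · exact h
    · rw [h] at hx; exact absurd hy hx
    · refine absurd (hU _ _ hy (.inr ?_)) hx
      rwa [canon_necklace_canon, canon_necklace_canon]
  · intro h hx
    refine absurd (Set.ncard_lt_ncard (t := {y : Necklace n q | y.canon ∈ U}) ⟨fun y hy => ?_, fun h => ?_⟩
      (Set.toFinite _)) (not_lt.2 h)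
    · refine hU _ _ hx (.inr ?_)
      rw [canon_necklace_canon, canon_necklace_canon]; exact hy
    · exact lt_strictTotal.irrefl _ (h hx)

-- Burnside's lemma for the action of the translations on the invariant set `U`, whose orbits are
-- the necklaces in `U`.
open Classical in
theorem sum_card_fixed {U : Set (Word n q)} (hU : UpOrb U) :
    ∑ g : Pos n, {u | u ∈ U ∧ g +ᵥ u = u}.ncard =
      {y : Necklace n q | y.canon ∈ U}.ncard * ∏ k, n k := by
  let S : SubAddAction (Pos n) (Word n q) := ⟨U, fun g u hu => (hU.vadd_mem g).2 hu⟩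
  have h := AddAction.sum_card_fixedBy_eq_card_orbits_mul_card_addGroup (Pos n) S
  have h1 : Fintype.card (Pos n) = ∏ k, n k := by simp [Pos]
  have h2 : ∀ g : Pos n, Fintype.card (AddAction.fixedBy S g) =
      {u | u ∈ U ∧ g +ᵥ u = u}.ncard := fun g => by
    rw [← Nat.card_eq_fintype_card, ← Nat.card_coe_set_eq]
    refine Nat.card_congr ⟨fun u => ⟨u.1.1, u.1.2, congrArg Subtype.val u.2⟩,
      fun u => ⟨⟨u.1, u.2.1⟩, Subtype.ext u.2.2⟩, fun u => rfl, fun u => rfl⟩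
  have h3 : Fintype.card (AddAction.orbitRel.Quotient (Pos n) S) =
      {y : Necklace n q | y.canon ∈ U}.ncard := by
    rw [← Nat.card_eq_fintype_card, ← Nat.card_coe_set_eq]
    refine Nat.card_eq_of_bijective (fun o => Quotient.liftOn o
      (fun u : S => (⟨Quotient.mk (translationSetoid n q) u.1, by
        have h := hU.canon_mem.2 u.2; rw [← canon_mk] at h; exact h⟩ :
          {y : Necklace n q | y.canon ∈ U})) ?_) ⟨?_, ?_⟩
    · rintro u v ⟨g, hg⟩
      refine Subtype.ext (necklace_mk_eq.2 ?_)
      rw [← hg]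
      exact canon_vadd g v.1
    · rintro ⟨u⟩ ⟨v⟩ h
      have := necklace_mk_eq.1 (congrArg Subtype.val h)
      obtain ⟨g, hg⟩ := canon_eq_canon_iff.1 this.symm
      exact Quotient.sound ⟨g, Subtype.ext hg⟩
    · rintro ⟨y, hy⟩
      exact ⟨Quotient.mk _ ⟨y.canon, hy⟩, Subtype.ext (mk_canon y)⟩
  rw [← h3, ← h1, ← h]
  exact Finset.sum_congr rfl fun g _ => (h2 g).symm

end necklace

end MDWord

/-! ### The automaton of initial segments and its closed walks -/

namespace MDWord

section longest

variable {A : Type}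

open Classical in
/-- The longest suffix that belongs to the set `S`. -/
noncomputable def longest (S : Set (List A)) : List A → List A
  | [] => []
  | a :: x => if a :: x ∈ S then a :: x else longest S x

variable {S : Set (List A)}

theorem longest_suffix (x : List A) : longest S x <:+ x := by
  induction x with
  | nil => exact List.suffix_rfl
  | cons a x ih =>
    rw [longest]
    split_ifs
    exacts [List.suffix_rfl, ih.trans (List.suffix_cons a x)]

theorem longest_mem (h : [] ∈ S) (x : List A) : longest S x ∈ S := by
  induction x with
  | nil => exact h
  | cons a x ih =>
    rw [longest]
    split_ifs with h'
    exacts [h', ih]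

theorem suffix_longest {x y : List A} (hy : y ∈ S) (hyx : y <:+ x) : y <:+ longest S x := by
  induction x with
  | nil => exact hyx
  | cons a x ih =>
    rw [longest]
    split_ifs with h
    · exact hyx
    · rcases List.suffix_cons_iff.1 hyx with rfl | h'
      exacts [absurd hy h, ih h']

theorem longest_of_mem {x : List A} (h : x ∈ S) : longest S x = x := by
  cases x with
  | nil => rfl
  | cons a x => rw [longest, if_pos h]

/-- Elements of `S` have length at most `s`, so only the last `s` letters matter. -/
theorem longest_append {s : ℕ} (hS : ∀ y ∈ S, y.length ≤ s) (z u : List A) (hu : s ≤ u.length) :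
    longest S (z ++ u) = longest S u := by
  induction z with
  | nil => rfl
  | cons b z ih =>
    rw [List.cons_append, longest, if_neg, ih]
    intro h
    have := hS _ h
    simp at this
    omega

theorem suffix_antisymm {x y : List A} (h : x <:+ y) (h' : y <:+ x) : x = y :=
  h.eq_of_length (le_antisymm h.length_le h'.length_le)

/-- The update rule of the Knuth–Morris–Pratt and Aho–Corasick automata: since `S` is closed under
prefixes, a suffix of `u ++ [a]` in `S` is, without its last letter, a suffix of `u` in `S`, hence
of `longest S u`. -/
theorem longest_snoc (h0 : [] ∈ S) (hp : ∀ y a, y ++ [a] ∈ S → y ∈ S) (u : List A) (a : A) :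
    longest S (u ++ [a]) = longest S (longest S u ++ [a]) := by
  apply suffix_antisymm
  · rcases List.eq_nil_or_concat (longest S (u ++ [a])) with h | ⟨y, b, h⟩
    · rw [h]; exact List.nil_suffix
    · have h1 := longest_mem h0 (u ++ [a])
      have h2 := longest_suffix (S := S) (u ++ [a])
      refine suffix_longest h1 ?_
      rw [h] at h1 h2 ⊢
      rw [List.concat_eq_append] at h1 h2 ⊢
      obtain ⟨z, hz⟩ := h2
      rw [← List.append_assoc] at hz
      obtain ⟨hz1, hz2⟩ := List.append_inj' hz rfl
      obtain ⟨z', hz'⟩ := suffix_longest (hp y b h1) ⟨z, hz1⟩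
      exact ⟨z', by rw [← List.append_assoc, hz', hz2]⟩
  · refine suffix_longest (longest_mem h0 _) ((longest_suffix _).trans ?_)
    obtain ⟨z, hz⟩ := longest_suffix (S := S) u
    exact ⟨z, by rw [← List.append_assoc, hz]⟩

theorem longest_map {e : A → A} (he : ∀ x, x.map e ∈ S ↔ x ∈ S) (x : List A) :
    longest S (x.map e) = (longest S x).map e := by
  induction x with
  | nil => rfl
  | cons a x ih =>
    have := he (a :: x)
    rw [List.map_cons] at this
    rw [List.map_cons, longest, longest, ih]
    by_cases h : a :: x ∈ S
    · rw [if_pos h, if_pos (this.2 h), List.map_cons]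
    · rw [if_neg h, if_neg (fun h' => h (this.1 h'))]

/-- The state after reading the letters of `l`, starting in the state `x`. -/
noncomputable def reach (S : Set (List A)) (x l : List A) : List A :=
  l.foldl (fun y a => longest S (y ++ [a])) x

theorem reach_snoc (x l : List A) (a : A) :
    reach S x (l ++ [a]) = longest S (reach S x l ++ [a]) := by
  simp [reach]

theorem reach_eq (h0 : [] ∈ S) (hp : ∀ y a, y ++ [a] ∈ S → y ∈ S) {x : List A} (hx : x ∈ S)
    (l : List A) : reach S x l = longest S (x ++ l) := by
  induction l using List.reverseRecOn with
  | nil => simp [reach, longest_of_mem hx]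
  | append_singleton l a ih =>
    rw [reach_snoc, ih, ← List.append_assoc, ← longest_snoc h0 hp]

theorem reach_map {e : A → A} (he : ∀ x, x.map e ∈ S ↔ x ∈ S) (x l : List A) :
    reach S (x.map e) (l.map e) = (reach S x l).map e := by
  induction l using List.reverseRecOn with
  | nil => rfl
  | append_singleton l a ih =>
    rw [List.map_append, List.map_singleton, reach_snoc, reach_snoc, ih, ← longest_map he]
    simp

end longest

section walks

variable {A : Type} [Fintype A]

/-- Every letter that is read is allowed in the state in which it is read. -/
def OkRun (S : Set (List A)) (P : List A → A → Prop) (x : List A) : List A → Prop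
  | [] => True
  | a :: l => P x a ∧ OkRun S P (longest S (x ++ [a])) l

theorem okRun_iff {S : Set (List A)} {P : List A → A → Prop} (x l : List A) :
    OkRun S P x l ↔ ∀ i (h : i < l.length), P (reach S x (l.take i)) l[i] := by
  induction l generalizing x with
  | nil => simp [OkRun]
  | cons a l ih =>
    rw [OkRun, ih]
    constructor
    · rintro ⟨h1, h2⟩ (_ | i) hi
      · exact h1
      · exact h2 i (by simpa using hi)
    · intro h
      exact ⟨h 0 (by simp), fun i hi => h (i + 1) (by simpa using hi)⟩

open Classical in
/-- The number of walks of length `p` from `x` to `y`. -/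
noncomputable def walks (S : Set (List A)) (P : List A → A → Prop) : ℕ → List A → List A → ℕ
  | 0, x, y => if x = y then 1 else 0
  | p + 1, x, y => ∑ a with P x a, walks S P p (longest S (x ++ [a])) y

-- The automaton is deterministic, so a walk is the same as the list of letters that it reads. The
-- finite set of these lists is the target of the bijection in `ncard_good`.
open Classical in
theorem exists_walks_finset (S : Set (List A)) (P : List A → A → Prop) (p : ℕ) (x y : List A) :
    ∃ T : Finset (List A), T.card = walks S P p x y ∧
      ∀ l, l ∈ T ↔ l.length = p ∧ OkRun S P x l ∧ reach S x l = y := by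
  induction p generalizing x with
  | zero =>
    by_cases h : x = y
    · exact ⟨{[]}, by simp [walks, h], fun l => by
        constructor
        · intro hl; obtain rfl := Finset.mem_singleton.1 hl; exact ⟨rfl, trivial, h⟩
        · rintro ⟨hl, -, -⟩; simpa using hl⟩
    · refine ⟨∅, by simp [walks, h], fun l => ?_⟩
      constructor
      · intro hl; simp at hl
      · rintro ⟨hl, -, h'⟩
        obtain rfl := List.length_eq_zero_iff.1 hl
        exact absurd h' h
  | succ p ih =>
    choose T hT hT' using ih
    refine ⟨(Finset.univ.filter (P x)).biUnion fun a =>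
      (T (longest S (x ++ [a]))).map ⟨List.cons a, List.cons_injective⟩, ?_, fun l => ?_⟩
    · rw [Finset.card_biUnion]
      · simp [hT, walks]
      · intro a _ b _ hab
        rw [Function.onFun, Finset.disjoint_left]
        intro l h1 h2
        simp only [Finset.mem_map, Function.Embedding.coeFn_mk] at h1 h2
        obtain ⟨l1, -, rfl⟩ := h1
        obtain ⟨l2, -, h⟩ := h2
        exact hab (List.cons.inj h).1.symm
    · simp only [Finset.mem_biUnion, Finset.mem_filter, Finset.mem_univ, true_and,
        Finset.mem_map, Function.Embedding.coeFn_mk, hT']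
      constructor
      · rintro ⟨a, ha, l', ⟨h1, h2, h3⟩, rfl⟩
        exact ⟨by simp [h1], ⟨ha, h2⟩, h3⟩
      · rintro ⟨h1, h2, h3⟩
        cases l with
        | nil => simp at h1
        | cons a l => exact ⟨a, h2.1, l, ⟨by simpa using h1, h2.2, h3⟩, rfl⟩

end walks

section patterns

variable {A G : Type} [AddCommGroup G] [AddAction G A]

/-- The translate by `r` of the first `t` letters of `w`. -/
def pat (w : ℕ → A) (t : ℕ) (r : G) : List A := (List.range t).map fun l => r +ᵥ w l

variable (G) in
/-- The translates of the first at most `s` letters of `w`. -/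
def pats (w : ℕ → A) (s : ℕ) : Set (List A) := {x | ∃ t ≤ s, ∃ r : G, x = pat w t r}

variable (G) in
/-- The letter `a` may be read in the state `x`. -/
def Allowed (w : ℕ → A) (s : ℕ) (Ok : ℕ → Set A) (x : List A) (a : A) : Prop :=
  ∀ t ≤ s, ∀ r : G, pat w t r <:+ x → (-r) +ᵥ a ∈ Ok t

variable (G) in
/-- Every translate of the sequence satisfies the bounds. -/
def Good (w : ℕ → A) (s : ℕ) (Ok : ℕ → Set A) (v : ℤ → A) : Prop :=
  ∀ i : ℤ, ∀ t ≤ s, ∀ r : G, (∀ l < t, r +ᵥ v (i + l) = w l) → r +ᵥ v (i + t) ∈ Ok t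

/-- The `s` letters before the position `i`. -/
def hist (s : ℕ) (v : ℤ → A) (i : ℤ) : List A :=
  (List.range s).map fun l : ℕ => v (i - s + l)

variable {w : ℕ → A} {s : ℕ} {Ok : ℕ → Set A}

theorem nil_mem_pats : [] ∈ pats G w s := ⟨0, Nat.zero_le _, 0, rfl⟩

theorem pat_mem_pats {t : ℕ} (ht : t ≤ s) (r : G) : pat w t r ∈ pats G w s := ⟨t, ht, r, rfl⟩

@[simp] theorem length_pat (t : ℕ) (r : G) : (pat w t r).length = t := by simp [pat]

theorem pats_prefix (y : List A) (a : A) (h : y ++ [a] ∈ pats G w s) : y ∈ pats G w s := by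
  obtain ⟨t, ht, r, h⟩ := h
  have hl := congrArg List.length h
  simp at hl
  subst hl
  rw [pat, List.range_succ, List.map_append] at h
  exact ⟨_, by omega, r, (List.append_inj' h rfl).1⟩

theorem map_pat (t : ℕ) (r γ : G) : (pat w t r).map (γ +ᵥ ·) = pat w t (γ + r) := by
  simp [pat, add_vadd]

theorem map_map_vadd (γ γ' : G) (x : List A) :
    (x.map (γ +ᵥ ·)).map (γ' +ᵥ ·) = x.map ((γ' + γ) +ᵥ ·) := by
  simp [add_vadd, Function.comp_def]

theorem map_neg_vadd (γ : G) (x : List A) : (x.map (γ +ᵥ ·)).map (-γ +ᵥ ·) = x := by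
  simp [Function.comp_def]

theorem map_mem_pats (γ : G) (x : List A) : x.map (γ +ᵥ ·) ∈ pats G w s ↔ x ∈ pats G w s := by
  constructor
  · rintro ⟨t, ht, r, h⟩
    refine ⟨t, ht, -γ + r, ?_⟩
    rw [← map_pat, ← h, map_neg_vadd]
  · rintro ⟨t, ht, r, rfl⟩
    exact ⟨t, ht, γ + r, map_pat t r γ⟩

theorem length_le_of_mem_pats {y : List A} (h : y ∈ pats G w s) : y.length ≤ s := by
  obtain ⟨t, ht, r, rfl⟩ := h
  simpa using ht

@[simp] theorem length_hist (v : ℤ → A) (i : ℤ) : (hist s v i).length = s := by simp [hist]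

theorem pat_suffix_hist {v : ℤ → A} {i : ℤ} {t : ℕ} (ht : t ≤ s) (r : G) :
    pat w t r <:+ hist s v i ↔ ∀ l < t, v (i - t + l) = r +ᵥ w l := by
  rw [List.suffix_iff_eq_drop, length_hist, length_pat]
  constructor
  · intro h l hl
    have h1 := congrArg (fun x : List A => x[l]?) h
    simp [pat, hist, hl, show s - t + l < s by omega, ht] at h1
    rw [h1]
    congr 1
    ring
  · intro h
    apply List.ext_getElem
    · simp [hist]; omega
    · intro l h1 h2
      simp only [length_pat] at h1
      simp only [pat, List.getElem_map, List.getElem_range, hist, List.getElem_drop]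
      rw [← h l h1]
      congr 1
      push_cast [ht]
      ring

/-- The condition depends only on the patterns that end in `x`, and each of them also ends in the
longest one. -/
theorem allowed_longest (x : List A) (a : A) :
    Allowed G w s Ok (longest (pats G w s) x) a ↔ Allowed G w s Ok x a :=
  ⟨fun h t ht r hr => h t ht r (suffix_longest (pat_mem_pats ht r) hr),
    fun h t ht r hr => h t ht r (hr.trans (longest_suffix x))⟩

/-- An occurrence of a pattern is looked at from its last position instead of its first. The sign of
`r` changes because `Good` translates the sequence and `Allowed` the pattern. -/
theorem good_iff (v : ℤ → A) :
    Good G w s Ok v ↔ ∀ i, Allowed G w s Ok (longest (pats G w s) (hist s v i)) (v i) := by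
  simp only [allowed_longest]
  constructor
  · intro h i t ht r hr
    rw [pat_suffix_hist ht] at hr
    have := h (i - t) t ht (-r) (fun l hl => by rw [hr l hl, neg_vadd_vadd])
    simpa using this
  · intro h i t ht r hr
    have := h (i + t) t ht (-r) ((pat_suffix_hist ht _).2 fun l hl => by
      rw [← hr l hl, neg_vadd_vadd]; congr 1; ring)
    simpa using this

/-- The set of patterns is invariant under translations, so the automaton commutes with them. This
gives sense to walks that close up to a translation. -/
theorem allowed_map (γ : G) (x : List A) (a : A) :
    Allowed G w s Ok (x.map (γ +ᵥ ·)) (γ +ᵥ a) ↔ Allowed G w s Ok x a := by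
  have key : ∀ (γ : G) (x : List A) (a : A), Allowed G w s Ok x a →
      Allowed G w s Ok (x.map (γ +ᵥ ·)) (γ +ᵥ a) := by
    intro γ x a h t ht r hr
    have h1 : pat w t (-γ + r) <:+ x := by
      rw [← map_pat, ← map_neg_vadd γ x]
      exact hr.map _
    have := h t ht _ h1
    rw [vadd_vadd]
    convert this using 2
    abel
  refine ⟨fun h => ?_, key γ x a⟩
  have := key (-γ) _ _ h
  rwa [map_neg_vadd, neg_vadd_vadd] at this

theorem hist_succ (v : ℤ → A) (i : ℤ) :
    longest (pats G w s) (hist s v (i + 1)) =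
      longest (pats G w s) (longest (pats G w s) (hist s v i) ++ [v i]) := by
  rw [← longest_snoc nil_mem_pats pats_prefix]
  have h : hist s v i ++ [v i] = [v (i - s)] ++ hist s v (i + 1) := by
    have h1 : hist s v i ++ [v i] = (List.range (s + 1)).map fun l : ℕ => v (i - s + l) := by
      rw [List.range_succ, List.map_append]; simp [hist]
    rw [h1, List.range_succ_eq_map, List.map_cons, List.map_map]
    simp only [hist, Nat.cast_zero, add_zero, List.singleton_append, List.cons.injEq, true_and]
    refine List.map_congr_left fun l _ => ?_
    simp only [Function.comp_apply]
    congr 1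
    push_cast
    ring
  rw [h, longest_append (fun y hy => length_le_of_mem_pats hy) _ _ (by simp)]

theorem hist_reach (v : ℤ → A) (i : ℤ) (m : ℕ) :
    longest (pats G w s) (hist s v (i + m)) =
      reach (pats G w s) (longest (pats G w s) (hist s v i))
        ((List.range m).map fun l : ℕ => v (i + l)) := by
  induction m with
  | zero => simp [reach]
  | succ m ih =>
    rw [List.range_succ, List.map_append, List.map_singleton, reach_snoc, ← ih, ← hist_succ]
    push_cast
    rw [add_assoc]

section closed

variable {γ : G} {p : ℕ}

theorem twist_mul {v : ℤ → A} (hv : ∀ i, v (i + p) = γ +ᵥ v i) (m : ℕ) (i : ℤ) :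
    v (i + m * p) = (m • γ) +ᵥ v i := by
  induction m with
  | zero => simp
  | succ m ih =>
    have : i + ((m + 1 : ℕ) : ℤ) * p = (i + m * p) + p := by push_cast; ring
    rw [this, hv, ih, vadd_vadd, succ_nsmul']

theorem twist_eq {v v' : ℤ → A} (hv : ∀ i, v (i + p) = γ +ᵥ v i)
    (hv' : ∀ i, v' (i + p) = γ +ᵥ v' i) (hp : 0 < p) (h : ∀ i : ℕ, i < p → v i = v' i) :
    v = v' := by
  have h0 : ∀ i : ℤ, 0 ≤ i → v i = v' i := fun i hi => by
    lift i to ℕ using hi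
    have h1 := twist_mul hv (i / p) ((i % p : ℕ) : ℤ)
    have h2 := twist_mul hv' (i / p) ((i % p : ℕ) : ℤ)
    have h3 : (((i % p : ℕ) : ℤ) + ((i / p : ℕ) : ℤ) * p) = (i : ℤ) := by
      have := Nat.mod_add_div' i p
      exact_mod_cast this
    rw [h3] at h1 h2
    rw [h1, h2, h _ (Nat.mod_lt _ hp)]
  funext i
  have h1 := twist_mul hv i.natAbs i
  have h2 := twist_mul hv' i.natAbs i
  rw [h0 _ (by
    have h4 : |i| * 1 ≤ |i| * p := mul_le_mul_of_nonneg_left (by exact_mod_cast hp) (abs_nonneg i)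
    have h5 := neg_abs_le i
    push_cast
    omega), h2] at h1
  exact (AddAction.injective _ h1).symm

theorem hist_twist {v : ℤ → A} (hv : ∀ i, v (i + p) = γ +ᵥ v i) (m : ℕ) (i : ℤ) :
    hist s v (i + m * p) = (hist s v i).map ((m • γ) +ᵥ ·) := by
  simp only [hist, List.map_map, Function.comp_def]
  refine List.map_congr_left fun l _ => ?_
  rw [← twist_mul hv]
  congr 1
  ring

/-- The sequence with period `p` up to the translation `γ` that begins with `l`. -/
def twistExt (γ : G) (l : List A) (a : A) (i : ℤ) : A :=
  ((i / l.length) • γ) +ᵥ l.getD (i % l.length).toNat a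

theorem twistExt_add (l : List A) (a : A) (hl : 0 < l.length) (i : ℤ) :
    twistExt γ l a (i + l.length) = γ +ᵥ twistExt γ l a i := by
  have h : (l.length : ℤ) ≠ 0 := by omega
  rw [twistExt, twistExt, Int.add_emod_right, vadd_vadd, Int.add_ediv_of_dvd_right (dvd_refl _),
    Int.ediv_self h, add_zsmul, one_zsmul, add_comm]

theorem twistExt_of_lt (l : List A) (a : A) {i : ℕ} (hi : i < l.length) :
    twistExt γ l a i = l[i] := by
  have h1 : (i : ℤ) / l.length = 0 := Int.ediv_eq_zero_of_lt (by omega) (by omega)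
  have h2 : (i : ℤ) % l.length = i := Int.emod_eq_of_lt (by omega) (by omega)
  rw [twistExt, h1, h2]
  simp [hi]

variable [Fintype A]

open Classical in
/-- Good sequences with a twisted period correspond to closed walks. -/
theorem ncard_good (hp : 0 < p) (F : Set A) (hF : ∀ a, γ +ᵥ a ∈ F ↔ a ∈ F) (T : Finset (List A))
    (hT : ∀ x, x ∈ T ↔ x ∈ pats G w s) :
    {v : ℤ → A | (∀ i, v (i + p) = γ +ᵥ v i) ∧ (∀ i, v i ∈ F) ∧ Good G w s Ok v}.ncard =
      ∑ x ∈ T, walks (pats G w s) (fun x a => a ∈ F ∧ Allowed G w s Ok x a) p x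
        (x.map (γ +ᵥ ·)) := by
  set S := pats G w s with hS
  set P : List A → A → Prop := fun x a => a ∈ F ∧ Allowed G w s Ok x a with hP
  choose Q hQ hQ' using exists_walks_finset S P p
  have : ∑ x ∈ T, walks S P p x (x.map (γ +ᵥ ·)) =
      (T.sigma fun x => Q x (x.map (γ +ᵥ ·))).card := by
    rw [Finset.card_sigma]
    exact Finset.sum_congr rfl fun x _ => (hQ _ _).symm
  rw [this, ← Set.ncard_coe_finset]
  have hPmap : ∀ x a, P (x.map (γ +ᵥ ·)) (γ +ᵥ a) ↔ P x a := fun x a => by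
    simp only [hP, hF, allowed_map]
  -- A sequence corresponds to the state before the position `0` and the first `p` letters.
  refine Set.ncard_congr (fun v _ => ⟨longest S (hist s v 0),
    (List.range p).map fun l : ℕ => v l⟩) ?_ ?_ ?_
  · rintro v ⟨h1, h2, h3⟩
    rw [good_iff] at h3
    rw [Finset.mem_coe, Finset.mem_sigma, hT, hQ']
    refine ⟨longest_mem nil_mem_pats _, by simp, ?_, ?_⟩
    · rw [okRun_iff]
      intro i hi
      simp only [List.length_map, List.length_range] at hi
      have h4 := hist_reach (G := G) (w := w) (s := s) v 0 i
      simp only [zero_add] at h4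
      have h5 : ((List.range p).map fun l : ℕ => v l).take i =
          (List.range i).map fun l : ℕ => v l := by
        rw [← List.map_take, List.take_range, min_eq_left hi.le]
      simp only [h5, List.getElem_map, List.getElem_range]
      rw [← h4]
      exact ⟨h2 _, h3 _⟩
    · have h4 := hist_reach (G := G) (w := w) (s := s) v 0 p
      simp only [zero_add] at h4
      rw [← h4]
      have h5 := hist_twist (s := s) h1 1 0
      simp only [Nat.cast_one, one_mul, zero_add, one_nsmul] at h5
      rw [h5, longest_map (map_mem_pats γ)]
  · rintro v v' ⟨h1, -, -⟩ ⟨h1', -, -⟩ h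
    simp only [Sigma.mk.injEq, heq_eq_eq] at h
    refine twist_eq h1 h1' hp fun i hi => ?_
    have := congrArg (fun l : List A => l[i]?) h.2
    simpa [hi] using this
  · rintro ⟨x, l⟩ hxl
    rw [Finset.mem_coe, Finset.mem_sigma, hT, hQ'] at hxl
    obtain ⟨hx, hlen, hok, hreach⟩ := hxl
    simp only at hx hlen hok hreach
    subst hlen
    -- The default letter `l[0]` is never used, since positions are reduced modulo the length.
    set v := twistExt γ l l[0] with hv
    have h1 : ∀ i, v (i + l.length) = γ +ᵥ v i := twistExt_add l _ hp
    have hl : ((List.range l.length).map fun i : ℕ => v i) = l := by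
      apply List.ext_getElem
      · simp
      · intro i h1 h2
        simp only [List.getElem_map, List.getElem_range]
        exact twistExt_of_lt l _ h2
    -- Each round of `l` changes the state by `γ`, because reading commutes with translations.
    have hR : ∀ m : ℕ, reach S x ((List.range (m * l.length)).map fun i : ℕ => v i) =
        x.map ((m • γ) +ᵥ ·) := by
      intro m
      induction m with
      | zero => simp [reach]
      | succ m ih =>
        have e : (List.range ((m + 1) * l.length)).map (fun i : ℕ => v i) =
            (List.range (m * l.length)).map (fun i : ℕ => v i) ++ l.map ((m • γ) +ᵥ ·) := by
          rw [add_mul, one_mul, List.range_add, List.map_append, List.map_map]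
          congr 1
          conv_rhs => rw [← hl]
          rw [List.map_map]
          refine List.map_congr_left fun i _ => ?_
          simp only [Function.comp_apply]
          rw [← twist_mul h1]
          congr 1
          push_cast
          ring
        have e2 : reach S x ((List.range (m * l.length)).map (fun i : ℕ => v i) ++
            l.map ((m • γ) +ᵥ ·)) = reach S (reach S x ((List.range (m * l.length)).map
              (fun i : ℕ => v i))) (l.map ((m • γ) +ᵥ ·)) := by
          simp only [reach, List.foldl_append]
        rw [e, e2, ih, reach_map (map_mem_pats _), hreach, map_map_vadd, succ_nsmul]
    -- After `s` rounds at least `s` letters have been read, so the initial state `x` is forgotten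
    -- and the state depends only on the sequence. Translating back by `s • γ` shows that the state
    -- before the position `0` is `x`.
    have h0 : longest S (hist s v 0) = x := by
      have h2 := hR s
      rw [reach_eq nil_mem_pats pats_prefix hx] at h2
      have hs : s ≤ s * l.length := Nat.le_mul_of_pos_right _ hp
      have e : (List.range (s * l.length)).map (fun i : ℕ => v i) =
          (List.range (s * l.length - s)).map (fun i : ℕ => v i) ++
            hist s v (0 + (s : ℕ) * (l.length : ℕ)) := by
        conv_lhs => rw [← Nat.sub_add_cancel hs]
        rw [List.range_add, List.map_append, List.map_map]
        congr 1
        refine List.map_congr_left fun i _ => ?_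
        simp only [Function.comp_apply]
        congr 1
        push_cast [hs]
        ring
      rw [e, ← List.append_assoc, longest_append (fun y hy => length_le_of_mem_pats hy) _ _
        (by simp), hist_twist h1, longest_map (map_mem_pats _)] at h2
      have := congrArg (List.map (-(s • γ) +ᵥ ·)) h2
      rwa [map_neg_vadd, map_neg_vadd] at this
    have hPv : ∀ i : ℤ, P (longest S (hist s v i)) (v i) := by
      have hnat : ∀ i : ℕ, i < l.length → P (longest S (hist s v i)) (v i) := by
        intro i hi
        have h4 := hist_reach (G := G) (w := w) (s := s) v 0 i
        simp only [zero_add] at h4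
        have h5 := (okRun_iff x l).1 hok i hi
        have h6 : l.take i = (List.range i).map fun l : ℕ => v l := by
          rw [← hl, ← List.map_take, List.take_range, min_eq_left hi.le]
        rw [h6] at h5
        rw [h4, ← hS, h0]
        convert h5 using 1
        exact twistExt_of_lt l _ hi
      have hstep : ∀ (i : ℤ) (m : ℕ), P (longest S (hist s v (i + m * l.length)))
          (v (i + m * l.length)) ↔ P (longest S (hist s v i)) (v i) := by
        intro i m
        induction m with
        | zero => simp
        | succ m ih =>
          rw [← ih, ← hPmap (longest S (hist s v (i + m * l.length)))]
          have e : i + ((m + 1 : ℕ) : ℤ) * l.length = (i + m * l.length) + (1 : ℕ) * l.length := by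
            push_cast; ring
          rw [e, hist_twist h1, longest_map (map_mem_pats _), twist_mul h1]
          simp [hS]
      have hpos : ∀ i : ℕ, P (longest S (hist s v i)) (v i) := fun i => by
        have h2 := hstep ((i % l.length : ℕ) : ℤ) (i / l.length)
        have h3 : (((i % l.length : ℕ) : ℤ) + ((i / l.length : ℕ) : ℤ) * l.length) = (i : ℤ) := by
          have := Nat.mod_add_div' i l.length
          exact_mod_cast this
        rw [h3] at h2
        exact h2.2 (hnat _ (Nat.mod_lt _ hp))
      intro i
      have h4 : |i| * 1 ≤ |i| * l.length :=
        mul_le_mul_of_nonneg_left (by exact_mod_cast hp) (abs_nonneg i)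
      have h5 := neg_abs_le i
      rw [← hstep i i.natAbs]
      have h6 : 0 ≤ i + (i.natAbs : ℤ) * l.length := by push_cast; omega
      generalize i + (i.natAbs : ℤ) * l.length = j at h6 ⊢
      lift j to ℕ using h6
      exact hpos j
    refine ⟨v, ⟨h1, fun i => (hPv i).1, (good_iff v).2 fun i => (hPv i).2⟩, ?_⟩
    rw [h0, hl]

end closed

end patterns

end MDWord

/-! ### Words as periodic sequences of slices -/

namespace MDWord

section seq

variable {d : ℕ} {n : Fin (d + 1) → ℕ} [∀ k, NeZero (n k)] {q : ℕ}

/-- The position of a multidimensional word with the last coordinate removed. -/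
abbrev front (g : Pos n) : Pos (fun k : Fin d => n k.castSucc) := fun k => g k.castSucc

theorem slice_vadd (g : Pos n) (v : Word n q) (j : Fin (n (Fin.last d))) :
    slice (g +ᵥ v) j = front g +ᵥ slice v (j + g (Fin.last d)) := by
  funext p
  refine congrArg v (funext fun k => ?_)
  refine Fin.lastCases ?_ (fun k => ?_) k
  · simp
  · simp

/-- The slices of a word as a periodic sequence. -/
def seq (v : Word n q) (i : ℤ) : Word (fun k : Fin d => n k.castSucc) q :=
  slice v ⟨(i % n (Fin.last d)).toNat, by
    have := NeZero.pos (n (Fin.last d))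
    have := Int.emod_lt_of_pos i (show (0 : ℤ) < n (Fin.last d) by omega)
    have := Int.emod_nonneg i (show (n (Fin.last d) : ℤ) ≠ 0 by omega)
    omega⟩

theorem seq_val (v : Word n q) (j : Fin (n (Fin.last d))) : seq v (j : ℕ) = slice v j := by
  have : ((j : ℕ) : ℤ) % n (Fin.last d) = j := Int.emod_eq_of_lt (by omega) (by omega)
  simp [seq, this]

theorem seq_natCast (v : Word n q) {j : ℕ} (hj : j < n (Fin.last d)) :
    seq v j = slice v ⟨j, hj⟩ := seq_val v ⟨j, hj⟩

theorem seq_emod (v : Word n q) {i j : ℤ} (h : i % n (Fin.last d) = j % n (Fin.last d)) :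
    seq v i = seq v j := by
  simp only [seq, h]

theorem seq_add (v : Word n q) (i : ℤ) : seq v (i + n (Fin.last d)) = seq v i :=
  seq_emod v (by simp)

theorem seq_vadd (g : Pos n) (v : Word n q) (i : ℤ) :
    seq (g +ᵥ v) i = front g +ᵥ seq v (i + (g (Fin.last d) : ℕ)) := by
  rw [seq, slice_vadd, seq]
  congr 2
  ext
  simp only [Fin.val_add]
  have h0 := NeZero.pos (n (Fin.last d))
  have h1 := Int.emod_nonneg i (show (n (Fin.last d) : ℤ) ≠ 0 by omega)
  have h2 := Int.emod_nonneg (i + (g (Fin.last d) : ℕ)) (show (n (Fin.last d) : ℤ) ≠ 0 by omega)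
  zify
  rw [Int.toNat_of_nonneg h1, Int.toNat_of_nonneg h2, Int.emod_add_emod]

theorem seq_injective : Function.Injective (seq : Word n q → ℤ → _) := fun u v h =>
  eq_of_slice_eq fun j => by rw [← seq_val, ← seq_val, h]

theorem exists_seq_eq (z : ℤ → Word (fun k : Fin d => n k.castSucc) q)
    (hz : ∀ i, z (i + n (Fin.last d)) = z i) : ∃ v : Word n q, seq v = z := by
  refine ⟨fun p => z (p (Fin.last d) : ℕ) (front p), funext fun i => funext fun p => ?_⟩
  simp only [seq, slice, Fin.snoc_last]
  have h0 := NeZero.pos (n (Fin.last d))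
  have h1 := Int.emod_nonneg i (show (n (Fin.last d) : ℤ) ≠ 0 by omega)
  have hf : front (n := n) (Fin.snoc (α := fun k => Fin (n k)) p
      ⟨(i % n (Fin.last d)).toNat, by
        have := Int.emod_lt_of_pos i (show (0 : ℤ) < n (Fin.last d) by omega)
        omega⟩) = p := funext fun k => Fin.snoc_castSucc ..
  rw [hf, Int.toNat_of_nonneg h1]
  refine congrFun ?_ p
  have hper : ∀ (m : ℕ) (i : ℤ), z (i + m * n (Fin.last d)) = z i := fun m i => by
    induction m with
    | zero => simp
    | succ m ih =>
      rw [← ih, ← hz (i + m * n (Fin.last d))]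
      congr 1
      push_cast
      ring
  have hi := Int.emod_add_mul_ediv i (n (Fin.last d))
  rcases le_total 0 (i / n (Fin.last d)) with h | h
  · have := hper (i / n (Fin.last d)).toNat (i % n (Fin.last d))
    rw [Int.toNat_of_nonneg h, mul_comm, hi] at this
    exact this.symm
  · have := hper (-(i / n (Fin.last d))).toNat i
    rw [Int.toNat_of_nonneg (by omega)] at this
    rw [← this]
    congr 1
    linarith

/-- The letters that may follow the first `t` slices of `f`. -/
def okSet (f : Word n q) (s : ℕ) (Θ : Set (Word (fun k : Fin d => n k.castSucc) q)) (t : ℕ) :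
    Set (Word (fun k : Fin d => n k.castSucc) q) :=
  if t < s then {a | a = seq f t ∨ pre (seq f t) a} else Θ

variable {f : Word n q} {s : Fin (n (Fin.last d))}
  {Θ : Set (Word (fun k : Fin d => n k.castSucc) q)}

/-- The existence of a first place where the bound is exceeded is turned into a condition for every
initial segment that still agrees with `f`. Equality is allowed before `s`, since the condition for
the next letter then takes over. -/
theorem gt_iff {v : Word n q} : Gt f s Θ v ↔ ∀ t : ℕ, t ≤ s → (∀ l < t, seq v l = seq f l) →
    seq v t ∈ okSet f s Θ t := by
  constructor
  · rintro ⟨t, hts, h1, h2⟩ t' ht' h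
    have ht'n : t' < n (Fin.last d) := by have := s.isLt; omega
    rcases lt_trichotomy t' (t : ℕ) with htt | rfl | htt
    · have h3 := h1 ⟨t', ht'n⟩ htt
      rw [← seq_val, ← seq_val] at h3
      rw [okSet, if_pos (by rw [Fin.le_def] at hts; omega)]
      exact .inl h3
    · rcases h2 with ⟨rfl, h2⟩ | ⟨h3, h2⟩
      · rw [okSet, if_neg (lt_irrefl _), seq_val]; exact h2
      · rw [okSet, if_pos (show (t : ℕ) < s from h3)]
        refine .inr ?_
        rw [seq_val, seq_val]; exact h2
    · have h3 := h t htt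
      rw [seq_val, seq_val] at h3
      rcases h2 with ⟨rfl, h2⟩ | ⟨-, h2⟩
      · omega
      · rw [h3] at h2; exact absurd h2 (pre_strictTotal.irrefl _)
  · intro h
    by_cases hall : ∀ l < s, slice v l = slice f l
    · refine ⟨s, le_rfl, hall, .inl ⟨rfl, ?_⟩⟩
      have := h s le_rfl fun l hl => by
        rw [seq_natCast _ (hl.trans s.isLt), seq_natCast _ (hl.trans s.isLt)]
        exact hall _ hl
      rwa [okSet, if_neg (lt_irrefl _), seq_val] at this
    · push Not at hall
      obtain ⟨t, ⟨hts, ht⟩, hmin⟩ := WellFounded.has_min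
        (wellFounded_lt (α := Fin (n (Fin.last d)))) {l | l < s ∧ slice v l ≠ slice f l} hall
      have hlt : ∀ l < t, slice v l = slice f l := fun l hl => by
        by_contra hne
        exact hmin l ⟨hl.trans hts, hne⟩ hl
      refine ⟨t, hts.le, hlt, .inr ⟨hts, ?_⟩⟩
      have := h t hts.le fun l hl => by
        rw [seq_natCast _ (hl.trans t.isLt), seq_natCast _ (hl.trans t.isLt)]
        exact hlt _ hl
      rw [okSet, if_pos (show (t : ℕ) < s from hts), seq_val, seq_val] at this
      exact this.resolve_left ht

/-- A translation shifts the sequence of slices by its last coordinate and translates each slice by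
the other ones, so all translates together test all shifts `i` and all translations `r` of letters.
-/
theorem mem_next_iff_good (hΘ : UpPre Θ) {v : Word n q} :
    v ∈ next f s Θ ↔ Good (Pos fun k : Fin d => n k.castSucc) (fun l => seq f l) s (okSet f s Θ)
      (seq v) := by
  rw [mem_next_iff hΘ]
  constructor
  · intro h i t ht r hr
    have h1 := Int.emod_nonneg i (show (n (Fin.last d) : ℤ) ≠ 0 by omega)
    have h2 := Int.emod_lt_of_pos i (show (0 : ℤ) < n (Fin.last d) by omega)
    let g : Pos n := Fin.snoc (α := fun k => Fin (n k)) r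
      ⟨(i % n (Fin.last d)).toNat, by omega⟩
    have hg : ∀ l : ℤ, seq (g +ᵥ v) l = r +ᵥ seq v (i + l) := fun l => by
      have h3 : front g = r := funext fun k => Fin.snoc_castSucc ..
      have h4 : ((g (Fin.last d) : ℕ) : ℤ) = i % n (Fin.last d) := by
        simp only [g, Fin.snoc_last]; exact Int.toNat_of_nonneg h1
      rw [seq_vadd, h3, h4]
      refine congrArg (r +ᵥ ·) (seq_emod v ?_)
      rw [Int.add_emod_emod, add_comm]
    have := gt_iff.1 (h g) t ht fun l hl => by rw [hg]; exact hr l hl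
    rwa [hg] at this
  · intro h g
    rw [gt_iff]
    intro t ht hl
    have := h (g (Fin.last d) : ℕ) t ht (front g) fun l hlt => by
      show _ = seq f l
      rw [← hl l hlt, seq_vadd, add_comm]
    rwa [seq_vadd, add_comm]

theorem vadd_eq_iff {v : Word n q} {g : Pos n} :
    g +ᵥ v = v ↔ ∀ i, seq v (i + (g (Fin.last d) : ℕ)) = -front g +ᵥ seq v i := by
  rw [← seq_injective.eq_iff, funext_iff]
  refine forall_congr' fun i => ?_
  rw [seq_vadd, eq_neg_vadd_iff]

/-- Words that are fixed by a translation are described by the slices in one period. -/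
theorem vadd_eq_iff_twist {v : Word n q} {g : Pos n} {p u : ℕ}
    (hpn : p ∣ n (Fin.last d)) (hpj : p ∣ g (Fin.last d))
    (hu : u * g (Fin.last d) ≡ p [MOD n (Fin.last d)]) :
    g +ᵥ v = v ↔ (∀ i, seq v (i + p) = (u • -front g) +ᵥ seq v i) ∧
      ∀ i, ((n (Fin.last d) / p) • front g) +ᵥ seq v i = seq v i := by
  obtain ⟨m, hm⟩ := hpn
  obtain ⟨c, hc⟩ := hpj
  have hp : 0 < p := Nat.pos_of_ne_zero (by rintro rfl; simp at hm; omega)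
  have hmp : n (Fin.last d) / p = m := by rw [hm, Nat.mul_div_cancel_left _ hp]
  rw [hmp, vadd_eq_iff]
  constructor
  · intro h
    constructor
    · intro i
      rw [← twist_mul h u i]
      refine seq_emod v ?_
      have h1 : ((u * g (Fin.last d) : ℕ) : ℤ) % n (Fin.last d) = (p : ℤ) % n (Fin.last d) := by
        exact_mod_cast hu
      push_cast at h1
      rw [Int.add_emod, ← h1, ← Int.add_emod]
    · intro i
      have h1 := twist_mul h m i
      have h2 : seq v (i + (m : ℤ) * (g (Fin.last d) : ℕ)) = seq v i := by
        refine seq_emod v ?_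
        have : (m : ℤ) * (g (Fin.last d) : ℕ) = n (Fin.last d) * c := by
          have hm' : (n (Fin.last d) : ℤ) = p * m := by exact_mod_cast hm
          have hc' : ((g (Fin.last d) : ℕ) : ℤ) = p * c := by exact_mod_cast hc
          rw [hc', hm']; ring
        rw [this]
        simp
      rw [h2] at h1
      conv_lhs => rw [h1]
      rw [vadd_vadd, smul_neg, add_neg_cancel, zero_vadd]
  · rintro ⟨h1, h2⟩ i
    have h3 := twist_mul h1 c i
    have h4 : ((c : ℤ) * p) = ((g (Fin.last d) : ℕ) : ℤ) := by rw [hc]; push_cast; ring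
    rw [h4] at h3
    rw [h3]
    -- The last coordinate of `g` is `p * c` and the period is `p * m`; the congruence `hu` is
    -- divided by `p`.
    have h5 : u * c ≡ 1 [MOD m] := by
      have h6 : p * (u * c) ≡ p * 1 [MOD p * m] := by
        rw [mul_one, ← hm, mul_left_comm, ← hc]; exact hu
      exact Nat.ModEq.mul_left_cancel' (by omega) h6
    obtain ⟨k, hk⟩ := (Nat.modEq_iff_dvd.1 h5)
    -- By `h5`, the `c`-fold twist differs from `-front g` by a multiple of `m • front g`, which
    -- fixes all slices.
    have h6 : c • u • -front g = -front g + k • (m • front g) := by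
      have : k • (m • front g) = (k * m : ℤ) • front g := by
        rw [mul_smul, natCast_zsmul]
      rw [this, mul_comm k, ← hk, sub_smul]
      push_cast
      rw [mul_smul, one_smul, natCast_zsmul, natCast_zsmul, smul_neg, smul_neg, smul_comm]
      abel
    have h7 : ∀ k : ℤ, (k • (m • front g)) +ᵥ seq v i = seq v i := fun k =>
      AddAction.mem_stabilizer_iff.1 (AddSubgroup.zsmul_mem _
        (AddAction.mem_stabilizer_iff.2 (h2 i)) k)
    rw [h6, ← vadd_vadd, h7]

open Classical in
/-- The fixed words of a translation above a bound correspond to closed walks. -/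
theorem ncard_next_fixed (hΘ : UpPre Θ) {g : Pos n} {p u : ℕ}
    (hpn : p ∣ n (Fin.last d)) (hpj : p ∣ g (Fin.last d))
    (hu : u * g (Fin.last d) ≡ p [MOD n (Fin.last d)])
    (T : Finset (List (Word (fun k : Fin d => n k.castSucc) q)))
    (hT : ∀ x, x ∈ T ↔ x ∈ pats (Pos fun k : Fin d => n k.castSucc) (fun l => seq f l) s) :
    {v | v ∈ next f s Θ ∧ g +ᵥ v = v}.ncard =
      ∑ x ∈ T, walks (pats (Pos fun k : Fin d => n k.castSucc) (fun l => seq f l) s)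
        (fun x a => ((n (Fin.last d) / p) • front g) +ᵥ a = a ∧
          Allowed (Pos fun k : Fin d => n k.castSucc) (fun l => seq f l) s (okSet f s Θ) x a) p x
        (x.map ((u • -front g) +ᵥ ·)) := by
  have hp : 0 < p := Nat.pos_of_ne_zero (by rintro rfl; simp at hpn; omega)
  refine Eq.trans ?_ (ncard_good (Ok := okSet f s Θ) (γ := u • -front g) hp
    {a | ((n (Fin.last d) / p) • front g) +ᵥ a = a} ?_ T hT)
  · refine Set.ncard_congr (fun v _ => seq v) ?_ (fun u v _ _ h => seq_injective h) ?_
    · rintro v ⟨h1, h2⟩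
      have h3 := (vadd_eq_iff_twist hpn hpj hu).1 h2
      exact ⟨h3.1, h3.2, (mem_next_iff_good hΘ).1 h1⟩
    · rintro z ⟨h1, h2, h3⟩
      -- After `n / p` twists the slices have been translated by a multiple of `(n / p) • front g`,
      -- which fixes them; so the sequence is periodic and comes from a word.
      obtain ⟨v, rfl⟩ := exists_seq_eq (n := n) z fun i => by
        have h4 := twist_mul h1 (n (Fin.last d) / p) i
        have h5 : ((n (Fin.last d) / p : ℕ) : ℤ) * p = n (Fin.last d) := by
          exact_mod_cast Nat.div_mul_cancel hpn
        rw [h5] at h4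
        rw [h4, smul_comm, smul_neg, smul_neg]
        have : (u • (n (Fin.last d) / p) • front g) +ᵥ z i = z i :=
          AddAction.mem_stabilizer_iff.1 (AddSubgroup.nsmul_mem _
            (AddAction.mem_stabilizer_iff.2 (h2 i)) u)
        rw [neg_vadd_eq_iff, this]
      exact ⟨v, ⟨(mem_next_iff_good hΘ).2 h3, (vadd_eq_iff_twist hpn hpj hu).2 ⟨h1, h2⟩⟩, rfl⟩
  · intro a
    simp only [Set.mem_ofPred_eq]
    rw [vadd_comm]
    exact (AddAction.injective _).eq_iff

end seq

end MDWord

/-! ### Evaluation of the basic terms -/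

namespace RAM

open Classical in
/-- The truth value of a proposition as a number. -/
noncomputable def ind (P : Prop) : ℕ := if P then 1 else 0

theorem ind_pos {P : Prop} (h : P) : ind P = 1 := if_pos h

theorem ind_neg {P : Prop} (h : ¬ P) : ind P = 0 := if_neg h

theorem ind_congr {P Q : Prop} (h : P ↔ Q) : ind P = ind Q := by rw [propext h]

theorem ind_ne_zero {P : Prop} : ind P ≠ 0 ↔ P := by
  rw [ind]; split_ifs <;> simp_all

namespace Term

/-- Negation of a truth value. -/
def neg (e : Term) : Term := .bin .minus (.lit 1) e

def and (e f : Term) : Term := .bin .times e f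

def or (e f : Term) : Term := neg (and (neg e) (neg f))

def le (e f : Term) : Term := neg (.bin .minus e f)

def lt (e f : Term) : Term := le (.bin .plus e (.lit 1)) f

def eq (e f : Term) : Term := and (le e f) (le f e)

/-- Bounded universal quantification. -/
def all (x : ℕ) (e f : Term) : Term := neg (.sum x e (neg f))

/-- Bounded existential quantification. -/
def ex (x : ℕ) (e f : Term) : Term := neg (all x e (neg f))

/-- The remainder of a division. -/
def mod (e f : Term) : Term := .bin .minus e (.bin .times f (.bin .quot e f))

/-- Selection by a truth value. -/
def sel (c e f : Term) : Term := .bin .plus (.bin .times c e) (.bin .times (neg c) f)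

/-- The smallest `x < e` such that `f` holds for all values of `y` that are at least `x`, counted
down from `x`; that is, the first value at which the condition `f` on `y` holds. -/
def first (x y : ℕ) (e f : Term) : Term := .sum x e (all y (.bin .plus (.var x) (.lit 1)) (neg f))

variable {σ : State} {e f : Term} {P Q : Prop}

theorem eval_neg (h : e.eval σ = ind P) : (neg e).eval σ = ind (¬ P) := by
  simp only [neg, Term.eval, h, Op.eval, ind]
  split_ifs <;> simp_all

theorem eval_and (h : e.eval σ = ind P) (h' : f.eval σ = ind Q) :
    (and e f).eval σ = ind (P ∧ Q) := by
  simp only [and, Term.eval, h, h', Op.eval, ind]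
  split_ifs <;> simp_all

theorem eval_or (h : e.eval σ = ind P) (h' : f.eval σ = ind Q) :
    (or e f).eval σ = ind (P ∨ Q) := by
  rw [or, eval_neg (eval_and (eval_neg h) (eval_neg h'))]
  exact ind_congr (by tauto)

theorem eval_le {a b : ℕ} (h : e.eval σ = a) (h' : f.eval σ = b) :
    (le e f).eval σ = ind (a ≤ b) := by
  simp only [le, neg, Term.eval, h, h', Op.eval, ind]
  split_ifs <;> omega

theorem eval_less {a b : ℕ} (h : e.eval σ = a) (h' : f.eval σ = b) :
    (lt e f).eval σ = ind (a < b) := by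
  rw [lt, eval_le (a := a + 1) (by simp only [Term.eval, Op.eval, h]) h']
  exact ind_congr Nat.succ_le_iff

theorem eval_eq {a b : ℕ} (h : e.eval σ = a) (h' : f.eval σ = b) :
    (eq e f).eval σ = ind (a = b) := by
  rw [eq, eval_and (eval_le h h') (eval_le h' h)]
  exact ind_congr ⟨fun h => le_antisymm h.1 h.2, fun h => ⟨h.le, h.ge⟩⟩

theorem eval_mod {a b : ℕ} (h : e.eval σ = a) (h' : f.eval σ = b) : (mod e f).eval σ = a % b := by
  simp only [mod, Term.eval, Op.eval, h, h']
  have := Nat.div_add_mod a b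
  omega

theorem eval_bin (o : Op) {a b : ℕ} (h : e.eval σ = a) (h' : f.eval σ = b) :
    (Term.bin o e f).eval σ = o.eval a b := by
  simp only [Term.eval, h, h']

open Classical in
theorem eval_sel {c : Term} {a b : ℕ} (hc : c.eval σ = ind P) (h : P → e.eval σ = a)
    (h' : ¬ P → f.eval σ = b) : (sel c e f).eval σ = if P then a else b := by
  simp only [sel, neg, Term.eval, Op.eval, hc, ind]
  split_ifs with hP
  · simp [h hP]
  · simp [h' hP]

theorem eval_sum {x m : ℕ} {F : ℕ → ℕ} (he : e.eval σ = m) (hm : m ≤ σ.var 4)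
    (hf : ∀ i < m, f.eval (σ.set x i) = F i) :
    (Term.sum x e f).eval σ = ∑ i ∈ Finset.range m, F i := by
  simp only [Term.eval, he, min_eq_left hm]
  exact Finset.sum_congr rfl fun i hi => hf i (Finset.mem_range.1 hi)

theorem eval_all {x m : ℕ} {F : ℕ → Prop} (he : e.eval σ = m) (hm : m ≤ σ.var 4)
    (hf : ∀ i < m, f.eval (σ.set x i) = ind (F i)) :
    (all x e f).eval σ = ind (∀ i < m, F i) := by
  rw [all, neg, Term.eval, eval_sum he hm fun i hi => eval_neg (hf i hi)]
  simp only [Term.eval, Op.eval]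
  by_cases h : ∀ i < m, F i
  · rw [ind_pos h,
      Finset.sum_eq_zero fun i hi => ind_neg (not_not.2 (h i (Finset.mem_range.1 hi)))]
    exact Nat.sub_zero 1
  · rw [ind_neg h]
    push Not at h
    obtain ⟨i, hi, hF⟩ := h
    have := Finset.single_le_sum (f := fun i => ind (¬ F i)) (fun _ _ => Nat.zero_le _)
      (Finset.mem_range.2 hi)
    simp only [ind_pos hF] at this
    omega

theorem eval_ex {x m : ℕ} {F : ℕ → Prop} (he : e.eval σ = m) (hm : m ≤ σ.var 4)
    (hf : ∀ i < m, f.eval (σ.set x i) = ind (F i)) :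
    (ex x e f).eval σ = ind (∃ i < m, F i) := by
  rw [ex, eval_neg (eval_all he hm fun i hi => eval_neg (hf i hi))]
  exact ind_congr (by simp)

/-- The sum counts the `i` such that no `j ≤ i` satisfies the condition, that is, the `i < v`. -/
theorem eval_first {x y m v : ℕ} {F : ℕ → Prop} (he : e.eval σ = m) (hm : m ≤ σ.var 4)
    (hx : x ≠ 4) (hf : ∀ i < m, ∀ j ≤ i, f.eval ((σ.set x i).set y j) = ind (F j)) (hv : v < m)
    (hF : F v) (hlt : ∀ j < v, ¬ F j) : (first x y e f).eval σ = v := by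
  rw [first, eval_sum (F := fun i => ind (i < v)) he hm]
  · have : (Finset.range m).filter (· < v) = Finset.range v := by
      ext i; simp only [Finset.mem_filter, Finset.mem_range]; omega
    have hi : ∀ i, ind (i < v) = if i < v then 1 else 0 := fun i => by
      unfold ind; split_ifs <;> rfl
    simp only [hi]
    rw [Finset.sum_boole, Nat.cast_id, this, Finset.card_range]
  · intro i hi
    rw [eval_all (m := i + 1) (F := fun j => ¬ F j) (by simp [Term.eval, Op.eval])
      (by simp only [State.set_var, if_neg hx.symm]; omega)
      fun j hj => eval_neg (hf i hi j (by omega))]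
    refine ind_congr ⟨fun h => ?_, fun h j hj => hlt j (by omega)⟩
    by_contra hvi
    exact h v (by omega) hF

theorem eval_bind {x v w : ℕ} (he : e.eval σ = v) (hv : v ≤ σ.var 5)
    (hf : f.eval (σ.set x v) = w) : (Term.bind x e f).eval σ = w := by
  rw [Term.eval, he, min_eq_left hv, hf]

/-- The invariant `Q` speaks about single cells, and the value of a cell may rely on the earlier
ones. The tables are thus filled by recursion. -/
theorem eval_tab {a c x m w : ℕ} {v : Term} (Q : ℕ → ℕ → Prop) (he : e.eval σ = m)
    (hm : m ≤ σ.var 4 ^ c)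
    (hv : ∀ i < m, ∀ τ : State, τ.var = (σ.set x i).var → (∀ b, b ≠ a → τ.arr b = σ.arr b) →
      (∀ j < i, Q j (τ.arr a j)) → Q i (min (v.eval τ) (σ.var 5)))
    (hf : ∀ τ : State, τ.var = σ.var → (∀ b, b ≠ a → τ.arr b = σ.arr b) →
      (∀ j < m, Q j (τ.arr a j)) → f.eval τ = w) : (Term.tab a c x e v f).eval σ = w := by
  have key : ∀ k ≤ m, ∀ j < k, Q j ((fill a x v.eval σ k).arr a j) := by
    intro k hk
    induction k with
    | zero => omega
    | succ k ih =>
      intro j hj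
      rw [fill_arr, if_pos hj]
      refine hv j (by omega) _ ?_ (fun b hb => ?_) fun l hl => ?_
      · simp [State.set]
      · rw [State.set_arr, fill_arr_ne _ _ _ _ _ hb]
      · rw [State.set_arr]
        have h1 := ih (by omega) l (by omega)
        rw [fill_arr, if_pos (by omega)] at h1
        rw [fill_arr, if_pos (by omega)]
        exact h1
  rw [Term.eval, he, min_eq_left hm]
  exact hf _ (fill_var ..) (fun b hb => fill_arr_ne _ _ _ _ _ hb) (key m le_rfl)

end Term

end RAM

/-! ### Letters that are counted in bulk -/

namespace MDWord

theorem snoc_suffix_snoc {A : Type} {x y : List A} {a b : A} :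
    x ++ [a] <:+ y ++ [b] ↔ x <:+ y ∧ a = b := by
  rw [List.suffix_concat_iff]
  constructor
  · rintro (h | ⟨t, h, ht⟩)
    · simp at h
    · obtain ⟨rfl, h⟩ := List.append_inj' h rfl
      exact ⟨ht, by simpa using h⟩
  · rintro ⟨h, rfl⟩
    exact .inr ⟨x, rfl, h⟩

section split

variable {A G : Type} [AddCommGroup G] [AddAction G A]

variable (G) in
/-- The letter `a` belongs to `U t` for all initial segments of length `t` of translates of `w`
that end in `x`. -/
def Bulk (w : ℕ → A) (s : ℕ) (U : ℕ → Set A) (x : List A) (a : A) : Prop :=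
  ∀ t ≤ s, ∀ r : G, pat w t r <:+ x → a ∈ U t

variable {w : ℕ → A} {s : ℕ} {Ok U : ℕ → Set A} {Λ F : Set A}

theorem Bulk.allowed (hinv : ∀ t ≤ s, ∀ (r : G) a, r +ᵥ a ∈ U t ↔ a ∈ U t)
    (hUO : ∀ t ≤ s, U t ⊆ Ok t) {x : List A} {a : A} (h : Bulk G w s U x a) :
    Allowed G w s Ok x a :=
  fun t ht r hr => hUO t ht ((hinv t ht _ _).2 (h t ht r hr))

theorem Bulk.longest_eq (hinv : ∀ t ≤ s, ∀ (r : G) a, r +ᵥ a ∈ U t ↔ a ∈ U t)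
    (hw : ∀ t < s, w t ∉ U t) {x : List A} {a : A} (h : Bulk G w s U x a) :
    longest (pats G w s) (x ++ [a]) = [] := by
  obtain ⟨t, ht, r, hr⟩ := longest_mem (nil_mem_pats (G := G) (w := w) (s := s)) (x ++ [a])
  have h1 := longest_suffix (S := pats G w s) (x ++ [a])
  rw [hr] at h1 ⊢
  cases t with
  | zero => rfl
  | succ t =>
    rw [pat, List.range_succ, List.map_append, List.map_singleton, snoc_suffix_snoc] at h1
    exact absurd ((hinv t (by omega) r _).1 (h1.2 ▸ h t (by omega) r h1.1)) (hw t (by omega))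

/-- An allowed letter outside some active `U t` only just satisfies that bound, so it belongs to
`Λ`. With `Λ` the orbits of a few rows, all other allowed letters can be counted together. -/
theorem Allowed.mem_or_bulk (hinv : ∀ t ≤ s, ∀ (r : G) a, r +ᵥ a ∈ U t ↔ a ∈ U t)
    (hOU : ∀ t ≤ s, ∀ a ∈ Ok t, a ∈ U t ∨ a ∈ Λ) (hΛ : ∀ (r : G) a, r +ᵥ a ∈ Λ ↔ a ∈ Λ)
    {x : List A} {a : A} (h : Allowed G w s Ok x a) : a ∈ Λ ∨ Bulk G w s U x a := by
  by_cases hb : Bulk G w s U x a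
  · exact .inr hb
  · simp only [Bulk] at hb
    push Not at hb
    obtain ⟨t, ht, r, hr, hU⟩ := hb
    refine .inl ((hΛ (-r) a).1 ((hOU t ht _ (h t ht r hr)).resolve_left fun h => ?_))
    exact hU ((hinv t ht _ _).1 h)

variable [Fintype A]

open Classical in
/-- The letters that lead out of the initial segments of `w` are counted together. -/
theorem walks_succ (hinv : ∀ t ≤ s, ∀ (r : G) a, r +ᵥ a ∈ U t ↔ a ∈ U t)
    (hUO : ∀ t ≤ s, U t ⊆ Ok t) (hOU : ∀ t ≤ s, ∀ a ∈ Ok t, a ∈ U t ∨ a ∈ Λ)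
    (hΛ : ∀ (r : G) a, r +ᵥ a ∈ Λ ↔ a ∈ Λ) (hw : ∀ t < s, w t ∉ U t) (T : Finset (List A))
    (hT : ∀ x, x ∈ T ↔ x ∈ pats G w s) (p : ℕ) (x y : List A) :
    walks (pats G w s) (fun x a => a ∈ F ∧ Allowed G w s Ok x a) (p + 1) x y =
      ∑ z ∈ T, ({a | a ∈ Λ ∧ a ∈ F ∧ Allowed G w s Ok x a ∧ ¬ Bulk G w s U x a ∧
          longest (pats G w s) (x ++ [a]) = z}.ncard +
        if z = [] then {a | a ∈ F ∧ Bulk G w s U x a}.ncard else 0) *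
        walks (pats G w s) (fun x a => a ∈ F ∧ Allowed G w s Ok x a) p z y := by
  set Wk := walks (pats G w s) (fun x a => a ∈ F ∧ Allowed G w s Ok x a) p
  have h0 : [] ∈ T := (hT _).2 nil_mem_pats
  simp only [add_mul, Finset.sum_add_distrib, ite_mul, zero_mul]
  rw [Finset.sum_ite_eq' T [], if_pos h0, walks,
    ← Finset.sum_filter_add_sum_filter_not _ (fun a => ¬ Bulk G w s U x a)]
  congr 1
  · rw [← Finset.sum_fiberwise_of_maps_to (t := T)
      (g := fun a => longest (pats G w s) (x ++ [a])) fun a _ =>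
        (hT _).2 (longest_mem nil_mem_pats _)]
    refine Finset.sum_congr rfl fun z _ => ?_
    rw [Finset.sum_congr rfl (g := fun _ => Wk z y) fun a ha => by
      rw [(Finset.mem_filter.1 ha).2], Finset.sum_const, smul_eq_mul, ← Set.ncard_coe_finset]
    congr 2
    ext a
    simp only [Finset.coe_filter, Finset.mem_filter, Finset.mem_univ, true_and,
      Set.mem_ofPred_eq]
    constructor
    · rintro ⟨⟨⟨h1, h2⟩, h3⟩, h4⟩
      exact ⟨(h2.mem_or_bulk hinv hOU hΛ).resolve_right h3, h1, h2, h3, h4⟩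
    · rintro ⟨-, h1, h2, h3, h4⟩
      exact ⟨⟨⟨h1, h2⟩, h3⟩, h4⟩
  · rw [Finset.sum_congr rfl (g := fun _ => Wk [] y) fun a ha => by
      rw [Bulk.longest_eq hinv hw (not_not.1 (Finset.mem_filter.1 ha).2)], Finset.sum_const,
      smul_eq_mul, ← Set.ncard_coe_finset]
    congr 2
    ext a
    simp only [Finset.coe_filter, Finset.mem_filter, Finset.mem_univ, true_and,
      Set.mem_ofPred_eq, not_not]
    exact ⟨fun h => ⟨h.1.1, h.2⟩, fun h => ⟨⟨h.1, h.2.allowed hinv hUO⟩, h.2⟩⟩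

end split

end MDWord

/-! ### Numbering of positions and words -/

namespace MDWord

section index

variable {d : ℕ} (m : Fin d → ℕ) [∀ k, NeZero (m k)]

/-- The position with a given index. -/
def un (r : ℕ) : Pos m := fun j =>
  ⟨r / (∏ i ∈ Finset.Iio j, m i) % m j, Nat.mod_lt _ (NeZero.pos _)⟩

variable {m}

theorem prod_Iio_castSucc (m : Fin (d + 1) → ℕ) (j : Fin d) :
    ∏ i ∈ Finset.Iio j.castSucc, m i = ∏ i ∈ Finset.Iio j, m i.castSucc := by
  rw [← Fin.map_castSuccEmb_Iio, Finset.prod_map]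
  rfl

theorem prod_Iio_last (m : Fin (d + 1) → ℕ) :
    ∏ i ∈ Finset.Iio (Fin.last d), m i = ∏ i : Fin d, m i.castSucc := by
  have : Finset.Iio (Fin.last d) = Finset.univ.map Fin.castSuccEmb := by
    ext i
    simp only [Finset.mem_Iio, Finset.mem_map, Finset.mem_univ, true_and, Fin.coe_castSuccEmb]
    rw [Fin.exists_castSucc_eq]
    exact Fin.lt_last_iff_ne_last
  rw [this, Finset.prod_map]
  rfl

theorem front_un {m : Fin (d + 1) → ℕ} [∀ k, NeZero (m k)] (r : ℕ) :
    front (un m r) = un (fun k : Fin d => m k.castSucc) r := by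
  funext j
  ext
  simp only [front, un, prod_Iio_castSucc]

theorem un_last {m : Fin (d + 1) → ℕ} [∀ k, NeZero (m k)] (r : ℕ) :
    (un m r (Fin.last d) : ℕ) = r / (∏ k : Fin d, m k.castSucc) % m (Fin.last d) := by
  simp only [un, prod_Iio_last]

theorem posIndex_un : ∀ {d : ℕ} {m : Fin d → ℕ} [∀ k, NeZero (m k)] (r : ℕ),
    posIndex (un m r) = r % ∏ k, m k
  | 0, m, _, r => by simp [posIndex, Nat.mod_one]
  | d + 1, m, _, r => by
    rw [posIndex_succ]
    have h := posIndex_un (m := fun k : Fin d => m k.castSucc) r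
    rw [show (fun k : Fin d => un m r k.castSucc) = un (fun k : Fin d => m k.castSucc) r from
      front_un r, h, un_last, Fin.prod_univ_castSucc, Nat.mod_mul]
    ring

theorem un_posIndex (g : Pos m) : un m (posIndex g) = g :=
  posIndex_injective (by rw [posIndex_un, Nat.mod_eq_of_lt (posIndex_lt g)])

theorem un_mod (r : ℕ) : un m (r % ∏ k, m k) = un m r := by
  rw [← posIndex_un, un_posIndex]

theorem un_zero : un m 0 = 0 := funext fun k => by ext; simp [un]

theorem un_inj {a b : ℕ} (ha : a < ∏ k, m k) (hb : b < ∏ k, m k) (h : un m a = un m b) : a = b := by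
  have := congrArg posIndex h
  rwa [posIndex_un, posIndex_un, Nat.mod_eq_of_lt ha, Nat.mod_eq_of_lt hb] at this

theorem exists_un_eq (g : Pos m) : ∃ r < ∏ k, m k, un m r = g :=
  ⟨_, posIndex_lt g, un_posIndex g⟩

theorem prod_pos_of_neZero : 0 < ∏ k, m k := Finset.prod_pos fun _ _ => NeZero.pos _

theorem posIndex_un_add (a b : ℕ) : posIndex (un m a + un m b) =
    ∑ j, (a / (∏ i ∈ Finset.Iio j, m i) + b / (∏ i ∈ Finset.Iio j, m i)) % m j *
      ∏ i ∈ Finset.Iio j, m i := by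
  simp only [posIndex, un, Pi.add_apply, Fin.val_add, Nat.add_mod, Nat.mod_mod]

theorem val_nsmul_fin {n : ℕ} [NeZero n] (c : ℕ) (a : Fin n) : ((c • a : Fin n) : ℕ) = c * a % n := by
  induction c with
  | zero => simp
  | succ c ih => rw [succ_nsmul, Fin.val_add, ih, Nat.mod_add_mod, add_mul, one_mul]

theorem posIndex_nsmul_un (c a : ℕ) : posIndex (c • un m a) =
    ∑ j, c * (a / (∏ i ∈ Finset.Iio j, m i)) % m j * ∏ i ∈ Finset.Iio j, m i := by
  simp only [posIndex, un, Pi.smul_apply, val_nsmul_fin, Nat.mul_mod_mod]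

theorem sum_pos_eq {M : Type} [AddCommMonoid M] (φ : Pos m → M) :
    ∑ g, φ g = ∑ r ∈ Finset.range (∏ k, m k), φ (un m r) := by
  symm
  refine Finset.sum_bij (fun r _ => un m r) (fun _ _ => Finset.mem_univ _) ?_ ?_ fun _ _ => rfl
  · exact fun a ha b hb h => un_inj (Finset.mem_range.1 ha) (Finset.mem_range.1 hb) h
  · intro g _
    obtain ⟨r, hr, h⟩ := exists_un_eq g
    exact ⟨r, Finset.mem_range.2 hr, h⟩

/-- A word as a number in base `q`. -/
def enc {q : ℕ} (w : Word m q) : ℕ := ∑ r ∈ Finset.range (∏ k, m k), (w (un m r) : ℕ) * q ^ r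

theorem sum_digits_lt {q : ℕ} (x : ℕ → ℕ) (n : ℕ) (hx : ∀ r < n, x r < q) :
    ∑ r ∈ Finset.range n, x r * q ^ r < q ^ n := by
  induction n with
  | zero => simp
  | succ n ih =>
    rw [Finset.sum_range_succ, pow_succ]
    have h1 := ih fun r hr => hx r (by omega)
    have h2 := hx n (by omega)
    nlinarith [Nat.zero_le (q ^ n)]

theorem sum_digits_div_mod {q : ℕ} (x : ℕ → ℕ) (n : ℕ) (hx : ∀ r < n, x r < q) {i : ℕ}
    (hi : i < n) : (∑ r ∈ Finset.range n, x r * q ^ r) / q ^ i % q = x i := by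
  have hq : 0 < q := lt_of_le_of_lt (Nat.zero_le _) (hx i hi)
  obtain ⟨k, rfl⟩ := Nat.exists_eq_add_of_lt hi
  rw [show i + k + 1 = (i + 1) + k by ring, Finset.sum_range_add, Finset.sum_range_succ]
  have h1 := sum_digits_lt x i fun r hr => hx r (by omega)
  have h2 : ∑ r ∈ Finset.range k, x (i + 1 + r) * q ^ (i + 1 + r) =
      q ^ i * (q * ∑ r ∈ Finset.range k, x (i + 1 + r) * q ^ r) := by
    rw [Finset.mul_sum, Finset.mul_sum]
    refine Finset.sum_congr rfl fun r _ => ?_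
    rw [pow_add, pow_succ]; ring
  rw [h2, show ∀ a b : ℕ, a + x i * q ^ i + q ^ i * b = a + q ^ i * (x i + b) by intros; ring,
    Nat.add_mul_div_left _ _ (pow_pos hq i), Nat.div_eq_of_lt h1, zero_add, Nat.add_mul_mod_self_left,
    Nat.mod_eq_of_lt (hx i hi)]

variable {q : ℕ}

theorem enc_lt (w : Word m q) : enc w < q ^ ∏ k, m k :=
  sum_digits_lt (fun r => (w (un m r) : ℕ)) _ fun _ _ => (w _).isLt

theorem enc_div_mod (w : Word m q) {r : ℕ} (hr : r < ∏ k, m k) :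
    enc w / q ^ r % q = w (un m r) :=
  sum_digits_div_mod (fun r => (w (un m r) : ℕ)) _ (fun _ _ => (w _).isLt) hr

/-- Words are stored as numbers so that the machine compares two of them in one step; the digits
recover the word. -/
theorem enc_injective : Function.Injective (enc : Word m q → ℕ) := fun u v h => by
  funext g
  obtain ⟨r, hr, rfl⟩ := exists_un_eq g
  have h1 := enc_div_mod u hr
  rw [h, enc_div_mod v hr] at h1
  exact Fin.ext h1.symm

theorem sum_range_mul_div_mod {M : Type} [AddCommMonoid M] (a b : ℕ) (φ : ℕ → M) :
    ∑ r ∈ Finset.range (a * b), φ r =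
      ∑ j ∈ Finset.range b, ∑ r ∈ Finset.range a, φ (a * j + r) := by
  induction b with
  | zero => simp
  | succ b ih => rw [mul_add, mul_one, Finset.sum_range_add, ih, Finset.sum_range_succ]

/-- The number of a word is composed of those of its slices. -/
theorem enc_succ {m : Fin (d + 1) → ℕ} [∀ k, NeZero (m k)] (w : Word m q) :
    enc w = ∑ j ∈ Finset.range (m (Fin.last d)),
      enc (seq w j) * q ^ ((∏ k : Fin d, m k.castSucc) * j) := by
  rw [enc, Fin.prod_univ_castSucc, sum_range_mul_div_mod]
  refine Finset.sum_congr rfl fun j hj => ?_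
  rw [enc, Finset.sum_mul]
  refine Finset.sum_congr rfl fun r hr => ?_
  have hj := Finset.mem_range.1 hj
  have hr := Finset.mem_range.1 hr
  rw [seq_natCast _ hj, pow_add, mul_comm (q ^ _), mul_assoc]
  congr 2
  refine congrArg w (funext fun k => ?_)
  refine Fin.lastCases ?_ (fun k => ?_) k
  · ext
    rw [un_last, Fin.snoc_last, Nat.mul_add_div (prod_pos_of_neZero), Nat.div_eq_of_lt hr, add_zero,
      Nat.mod_eq_of_lt hj]
  · rw [Fin.snoc_castSucc]
    change front (un m _) k = _
    rw [front_un, ← un_mod, Nat.mul_add_mod, Nat.mod_eq_of_lt hr]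

end index

end MDWord

/-! ### Terms and data for the automaton in one dimension -/

namespace MDWord

open RAM

section terms

/-- The address of a cell of a table with `N` columns. -/
def cellT (a b : Term) : Term := .bin .plus (.bin .times a (.var 3)) b

/-- The letter with the index `r` in the row `l`. -/
def letT (l r : Term) : Term := .read 6 (cellT (cellT (.var 21) l) r)

def tauT (l : Term) : Term := .read 7 (cellT (.var 21) l)

/-- Sums of translations are read from a table, since computing one takes a loop over the
dimensions. -/
def adT (a b : Term) : Term := .read 4 (cellT a b)

/-- The number of fixed words above the row `t`, or above the bound for the row `s`. -/
def tvT (t h : Term) : Term :=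
  .sel (.lt t (.var 25)) (.read 8 (cellT (cellT (.var 21) t) h)) (.read 10 (cellT (.var 21) h))

def bndT (t : Term) : Term := .sel (.lt t (.var 25)) (tauT t) (.var 27)

/-- The state with number `(s - t) * K + r`, where `K` is the number of positions in a slice, stands
for the translate by `r` of the first `t` rows. Longer strings thus have smaller numbers. Different
numbers may give the same string, hence the restriction to the first of them in `canonT`. -/
def lenT (x : ℕ) : Term := .bin .minus (.var 25) (.bin .quot (.var x) (.var 24))

def rotT (x : ℕ) : Term := .mod (.var x) (.var 24)

/-- The string of the state `x` is the translate of that of `y`. -/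
def eqsT (x y : ℕ) (c : Term) (l : ℕ) : Term :=
  .and (.eq (lenT x) (lenT y))
    (.all l (lenT x) (.eq (letT (.var l) (rotT x)) (letT (.var l) (adT c (rotT y)))))

/-- The state `x` is the first one with its string. -/
def canonT (x x' l : ℕ) : Term := .all x' (.var x) (.neg (eqsT x' x (.lit 0) l))

/-- The string of the state `i` ends with the translate by `-r` of the first `t` rows. -/
def actT (i t r l : ℕ) : Term :=
  .and (.le (.var t) (lenT i))
    (.all l (.var t) (.eq
      (letT (.bin .plus (.bin .minus (lenT i) (.var t)) (.var l)) (adT (rotT i) (.var r)))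
      (letT (.var l) (.lit 0))))

def rowT (e : ℕ) : Term := .bin .quot (.var e) (.var 24)

def letterT (e : ℕ) : Term := letT (rowT e) (rotT e)

/-- The string of the state `i` and the letter `e` end with the string of the state `y`. -/
def sufT (y i e l : ℕ) : Term :=
  .or (.eq (lenT y) (.lit 0))
    (.and (.and (.le (lenT y) (.bin .plus (lenT i) (.lit 1)))
      (.all l (.bin .minus (lenT y) (.lit 1)) (.eq (letT (.var l) (rotT y))
        (letT (.bin .plus (.bin .minus (.bin .plus (lenT i) (.lit 1)) (lenT y)) (.var l))
          (rotT i)))))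
      (.eq (letT (.bin .minus (lenT y) (.lit 1)) (rotT y)) (letterT e)))

/-- The translate by `r` of the letter `e` may follow the first `t` rows. -/
def okT (t e r g : ℕ) : Term :=
  .or (.lt (tvT' e) (tvT (.var t) (.lit 0)))
    (.and (.eq (tvT' e) (tvT (.var t) (.lit 0)))
      (.all g (.var 24) (.or (.le (bndT (.var t)) (.var g))
        (.neg (.eq (letT (rowT e) (adT (adT (rotT e) (.var r)) (.var g)))
          (letT (rowT e) (tauT (rowT e))))))))
where tvT' (e : ℕ) : Term := .read 8 (cellT (cellT (.var 21) (rowT e)) (.lit 0))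

def allowedT (i e t r l : ℕ) : Term :=
  .all t (.bin .plus (.var 25) (.lit 1)) (.all r (.var 24) (.or (.neg (actT i t r l)) (okT t e r l)))

def activeT (i t r l : ℕ) : Term := .ex r (.var 24) (actT i t r l)

def bulkT (i e t r l : ℕ) : Term :=
  .all t (.bin .plus (.var 25) (.lit 1)) (.or (.neg (activeT i t r l))
    (.lt (okT.tvT' e) (tvT (.var t) (.lit 0))))

/-- The smallest number of fixed words above the rows that may follow the state `i`. -/
def bulkCountT (i t t' r l : ℕ) : Term :=
  .sum t (.bin .plus (.var 25) (.lit 1)) (.bin .times (.and (activeT i t r l)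
    (.all t' (.bin .plus (.var 25) (.lit 1)) (.or (.neg (activeT i t' r l))
      (.or (.lt (tvT (.var t) (.var 30)) (tvT (.var t') (.var 30)))
        (.and (.eq (tvT (.var t) (.var 30)) (tvT (.var t') (.var 30)))
          (.le (.var t) (.var t')))))))
    (tvT (.var t) (.var 30)))

end terms

section level

variable {d : ℕ} {n : Fin (d + 1) → ℕ} {q : ℕ}

/-- The size of the slices. -/
abbrev fr (n : Fin (d + 1) → ℕ) : Fin d → ℕ := fun k => n k.castSucc

variable [∀ k, NeZero (n k)]

/-- The words above the first `t` rows, or above the bound for the row `s`. -/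
def lvU (f : Word n q) (s : ℕ) (U : Set (Word (fr n) q)) (t : ℕ) : Set (Word (fr n) q) :=
  if t < s then above (seq f t) else U

noncomputable def lvB (f : Word n q) (s bnd t : ℕ) : ℕ := if t < s then trIndex (seq f t) else bnd

/-- The words above the necklaces in the complement of `U`, and those from the largest of them for
which the index of the translation is at least `b`. -/
def thr (U : Set (Word (fr n) q)) (b : ℕ) : Set (Word (fr n) q) :=
  {a | a ∈ U ∨ (above a).ncard = U.ncard ∧ b ≤ trIndex a}

variable {f : Word n q} {s S bnd : ℕ} {U : Set (Word (fr n) q)}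

theorem upOrb_lvU (hU : UpOrb U) (t : ℕ) : UpOrb (lvU f s U t) := by
  rw [lvU]; split_ifs
  exacts [upOrb_above _, hU]

theorem upPre_thr (hU : UpOrb U) (b : ℕ) : UpPre (thr U b) := by
  rintro u v (h | ⟨h, hb⟩) huv
  · exact .inl (hU.upPre _ _ h huv)
  · rcases huv with h1 | ⟨h1, h2⟩
    · refine .inl ((hU.mem_iff_card v).2 ?_)
      rw [← h]
      exact ((upOrb_above u).mem_iff_card v).1 h1
    · refine .inr ⟨?_, by omega⟩
      rw [← h]
      exact (canon_eq_iff_card.1 h1).symm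

/-- A row before `s` gives the same kind of bound as the last one: equal or larger for `pre` means a
larger necklace, or the same necklace with at least the index of the row. One test therefore serves
for all rows. -/
theorem okSet_eq (t : ℕ) : okSet f s (thr U bnd) t = thr (lvU f s U t) (lvB f s bnd t) := by
  rw [okSet, lvU, lvB]
  split_ifs with h
  · ext a
    simp only [thr, Set.mem_ofPred_eq, pre, above]
    change _ ↔ _ ∨ (above a).ncard = (above (seq f t)).ncard ∧ _
    rw [← canon_eq_iff_card]
    constructor
    · rintro (rfl | h | h)
      exacts [.inr ⟨rfl, le_rfl⟩, .inl h, .inr ⟨h.1.symm, h.2.le⟩]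
    · rintro (h | ⟨h, h'⟩)
      · exact .inr (.inl h)
      · rcases h'.eq_or_lt with h' | h'
        exacts [.inl (eq_of_trIndex h h'.symm), .inr (.inr ⟨h.symm, h'⟩)]
  · rfl

/-- The state contains the data for counting the words above a bound. -/
structure Lev (σ : State) (f : Word n q) (s S : ℕ) (U : Set (Word (fr n) q)) (bnd : ℕ) : Prop where
  range : (∏ k, fr n k) * n (Fin.last d) ≤ σ.var 4
  K_eq : σ.var 24 = ∏ k, fr n k
  s_eq : σ.var 25 = s
  S_eq : σ.var 26 = S
  bnd_eq : σ.var 27 = bnd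
  s_lt : s < n (Fin.last d)
  s_le : s ≤ S
  S_le : S ≤ n (Fin.last d)
  lets : ∀ l < S, ∀ r < ∏ k, fr n k,
    σ.arr 6 ((σ.var 21 * σ.var 3 + l) * σ.var 3 + r) = enc (un (fr n) r +ᵥ seq f l)
  taus : ∀ l < S, σ.arr 7 (σ.var 21 * σ.var 3 + l) = trIndex (seq f l)
  adds : ∀ a < ∏ k, fr n k, ∀ b < ∏ k, fr n k, σ.arr 4 (a * σ.var 3 + b) = posIndex (un (fr n) a + un (fr n) b)
  tabs : ∀ l < S, ∀ h < ∏ k, fr n k, σ.arr 8 ((σ.var 21 * σ.var 3 + l) * σ.var 3 + h) =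
    {a | a ∈ above (seq f l) ∧ un (fr n) h +ᵥ a = a}.ncard
  foc : ∀ h < ∏ k, fr n k, σ.arr 10 (σ.var 21 * σ.var 3 + h) = {a | a ∈ U ∧ un (fr n) h +ᵥ a = a}.ncard
  up : UpOrb U
  letters : ∀ a, (above a).ncard = U.ncard → bnd ≤ trIndex a → ∃ l < S, canon a = canon (seq f l)

namespace Lev

variable {σ τ : State}

theorem congr (L : Lev σ f s S U bnd) (h : ∀ x ∈ [3, 4, 21, 24, 25, 26, 27], τ.var x = σ.var x)
    (h' : ∀ a ∈ [4, 6, 7, 8, 10], τ.arr a = σ.arr a) : Lev τ f s S U bnd := by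
  simp only [List.forall_mem_cons, List.not_mem_nil, false_imp_iff, implies_true, and_true] at h h'
  obtain ⟨h1, h2, h3, h4, h5, h6, h7⟩ := h
  obtain ⟨g1, g2, g3, g4, g5⟩ := h'
  constructor
  all_goals try simp only [h1, h2, h3, h4, h5, h6, h7, g1, g2, g3, g4, g5]
  exacts [L.range, L.K_eq, L.s_eq, L.S_eq, L.bnd_eq, L.s_lt, L.s_le, L.S_le, L.lets, L.taus,
    L.adds, L.tabs, L.foc, L.up, L.letters]

theorem set (L : Lev σ f s S U bnd) {x : ℕ} (hx : 28 ≤ x) (v : ℕ) :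
    Lev (σ.set x v) f s S U bnd := by
  refine L.congr (fun y hy => ?_) fun a _ => rfl
  rw [State.set_var, if_neg]
  rintro rfl
  simp at hy
  omega

end Lev

end level

end MDWord

/-! ### Correctness of the tests on strings and letters -/

namespace MDWord

open RAM

section pat

variable {A G : Type} [AddCommGroup G] [AddAction G A] {w : ℕ → A}

theorem pat_eq_pat {t t' : ℕ} {r r' : G} :
    pat w t r = pat w t' r' ↔ t = t' ∧ ∀ l < t, r +ᵥ w l = r' +ᵥ w l := by
  constructor
  · intro h
    have hl := congrArg List.length h
    simp only [length_pat] at hl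
    subst hl
    refine ⟨rfl, fun l hl => ?_⟩
    have := congrArg (fun x : List A => x[l]?) h
    simpa [pat, hl] using this
  · rintro ⟨rfl, h⟩
    exact List.map_congr_left fun l hl => h l (List.mem_range.1 hl)

theorem pat_suffix_pat {t t' : ℕ} {r r' : G} :
    pat w t r <:+ pat w t' r' ↔ t ≤ t' ∧ ∀ l < t, r' +ᵥ w (t' - t + l) = r +ᵥ w l := by
  constructor
  · intro h
    have hl := h.length_le
    simp only [length_pat] at hl
    refine ⟨hl, fun l hlt => ?_⟩
    have h1 := List.suffix_iff_eq_drop.1 h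
    have := congrArg (fun x : List A => x[l]?) h1
    simp only [length_pat, List.getElem?_drop] at this
    rw [pat, pat] at this
    simp only [List.getElem?_map, List.getElem?_range hlt,
      List.getElem?_range (show t' - t + l < t' by omega), Option.map_some,
      Option.some.injEq] at this
    exact this.symm
  · rintro ⟨ht, h⟩
    refine List.suffix_iff_eq_drop.2 (List.ext_getElem? fun l => ?_)
    simp only [length_pat, List.getElem?_drop]
    rw [pat, pat]
    rcases lt_or_ge l t with hl | hl
    · simp only [List.getElem?_map, List.getElem?_range hl,
        List.getElem?_range (show t' - t + l < t' by omega), Option.map_some,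
        Option.some.injEq]
      exact (h l hl).symm
    · rw [List.getElem?_eq_none (by simpa using hl), List.getElem?_eq_none (by simp; omega)]

theorem pat_suffix_snoc {t t' : ℕ} {r r' : G} {a : A} :
    pat w t r <:+ pat w t' r' ++ [a] ↔ t = 0 ∨ (t ≤ t' + 1 ∧
      ∀ l < t - 1, r +ᵥ w l = r' +ᵥ w (t' + 1 - t + l)) ∧ r +ᵥ w (t - 1) = a := by
  cases t with
  | zero => simp [pat]
  | succ t =>
    rw [show pat w (t + 1) r = pat w t r ++ [r +ᵥ w t] by simp [pat, List.range_succ],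
      snoc_suffix_snoc, pat_suffix_pat]
    simp only [Nat.add_sub_cancel, Nat.add_sub_add_right, Nat.add_le_add_iff_right,
      Nat.succ_ne_zero, false_or, and_congr_left_iff, and_congr_right_iff]
    exact fun _ _ => ⟨fun h l hl => (h l hl).symm, fun h l hl => (h l hl).symm⟩

end pat

section level

variable {d : ℕ} {n : Fin (d + 1) → ℕ} [∀ k, NeZero (n k)] {q : ℕ}
variable {f : Word n q} {s S bnd : ℕ} {U : Set (Word (fr n) q)} {σ : State}

/-- The string of the state `x`. -/
def str (f : Word n q) (s x : ℕ) : List (Word (fr n) q) :=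
  pat (fun l : ℕ => seq f l) (s - x / ∏ k, fr n k) (un (fr n) (x % ∏ k, fr n k))

/-- The letter with the number `e`. -/
def letter (f : Word n q) (e : ℕ) : Word (fr n) q :=
  un (fr n) (e % ∏ k, fr n k) +ᵥ seq f (e / ∏ k, fr n k : ℕ)

namespace Lev

theorem K_pos : 0 < ∏ k, fr n k := Finset.prod_pos fun _ _ => NeZero.pos _

theorem K_le (L : Lev σ f s S U bnd) : ∏ k, fr n k ≤ σ.var 4 :=
  (Nat.le_mul_of_pos_right _ (NeZero.pos _)).trans L.range

theorem s_succ_le (L : Lev σ f s S U bnd) : s + 1 ≤ σ.var 4 :=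
  (L.s_lt.nat_succ_le.trans (Nat.le_mul_of_pos_left _ K_pos)).trans L.range

theorem eval_var {x v : ℕ} (h : σ.var x = v) : (Term.var x).eval σ = v := h

theorem eval_cell {a b : Term} {a' b' : ℕ} (ha : a.eval σ = a') (hb : b.eval σ = b') :
    (cellT a b).eval σ = a' * σ.var 3 + b' := by
  simp only [cellT, Term.eval, Op.eval, ha, hb]

theorem eval_let (L : Lev σ f s S U bnd) {l r : Term} {l' r' : ℕ} (hl : l.eval σ = l')
    (hr : r.eval σ = r') (hl' : l' < S) (hr' : r' < ∏ k, fr n k) :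
    (letT l r).eval σ = enc (un (fr n) r' +ᵥ seq f l') := by
  rw [letT, Term.eval, eval_cell (eval_cell rfl hl) hr]
  exact L.lets l' hl' r' hr'

theorem eval_tau (L : Lev σ f s S U bnd) {l : Term} {l' : ℕ} (hl : l.eval σ = l') (hl' : l' < S) :
    (tauT l).eval σ = trIndex (seq f l') := by
  rw [tauT, Term.eval, eval_cell rfl hl]
  exact L.taus l' hl'

theorem eval_ad (L : Lev σ f s S U bnd) {a b : Term} {a' b' : ℕ} (ha : a.eval σ = a')
    (hb : b.eval σ = b') (ha' : a' < ∏ k, fr n k) (hb' : b' < ∏ k, fr n k) :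
    (adT a b).eval σ = posIndex (un (fr n) a' + un (fr n) b') := by
  rw [adT, Term.eval, eval_cell ha hb]
  exact L.adds a' ha' b' hb'

theorem eval_tv (L : Lev σ f s S U bnd) {t h : Term} {t' h' : ℕ} (ht : t.eval σ = t')
    (hh : h.eval σ = h') (hh' : h' < ∏ k, fr n k) :
    (tvT t h).eval σ = {a | a ∈ lvU f s U t' ∧ un (fr n) h' +ᵥ a = a}.ncard := by
  rw [tvT, Term.eval_sel (Term.eval_less ht (eval_var L.s_eq))
    (a := {a | a ∈ above (seq f t') ∧ un (fr n) h' +ᵥ a = a}.ncard)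
    (b := {a | a ∈ U ∧ un (fr n) h' +ᵥ a = a}.ncard), lvU]
  · split_ifs <;> rfl
  · intro h
    rw [Term.eval, eval_cell (eval_cell rfl ht) hh]
    exact L.tabs t' (h.trans_le L.s_le) h' hh'
  · intro h
    rw [Term.eval, eval_cell rfl hh]
    exact L.foc h' hh'

theorem eval_tv_zero (L : Lev σ f s S U bnd) {t : Term} {t' : ℕ} (ht : t.eval σ = t') :
    (tvT t (.lit 0)).eval σ = (lvU f s U t').ncard := by
  rw [L.eval_tv ht (h' := 0) rfl K_pos]
  simp [un_zero]

theorem eval_bnd (L : Lev σ f s S U bnd) {t : Term} {t' : ℕ} (ht : t.eval σ = t') :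
    (bndT t).eval σ = lvB f s bnd t' := by
  rw [bndT, Term.eval_sel (Term.eval_less ht (eval_var L.s_eq))
    (fun h => L.eval_tau ht (h.trans_le L.s_le)) (fun _ => eval_var L.bnd_eq), lvB]
  split_ifs <;> rfl

variable {x y i e t t' r l : ℕ} {x' y' i' e' v r' : ℕ}

theorem eval_len (L : Lev σ f s S U bnd) (hx : σ.var x = x') :
    (lenT x).eval σ = s - x' / ∏ k, fr n k := by
  simp only [lenT, Term.eval, Op.eval, hx, L.s_eq, L.K_eq]

theorem eval_rot (L : Lev σ f s S U bnd) (hx : σ.var x = x') :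
    (rotT x).eval σ = x' % ∏ k, fr n k :=
  Term.eval_mod hx L.K_eq

theorem eval_row (L : Lev σ f s S U bnd) (hx : σ.var x = x') :
    (rowT x).eval σ = x' / ∏ k, fr n k :=
  Term.eval_bin .quot hx L.K_eq

theorem row_lt {m : ℕ} (h : e' < m * ∏ k, fr n k) : e' / (∏ k, fr n k) < m :=
  Nat.div_lt_of_lt_mul (by rwa [mul_comm])

theorem eval_letter (L : Lev σ f s S U bnd) (he : σ.var e = e') (he' : e' < S * ∏ k, fr n k) :
    (letterT e).eval σ = enc (letter f e') :=
  L.eval_let (L.eval_row he) (L.eval_rot he) (row_lt he') (Nat.mod_lt _ K_pos)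

theorem eval_eqs (L : Lev σ f s S U bnd) {c : Term} {c' : ℕ} (hl : 28 ≤ l) (hxl : x ≠ l)
    (hyl : y ≠ l) (hx : σ.var x = x') (hy : σ.var y = y')
    (hc : ∀ i, c.eval (σ.set l i) = c') (hc' : c' < ∏ k, fr n k) :
    (eqsT x y c l).eval σ = ind (str f s x' = (str f s y').map (un (fr n) c' +ᵥ ·)) := by
  rw [eqsT, Term.eval_and (Term.eval_eq (L.eval_len hx) (L.eval_len hy))
    (Term.eval_all (L.eval_len hx) ((Nat.sub_le _ _).trans (by have := L.s_succ_le; omega))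
    (F := fun l : ℕ => un (fr n) (x' % ∏ k, fr n k) +ᵥ seq f l =
      (un (fr n) c' + un (fr n) (y' % ∏ k, fr n k)) +ᵥ seq f l) fun i hi => ?_)]
  · rw [str, str, map_pat]
    exact ind_congr pat_eq_pat.symm
  · have L' := L.set hl i
    have hiS : i < S := (hi.trans_le (Nat.sub_le _ _)).trans_le L.s_le
    have h1 := Nat.mod_lt x' (K_pos (n := n))
    have h2 := Nat.mod_lt y' (K_pos (n := n))
    rw [Term.eval_eq (L'.eval_let (l' := i) (by simp [Term.eval])
        (L'.eval_rot (x := x) (by simp [hxl, hx])) hiS h1)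
      (L'.eval_let (l' := i) (by simp [Term.eval])
        (L'.eval_ad (hc i) (L'.eval_rot (x := y) (by simp [hyl, hy])) hc' h2) hiS (posIndex_lt _)),
      un_posIndex]
    exact ind_congr enc_injective.eq_iff

theorem eval_eqs_zero (L : Lev σ f s S U bnd) (hl : 28 ≤ l) (hxl : x ≠ l)
    (hyl : y ≠ l) (hx : σ.var x = x') (hy : σ.var y = y') :
    (eqsT x y (.lit 0) l).eval σ = ind (str f s x' = str f s y') := by
  rw [L.eval_eqs hl hxl hyl hx hy (c' := 0) (fun _ => rfl) K_pos, un_zero]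
  simp

theorem eval_canon (L : Lev σ f s S U bnd) {z : ℕ} (hl : 28 ≤ l) (hz : 28 ≤ z) (hxl : x ≠ l)
    (hzl : z ≠ l) (hxz : x ≠ z) (hx : σ.var x = x') (hx' : x' < (s + 1) * ∏ k, fr n k) :
    (canonT x z l).eval σ = ind (∀ j < x', str f s j ≠ str f s x') := by
  have hM : (s + 1) * ∏ k, fr n k ≤ σ.var 4 := by
    refine le_trans ?_ L.range
    rw [mul_comm]
    exact Nat.mul_le_mul_left _ L.s_lt
  exact Term.eval_all hx (by omega) fun j hj => Term.eval_neg <|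
    (L.set hz j).eval_eqs_zero hl hzl hxl (by simp) (by simp [hxz, hx])

theorem eval_act (L : Lev σ f s S U bnd) (hl : 28 ≤ l) (hil : i ≠ l) (htl : t ≠ l)
    (hrl : r ≠ l) (hi : σ.var i = i') (ht : σ.var t = v) (hr : σ.var r = r')
    (hv : v ≤ s) (hr' : r' < ∏ k, fr n k) :
    (actT i t r l).eval σ =
      ind (pat (fun l : ℕ => seq f l) v (-un (fr n) r') <:+ str f s i') := by
  have h1 := Nat.mod_lt i' (K_pos (n := n))
  rw [actT, Term.eval_and (Term.eval_le (eval_var ht) (L.eval_len hi))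
    (Term.eval_all (eval_var ht) (by have := L.s_succ_le; omega)
    (F := fun l : ℕ =>
      un (fr n) (i' % ∏ k, fr n k) +ᵥ seq f ((s - i' / (∏ k, fr n k) - v + l : ℕ) : ℤ) =
      -un (fr n) r' +ᵥ seq f l) fun j hj => ?_)]
  · rw [str]
    exact ind_congr (pat_suffix_pat (w := fun l : ℕ => seq f l)).symm
  · have L' := L.set hl j
    have hs := L.s_le
    have h2 : s - i' / (∏ k, fr n k) ≤ s := Nat.sub_le _ _
    rw [Term.eval_eq (L'.eval_let
      (Term.eval_bin .plus (Term.eval_bin .minus (L'.eval_len (x' := i') (by simp [hil, hi]))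
        (eval_var (v := v) (by simp [htl, ht]))) (eval_var (v := j) (by simp)))
      (L'.eval_ad (L'.eval_rot (x := i) (by simp [hil, hi])) (eval_var (v := r') (by simp [hrl, hr]))
        h1 hr') (by simp only [Op.eval]; omega) (posIndex_lt _))
      (L'.eval_let (eval_var (v := j) (by simp)) (r' := 0) rfl (by omega) K_pos), un_posIndex,
      un_zero, zero_vadd]
    refine ind_congr (enc_injective.eq_iff.trans ?_)
    simp only [Op.eval]
    rw [eq_neg_vadd_iff, vadd_vadd, add_comm]

theorem eval_suf (L : Lev σ f s S U bnd) (hl : 28 ≤ l) (hyl : y ≠ l) (hil : i ≠ l)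
    (hy : σ.var y = y') (hi : σ.var i = i') (he : σ.var e = e') (he' : e' < S * ∏ k, fr n k) :
    (sufT y i e l).eval σ = ind (str f s y' <:+ str f s i' ++ [letter f e']) := by
  have h1 := Nat.mod_lt i' (K_pos (n := n))
  have h2 := Nat.mod_lt y' (K_pos (n := n))
  have hs := L.s_le
  have h3 : s - i' / (∏ k, fr n k) ≤ s := Nat.sub_le _ _
  have h4 : s - y' / (∏ k, fr n k) ≤ s := Nat.sub_le _ _
  rw [str, str, ind_congr pat_suffix_snoc, sufT]
  have hS : 0 < S := by
    rcases Nat.eq_zero_or_pos S with h | h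
    · simp [h] at he'
    · exact h
  refine Term.eval_or (Term.eval_eq (L.eval_len hy) rfl) (Term.eval_and
    (Term.eval_and (Term.eval_le (L.eval_len hy) (Term.eval_bin .plus (L.eval_len hi) rfl))
      (Term.eval_all (Term.eval_bin .minus (L.eval_len hy) rfl) ?_ fun j hj => ?_)) ?_)
  · have := L.s_succ_le
    change s - y' / (∏ k, fr n k) - 1 ≤ _
    omega
  · have L' := L.set hl j
    replace hj : j < s - y' / (∏ k, fr n k) - 1 := hj
    rw [Term.eval_eq (L'.eval_let (eval_var (v := j) (by simp))
      (L'.eval_rot (x := y) (x' := y') (by simp [hyl, hy])) (by omega) h2)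
      (L'.eval_let (Term.eval_bin .plus (Term.eval_bin .minus
        (Term.eval_bin .plus (L'.eval_len (x := i) (x' := i') (by simp [hil, hi])) (b := 1) rfl)
        (L'.eval_len (x := y) (x' := y') (by simp [hyl, hy]))) (eval_var (v := j) (by simp)))
      (L'.eval_rot (x := i) (x' := i') (by simp [hil, hi])) (by simp only [Op.eval]; omega) h1)]
    exact ind_congr enc_injective.eq_iff
  · rw [Term.eval_eq (L.eval_let (Term.eval_bin .minus (L.eval_len hy) (b := 1) rfl)
      (L.eval_rot hy) (by simp only [Op.eval]; omega) h2) (L.eval_letter he he')]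
    exact ind_congr enc_injective.eq_iff

theorem eval_above (L : Lev σ f s S U bnd) (he : σ.var e = e') (he' : e' < S * ∏ k, fr n k) :
    (okT.tvT' e).eval σ = (above (letter f e')).ncard := by
  rw [okT.tvT', Term.eval, eval_cell (eval_cell rfl (L.eval_row he)) (b' := 0) rfl]
  have := L.tabs _ (row_lt he') 0 K_pos
  have h : above (letter f e') = above (seq f (e' / ∏ k, fr n k : ℕ)) := by
    simp only [above, letter, canon_vadd]
  refine this.trans ?_
  rw [un_zero, h]
  simp

/-- Whether the letter lies in a larger, or exactly in the bounding, necklace is decided by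
comparing numbers of words above. In the second case its index is at least the bound if no
translation with a smaller index leads to the canonical representation, which is obtained from the
row of the letter and the stored index of that row. -/
theorem eval_ok (L : Lev σ f s S U bnd) {g : ℕ} (hg : 28 ≤ g) (htg : t ≠ g) (heg : e ≠ g)
    (hrg : r ≠ g) (ht : σ.var t = v) (he : σ.var e = e') (hr : σ.var r = r')
    (he' : e' < S * ∏ k, fr n k) (hr' : r' < ∏ k, fr n k) :
    (okT t e r g).eval σ = ind (un (fr n) r' +ᵥ letter f e' ∈ okSet f s (thr U bnd) v) := by
  have h1 := Nat.mod_lt e' (K_pos (n := n))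
  have hr1 := row_lt he'
  rw [okT, Term.eval_or (Term.eval_less (L.eval_above he he') (L.eval_tv_zero (eval_var ht)))
    (Term.eval_and (Term.eval_eq (L.eval_above he he') (L.eval_tv_zero (eval_var ht)))
    (Term.eval_all (eval_var L.K_eq) L.K_le (F := fun j => lvB f s bnd v ≤ j ∨
      ¬ (un (fr n) j + un (fr n) r') +ᵥ letter f e' = canon (letter f e')) fun j hj =>
      Term.eval_or (Term.eval_le ((L.set hg j).eval_bnd (eval_var (v := v) (by simp [htg, ht])))
        (eval_var (v := j) (by simp)))
      (Term.eval_neg ?_)))]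
  · rw [okSet_eq]
    refine ind_congr ?_
    have hab : above (un (fr n) r' +ᵥ letter f e') = above (letter f e') := by
      simp only [above, canon_vadd]
    rw [← (upOrb_lvU L.up v).mem_iff_card, thr, Set.mem_ofPred_eq, (upOrb_lvU L.up v).vadd_mem, hab]
    refine or_congr_right (and_congr_right fun _ => ?_)
    constructor
    · intro h
      obtain ⟨g, hg1, hg2⟩ := trIndex_spec (un (fr n) r' +ᵥ letter f e')
      rw [← hg2]
      refine (h _ (posIndex_lt g)).resolve_right fun h => h ?_
      rw [un_posIndex, add_vadd, hg1, canon_vadd]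
    · intro h j hj
      by_contra! hlt
      obtain ⟨h2, h3⟩ := hlt
      rw [add_vadd, ← canon_vadd (un (fr n) r') (letter f e')] at h3
      have := trIndex_le h3
      rw [posIndex_un, Nat.mod_eq_of_lt hj] at this
      omega
  · have L' := L.set hg j
    have he2 : (σ.set g j).var e = e' := by simp [heg, he]
    rw [Term.eval_eq (L'.eval_let (L'.eval_row he2)
      (L'.eval_ad (L'.eval_ad (L'.eval_rot he2) (eval_var (v := r') (by simp [hrg, hr])) h1 hr')
        (eval_var (v := j) (by simp)) (posIndex_lt _) hj) hr1 (posIndex_lt _))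
      (L'.eval_let (L'.eval_row he2) (L'.eval_tau (L'.eval_row he2) hr1) hr1 (trIndex_lt _))]
    refine ind_congr (enc_injective.eq_iff.trans ?_)
    have hc : canon (letter f e') = canon (seq f (e' / ∏ k, fr n k : ℕ)) := canon_vadd _ _
    obtain ⟨g', hg1, hg2⟩ := trIndex_spec (seq f (e' / ∏ k, fr n k : ℕ))
    rw [un_posIndex, un_posIndex, ← hg2, un_posIndex, hg1, hc, letter, vadd_vadd]
    rw [add_comm, add_comm (un _ (e' % _)), add_assoc]

theorem eval_allowed (L : Lev σ f s S U bnd) (hl : 28 ≤ l) (ht : 28 ≤ t) (hr : 28 ≤ r)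
    (hil : i ≠ l) (hel : e ≠ l) (hit : i ≠ t) (het : e ≠ t) (hir : i ≠ r) (her : e ≠ r)
    (htl : t ≠ l) (hrl : r ≠ l) (htr : t ≠ r)
    (hi : σ.var i = i') (he : σ.var e = e') (he' : e' < S * ∏ k, fr n k) :
    (allowedT i e t r l).eval σ = ind (Allowed (Pos (fr n)) (fun l : ℕ => seq f l) s
      (okSet f s (thr U bnd)) (str f s i') (letter f e')) := by
  rw [allowedT, Term.eval_all (Term.eval_bin .plus (eval_var L.s_eq) (b := 1) rfl) L.s_succ_le
    fun v hv => Term.eval_all (eval_var (L.set ht v).K_eq) (L.set ht v).K_le fun r' hr' =>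
      Term.eval_or (Term.eval_neg
        (((L.set ht v).set hr r').eval_act (v := v) (i' := i') (r' := r') hl hil htl hrl
          (by simp [hit, hir, hi]) (by simp [htr]) (by simp) (by simp only [Op.eval] at hv; omega) hr'))
        (((L.set ht v).set hr r').eval_ok (v := v) (e' := e') (r' := r') hl htl hel hrl
          (by simp [htr]) (by simp [het, her, he]) (by simp)
          he' hr')]
  refine ind_congr ?_
  simp only [Op.eval, Nat.lt_succ_iff, Allowed, ← imp_iff_not_or]
  constructor
  · intro h v hv g hg
    obtain ⟨r', hr', h2⟩ := exists_un_eq (-g)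
    have h3 := h v hv r' hr'
    rw [h2, neg_neg] at h3
    exact h3 hg
  · intro h v hv r' hr' h2
    have := h v hv _ h2
    rwa [neg_neg] at this

theorem eval_active (L : Lev σ f s S U bnd) (hl : 28 ≤ l) (hr : 28 ≤ r)
    (hil : i ≠ l) (hir : i ≠ r) (htl : t ≠ l) (hrl : r ≠ l) (htr : t ≠ r)
    (hi : σ.var i = i') (ht : σ.var t = v) (hv : v ≤ s) :
    (activeT i t r l).eval σ =
      ind (∃ g : Pos (fr n), pat (fun l : ℕ => seq f l) v g <:+ str f s i') := by
  rw [activeT, Term.eval_ex (eval_var L.K_eq) L.K_le fun r' hr' =>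
        ((L.set hr r').eval_act (v := v) (i' := i') (r' := r') hl hil htl hrl
          (by simp [hir, hi]) (by simp [htr, ht]) (by simp) hv hr')]
  refine ind_congr ?_
  constructor
  · rintro ⟨r', -, h⟩
    exact ⟨_, h⟩
  · rintro ⟨g, hg⟩
    obtain ⟨r', hr', h2⟩ := exists_un_eq (-g)
    exact ⟨r', hr', by rwa [h2, neg_neg]⟩

theorem eval_bulk (L : Lev σ f s S U bnd) (hl : 28 ≤ l) (ht : 28 ≤ t) (hr : 28 ≤ r)
    (hil : i ≠ l) (hit : i ≠ t) (het : e ≠ t) (hir : i ≠ r)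
    (htl : t ≠ l) (hrl : r ≠ l) (htr : t ≠ r)
    (hi : σ.var i = i') (he : σ.var e = e') (he' : e' < S * ∏ k, fr n k) :
    (bulkT i e t r l).eval σ = ind (Bulk (Pos (fr n)) (fun l : ℕ => seq f l) s
      (lvU f s U) (str f s i') (letter f e')) := by
  rw [bulkT, Term.eval_all (Term.eval_bin .plus (eval_var L.s_eq) (b := 1) rfl) L.s_succ_le
    fun v hv => Term.eval_or (Term.eval_neg
        ((L.set ht v).eval_active (v := v) (i' := i') hl hr hil hir htl hrl htr
          (by simp [hit, hi]) (by simp) (by simp only [Op.eval] at hv; omega)))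
        (Term.eval_less ((L.set ht v).eval_above (e' := e') (by simp [het, he]) he')
          ((L.set ht v).eval_tv_zero (eval_var (v := v) (by simp))))]
  refine ind_congr ?_
  simp only [Op.eval, Nat.lt_succ_iff, Bulk, ← imp_iff_not_or, ← (upOrb_lvU L.up _).mem_iff_card]
  exact ⟨fun h t ht r hr => h t ht ⟨r, hr⟩, fun h t ht hr => h t ht hr.choose hr.choose_spec⟩

end Lev

end level

end MDWord

/-! ### Counting the transitions of the automaton -/

namespace MDWord

open RAM

section count

/-- Repetitions in the enumeration are avoided by counting only the first number of each element. -/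
theorem sum_ind_first {A : Type} (m : ℕ) (L : ℕ → A) (P : A → Prop) :
    ∑ e ∈ Finset.range m, ind ((∀ j < e, L j ≠ L e) ∧ P (L e)) =
      {a | (∃ e < m, L e = a) ∧ P a}.ncard := by
  classical
  have h : ∀ e, ind ((∀ j < e, L j ≠ L e) ∧ P (L e)) =
      if (∀ j < e, L j ≠ L e) ∧ P (L e) then 1 else 0 := fun e => by unfold ind; split_ifs <;> rfl
  simp only [h]
  rw [Finset.sum_boole, Nat.cast_id, ← Set.ncard_coe_finset]
  refine Set.ncard_congr (fun e _ => L e) ?_ ?_ ?_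
  · intro e he
    simp only [Finset.coe_filter, Finset.mem_range, Set.mem_ofPred_eq] at he
    exact ⟨⟨e, he.1, rfl⟩, he.2.2⟩
  · intro a b ha hb hab
    simp only [Finset.coe_filter, Finset.mem_range, Set.mem_ofPred_eq] at ha hb
    rcases lt_trichotomy a b with h | h | h
    exacts [absurd hab (hb.2.1 a h), h, absurd hab.symm (ha.2.1 b h)]
  · rintro a ⟨h1, h2⟩
    have h3 := Nat.find_spec h1
    refine ⟨Nat.find h1, ?_, h3.2⟩
    simp only [Finset.coe_filter, Finset.mem_range, Set.mem_ofPred_eq]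
    refine ⟨h3.1, fun j hj hj' => Nat.find_min h1 hj ⟨hj.trans h3.1, hj'.trans h3.2⟩, ?_⟩
    rwa [h3.2]

theorem sum_image_first {A : Type} [DecidableEq A] (m : ℕ) (L : ℕ → A) (φ : A → ℕ) :
    ∑ z ∈ (Finset.range m).image L, φ z =
      ∑ e ∈ Finset.range m, ind (∀ j < e, L j ≠ L e) * φ (L e) := by
  classical
  have h : ∀ e, ind (∀ j < e, L j ≠ L e) * φ (L e) =
      if ∀ j < e, L j ≠ L e then φ (L e) else 0 := fun e => by
    unfold ind; split_ifs <;> simp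
  simp only [h]
  rw [← Finset.sum_filter]
  symm
  refine Finset.sum_bij (fun e _ => L e) ?_ ?_ ?_ fun _ _ => rfl
  · exact fun e he => Finset.mem_image_of_mem _ (Finset.mem_filter.1 he).1
  · intro a ha b hb hab
    rcases lt_trichotomy a b with h | h | h
    exacts [absurd hab ((Finset.mem_filter.1 hb).2 a h), h,
      absurd hab.symm ((Finset.mem_filter.1 ha).2 b h)]
  · intro z hz
    obtain ⟨e, he, h1⟩ := Finset.mem_image.1 hz
    have h2 : ∃ e, L e = z := ⟨e, h1⟩
    have h3 := Nat.find_spec h2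
    refine ⟨Nat.find h2, Finset.mem_filter.2 ⟨Finset.mem_range.2 ?_, fun j hj hj' =>
      Nat.find_min h2 hj (hj'.trans h3)⟩, h3⟩
    exact lt_of_le_of_lt (Nat.find_min' h2 h1) (Finset.mem_range.1 he)

/-- Ties are broken by the index, so exactly one summand survives, namely that of the smallest
minimizer. -/
theorem exists_sum_min {s : ℕ} {P : ℕ → Prop} (c : ℕ → ℕ) (h : ∃ t ≤ s, P t) :
    ∃ t ≤ s, P t ∧ (∀ t' ≤ s, P t' → c t ≤ c t') ∧
      ∑ t ∈ Finset.range (s + 1), ind (P t ∧ ∀ t' < s + 1, ¬ P t' ∨ c t < c t' ∨ c t = c t' ∧ t ≤ t')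
        * c t = c t := by
  classical
  obtain ⟨t0, ht0, hP0⟩ := h
  obtain ⟨t, ht, hmin⟩ := ((Finset.range (s + 1)).filter P).exists_min_image
    (fun t => toLex (c t, t)) ⟨t0, Finset.mem_filter.2 ⟨Finset.mem_range.2 (by omega), hP0⟩⟩
  simp only [Finset.mem_filter, Finset.mem_range, Prod.Lex.toLex_le_toLex] at ht hmin
  refine ⟨t, by omega, ht.2, fun t' ht' h' => ?_, ?_⟩
  · rcases hmin t' ⟨by omega, h'⟩ with h | h
    exacts [h.le, h.1.le]
  · rw [Finset.sum_eq_single_of_mem t (Finset.mem_range.2 ht.1), ind_pos, one_mul]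
    · refine ⟨ht.2, fun t' ht' => ?_⟩
      by_cases hP : P t'
      exacts [.inr (hmin t' ⟨ht', hP⟩), .inl hP]
    · intro t' ht' hne
      rw [ind_neg, zero_mul]
      rintro ⟨h1, h2⟩
      have h3 := (h2 t ht.1).resolve_left (not_not.2 ht.2)
      have h4 := hmin t' ⟨Finset.mem_range.1 ht', h1⟩
      omega

/-- The witness is the gcd of `n` and `j`, with `u` from Bézout's identity. Its minimality lets the
program find it by trying values in increasing order. -/
theorem exists_period {n : ℕ} (hn : 0 < n) (j : ℕ) : ∃ p, 1 ≤ p ∧ p ≤ n ∧ p ∣ n ∧ p ∣ j ∧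
    (∃ u < n, u * j % n = p % n) ∧ ∀ p', 1 ≤ p' → (∃ u < n, u * j % n = p' % n) → p ≤ p' := by
  refine ⟨Nat.gcd n j, Nat.gcd_pos_of_pos_left _ hn, Nat.gcd_le_left _ hn, Nat.gcd_dvd_left _ _,
    Nat.gcd_dvd_right _ _, ?_, ?_⟩
  · have h := Nat.gcd_eq_gcd_ab n j
    have h0 : (n : ℤ) ≠ 0 := by omega
    have h1 := Int.emod_nonneg (Nat.gcdB n j) h0
    have h2 := Int.emod_lt_of_pos (Nat.gcdB n j) (show (0 : ℤ) < n by omega)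
    refine ⟨(Nat.gcdB n j % n).toNat, by omega, ?_⟩
    zify
    rw [Int.toNat_of_nonneg h1, h]
    have h3 := Int.emod_add_mul_ediv (Nat.gcdB n j) n
    exact Int.modEq_iff_dvd.2 ⟨Nat.gcdA n j + Nat.gcdB n j / n * j, by
      linear_combination (-(j : ℤ)) * h3⟩
  · rintro p' hp' ⟨u, -, hu⟩
    refine Nat.le_of_dvd hp' ?_
    have h1 : Nat.gcd n j ∣ u * j % n :=
      (Nat.dvd_mod_iff (Nat.gcd_dvd_left n j)).2 (Dvd.dvd.mul_left (Nat.gcd_dvd_right n j) u)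
    rw [hu] at h1
    exact (Nat.dvd_mod_iff (Nat.gcd_dvd_left n j)).1 h1

theorem walks_le {A : Type} [Fintype A] (S : Set (List A)) (P : List A → A → Prop) (p : ℕ)
    (x y : List A) : walks S P p x y ≤ Fintype.card A ^ p := by
  classical
  induction p generalizing x with
  | zero => rw [walks]; split_ifs <;> simp
  | succ p ih =>
    rw [walks, pow_succ']
    refine (Finset.sum_le_card_nsmul _ _ _ fun a _ => ih _).trans ?_
    rw [smul_eq_mul]
    exact Nat.mul_le_mul_right _ (Finset.card_le_univ _)

end count

section terms

/-- The number of transitions from the state `34` to the state `35`. -/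
def stepT : Term :=
  .bin .plus
    (.sum 36 (.bin .times (.var 26) (.var 24))
      (.and (.all 40 (.var 36) (.neg (.eq (letterT 40) (letterT 36))))
        (.and (.eq (letT (rowT 36) (adT (.var 30) (rotT 36))) (letterT 36))
          (.and (allowedT 34 36 37 38 39) (.and (.neg (bulkT 34 36 37 38 39))
            (.and (sufT 35 34 36 39) (.all 40 (.var 35) (.neg (sufT 40 34 36 39)))))))))
    (.bin .times (.eq (.var 35) (.bin .times (.var 25) (.var 24)))
      (bulkCountT 34 37 40 38 39))

end terms

section level

variable {d : ℕ} {n : Fin (d + 1) → ℕ} [∀ k, NeZero (n k)] {q : ℕ}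
variable {f : Word n q} {s S bnd : ℕ} {U : Set (Word (fr n) q)} {σ : State}

variable (f s) in
/-- The state `x` is the first one with its string. -/
def First (x : ℕ) : Prop := ∀ j < x, str f s j ≠ str f s x

theorem length_str (x : ℕ) : (str f s x).length = s - x / ∏ k, fr n k := length_pat _ _

theorem length_str_le {x y : ℕ} (h : x ≤ y) : (str f s y).length ≤ (str f s x).length := by
  rw [length_str, length_str]
  exact Nat.sub_le_sub_left (Nat.div_le_div_right h) _

theorem mem_pats_iff_str {z : List (Word (fr n) q)} :
    z ∈ pats (Pos (fr n)) (fun l : ℕ => seq f l) s ↔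
      ∃ x < (s + 1) * ∏ k, fr n k, str f s x = z := by
  constructor
  · rintro ⟨t, ht, g, rfl⟩
    obtain ⟨r, hr, rfl⟩ := exists_un_eq g
    refine ⟨(s - t) * (∏ k, fr n k) + r, ?_, ?_⟩
    · have : (s - t) * (∏ k, fr n k) ≤ s * ∏ k, fr n k :=
        Nat.mul_le_mul_right _ (Nat.sub_le _ _)
      rw [add_mul]; omega
    · have hK : 0 < ∏ k, fr n k := by omega
      rw [str, mul_comm, Nat.mul_add_div hK, Nat.div_eq_of_lt hr, Nat.mul_add_mod,
        Nat.mod_eq_of_lt hr, add_zero, Nat.sub_sub_self ht]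
  · rintro ⟨x, -, rfl⟩
    exact ⟨_, Nat.sub_le _ _, _, rfl⟩

/-- States are numbered by decreasing length, so the first state whose string is a suffix has the
longest such string, and it is the first state with that string. -/
theorem first_suffix_iff {x : List (Word (fr n) q)} {y : ℕ} (hy : y < (s + 1) * ∏ k, fr n k) :
    (str f s y <:+ x ∧ ∀ j < y, ¬ str f s j <:+ x) ↔
      longest (pats (Pos (fr n)) (fun l : ℕ => seq f l) s) x = str f s y ∧ First f s y := by
  constructor
  · rintro ⟨h1, h2⟩
    obtain ⟨z, hz, hz'⟩ := mem_pats_iff_str.1 (longest_mem (nil_mem_pats (G := Pos (fr n))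
      (w := fun l : ℕ => seq f l) (s := s)) x)
    have hzx : str f s z <:+ x := hz' ▸ longest_suffix x
    have h3 : y ≤ z := by
      by_contra! h
      exact h2 z h hzx
    refine ⟨?_, fun j hj h => h2 j hj (h ▸ h1)⟩
    have h4 := suffix_longest (mem_pats_iff_str.2 ⟨y, hy, rfl⟩) h1
    refine (h4.eq_of_length (le_antisymm h4.length_le ?_)).symm
    rw [← hz']
    exact length_str_le h3
  · rintro ⟨h1, h2⟩
    refine ⟨h1 ▸ longest_suffix x, fun j hj h => h2 j hj ?_⟩
    have h3 := suffix_longest (mem_pats_iff_str.2 ⟨j, hj.trans hy, rfl⟩) h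
    rw [h1] at h3
    exact h3.eq_of_length (le_antisymm h3.length_le (length_str_le hj.le))

theorem exists_letter_iff {a : Word (fr n) q} :
    (∃ e < S * ∏ k, fr n k, letter f e = a) ↔ ∃ l < S, canon a = canon (seq f (l : ℕ)) := by
  constructor
  · rintro ⟨e, he, rfl⟩
    exact ⟨_, Lev.row_lt he, canon_vadd _ _⟩
  · rintro ⟨l, hl, h⟩
    obtain ⟨g, rfl⟩ := canon_eq_canon_iff.1 h.symm
    obtain ⟨r, hr, rfl⟩ := exists_un_eq g
    replace hr : r < ∏ k, fr n k := hr
    refine ⟨l * (∏ k, fr n k) + r, ?_, ?_⟩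
    · have : (l + 1) * (∏ k, fr n k) ≤ S * ∏ k, fr n k := Nat.mul_le_mul_right _ hl
      rw [add_mul] at this; omega
    · have hK : 0 < ∏ k, fr n k := by omega
      rw [letter, mul_comm, Nat.mul_add_div hK, Nat.div_eq_of_lt hr, Nat.mul_add_mod,
        Nat.mod_eq_of_lt hr, add_zero]

variable (f s U) in
/-- The number of letters that are fixed by `h` and not bounded by any initial segment of `f`. -/
noncomputable def bulkCount (h x : ℕ) : ℕ :=
  {a | un (fr n) h +ᵥ a = a ∧
    Bulk (Pos (fr n)) (fun l : ℕ => seq f l) s (lvU f s U) (str f s x) a}.ncard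

variable (f s S U bnd) in
/-- The number of transitions from the state `x` to the string `z`. -/
noncomputable def step (h x : ℕ) (z : List (Word (fr n) q)) : ℕ :=
  {a | (∃ l < S, canon a = canon (seq f (l : ℕ))) ∧ un (fr n) h +ᵥ a = a ∧
      Allowed (Pos (fr n)) (fun l : ℕ => seq f l) s (okSet f s (thr U bnd)) (str f s x) a ∧
      ¬ Bulk (Pos (fr n)) (fun l : ℕ => seq f l) s (lvU f s U) (str f s x) a ∧
      longest (pats (Pos (fr n)) (fun l : ℕ => seq f l) s) (str f s x ++ [a]) = z}.ncard +
    open Classical in if z = [] then bulkCount f s U h x else 0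

namespace Lev

variable {h x y : ℕ}

/-- The sets above the active bounds form a chain, so their intersection is the smallest of them,
and it is found as the one with the fewest fixed words. The empty segment is always active, so a
minimum exists. -/
theorem eval_bulkCount (L : Lev σ f s S U bnd) (hx : σ.var 34 = x) (hh : σ.var 30 = h)
    (hh' : h < ∏ k, fr n k) :
    (bulkCountT 34 37 40 38 39).eval σ = bulkCount f s U h x := by
  let c : ℕ → ℕ := fun t => {a | a ∈ lvU f s U t ∧ un (fr n) h +ᵥ a = a}.ncard
  let P : ℕ → Prop := fun t => ∃ g : Pos (fr n), pat (fun l : ℕ => seq f l) t g <:+ str f s x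
  rw [bulkCountT, Term.eval_sum (Term.eval_bin .plus (eval_var L.s_eq) (b := 1) rfl) L.s_succ_le
    (F := fun t => ind (P t ∧ ∀ t' < s + 1, ¬ P t' ∨ c t < c t' ∨ c t = c t' ∧ t ≤ t') * c t)]
  · obtain ⟨t, ht, hP, hmin, hsum⟩ := exists_sum_min (s := s) (P := P) c
      ⟨0, Nat.zero_le _, 0, List.nil_suffix⟩
    refine hsum.trans ?_
    rw [bulkCount]
    refine congrArg Set.ncard (Set.ext fun a => ?_)
    simp only [Set.mem_ofPred_eq]
    constructor
    · rintro ⟨h1, h2⟩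
      refine ⟨h2, fun t' ht' r hr => ?_⟩
      rcases (upOrb_lvU (f := f) (s := s) L.up t).subset_or (upOrb_lvU L.up t') with h3 | h3
      · exact h3 h1
      -- If the inclusion goes the other way, minimality forces the two sets of fixed words to be
      -- equal.
      · have h4 := Set.eq_of_subset_of_ncard_le
          (s := {a | a ∈ lvU f s U t' ∧ un (fr n) h +ᵥ a = a})
          (t := {a | a ∈ lvU f s U t ∧ un (fr n) h +ᵥ a = a}) (fun a ha => ⟨h3 ha.1, ha.2⟩)
          (hmin t' ht' ⟨r, hr⟩) (Set.toFinite _)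
        have : a ∈ {a | a ∈ lvU f s U t' ∧ un (fr n) h +ᵥ a = a} := h4 ▸ ⟨h1, h2⟩
        exact this.1
    · rintro ⟨h1, h2⟩
      obtain ⟨g, hg⟩ := hP
      exact ⟨h2 t ht g hg, h1⟩
  · intro t ht
    replace ht : t < s + 1 := ht
    have L1 := L.set (x := 37) (by omega) t
    refine Term.eval_bin .times (Term.eval_and
      (L1.eval_active (v := t) (by omega) (by omega) (by omega) (by omega) (by omega) (by omega)
        (by omega) (by simpa using hx) (by simp) (by omega))
      (Term.eval_all (Term.eval_bin .plus (eval_var L1.s_eq) (b := 1) rfl) L1.s_succ_le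
        fun t' ht' => ?_)) (L1.eval_tv (eval_var (by simp)) (eval_var (by simpa using hh)) hh')
    replace ht' : t' < s + 1 := ht'
    have L2 := L1.set (x := 40) (by omega) t'
    have e1 : (tvT (.var 37) (.var 30)).eval ((σ.set 37 t).set 40 t') = c t :=
      L2.eval_tv (eval_var (by simp)) (eval_var (by simpa using hh)) hh'
    have e2 : (tvT (.var 40) (.var 30)).eval ((σ.set 37 t).set 40 t') = c t' :=
      L2.eval_tv (eval_var (by simp)) (eval_var (by simpa using hh)) hh'
    exact Term.eval_or (Term.eval_neg (L2.eval_active (v := t') (by omega) (by omega) (by omega)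
        (by omega) (by omega) (by omega) (by omega) (by simpa using hx) (by simp) (by omega)))
      (Term.eval_or (Term.eval_less e1 e2) (Term.eval_and (Term.eval_eq e1 e2)
        (Term.eval_le (eval_var (by simp)) (eval_var (by simp)))))

theorem states_le (L : Lev σ f s S U bnd) : (s + 1) * ∏ k, fr n k ≤ σ.var 4 := by
  refine le_trans ?_ L.range
  rw [mul_comm]
  exact Nat.mul_le_mul_left _ L.s_lt

theorem letters_le (L : Lev σ f s S U bnd) : S * ∏ k, fr n k ≤ σ.var 4 := by
  refine le_trans ?_ L.range
  rw [mul_comm]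
  exact Nat.mul_le_mul_left _ L.S_le

theorem eval_step (L : Lev σ f s S U bnd) (hx : σ.var 34 = x) (hy : σ.var 35 = y)
    (hy' : y < (s + 1) * ∏ k, fr n k) (hh : σ.var 30 = h) (hh' : h < ∏ k, fr n k) :
    stepT.eval σ = ind (First f s y) * step f s S bnd U h x (str f s y) := by
  rw [stepT, Term.eval_bin .plus (Term.eval_sum
    (Term.eval_bin .times (eval_var L.S_eq) (eval_var L.K_eq)) L.letters_le
    (F := fun e => ind ((∀ j < e, letter f j ≠ letter f e) ∧ un (fr n) h +ᵥ letter f e = letter f e ∧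
      Allowed (Pos (fr n)) (fun l : ℕ => seq f l) s (okSet f s (thr U bnd)) (str f s x) (letter f e) ∧
      ¬ Bulk (Pos (fr n)) (fun l : ℕ => seq f l) s (lvU f s U) (str f s x) (letter f e) ∧
      str f s y <:+ str f s x ++ [letter f e] ∧
      ∀ j < y, ¬ str f s j <:+ str f s x ++ [letter f e])) fun e he => ?_)
    (Term.eval_bin .times (Term.eval_eq (eval_var hy)
      (Term.eval_bin .times (eval_var L.s_eq) (eval_var L.K_eq))) (L.eval_bulkCount hx hh hh'))]
  · simp only [Op.eval, first_suffix_iff hy']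
    rw [sum_ind_first (S * ∏ k, fr n k) (letter f) fun a => un (fr n) h +ᵥ a = a ∧
      Allowed (Pos (fr n)) (fun l : ℕ => seq f l) s (okSet f s (thr U bnd)) (str f s x) a ∧
      ¬ Bulk (Pos (fr n)) (fun l : ℕ => seq f l) s (lvU f s U) (str f s x) a ∧
      longest (pats (Pos (fr n)) (fun l : ℕ => seq f l) s) (str f s x ++ [a]) = str f s y ∧
      First f s y]
    simp only [exists_letter_iff]
    have hnil : str f s y = [] ↔ s * ∏ k, fr n k ≤ y := by
      rw [← List.length_eq_zero_iff, length_str, Nat.sub_eq_zero_iff_le, Nat.le_div_iff_mul_le K_pos]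
    by_cases hF : First f s y
    · simp only [hF, and_true, ind_pos, one_mul]
      rw [step]
      congr 1
      rw [ind]
      -- The states from `s * K` on are those with the empty string, and the first of them is `s *
      -- K` itself.
      have : y = s * ∏ k, fr n k ↔ str f s y = [] := by
        rw [hnil]
        refine ⟨fun h => h.ge, fun h => ?_⟩
        by_contra hne
        refine hF (s * ∏ k, fr n k) (by omega) ?_
        rw [hnil.2 h, ← List.length_eq_zero_iff, length_str, Nat.mul_div_cancel _ K_pos,
          Nat.sub_self]
      simp only [this, ite_mul, one_mul, zero_mul]
    · have : y ≠ s * ∏ k, fr n k := by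
        rintro rfl
        refine hF fun j hj h => ?_
        have h1 := congrArg List.length h
        rw [length_str, length_str, Nat.mul_div_cancel _ K_pos, Nat.sub_self] at h1
        have := row_lt hj
        omega
      rw [ind_neg this, ind_neg hF]
      simp [hF]
  · replace he : e < S * ∏ k, fr n k := he
    have L1 := L.set (x := 36) (by omega) e
    have hM := L.states_le
    have hM' := L.letters_le
    have he1 : ((σ.set 36 e).var 36) = e := by simp
    have hx1 : ((σ.set 36 e).var 34) = x := by simpa using hx
    have hy1 : ((σ.set 36 e).var 35) = y := by simpa using hy
    refine Term.eval_and (Term.eval_all (eval_var he1) (by simp; omega) fun j hj => ?_)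
      (Term.eval_and ?_ (Term.eval_and
        (L1.eval_allowed (by omega) (by omega) (by omega) (by omega) (by omega) (by omega) (by omega)
          (by omega) (by omega) (by omega) (by omega) (by omega) hx1 he1 he)
        (Term.eval_and (Term.eval_neg (L1.eval_bulk (by omega) (by omega) (by omega) (by omega)
          (by omega) (by omega) (by omega) (by omega) (by omega) (by omega) hx1 he1 he))
          (Term.eval_and (L1.eval_suf (by omega) (by omega) (by omega) hy1 hx1 he1 he)
            (Term.eval_all (eval_var hy1) (by simp; omega) fun j hj => Term.eval_neg
              ((L1.set (x := 40) (by omega) j).eval_suf (y' := j) (i' := x) (e' := e) (by omega)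
                (by omega) (by omega) (by simp) (by simpa using hx) (by simp) he))))))
    · have L2 := L1.set (x := 40) (by omega) j
      rw [Term.eval_neg (Term.eval_eq (L2.eval_letter (e' := j) (by simp) (by omega))
        (L2.eval_letter (e' := e) (by simp) he))]
      exact ind_congr (not_congr enc_injective.eq_iff)
    · have h1 := Nat.mod_lt e (K_pos (n := n))
      rw [Term.eval_eq (L1.eval_let (L1.eval_row he1)
        (L1.eval_ad (eval_var (v := h) (by simpa using hh)) (L1.eval_rot he1) hh' h1)
        (row_lt he) (posIndex_lt _)) (L1.eval_letter he1 he), un_posIndex]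
      refine ind_congr (enc_injective.eq_iff.trans ?_)
      rw [letter, vadd_vadd]

end Lev

end level

end MDWord

/-! ### Counting walks and closed walks -/

namespace MDWord

open RAM

section terms

/-- The index of a multiple of the translation with the index `r`. -/
def muT (c r : Term) : Term :=
  .sum 33 (.var 21) (.bin .times
    (.mod (.bin .times c (.bin .quot r (.read 2 (.var 33)))) (.read 0 (.var 33)))
    (.read 2 (.var 33)))

def lastT : Term := .bin .quot (.var 22) (.var 24)

def frontT : Term := .mod (.var 22) (.var 24)

def sqT : Term := .bin .times (.var 32) (.var 32)

/-- The table of walks is linear: the number of walks of length `a` from `b` to `c` has the address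
`a D² + b D + c`, where `D` is the number of states. Hence each length only uses earlier cells. -/
def gridT (a b c : Term) : Term :=
  .bin .plus (.bin .times a sqT) (.bin .plus (.bin .times b (.var 32)) c)

/-- The number of walks. -/
def powT : Term :=
  .sel (.lt (.var 33) sqT) (.eq (.bin .quot (.var 33) (.var 32)) (.mod (.var 33) (.var 32)))
    (.sum 34 (.var 32) (.bin .times
      (.read 11 (.bin .plus (.bin .times (.mod (.bin .quot (.var 33) (.var 32)) (.var 32))
        (.var 32)) (.var 34)))
      (.read 12 (gridT (.bin .minus (.bin .quot (.var 33) sqT) (.lit 1)) (.var 34)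
        (.mod (.var 33) (.var 32))))))

/-- The number of closed walks. -/
def closedT : Term :=
  .sum 34 (.var 32) (.sum 35 (.var 32) (.bin .times
    (.and (canonT 34 36 37) (.and (canonT 35 36 37) (eqsT 34 35 (.var 31) 37)))
    (.read 12 (gridT (.var 28) (.var 34) (.var 35)))))

/-- The number of fixed words of the translation `22` above the bound. -/
def levelT : Term :=
  .bind 28 (.bin .plus (.first 33 35 (.var 23) (.ex 36 (.var 23)
    (.eq (.mod (.bin .times (.var 36) lastT) (.var 23))
      (.mod (.bin .plus (.var 35) (.lit 1)) (.var 23))))) (.lit 1)) <|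
  .bind 29 (.first 33 35 (.var 23) (.eq (.mod (.bin .times (.var 35) lastT) (.var 23))
      (.mod (.var 28) (.var 23)))) <|
  .bind 30 (muT (.bin .quot (.var 23) (.var 28)) frontT) <|
  .bind 31 (muT (.var 29) frontT) <|
  .bind 32 (.bin .times (.bin .plus (.var 25) (.lit 1)) (.var 24)) <|
  .tab 11 2 33 sqT (.bind 34 (.bin .quot (.var 33) (.var 32))
    (.bind 35 (.mod (.var 33) (.var 32)) stepT)) <|
  .tab 12 3 33 (.bin .times (.bin .plus (.var 28) (.lit 1)) sqT) powT closedT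

end terms

theorem ind_and {P Q : Prop} : ind (P ∧ Q) = ind P * ind Q := by
  unfold ind; split_ifs <;> simp_all

theorem card_word {d : ℕ} (m : Fin d → ℕ) (q : ℕ) : Fintype.card (Word m q) = q ^ ∏ k, m k := by
  simp [Fintype.card_pi]

theorem grid_div {D a b c : ℕ} (hb : b < D) (hc : c < D) :
    (a * (D * D) + (b * D + c)) / (D * D) = a := by
  have hD : 0 < D := by omega
  have : b * D + c < D * D := by nlinarith
  rw [mul_comm a, Nat.mul_add_div (Nat.mul_pos hD hD), Nat.div_eq_of_lt this, add_zero]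

theorem grid_div_mod {D a b c : ℕ} (hb : b < D) (hc : c < D) :
    (a * (D * D) + (b * D + c)) / D % D = b := by
  have hD : 0 < D := by omega
  rw [show a * (D * D) + (b * D + c) = D * (a * D + b) + c by ring, Nat.mul_add_div hD,
    Nat.div_eq_of_lt hc, add_zero, mul_comm, Nat.mul_add_mod, Nat.mod_eq_of_lt hb]

theorem grid_mod {D a b c : ℕ} (hc : c < D) : (a * (D * D) + (b * D + c)) % D = c := by
  rw [show a * (D * D) + (b * D + c) = D * (a * D + b) + c by ring, Nat.mul_add_mod,
    Nat.mod_eq_of_lt hc]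

section level

variable {d : ℕ} {n : Fin (d + 1) → ℕ} [∀ k, NeZero (n k)] {q : ℕ}
variable {f : Word n q} {s S bnd : ℕ} {U : Set (Word (fr n) q)} {σ τ : State}

variable (f s U bnd) in
/-- The number of walks that are labelled by fixed letters. -/
noncomputable def wk (h p : ℕ) (x y : List (Word (fr n) q)) : ℕ :=
  walks (pats (Pos (fr n)) (fun l : ℕ => seq f l) s) (fun x a => un (fr n) h +ᵥ a = a ∧
    Allowed (Pos (fr n)) (fun l : ℕ => seq f l) s (okSet f s (thr U bnd)) x a) p x y

theorem sum_pats [DecidableEq (List (Word (fr n) q))] (φ : List (Word (fr n) q) → ℕ) :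
    ∑ z ∈ (Finset.range ((s + 1) * ∏ k, fr n k)).image (str f s), φ z =
      ∑ x ∈ Finset.range ((s + 1) * ∏ k, fr n k), ind (First f s x) * φ (str f s x) :=
  sum_image_first _ _ _

theorem mem_image_str [DecidableEq (List (Word (fr n) q))] (z : List (Word (fr n) q)) :
    z ∈ (Finset.range ((s + 1) * ∏ k, fr n k)).image (str f s) ↔
      z ∈ pats (Pos (fr n)) (fun l : ℕ => seq f l) s := by
  rw [mem_pats_iff_str]
  simp

namespace Lev

/-- The case of `walks_succ` in which `Λ` consists of the orbits of the first `S` rows. A letter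
that meets the bound in the row `s` exactly is a translate of one of these rows by the field
`letters`. -/
theorem wk_succ (L : Lev σ f s S U bnd) (h p x : ℕ) (y : List (Word (fr n) q)) :
    wk f s bnd U h (p + 1) (str f s x) y = ∑ z ∈ Finset.range ((s + 1) * ∏ k, fr n k),
      ind (First f s z) * step f s S bnd U h x (str f s z) * wk f s bnd U h p (str f s z) y := by
  classical
  have h1 := walks_succ (G := Pos (fr n)) (w := fun l : ℕ => seq f l) (s := s)
    (Ok := okSet f s (thr U bnd)) (U := lvU f s U) (F := {a | un (fr n) h +ᵥ a = a})
    (Λ := {a | ∃ l < S, canon a = canon (seq f (l : ℕ))})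
    (fun t _ r a => (upOrb_lvU L.up t).vadd_mem r) (fun t _ a ha => by rw [okSet_eq]; exact .inl ha)
    (fun t ht a ha => by
      rw [okSet_eq] at ha
      refine ha.imp_right fun ha => ?_
      rcases ht.lt_or_eq with h | rfl
      · refine ⟨t, h.trans_le L.s_le, canon_eq_iff_card.2 ?_⟩
        rw [ha.1, lvU, if_pos h]
      · rw [lvU, lvB, if_neg (lt_irrefl _), if_neg (lt_irrefl _)] at ha
        exact L.letters a ha.1 ha.2)
    (fun r a => by simp only [Set.mem_ofPred_eq, canon_vadd])
    (fun t ht h => by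
      rw [lvU, if_pos ht] at h
      exact lt_strictTotal.irrefl _ h)
    ((Finset.range ((s + 1) * ∏ k, fr n k)).image (str f s)) mem_image_str p (str f s x) y
  refine h1.trans ((sum_pats (f := f) (s := s) _).trans (Finset.sum_congr rfl fun z _ => ?_))
  rw [mul_assoc]
  congr 2

/-- For each starting state exactly one first state has the translated string as its own. The
closing condition is stated with `-γ` on the side of the end, which is the translation that the
program computes. -/
theorem sum_closed (γ : Pos (fr n)) (h p r : ℕ) (hr : un (fr n) r = -γ)
    [DecidableEq (List (Word (fr n) q))] :
    ∑ x ∈ (Finset.range ((s + 1) * ∏ k, fr n k)).image (str f s),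
      wk f s bnd U h p x (x.map (γ +ᵥ ·)) =
    ∑ x ∈ Finset.range ((s + 1) * ∏ k, fr n k), ∑ y ∈ Finset.range ((s + 1) * ∏ k, fr n k),
      ind (First f s x ∧ First f s y ∧ str f s x = (str f s y).map (un (fr n) r +ᵥ ·)) *
        wk f s bnd U h p (str f s x) (str f s y) := by
  rw [sum_pats]
  refine Finset.sum_congr rfl fun x hx => ?_
  have hxp : str f s x ∈ pats (Pos (fr n)) (fun l : ℕ => seq f l) s := mem_pats_iff_str.2 ⟨x, Finset.mem_range.1 hx, rfl⟩
  by_cases hF : First f s x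
  · rw [ind_pos hF, one_mul]
    have h1 : ∀ y, ind (First f s x ∧ First f s y ∧
        str f s x = (str f s y).map (un (fr n) r +ᵥ ·)) *
        wk f s bnd U h p (str f s x) (str f s y) = ind (First f s y) *
        (ind (str f s x = (str f s y).map (un (fr n) r +ᵥ ·)) *
          wk f s bnd U h p (str f s x) (str f s y)) := fun y => by
      rw [ind_and, ind_and, ind_pos hF, one_mul, mul_assoc]
    simp only [h1]
    rw [← sum_pats (f := f) (s := s) fun z => ind (str f s x = z.map (un (fr n) r +ᵥ ·)) *
      wk f s bnd U h p (str f s x) z,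
      Finset.sum_eq_single_of_mem ((str f s x).map (γ +ᵥ ·)), hr, map_neg_vadd, ind_pos rfl,
      one_mul]
    · exact (mem_image_str _).2 ((map_mem_pats _ _).2 hxp)
    · intro z _ hz
      rw [ind_neg, zero_mul]
      intro h2
      refine hz ?_
      rw [h2, hr]
      have := map_neg_vadd (-γ) z
      rw [neg_neg] at this
      exact this.symm
  · rw [ind_neg hF, zero_mul, Finset.sum_eq_zero]
    intro y _
    rw [ind_neg (fun h => hF h.1), zero_mul]

theorem step_le (h x : ℕ) (z : List (Word (fr n) q)) :
    step f s S bnd U h x z ≤ 2 * q ^ ∏ k, fr n k := by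
  have h1 : ∀ A : Set (Word (fr n) q), A.ncard ≤ q ^ ∏ k, fr n k := fun A => by
    rw [← card_word, ← Nat.card_eq_fintype_card, ← Set.ncard_univ]
    exact Set.ncard_le_ncard (Set.subset_univ _) (Set.toFinite _)
  rw [step, two_mul]
  refine add_le_add (h1 _) ?_
  split_ifs
  exacts [h1 _, Nat.zero_le _]

/-- The additional data that are used in the count. -/
structure Ext (σ : State) (n : Fin (d + 1) → ℕ) (q : ℕ) : Prop where
  n_eq : σ.var 23 = n (Fin.last d)
  d_eq : σ.var 21 = d
  d_le : d ≤ σ.var 4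
  dims : ∀ j : Fin d, σ.arr 0 j = fr n j
  prods : ∀ j : Fin d, σ.arr 2 j = ∏ i ∈ Finset.Iio j, fr n i
  lt : ∏ k, n k < σ.var 4
  le : σ.var 4 ≤ σ.var 5
  cap : 2 * q ^ ∏ k, n k ≤ σ.var 5

theorem Ext.congr (X : Ext σ n q) (h : ∀ x ∈ [4, 5, 21, 23], τ.var x = σ.var x)
    (h' : ∀ a ∈ [0, 2], τ.arr a = σ.arr a) : Ext τ n q := by
  simp only [List.forall_mem_cons, List.not_mem_nil, false_imp_iff, implies_true, and_true] at h h'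
  obtain ⟨h1, h2, h3, h4⟩ := h
  obtain ⟨g1, g2⟩ := h'
  constructor
  all_goals simp only [h1, h2, h3, h4, g1, g2]
  exacts [X.n_eq, X.d_eq, X.d_le, X.dims, X.prods, X.lt, X.le, X.cap]

theorem Ext.set (X : Ext σ n q) {x : ℕ} (hx : 24 ≤ x) (v : ℕ) : Ext (σ.set x v) n q := by
  refine X.congr (fun y hy => ?_) fun a _ => rfl
  rw [State.set_var, if_neg]
  rintro rfl
  simp at hy
  omega

theorem Ext.eval_mu (X : Ext σ n q) {c r : Term} {c' r' : ℕ}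
    (hc : ∀ i, c.eval (σ.set 33 i) = c') (hr : ∀ i, r.eval (σ.set 33 i) = r') :
    (muT c r).eval σ = posIndex (c' • un (fr n) r') := by
  rw [posIndex_nsmul_un, muT, Term.eval_sum (eval_var X.d_eq) X.d_le (F := fun j =>
    if h : j < d then c' * (r' / (∏ i ∈ Finset.Iio (⟨j, h⟩ : Fin d), fr n i)) % fr n ⟨j, h⟩ *
      ∏ i ∈ Finset.Iio (⟨j, h⟩ : Fin d), fr n i else 0)]
  · rw [Finset.sum_range]
    exact Finset.sum_congr rfl fun j _ => by rw [dif_pos j.isLt]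
  · intro j hj
    have e1 : (Term.read 2 (.var 33)).eval (σ.set 33 j) =
        ∏ i ∈ Finset.Iio (⟨j, hj⟩ : Fin d), fr n i := by
      simp only [Term.eval, State.set_var, if_pos, State.set_arr]
      exact X.prods ⟨j, hj⟩
    have e2 : (Term.read 0 (.var 33)).eval (σ.set 33 j) = fr n ⟨j, hj⟩ := by
      simp only [Term.eval, State.set_var, if_pos, State.set_arr]
      exact X.dims ⟨j, hj⟩
    rw [dif_pos hj, Term.eval_bin .times (Term.eval_mod (Term.eval_bin .times (hc j)
      (Term.eval_bin .quot (hr j) e1)) e2) e1]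
    rfl

end Lev

end level

end MDWord

/-! ### The number of fixed words above a bound -/

namespace MDWord

open RAM

section level

variable {d : ℕ} {n : Fin (d + 1) → ℕ} [∀ k, NeZero (n k)] {q : ℕ}
variable {f : Word n q} {s S bnd : ℕ} {U : Set (Word (fr n) q)} {σ τ : State}

theorem wk_le (h p : ℕ) (x y : List (Word (fr n) q)) (hq : 0 < q) (hp : p ≤ n (Fin.last d)) :
    wk f s bnd U h p x y ≤ q ^ ∏ k, n k := by
  refine (walks_le _ _ _ _ _).trans ?_
  rw [card_word, ← pow_mul, Fin.prod_univ_castSucc]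
  exact Nat.pow_le_pow_right hq (Nat.mul_le_mul_left _ hp)

namespace Lev

variable {D h p : ℕ}

variable (f s U bnd) in
/-- The value of a cell of the table of the numbers of walks. -/
def PowCell (D h j v : ℕ) : Prop :=
  First f s (j % D) → (First f s (j / D % D) ∨ 1 ≤ j / (D * D)) →
    v = wk f s bnd U h (j / (D * D)) (str f s (j / D % D)) (str f s (j % D))

theorem eval_sq (hD : σ.var 32 = D) : sqT.eval σ = D * D :=
  Term.eval_bin .times (eval_var hD) (eval_var hD)

theorem eval_grid (hD : σ.var 32 = D) {a b c : Term} {a' b' c' : ℕ} (ha : a.eval σ = a')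
    (hb : b.eval σ = b') (hc : c.eval σ = c') :
    (gridT a b c).eval σ = a' * (D * D) + (b' * D + c') :=
  Term.eval_bin .plus (Term.eval_bin .times ha (eval_sq hD))
    (Term.eval_bin .plus (Term.eval_bin .times hb (eval_var hD)) hc)

theorem first_inj {x y : ℕ} (hx : First f s x) (hy : First f s y) (h : str f s x = str f s y) :
    x = y := by
  rcases lt_trichotomy x y with h' | h' | h'
  exacts [absurd h (hy x h'), h', absurd h.symm (hx y h')]

/-- For length `0` the numbers of the states are compared instead of their strings, which is right
only if both are first states. For positive length the start may be any state, because its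
transitions depend only on its string and lead to first states. -/
theorem eval_pow (L : Lev τ f s S U bnd) (hD : τ.var 32 = (s + 1) * ∏ k, fr n k) {j : ℕ}
    (hj : τ.var 33 = j)
    (hstep : ∀ i < ((s + 1) * ∏ k, fr n k) * ((s + 1) * ∏ k, fr n k), τ.arr 11 i =
      ind (First f s (i % ((s + 1) * ∏ k, fr n k))) *
        step f s S bnd U h (i / ((s + 1) * ∏ k, fr n k)) (str f s (i % ((s + 1) * ∏ k, fr n k))))
    (hpow : ∀ i < j, PowCell f s bnd U ((s + 1) * ∏ k, fr n k) h i (τ.arr 12 i)) :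
    PowCell f s bnd U ((s + 1) * ∏ k, fr n k) h j (powT.eval τ) := by
  intro F1 F2
  have hDM := L.states_le
  have hD0 : 0 < (s + 1) * ∏ k, fr n k := Nat.mul_pos (Nat.succ_pos _) K_pos
  generalize hDD : (s + 1) * ∏ k, fr n k = D at *
  have hx : j / D % D < D := Nat.mod_lt _ hD0
  have hy : j % D < D := Nat.mod_lt _ hD0
  have e1 : (Term.bin .quot (.var 33) (.var 32)).eval τ = j / D :=
    Term.eval_bin .quot (eval_var hj) (eval_var hD)
  have e2 : (Term.mod (.var 33) (.var 32)).eval τ = j % D :=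
    Term.eval_mod (eval_var hj) (eval_var hD)
  by_cases hlt : j < D * D
  · have hx1 : j / D < D := Nat.div_lt_of_lt_mul hlt
    have hz : j / (D * D) = 0 := Nat.div_eq_of_lt hlt
    rw [powT, Term.eval_sel (Term.eval_less (eval_var hj) (eval_sq hD)) (a := ind (j / D = j % D))
      (b := 0) (fun _ => Term.eval_eq e1 e2) (fun h => absurd hlt h), if_pos hlt, hz, wk, walks]
    rw [hz, Nat.mod_eq_of_lt hx1] at F2
    rw [Nat.mod_eq_of_lt hx1]
    have F2 := F2.resolve_right (by omega)
    by_cases h : j / D = j % D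
    · rw [ind_pos h, if_pos (by rw [h])]
    · rw [ind_neg h, if_neg fun h' => h (first_inj F2 F1 h')]
  · have hz : 1 ≤ j / (D * D) := (Nat.one_le_div_iff (Nat.mul_pos hD0 hD0)).2 (not_lt.1 hlt)
    obtain ⟨z, hz'⟩ : ∃ z, j / (D * D) = z + 1 := ⟨j / (D * D) - 1, by omega⟩
    rw [powT, Term.eval_sel (Term.eval_less (eval_var hj) (eval_sq hD)) (a := 0)
      (b := ∑ x ∈ Finset.range D, ind (First f s x) * step f s S bnd U h (j / D % D) (str f s x) *
        wk f s bnd U h z (str f s x) (str f s (j % D))) (fun h => absurd h hlt) fun _ => ?_,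
      if_neg hlt, hz', L.wk_succ, hDD]
    refine Term.eval_sum (eval_var hD) hDM fun x hx' => ?_
    have hD' : (τ.set 34 x).var 32 = D := by simpa using hD
    have hj' : (τ.set 34 x).var 33 = j := by simpa using hj
    have e1' : (Term.bin .quot (.var 33) (.var 32)).eval (τ.set 34 x) = j / D :=
      Term.eval_bin .quot (eval_var hj') (eval_var hD')
    have e2' : (Term.mod (.var 33) (.var 32)).eval (τ.set 34 x) = j % D :=
      Term.eval_mod (eval_var hj') (eval_var hD')
    have i1 : (Term.bin .plus (.bin .times (.mod (.bin .quot (.var 33) (.var 32)) (.var 32))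
        (.var 32)) (.var 34)).eval (τ.set 34 x) = j / D % D * D + x :=
      Term.eval_bin .plus (Term.eval_bin .times (Term.eval_mod e1' (eval_var hD')) (eval_var hD'))
        (eval_var (by simp))
    have i2 : (gridT (.bin .minus (.bin .quot (.var 33) sqT) (.lit 1)) (.var 34)
        (.mod (.var 33) (.var 32))).eval (τ.set 34 x) = z * (D * D) + (x * D + j % D) := by
      refine eval_grid hD' ?_ (eval_var (by simp)) e2'
      rw [Term.eval_bin .minus (Term.eval_bin .quot (eval_var hj') (eval_sq hD')) (b := 1) rfl]
      simp only [Op.eval]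
      omega
    rw [Term.eval_bin .times (a := τ.arr 11 (j / D % D * D + x))
      (b := τ.arr 12 (z * (D * D) + (x * D + j % D))) (by rw [Term.eval, i1]; rfl)
      (by rw [Term.eval, i2]; rfl)]
    have h1 := hstep (j / D % D * D + x) (by nlinarith)
    have h2 : (j / D % D * D + x) % D = x := by
      rw [mul_comm, Nat.mul_add_mod, Nat.mod_eq_of_lt hx']
    have h3 : (j / D % D * D + x) / D = j / D % D := by
      rw [mul_comm, Nat.mul_add_div hD0, Nat.div_eq_of_lt hx', add_zero]
    rw [h2, h3] at h1
    by_cases hF : First f s x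
    · have h4 := hpow (z * (D * D) + (x * D + j % D)) ?_
      · rw [PowCell, grid_div hx' hy, grid_div_mod hx' hy, grid_mod hy] at h4
        rw [h1, h4 F1 (.inl hF)]
        rfl
      · have h5 : (z + 1) * (D * D) ≤ j := hz' ▸ Nat.div_mul_le_self j (D * D)
        nlinarith
    · rw [h1, ind_neg hF]
      simp [Op.eval]

theorem eval_closed (L : Lev τ f s S U bnd) (hD : τ.var 32 = (s + 1) * ∏ k, fr n k)
    (hp : τ.var 28 = p) {r : ℕ} (hr : τ.var 31 = r) (hr' : r < ∏ k, fr n k)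
    (hp1 : 1 ≤ p)
    (hpow : ∀ i < (p + 1) * (((s + 1) * ∏ k, fr n k) * ((s + 1) * ∏ k, fr n k)),
      PowCell f s bnd U ((s + 1) * ∏ k, fr n k) h i (τ.arr 12 i)) :
    closedT.eval τ = ∑ x ∈ Finset.range ((s + 1) * ∏ k, fr n k),
      ∑ y ∈ Finset.range ((s + 1) * ∏ k, fr n k),
      ind (First f s x ∧ First f s y ∧ str f s x = (str f s y).map (un (fr n) r +ᵥ ·)) *
        wk f s bnd U h p (str f s x) (str f s y) := by
  have hDM := L.states_le
  refine Term.eval_sum (eval_var hD) hDM fun x hx => Term.eval_sum (eval_var (by simpa using hD))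
    (by simpa using hDM) fun y hy => ?_
  have L1 := (L.set (x := 34) (by omega) x).set (x := 35) (by omega) y
  have hx1 : ((τ.set 34 x).set 35 y).var 34 = x := by simp
  have hy1 : ((τ.set 34 x).set 35 y).var 35 = y := by simp
  have hD1 : ((τ.set 34 x).set 35 y).var 32 = (s + 1) * ∏ k, fr n k := by simpa using hD
  rw [Term.eval_bin .times (Term.eval_and (L1.eval_canon (z := 36) (l := 37) (by omega) (by omega)
      (by omega) (by omega) (by omega) hx1 hx)
    (Term.eval_and (L1.eval_canon (z := 36) (l := 37) (by omega) (by omega) (by omega) (by omega)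
      (by omega) hy1 hy)
    (L1.eval_eqs (by omega) (by omega) (by omega) hx1 hy1
      (fun i => eval_var (v := r) (by simpa using hr)) hr')))
    (b := τ.arr 12 (p * (((s + 1) * ∏ k, fr n k) * ((s + 1) * ∏ k, fr n k)) +
      (x * ((s + 1) * ∏ k, fr n k) + y)))
    (by rw [Term.eval, eval_grid hD1 (eval_var (v := p) (by simpa using hp)) (eval_var hx1)
          (eval_var hy1)]; rfl)]
  have h4 := hpow (p * (((s + 1) * ∏ k, fr n k) * ((s + 1) * ∏ k, fr n k)) +
      (x * ((s + 1) * ∏ k, fr n k) + y)) (by nlinarith)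
  rw [PowCell, grid_div hx hy, grid_div_mod hx hy, grid_mod hy] at h4
  change ind (First f s x ∧ First f s y ∧ _) * _ = _
  by_cases hF : First f s y
  · rw [h4 hF (.inr hp1)]
  · rw [ind_neg fun h => hF h.2.1, zero_mul, zero_mul]

/-- With `j` the last coordinate of `g`, the period is `p = gcd(n, j)` and `u * j ≡ p` modulo `n`.
Letters must be fixed by `(n / p) • front g`, with index `h'`, and walks close up to `u • -front g`,
whose negative has the index `r`. All intermediate values are shown to be below the cutoffs. -/
theorem eval_level (L : Lev σ f s S U bnd) (X : Ext σ n q) (hq : 0 < q) {g : ℕ}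
    (hg : σ.var 22 = g) (hg' : g < ∏ k, n k) :
    levelT.eval σ =
      {v | v ∈ next f ⟨s, L.s_lt⟩ (thr U bnd) ∧ un n g +ᵥ v = v}.ncard := by
  classical
  have hK := K_pos (n := n)
  have hn0 := NeZero.pos (n (Fin.last d))
  have hM := X.lt
  have hMc := X.le
  have hprod : ∏ k, n k = (∏ k, fr n k) * n (Fin.last d) := Fin.prod_univ_castSucc _
  have hnM : n (Fin.last d) ≤ ∏ k, n k := by
    rw [hprod]; exact Nat.le_mul_of_pos_left _ hK
  have hKM : ∏ k, fr n k ≤ ∏ k, n k := by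
    rw [hprod]; exact Nat.le_mul_of_pos_right _ hn0
  set j := g / ∏ k, fr n k with hj
  have hjn : j < n (Fin.last d) := Nat.div_lt_of_lt_mul (hprod ▸ hg')
  have hlast : (un n g (Fin.last d) : ℕ) = j := by
    rw [un_last, Nat.mod_eq_of_lt hjn]
  have hfront : front (un n g) = un (fr n) (g % ∏ k, fr n k) := by
    rw [front_un, un_mod]
  have ej : ∀ {τ : State}, τ.var 22 = g → τ.var 24 = ∏ k, fr n k → lastT.eval τ = j :=
    fun h1 h2 => Term.eval_bin .quot (eval_var h1) (eval_var h2)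
  have ef : ∀ {τ : State}, τ.var 22 = g → τ.var 24 = ∏ k, fr n k →
      frontT.eval τ = g % ∏ k, fr n k := fun h1 h2 => Term.eval_mod (eval_var h1) (eval_var h2)
  obtain ⟨p, hp1, hpn, hpn', hpj, hpu, hpmin⟩ := exists_period hn0 j
  have hu := Nat.find_spec hpu
  have humin := fun v (hv : v < Nat.find hpu) => Nat.find_min hpu hv
  set u := Nat.find hpu with hudef
  rw [levelT]
  refine Term.eval_bind (v := p) ?_ (by omega) ?_
  -- The search runs over `p - 1`, so that `0` is excluded as a period.
  · rw [Term.eval_bin .plus (Term.eval_first (v := p - 1)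
      (F := fun p' => ∃ u < n (Fin.last d), u * j % n (Fin.last d) = (p' + 1) % n (Fin.last d))
      (eval_var X.n_eq) (by omega) (by omega) (fun i hi j' hj' => ?_) (by omega)
      (by rw [Nat.sub_add_cancel hp1]; exact hpu) fun j' hj' h => ?_) (b := 1) rfl]
    · simp only [Op.eval]; omega
    · have X1 := (X.set (x := 33) (by omega) i).set (x := 35) (by omega) j'
      have L1 := (L.set (x := 33) (by omega) i).set (x := 35) (by omega) j'
      exact Term.eval_ex (eval_var X1.n_eq) (by simp; omega) fun u' _ => Term.eval_eq
        (Term.eval_mod (Term.eval_bin .times (eval_var (by simp))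
          (ej (by simpa using hg) (by simpa using L.K_eq))) (eval_var (by simpa using X.n_eq)))
        (Term.eval_mod (Term.eval_bin .plus (eval_var (v := j') (by simp)) (b := 1) rfl)
          (eval_var (by simpa using X.n_eq)))
    · have := hpmin (j' + 1) (by omega) h
      omega
  have L1 := L.set (x := 28) (by omega) p
  have X1 := X.set (x := 28) (by omega) p
  have g1 : (σ.set 28 p).var 22 = g := by simpa using hg
  have p1 : (σ.set 28 p).var 28 = p := by simp
  have hM1 : ∏ k, n k < (σ.set 28 p).var 4 := X1.lt
  have hMc1 := X1.le
  generalize σ.set 28 p = σ1 at *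
  refine Term.eval_bind (v := u) ?_ (by omega) ?_
  · refine Term.eval_first (F := fun u => u * j % n (Fin.last d) = p % n (Fin.last d))
      (eval_var X1.n_eq) (by omega) (by omega) (fun i hi u' hu' => ?_) hu.1 hu.2
      (fun u' hu' h => humin u' hu' ⟨hu'.trans hu.1, h⟩)
    exact Term.eval_eq
        (Term.eval_mod (Term.eval_bin .times (eval_var (by simp))
          (ej (by simpa using g1) (by simpa using L1.K_eq))) (eval_var (by simpa using X1.n_eq)))
        (Term.eval_mod (eval_var (by simpa using p1)) (eval_var (by simpa using X1.n_eq)))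
  have L2 := L1.set (x := 29) (by omega) u
  have X2 := X1.set (x := 29) (by omega) u
  have g2 : (σ1.set 29 u).var 22 = g := by simpa using g1
  have p2 : (σ1.set 29 u).var 28 = p := by simpa using p1
  have u2 : (σ1.set 29 u).var 29 = u := by simp
  have hM2 : ∏ k, n k < (σ1.set 29 u).var 4 := X2.lt
  have hMc2 := X2.le
  generalize σ1.set 29 u = σ2 at *
  have hmu : ∀ c : ℕ, posIndex (c • un (fr n) (g % ∏ k, fr n k)) < ∏ k, fr n k :=
    fun c => posIndex_lt _
  set h' := posIndex ((n (Fin.last d) / p) • un (fr n) (g % ∏ k, fr n k)) with hh'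
  have hh'K : h' < ∏ k, fr n k := hmu _
  refine Term.eval_bind (v := h') ?_ (by omega) ?_
  · exact X2.eval_mu (fun i => Term.eval_bin .quot (eval_var (by simpa using X2.n_eq))
      (eval_var (by simpa using p2))) (fun i => ef (by simpa using g2) (by simpa using L2.K_eq))
  have L3 := L2.set (x := 30) (by omega) h'
  have X3 := X2.set (x := 30) (by omega) h'
  have g3 : (σ2.set 30 h').var 22 = g := by simpa using g2
  have p3 : (σ2.set 30 h').var 28 = p := by simpa using p2
  have u3 : (σ2.set 30 h').var 29 = u := by simpa using u2
  have h3 : (σ2.set 30 h').var 30 = h' := by simp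
  have hM3 : ∏ k, n k < (σ2.set 30 h').var 4 := X3.lt
  have hMc3 := X3.le
  generalize σ2.set 30 h' = σ3 at *
  set r := posIndex (u • un (fr n) (g % ∏ k, fr n k)) with hr
  have hrK : r < ∏ k, fr n k := hmu _
  refine Term.eval_bind (v := r) ?_ (by omega) ?_
  · exact X3.eval_mu (fun i => eval_var (by simpa using u3))
      (fun i => ef (by simpa using g3) (by simpa using L3.K_eq))
  have L4 := L3.set (x := 31) (by omega) r
  have X4 := X3.set (x := 31) (by omega) r
  have p4 : (σ3.set 31 r).var 28 = p := by simpa using p3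
  have h4 : (σ3.set 31 r).var 30 = h' := by simpa using h3
  have r4 : (σ3.set 31 r).var 31 = r := by simp
  have hM4 : ∏ k, n k < (σ3.set 31 r).var 4 := X4.lt
  have hMc4 := X4.le
  generalize σ3.set 31 r = σ4 at *
  have hDN : (s + 1) * ∏ k, fr n k ≤ ∏ k, n k := by
    rw [hprod, mul_comm]; exact Nat.mul_le_mul_left _ L.s_lt
  refine Term.eval_bind (v := (s + 1) * ∏ k, fr n k) ?_ (by omega) ?_
  · exact Term.eval_bin .times (Term.eval_bin .plus (eval_var L4.s_eq) (b := 1) rfl)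
      (eval_var L4.K_eq)
  have L5 := L4.set (x := 32) (by omega) ((s + 1) * ∏ k, fr n k)
  have X5 := X4.set (x := 32) (by omega) ((s + 1) * ∏ k, fr n k)
  have p5 : (σ4.set 32 ((s + 1) * ∏ k, fr n k)).var 28 = p := by simpa using p4
  have h5 : (σ4.set 32 ((s + 1) * ∏ k, fr n k)).var 30 = h' := by simpa using h4
  have r5 : (σ4.set 32 ((s + 1) * ∏ k, fr n k)).var 31 = r := by simpa using r4
  have D5 : (σ4.set 32 ((s + 1) * ∏ k, fr n k)).var 32 = (s + 1) * ∏ k, fr n k := by simp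
  have hM5 : ∏ k, n k < (σ4.set 32 ((s + 1) * ∏ k, fr n k)).var 4 := X5.lt
  have hMc5 := X5.le
  have hcap5 := X5.cap
  generalize σ4.set 32 ((s + 1) * ∏ k, fr n k) = σ5 at *
  have hD0 : 0 < (s + 1) * ∏ k, fr n k := Nat.mul_pos (Nat.succ_pos _) K_pos
  have hsq : ((s + 1) * ∏ k, fr n k) * ((s + 1) * ∏ k, fr n k) ≤ σ5.var 4 ^ 2 := by
    rw [sq]; exact Nat.mul_le_mul (by omega) (by omega)
  refine Term.eval_tab (fun i v => v = ind (First f s (i % ((s + 1) * ∏ k, fr n k))) *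
        step f s S bnd U h' (i / ((s + 1) * ∏ k, fr n k)) (str f s (i % ((s + 1) * ∏ k, fr n k))))
    (eval_sq D5) hsq ?_ ?_
  · intro i hi τ hτ hτa _
    have L6 : Lev τ f s S U bnd := L5.congr (fun x hx => by
      rw [hτ, State.set_var, if_neg]; rintro rfl; simp at hx) fun a ha => hτa a (by
      rintro rfl; simp at ha)
    have D6 : τ.var 32 = (s + 1) * ∏ k, fr n k := by rw [hτ]; simpa using D5
    have i6 : τ.var 33 = i := by rw [hτ]; simp
    have h6 : τ.var 30 = h' := by rw [hτ]; simpa using h5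
    have c6 : τ.var 5 = σ5.var 5 := by rw [hτ]; simp
    have hx : i / ((s + 1) * ∏ k, fr n k) < (s + 1) * ∏ k, fr n k := Nat.div_lt_of_lt_mul hi
    have hy : i % ((s + 1) * ∏ k, fr n k) < (s + 1) * ∏ k, fr n k := Nat.mod_lt _ hD0
    have e : (Term.bind 34 (.bin .quot (.var 33) (.var 32))
        (.bind 35 (.mod (.var 33) (.var 32)) stepT)).eval τ =
        ind (First f s (i % ((s + 1) * ∏ k, fr n k))) * step f s S bnd U h'
          (i / ((s + 1) * ∏ k, fr n k)) (str f s (i % ((s + 1) * ∏ k, fr n k))) := by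
      refine Term.eval_bind (Term.eval_bin .quot (eval_var i6) (eval_var D6))
        (by simp only [Op.eval]; omega) (Term.eval_bind (Term.eval_mod
        (eval_var (v := i) (by simpa using i6)) (eval_var (by simpa using D6)))
        (by simp only [State.set_var]; norm_num; omega) ?_)
      exact ((L6.set (x := 34) (by omega) _).set (x := 35) (by omega) _).eval_step (by simp [Op.eval])
        (by simp) hy (by simpa using h6) hh'K
    rw [e]
    -- A transition number is at most `2 q ^ K`: at most `q ^ K` letters inspected singly and at
    -- most as many counted in bulk. This is the reason for the factor `2` in the cap.
    refine min_eq_left ?_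
    calc _ ≤ 1 * (2 * q ^ ∏ k, fr n k) := Nat.mul_le_mul
          (show ind _ ≤ 1 by unfold ind; split_ifs <;> simp) (step_le _ _ _)
      _ ≤ 2 * q ^ ∏ k, n k := by
          rw [one_mul]
          exact Nat.mul_le_mul_left _ (Nat.pow_le_pow_right hq hKM)
      _ ≤ _ := hcap5
  · intro τ hτ hτa hstep
    have L6 : Lev τ f s S U bnd := L5.congr (fun x hx => by rw [hτ]) fun a ha => hτa a (by
      rintro rfl; simp at ha)
    have D6 : τ.var 32 = (s + 1) * ∏ k, fr n k := by rw [hτ]; exact D5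
    refine Term.eval_tab (PowCell f s bnd U ((s + 1) * ∏ k, fr n k) h')
      (Term.eval_bin .times (Term.eval_bin .plus (eval_var (hτ ▸ p5)) (b := 1) rfl) (eval_sq D6))
      ?_ ?_ ?_
    · rw [hτ, pow_succ']
      exact Nat.mul_le_mul (by simp only [Op.eval]; omega) hsq
    · intro i hi τ' hτ' hτa' hpow
      have hcell := (L6.congr (τ := τ') (fun x hx => by
        rw [hτ', State.set_var, if_neg]; rintro rfl; simp at hx) fun a ha => hτa' a (by
        rintro rfl; simp at ha)).eval_pow (h := h') (j := i) (by rw [hτ']; simpa using D6)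
        (by rw [hτ']; simp) (fun j hj => by rw [hτa' 11 (by omega)]; exact hstep j hj) hpow
      intro F1 F2
      rw [hcell F1 F2]
      refine min_eq_left ((wk_le _ _ _ _ hq ?_).trans ?_)
      · have h1 : i / (((s + 1) * ∏ k, fr n k) * ((s + 1) * ∏ k, fr n k)) < p + 1 :=
          Nat.div_lt_of_lt_mul (by rw [mul_comm]; exact hi)
        omega
      · rw [hτ]
        omega
    · intro τ' hτ' hτa' hpow
      rw [(L6.congr (τ := τ') (fun x hx => by rw [hτ']) fun a ha => hτa' a (by
        rintro rfl; simp at ha)).eval_closed (p := p) (r := r) (h := h') (by rw [hτ', D6])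
        (by rw [hτ', hτ, p5]) (by rw [hτ', hτ, r5]) hrK hp1 hpow]
      rw [ncard_next_fixed (upPre_thr L.up bnd) hpn' (by rw [hlast]; exact hpj)
        (by rw [hlast]; exact hu.2) ((Finset.range ((s + 1) * ∏ k, fr n k)).image (str f s))
        mem_image_str]
      refine Eq.trans (sum_closed (f := f) (s := s) (bnd := bnd) (U := U) (u • -front (un n g)) h' p r
        ?_).symm ?_
      · rw [hr, un_posIndex, hfront, smul_neg, neg_neg]
      · refine Finset.sum_congr rfl fun x _ => ?_
        rw [wk, hh', un_posIndex, hfront]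

end Lev

end level

end MDWord

/-! ### Lifting a bound through all dimensions -/

namespace MDWord

open RAM

section terms

/-- The row `s` itself is among the letters inspected singly only in the dimension of a query about
a translation (variable `8` equal to `1`). Otherwise the bound for the index is `N`, which no index
reaches, so that only strictly larger necklaces qualify. -/
def setLevelT (e : Term) : Term :=
  .bind 23 (.read 0 (.var 21)) <|
  .bind 24 (.read 2 (.var 21)) <|
  .bind 25 (.read 5 (.var 21)) <|
  .bind 26 (.bin .plus (.var 25) (.bin .times (.eq (.var 21) (.var 7)) (.var 8))) <|
  .bind 27 (.sel (.and (.eq (.var 21) (.var 7)) (.eq (.var 8) (.lit 1))) (.var 9) (.var 3)) e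

/-- The tables of the numbers of fixed words above the bounds in all dimensions. -/
def withFocT (e : Term) : Term :=
  .tab 10 1 20 (.bin .times (.bin .plus (.var 0) (.lit 1)) (.var 3))
    (.bind 22 (.mod (.var 20) (.var 3)) <|
      .sel (.le (.bin .quot (.var 20) (.var 3)) (.var 7))
        (.read 8 (cellT (cellT (.var 7) (.read 5 (.var 7))) (.var 22)))
        (.bind 21 (.bin .minus (.bin .quot (.var 20) (.var 3)) (.lit 1)) (setLevelT levelT))) e

/-- The number of necklaces above the bound. -/
def countT : Term :=
  withFocT (.bin .quot (.sum 22 (.var 3) (.read 10 (cellT (.var 0) (.var 22)))) (.var 3))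

end terms

section dims

variable (nn : ℕ → ℕ)

/-- The sizes are a sequence on all of `ℕ`, of which each dimension uses an initial segment; so
slices of slices need no casts. -/
abbrev dim (k : ℕ) : Fin k → ℕ := fun j => nn j

def size (k : ℕ) : ℕ := ∏ j ∈ Finset.range k, nn j

variable {nn} {d q : ℕ}

theorem size_eq (k : ℕ) : ∏ j, dim nn k j = size nn k := (Finset.prod_range _).symm

theorem size_fr (k : ℕ) : ∏ j, fr (dim nn (k + 1)) j = size nn k := size_eq k

theorem size_succ (k : ℕ) : size nn (k + 1) = size nn k * nn k := Finset.prod_range_succ _ _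

theorem prod_Iio_dim {k : ℕ} (j : Fin k) : ∏ i ∈ Finset.Iio j, dim nn k i = size nn j := by
  have h : Finset.range (j : ℕ) = (Finset.Iio j).map Fin.valEmbedding := by
    rw [Fin.map_valEmbedding_Iio]
    ext; simp
  rw [size, h, Finset.prod_map]
  rfl

variable [∀ k, NeZero (nn k)]

theorem size_pos (k : ℕ) : 0 < size nn k := Finset.prod_pos fun _ _ => NeZero.pos _

theorem size_mono {k l : ℕ} (h : k ≤ l) : size nn k ≤ size nn l :=
  monotone_nat_of_le_succ (f := size nn)
    (fun k => by rw [size_succ]; exact Nat.le_mul_of_pos_right _ (NeZero.pos _)) h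

theorem posIndex_un_dim (k a b : ℕ) : posIndex (un (dim nn k) a + un (dim nn k) b) =
    ∑ j ∈ Finset.range k, (a / size nn j + b / size nn j) % nn j * size nn j := by
  rw [posIndex_un_add, Finset.sum_range]
  simp only [prod_Iio_dim]

/-- Indices of translations of a slice are those with vanishing higher coordinates. One table of
sums in the full dimension therefore serves all lower dimensions. -/
theorem posIndex_un_level {k : ℕ} (hk : k ≤ d) {a b : ℕ} (ha : a < size nn k) (hb : b < size nn k) :
    posIndex (un (dim nn d) a + un (dim nn d) b) =
      posIndex (un (dim nn k) a + un (dim nn k) b) := by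
  rw [posIndex_un_dim, posIndex_un_dim]
  obtain ⟨m, rfl⟩ := Nat.exists_eq_add_of_le hk
  rw [Finset.sum_range_add, add_eq_left]
  refine Finset.sum_eq_zero fun j _ => ?_
  have := size_mono (nn := nn) (show k ≤ k + j by omega)
  rw [Nat.div_eq_of_lt (by omega), Nat.div_eq_of_lt (by omega)]
  simp

/-- The sets of words above the bound in all dimensions. -/
def chain (F : ∀ k, Word (dim nn k) q) (s : ℕ → ℕ) (hs : ∀ k, s k < nn k) (bnd : ℕ → ℕ) (b : ℕ)
    (U : ∀ k, Set (Word (dim nn k) q)) : ∀ k, Set (Word (dim nn k) q)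
  | 0 => U 0
  | k + 1 => if k < b then U (k + 1) else
      next (n := dim nn (k + 1)) (F (k + 1)) ⟨s k, hs k⟩
        (thr (n := dim nn (k + 1)) (chain F s hs bnd b U k) (bnd k))

/-- The rows of a word. -/
abbrev row {k : ℕ} (w : Word (dim nn (k + 1)) q) (l : ℕ) : Word (dim nn k) q :=
  seq (n := dim nn (k + 1)) w l

/-- The sizes and the tables that depend only on them. -/
structure Base (nn : ℕ → ℕ) [∀ k, NeZero (nn k)] (d q : ℕ) (σ : State) : Prop where
  d_eq : σ.var 0 = d
  q_eq : σ.var 1 = q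
  N_eq : σ.var 3 = size nn d
  M_eq : σ.var 4 = size nn d * (d + 1)
  le : σ.var 4 ≤ σ.var 5
  cap : 2 * q ^ size nn d ≤ σ.var 5
  dims : ∀ j < d, σ.arr 0 j = nn j
  prods : ∀ j ≤ d, σ.arr 2 j = size nn j
  pows : ∀ j < size nn d, σ.arr 3 j = q ^ j
  adds : ∀ a < size nn d, ∀ b < size nn d, σ.arr 4 (a * size nn d + b) =
    posIndex (un (dim nn d) a + un (dim nn d) b)

theorem Base.congr {σ τ : State} (B : Base nn d q σ) (h : ∀ x ∈ [0, 1, 3, 4, 5], τ.var x = σ.var x)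
    (h' : ∀ a ∈ [0, 2, 3, 4], τ.arr a = σ.arr a) : Base nn d q τ := by
  simp only [List.forall_mem_cons, List.not_mem_nil, false_imp_iff, implies_true, and_true] at h h'
  obtain ⟨h1, h2, h3, h4, h5⟩ := h
  obtain ⟨g1, g2, g3, g4⟩ := h'
  constructor
  all_goals simp only [h1, h2, h3, h4, h5, g1, g2, g3, g4]
  exacts [B.d_eq, B.q_eq, B.N_eq, B.M_eq, B.le, B.cap, B.dims, B.prods, B.pows, B.adds]

/-- The state contains the data for counting the necklaces above a bound. -/
structure Query (F : ∀ k, Word (dim nn k) q) (s : ℕ → ℕ) (b ty bnd : ℕ)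
    (U : Set (Word (dim nn b) q)) (d : ℕ) (σ : State) : Prop where
  base : Base nn d q σ
  b_lt : b < d
  b_eq : σ.var 7 = b
  ty_eq : σ.var 8 = ty
  ty_le : ty ≤ 1
  bnd_eq : ty = 1 → σ.var 9 = bnd
  bnd_le : bnd ≤ size nn d
  digits : ∀ k < d, σ.arr 5 k = s k
  digits_lt : ∀ k, s k < nn k
  lets : ∀ k < d, b ≤ k → ∀ l < s k + (if k = b then ty else 0), ∀ r < size nn k,
    σ.arr 6 ((k * size nn d + l) * size nn d + r) =
      enc (un (dim nn k) r +ᵥ row (F (k + 1)) l)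
  taus : ∀ k < d, b ≤ k → ∀ l < s k + (if k = b then ty else 0),
    σ.arr 7 (k * size nn d + l) = trIndex (row (F (k + 1)) l)
  tabs : ∀ k < d, b ≤ k → ∀ l < s k + (if k = b then ty else 0), ∀ h < size nn k,
    σ.arr 8 ((k * size nn d + l) * size nn d + h) =
      {a | a ∈ above (row (F (k + 1)) l) ∧
        un (dim nn k) h +ᵥ a = a}.ncard
  root : ∀ h < size nn b, σ.arr 8 ((b * size nn d + s b) * size nn d + h) =
    {a | a ∈ U ∧ un (dim nn b) h +ᵥ a = a}.ncard
  up : UpOrb U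
  letters : ty = 1 → U = above (row (F (b + 1)) (s b))

namespace Query

variable {F : ∀ k, Word (dim nn k) q} {s : ℕ → ℕ} {b ty bnd : ℕ} {σ τ : State}
  {U : ∀ k, Set (Word (dim nn k) q)}

theorem congr {U : Set (Word (dim nn b) q)} (Q : Query F s b ty bnd U d σ)
    (h : ∀ x ∈ [0, 1, 3, 4, 5, 7, 8, 9], τ.var x = σ.var x)
    (h' : ∀ a ∈ [0, 2, 3, 4, 5, 6, 7, 8], τ.arr a = σ.arr a) : Query F s b ty bnd U d τ := by
  have B : Base nn d q τ := Q.base.congr (fun x hx => h x (by revert hx; simp; omega))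
    fun a ha => h' a (by revert ha; simp; omega)
  simp only [List.forall_mem_cons, List.not_mem_nil, false_imp_iff, implies_true, and_true] at h h'
  obtain ⟨-, -, -, -, -, h1, h2, h3⟩ := h
  obtain ⟨-, -, -, -, g1, g2, g3, g4⟩ := h'
  constructor
  all_goals try simp only [h1, h2, h3, g1, g2, g3, g4]
  exacts [B, Q.b_lt, Q.b_eq, Q.ty_eq, Q.ty_le, Q.bnd_eq, Q.bnd_le, Q.digits, Q.digits_lt, Q.lets,
    Q.taus, Q.tabs, Q.root, Q.up, Q.letters]

/-- The bounds for the translations. -/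
def bounds (nn : ℕ → ℕ) (d b ty bnd k : ℕ) : ℕ := if k = b ∧ ty = 1 then bnd else size nn d

/-- In the dimension of the query the chain starts anew with the given set; what it is below is
irrelevant. -/
theorem chain_self {hs : ∀ k, s k < nn k} {bnd : ℕ → ℕ} : chain F s hs bnd b U b = U b := by
  cases b with
  | zero => rfl
  | succ b => rw [chain, if_pos (Nat.lt_succ_self b)]

theorem chain_succ {hs : ∀ k, s k < nn k} {bnd : ℕ → ℕ} {k : ℕ} (h : b ≤ k) :
    chain F s hs bnd b U (k + 1) = next (n := dim nn (k + 1)) (F (k + 1)) ⟨s k, hs k⟩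
      (thr (n := dim nn (k + 1)) (chain F s hs bnd b U k) (bnd k)) := by
  rw [chain, if_neg (by omega)]

theorem upOrb_chain {hs : ∀ k, s k < nn k} {bnd : ℕ → ℕ} (hU : UpOrb (U b)) {k : ℕ} (h : b ≤ k) :
    UpOrb (chain F s hs bnd b U k) := by
  induction k, h using Nat.le_induction with
  | base => rw [chain_self]; exact hU
  | succ k hk ih =>
    rw [chain_succ hk]
    exact upOrb_next (n := dim nn (k + 1)) (upPre_thr (n := dim nn (k + 1)) ih _)

theorem eval_setLevel (Q : Query F s b ty bnd (U b) d σ) (hq : 0 < q) (h0 : 1 ≤ d) {k : ℕ}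
    (hk : k < d) (hbk : b ≤ k) (hk' : σ.var 21 = k) {g : ℕ} (hg : σ.var 22 = g)
    (hg' : g < size nn (k + 1))
    (hfoc : ∀ h < size nn k, σ.arr 10 (k * size nn d + h) =
      {a | a ∈ chain F s Q.digits_lt (bounds nn d b ty bnd) b U k ∧
        un (dim nn k) h +ᵥ a = a}.ncard) :
    (setLevelT levelT).eval σ =
      {a | a ∈ chain F s Q.digits_lt (bounds nn d b ty bnd) b U (k + 1) ∧
        un (dim nn (k + 1)) g +ᵥ a = a}.ncard := by
  have B := Q.base
  have hkd := size_mono (nn := nn) (show k + 1 ≤ d by omega)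
  have hnk : nn k ≤ size nn (k + 1) := by
    rw [size_succ]; exact Nat.le_mul_of_pos_left _ (size_pos _)
  have hkk : size nn k ≤ size nn (k + 1) := size_mono (by omega)
  have hM : size nn d < σ.var 4 := by
    rw [B.M_eq]
    have := size_pos (nn := nn) d
    nlinarith
  have hMc := B.le
  have hsk := Q.digits_lt k
  have hty := Q.ty_le
  have hbnd := Q.bnd_le
  rw [setLevelT]
  refine Term.eval_bind (v := nn k) ?_ (by omega) (Term.eval_bind (v := size nn k) ?_ (by simp; omega)
    (Term.eval_bind (v := s k) ?_ (by simp; omega)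
    (Term.eval_bind (v := s k + if k = b then ty else 0) ?_ (by simp; split_ifs <;> omega)
    (Term.eval_bind (v := bounds nn d b ty bnd k) ?_ ?_ ?_))))
  · rw [Term.eval, Lev.eval_var hk']; exact B.dims k hk
  · rw [Term.eval, Lev.eval_var (v := k) (by simpa using hk')]; exact B.prods k hk.le
  · rw [Term.eval, Lev.eval_var (v := k) (by simpa using hk')]; exact Q.digits k hk
  · rw [Term.eval_bin .plus (a := s k) (Lev.eval_var (by simp)) (Term.eval_bin .times
      (Term.eval_eq (Lev.eval_var (v := k) (by simpa using hk'))
        (Lev.eval_var (v := b) (by simpa using Q.b_eq)))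
      (Lev.eval_var (v := ty) (by simpa using Q.ty_eq)))]
    simp only [Op.eval, ind]
    split_ifs <;> simp
  · rw [Term.eval_sel (Term.eval_and
      (Term.eval_eq (Lev.eval_var (v := k) (by simpa using hk'))
        (Lev.eval_var (v := b) (by simpa using Q.b_eq)))
      (Term.eval_eq (Lev.eval_var (v := ty) (by simpa using Q.ty_eq)) (b := 1) rfl)) (a := bnd)
      (fun h => Lev.eval_var (by simpa using Q.bnd_eq h.2))
      (fun _ => Lev.eval_var (v := size nn d) (by simpa using B.N_eq)), bounds]
    split_ifs <;> rfl
  · rw [bounds]; simp; split_ifs <;> omega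
  have hfr := size_fr (nn := nn) k
  have hup := upOrb_chain (F := F) (hs := Q.digits_lt) (bnd := bounds nn d b ty bnd) Q.up hbk
  refine Eq.trans (Lev.eval_level (n := dim nn (k + 1)) (f := F (k + 1)) (s := s k)
    (S := s k + if k = b then ty else 0) (bnd := bounds nn d b ty bnd k)
    (U := chain F s Q.digits_lt (bounds nn d b ty bnd) b U k) ?_ ?_ hq (g := g)
    (by simpa using hg) (by rw [size_eq]; exact hg')) ?_
  · constructor
    · rw [hfr]; simp only [State.set_var]
      norm_num
      change size nn k * nn k ≤ _
      rw [← size_succ]; omega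
    · rw [hfr]; simp
    · simp
    · simp
    · simp
    · exact hsk
    · omega
    · change _ ≤ nn k
      split_ifs <;> omega
    · rw [hfr]
      intro l hl r hr
      simp [hk', B.N_eq]
      exact Q.lets k hk hbk l hl r hr
    · intro l hl
      simp [hk', B.N_eq]
      exact Q.taus k hk hbk l hl
    · rw [hfr]
      intro x hx y hy
      simp [B.N_eq]
      rw [B.adds x (by omega) y (by omega)]
      exact posIndex_un_level (by omega) hx hy
    · rw [hfr]
      intro l hl r hr
      simp [hk', B.N_eq]
      exact Q.tabs k hk hbk l hl r hr
    · rw [hfr]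
      intro h hh
      simp [hk', B.N_eq]
      exact hfoc h hh
    · exact hup
    · intro a ha hba
      rw [bounds] at hba
      split_ifs at hba with h
      · obtain ⟨rfl, rfl⟩ := h
        refine ⟨s k, by simp, canon_eq_iff_card.2 ?_⟩
        rw [chain_self, Q.letters rfl] at ha
        exact ha
      -- Here the bound is the full size `N`, and all indices are smaller.
      · exfalso
        have := trIndex_lt a
        rw [hfr] at this
        omega
  · constructor
    · simp; rfl
    · simpa using hk'
    · simp
      have := size_pos (nn := nn) d
      have : d + 1 ≤ σ.var 4 := by rw [B.M_eq]; nlinarith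
      omega
    · intro j
      simp
      exact B.dims j (j.isLt.trans hk)
    · intro j
      simp
      rw [B.prods j (j.isLt.le.trans hk.le)]
      exact (prod_Iio_dim (k := k) j).symm
    · rw [size_eq]; simp; omega
    · simpa using B.le
    · rw [size_eq]; simp
      exact (Nat.mul_le_mul_left 2 (Nat.pow_le_pow_right hq hkd)).trans B.cap
  · rw [chain_succ hbk]

theorem set {U : Set (Word (dim nn b) q)} (Q : Query F s b ty bnd U d σ) {x : ℕ} (hx : 10 ≤ x)
    (v : ℕ) : Query F s b ty bnd U d (σ.set x v) := by
  refine Q.congr (fun y hy => ?_) fun a _ => rfl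
  rw [State.set_var, if_neg]
  rintro rfl
  simp at hy
  omega

theorem ncard_le_cap (B : Base nn d q σ) (hq : 0 < q) {k : ℕ} (hk : k ≤ d)
    (U : Set (Word (dim nn k) q)) : U.ncard ≤ σ.var 5 := by
  refine (Set.ncard_le_card U).trans ?_
  rw [Nat.card_eq_fintype_card, card_word, size_eq]
  have := Nat.pow_le_pow_right hq (size_mono (nn := nn) hk)
  have := B.cap
  omega

/-- The array `10` holds the numbers of fixed words above the bounds. -/
def Foc (F : ∀ k, Word (dim nn k) q) (s : ℕ → ℕ) (hs : ∀ k, s k < nn k) (b ty bnd d : ℕ)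
    (U : ∀ k, Set (Word (dim nn k) q)) (σ : State) : Prop :=
  ∀ k, b ≤ k → k ≤ d → ∀ g < size nn k, σ.arr 10 (k * size nn d + g) =
    {a | a ∈ chain F s hs (bounds nn d b ty bnd) b U k ∧ un (dim nn k) g +ᵥ a = a}.ncard

/-- The cell `k * N + g` belongs to the dimension `k`, so the cells of one dimension are filled
after those of the previous one, as required by the recursion. In the dimension `b` of the query
they are copied from the root; smaller dimensions contain irrelevant values. -/
theorem eval_withFoc (Q : Query F s b ty bnd (U b) d σ) (hq : 0 < q) {e : Term} {w : ℕ}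
    (hf : ∀ τ : State, τ.var = σ.var → (∀ a, a ≠ 10 → τ.arr a = σ.arr a) →
      Foc F s Q.digits_lt b ty bnd d U τ → e.eval τ = w) : (withFocT e).eval σ = w := by
  have B := Q.base
  have hN := size_pos (nn := nn) d
  refine Term.eval_tab (m := (d + 1) * size nn d) (fun j v => ∀ k g, j = k * size nn d + g → b ≤ k →
    g < size nn k → v = {a | a ∈ chain F s Q.digits_lt (bounds nn d b ty bnd) b U k ∧
      un (dim nn k) g +ᵥ a = a}.ncard) ?_ ?_ ?_ ?_
  · exact Term.eval_bin .times (Term.eval_bin .plus (Lev.eval_var B.d_eq) rfl) (Lev.eval_var B.N_eq)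
  · rw [B.M_eq, pow_one, mul_comm]
  · intro i hi τ hτ hτ' ih k g hig hbk hg
    have hkd : k ≤ d := by
      by_contra h
      have := Nat.mul_le_mul_right (size nn d) (show d + 1 ≤ k by omega)
      omega
    have hgd := hg.trans_le (size_mono (nn := nn) hkd)
    have hi1 : i % size nn d = g := by
      rw [hig, mul_comm, Nat.mul_add_mod, Nat.mod_eq_of_lt hgd]
    have hi2 : i / size nn d = k := by
      rw [hig, mul_comm, Nat.mul_add_div hN, Nat.div_eq_of_lt hgd, add_zero]
    have Qτ : Query F s b ty bnd (U b) d τ := (Q.set (x := 20) (by omega) i).congr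
      (fun x _ => by rw [hτ]) (fun a ha => hτ' a (by rintro rfl; simp at ha))
    have h20 : τ.var 20 = i := by rw [hτ]; simp
    have h5 : τ.var 5 = σ.var 5 := by rw [hτ]; simp
    suffices H : Term.eval _ τ = {a | a ∈ chain F s Q.digits_lt (bounds nn d b ty bnd) b U k ∧
        un (dim nn k) g +ᵥ a = a}.ncard by
      rw [H, min_eq_left (ncard_le_cap B hq hkd _)]
    refine Term.eval_bind (v := g) (Term.eval_mod (Lev.eval_var h20)
      (Lev.eval_var Qτ.base.N_eq) |>.trans hi1) ?_ ?_
    · have := B.le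
      rw [B.M_eq] at this
      rw [h5]
      nlinarith
    have Qg := Qτ.set (x := 22) (by omega) g
    have h20' : (τ.set 22 g).var 20 = i := by simpa using h20
    have hk' : (Term.bin .quot (.var 20) (.var 3)).eval (τ.set 22 g) = k :=
      (Term.eval_bin .quot (Lev.eval_var h20') (Lev.eval_var Qg.base.N_eq)).trans hi2
    rw [Term.eval_sel (Term.eval_le hk' (Lev.eval_var Qg.b_eq))
      (a := {a | a ∈ chain F s Q.digits_lt (bounds nn d b ty bnd) b U k ∧
        un (dim nn k) g +ᵥ a = a}.ncard)
      (b := {a | a ∈ chain F s Q.digits_lt (bounds nn d b ty bnd) b U k ∧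
        un (dim nn k) g +ᵥ a = a}.ncard), ite_self]
    · intro hkb
      obtain rfl : k = b := by omega
      rw [chain_self, ← Q.root g hg, ← hτ' 8 (by omega)]
      have h := Qg.digits k Q.b_lt
      rw [Term.eval, Lev.eval_cell (Lev.eval_cell (Lev.eval_var Qg.b_eq)
        (b' := s k) (by rw [Term.eval, Lev.eval_var Qg.b_eq, h])) (Lev.eval_var (v := g) (by simp)),
        Qg.base.N_eq]
      rfl
    · intro hkb
      obtain ⟨k, rfl⟩ : ∃ k', k = k' + 1 := ⟨k - 1, by omega⟩
      refine Term.eval_bind (v := k) (Term.eval_bin .minus hk' (b := 1) rfl) ?_ ?_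
      · have := B.le
        rw [B.M_eq] at this
        simp only [State.set_var]
        norm_num
        rw [h5]
        nlinarith
      refine eval_setLevel (Qg.set (x := 21) (by omega) k) hq (by omega) (by omega) (by omega)
        (by simp) (by simp) hg fun h hh => ?_
      have hdN := hh.trans_le (size_mono (nn := nn) (show k ≤ d by omega))
      exact ih (k * size nn d + h) (by rw [hig]; nlinarith) k h rfl (by omega) hh
  · intro τ hτ hτ' h
    refine hf τ hτ hτ' fun k hbk hkd g hg => h _ ?_ k g rfl hbk hg
    have := size_mono (nn := nn) hkd
    nlinarith

theorem eval_count (Q : Query F s b ty bnd (U b) d σ) (hq : 0 < q) :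
    countT.eval σ = {y : Necklace (dim nn d) q |
      y.canon ∈ chain F s Q.digits_lt (bounds nn d b ty bnd) b U d}.ncard := by
  have B := Q.base
  have hN := size_pos (nn := nn) d
  refine Q.eval_withFoc hq fun τ hτ _ hfoc => ?_
  have h3 : τ.var 3 = size nn d := by rw [hτ]; exact B.N_eq
  have h0 : τ.var 0 = d := by rw [hτ]; exact B.d_eq
  have h4 : τ.var 4 = size nn d * (d + 1) := by rw [hτ]; exact B.M_eq
  have hup := upOrb_chain (F := F) (hs := Q.digits_lt) (bnd := bounds nn d b ty bnd) Q.up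
    Q.b_lt.le
  have hsum := sum_card_fixed hup
  rw [sum_pos_eq, size_eq] at hsum
  rw [Term.eval_bin .quot (Term.eval_sum (Lev.eval_var h3) (by rw [h4]; nlinarith)
    (F := fun g => {a | a ∈ chain F s Q.digits_lt (bounds nn d b ty bnd) b U d ∧
        un (dim nn d) g +ᵥ a = a}.ncard) fun g hg => ?_) (Lev.eval_var h3), hsum]
  · exact Nat.mul_div_cancel _ hN
  · rw [← hfoc d Q.b_lt.le le_rfl g hg, Term.eval,
      Lev.eval_cell (Lev.eval_var (v := d) (by simpa using h0)) (Lev.eval_var (v := g) (by simp))]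
    simp [h3]

end Query

end dims

end MDWord

/-! ### What the lifted bounds say about the wanted word -/

namespace MDWord

open RAM

theorem next_congr {d q : ℕ} {n : Fin (d + 1) → ℕ} {f f' : Word n q} {s : Fin (n (Fin.last d))}
    {Θ : Set (Word (fr n) q)} (h : ∀ l < s, slice f l = slice f' l) : next f s Θ = next f' s Θ := by
  have key : ∀ v, Gt f s Θ v ↔ Gt f' s Θ v := fun v => exists_congr fun t =>
    and_congr_right fun ht => and_congr
      (forall₂_congr fun l hl => by rw [h l (hl.trans_le ht)])
      (or_congr_right (and_congr_right fun ht => by rw [h t ht]))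
  ext v
  exact key _

theorem thr_of_le {d q : ℕ} {n : Fin (d + 1) → ℕ} [∀ k, NeZero (n k)] {U : Set (Word (fr n) q)}
    {b : ℕ} (h : ∏ k, fr n k ≤ b) : thr U b = U := by
  ext a
  have := trIndex_lt a
  exact ⟨fun h => h.resolve_right fun h => by omega, .inl⟩

theorem mem_thr_above {d q : ℕ} {n : Fin (d + 1) → ℕ} [∀ k, NeZero (n k)] {a c : Word (fr n) q}
    {b : ℕ} : a ∈ thr (above c) b ↔ lt (canon c) (canon a) ∨ canon a = canon c ∧ b ≤ trIndex a := by
  rw [canon_eq_iff_card]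
  rfl

theorem trIndex_canon {d q : ℕ} {n : Fin d → ℕ} [∀ k, NeZero (n k)] (u : Word n q) :
    trIndex (canon u) = 0 := by
  have := trIndex_le (u := canon u) (g := 0) (by rw [zero_vadd, canon_canon])
  rw [← un_zero, posIndex_un, Nat.zero_mod] at this
  omega

theorem above_canon {d q : ℕ} {n : Fin d → ℕ} [∀ k, NeZero (n k)] (u : Word n q) :
    above (canon u) = above u := by rw [above, above, canon_canon]

variable {nn : ℕ → ℕ} [∀ k, NeZero (nn k)] {d q : ℕ} {F G : ∀ k, Word (dim nn k) q} {s : ℕ → ℕ}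
  {hs : ∀ k, s k < nn k} {b k bnd : ℕ} {B : ℕ → ℕ} {U : ∀ k, Set (Word (dim nn k) q)}

theorem slice_eq_row {f : Word (dim nn (k + 1)) q} {l : ℕ} (hl : l < nn k) :
    slice (n := dim nn (k + 1)) f ⟨l, hl⟩ = row f l :=
  (seq_natCast (n := dim nn (k + 1)) f hl).symm

/-- Only the rows before the current ones enter the bound. So the program, which knows no others,
computes the bound that belongs to the unknown words `F`. -/
theorem chain_congr (h : ∀ k, b ≤ k → ∀ l < s k, row (F (k + 1)) l = row (G (k + 1)) l)
    (hk : b ≤ k) : chain F s hs B b U k = chain G s hs B b U k := by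
  induction k, hk using Nat.le_induction with
  | base => rw [Query.chain_self, Query.chain_self]
  | succ k hk ih =>
    rw [Query.chain_succ hk, Query.chain_succ hk, ih]
    refine next_congr (n := dim nn (k + 1)) fun l hl => ?_
    have := h k hk l hl
    rwa [← slice_eq_row l.2, ← slice_eq_row l.2] at this

theorem exists_row_eq (f : Word (dim nn (k + 1)) q) {s : ℕ} (hs : s < nn k)
    (c : Word (dim nn k) q) :
    ∃ f' : Word (dim nn (k + 1)) q, row f' s = c ∧ ∀ l < nn k, l ≠ s → row f' l = row f l := by
  obtain ⟨f', h⟩ := exists_seq_eq (n := dim nn (k + 1))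
    (fun i => if i % nn k = s then c else seq (n := dim nn (k + 1)) f i) fun i => by
      rw [seq_add]
      change (if (i + nn k) % (nn k : ℤ) = s then c else _) = _
      rw [Int.add_emod_right]
  refine ⟨f', ?_, fun l hl hls => ?_⟩
  · rw [row, h]
    have : ((s : ℤ) % nn k) = s := by exact_mod_cast Nat.mod_eq_of_lt hs
    simp only [this, if_true]
  · rw [row, h]
    have : ((l : ℤ) % nn k) = l := by exact_mod_cast Nat.mod_eq_of_lt hl
    simp only [this]
    rw [if_neg (by exact_mod_cast hls)]

/-- From the dimension `k` on, the words are the canonical representations of the rows of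
the words in the next dimension. -/
structure Foci (F : ∀ k, Word (dim nn k) q) (s : ℕ → ℕ) (d : ℕ) (w : Word (dim nn d) q) (k : ℕ) :
    Prop where
  top : F d = w
  step : ∀ j, k ≤ j → j < d → F j = canon (row (F (j + 1)) (s j))

/-- Going down from the full word, each focus is defined as the canonical representation of the
current row of the previous one. -/
theorem exists_foci (hq : 0 < q) (s : ℕ → ℕ) (w : Word (dim nn d) q) :
    ∃ F : ∀ k, Word (dim nn k) q, Foci F s d w 0 := by
  induction d with
  | zero =>
    exact ⟨Function.update (fun k _ => ⟨0, hq⟩) 0 w, by simp, fun j _ hj => absurd hj (by omega)⟩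
  | succ d ih =>
    obtain ⟨F, hF⟩ := ih (canon (row w (s d)))
    refine ⟨Function.update F (d + 1) w, by simp, fun j _ hj => ?_⟩
    rw [Function.update_of_ne (by omega)]
    rcases Nat.lt_succ_iff_lt_or_eq.1 hj with hj | rfl
    · rw [Function.update_of_ne (by omega), hF.step j (by omega) hj]
    · rw [Function.update_self, hF.top]

namespace Foci

variable {w : Word (dim nn d) q}

theorem canon_eq (h : Foci F s d w k) (hw : canon w = w) {j : ℕ} (hj : k ≤ j) (hjd : j ≤ d) :
    canon (F j) = F j := by
  rcases hjd.eq_or_lt with rfl | hjd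
  · rw [h.top, hw]
  · rw [h.step j hj hjd, canon_canon]

theorem mono (h : Foci F s d w k) {k' : ℕ} (hk : k ≤ k') {s' : ℕ → ℕ}
    (hs : ∀ j, k' ≤ j → s' j = s j) : Foci F s' d w k' :=
  ⟨h.top, fun j hj hjd => by rw [hs j hj]; exact h.step j (hk.trans hj) hjd⟩

/-- When a row is completed, the words in lower dimensions refer to the next row and have to be
chosen anew. -/
theorem extend (h : Foci F s d w k) (hq : 0 < q) (hk : k ≤ d) :
    ∃ G, Foci G s d w 0 ∧ ∀ j, k ≤ j → G j = F j := by
  obtain ⟨G, hG⟩ := exists_foci hq s (F k)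
  refine ⟨fun j => if j ≤ k then G j else F j, ⟨?_, fun j _ hjd => ?_⟩, fun j hj => ?_⟩
  · rcases hk.eq_or_lt with rfl | hk
    · simp [hG.top, h.top]
    · simp [hk, h.top]
  · rcases lt_trichotomy j k with hj | rfl | hj
    · simp only [hj.le, Nat.succ_le_of_lt hj, if_true]
      exact hG.step j (by omega) hj
    · simp only [le_refl, if_true, if_neg (show ¬ j + 1 ≤ j by omega)]
      rw [hG.top, h.step j le_rfl hjd]
    · simp only [if_neg (show ¬ j ≤ k by omega), if_neg (show ¬ j + 1 ≤ k by omega)]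
      exact h.step j hj.le hjd
  · rcases hj.eq_or_lt with rfl | hj
    · simp [hG.top]
    · simp [hj]

theorem mem_chain_succ (h : Foci F s d w b) (hw : canon w = w) (hb : b ≤ k) (hk : k < d) :
    F (k + 1) ∈ chain F s hs B b U (k + 1) ↔
      row (F (k + 1)) (s k) ∈ thr (n := dim nn (k + 1)) (chain F s hs B b U k) (B k) := by
  rw [Query.chain_succ hb, self_mem_next_iff (h.canon_eq hw (by omega) (by omega)),
    slice_eq_row (hs k)]

/-- A focus is canonical, so it lies in the next set of the chain exactly if its current row passes
the threshold. With the bound `N` for the index this only depends on the necklace of the row, that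
is, on the focus one dimension lower. -/
theorem mem_chain (h : Foci F s d w b) (hw : canon w = w) (hU : UpOrb (U b)) {l : ℕ} (hb : b ≤ l)
    (hk : l ≤ k) (hkd : k ≤ d) (hB : ∀ j, l ≤ j → j < k → B j = size nn d) :
    F k ∈ chain F s hs B b U k ↔ F l ∈ chain F s hs B b U l := by
  induction k, hk using Nat.le_induction with
  | base => rfl
  | succ k hk ih =>
    have hup := Query.upOrb_chain (F := F) (hs := hs) (bnd := B) hU (hb.trans hk)
    rw [← ih (by omega) fun j hj hjk => hB j hj (by omega),
      h.mem_chain_succ hw (hb.trans hk) (by omega), hB k hk (by omega),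
      thr_of_le (by rw [size_fr]; exact size_mono (by omega)), h.step k (hb.trans hk) (by omega)]
    exact hup.canon_mem.symm

theorem mem_chain_zero (h : Foci F s d w 0) (hw : canon w = w) (hU : UpOrb (U 0)) :
    w ∈ chain F s hs (Query.bounds nn d 0 0 bnd) 0 U d ↔ F 0 ∈ U 0 := by
  have := h.mem_chain (U := U) (hs := hs) (B := Query.bounds nn d 0 0 bnd) hw hU le_rfl
    (Nat.zero_le _) le_rfl fun j _ _ => if_neg (by simp)
  rwa [h.top] at this

/-- If the root is the set above the current row, then this row is not in it, so it passes the
threshold only through its index. A count thus tests the index of the unknown translation. -/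
theorem mem_chain_above (h : Foci F s d w b) (hw : canon w = w) (hb : b < d)
    (hU : U b = above (row (F (b + 1)) (s b))) :
    w ∈ chain F s hs (Query.bounds nn d b 1 bnd) b U d ↔
      bnd ≤ trIndex (row (F (b + 1)) (s b)) := by
  have := h.mem_chain (U := U) (hs := hs) (B := Query.bounds nn d b 1 bnd) hw
    (hU ▸ upOrb_above _) (by omega : b ≤ b + 1) hb le_rfl fun j hj _ => if_neg (by omega)
  rw [h.top] at this
  rw [this, h.mem_chain_succ hw le_rfl hb, Query.chain_self, hU,
    mem_thr_above]
  simp only [true_and, Query.bounds, if_true, and_self]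
  exact or_iff_right (lt_strictTotal.irrefl _)

/-- When the current row is the last one, a threshold just above its index describes the strict
order on complete words, so the same program computes the table for the completed word. -/
theorem chain_above (h : Foci F s d w b) (hw : canon w = w) (hb : b < d)
    (hU : U b = above (row (F (b + 1)) (s b))) (hn : s b + 1 = nn b) :
    chain F s hs (Query.bounds nn d b 1 (trIndex (row (F (b + 1)) (s b)) + 1)) b U (b + 1) =
      above (F (b + 1)) := by
  rw [above_eq_next (n := dim nn (b + 1)) (s := ⟨s b, hs b⟩)
    (h.canon_eq hw (by omega) (by omega)) hn, Query.chain_succ le_rfl, Query.chain_self, hU]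
  congr 1
  ext a
  rw [mem_thr_above, slice_eq_row (hs b)]
  simp only [Query.bounds, and_self, if_true]
  exact or_congr Iff.rfl ⟨fun h => ⟨h.1.symm, h.2⟩, fun h => ⟨h.1.symm, h.2⟩⟩

end Foci

theorem chain_univ (hU : U 0 = Set.univ) (hs0 : ∀ k, s k = 0) (k : ℕ) :
    chain F s hs B 0 U k = Set.univ := by
  induction k with
  | zero => exact hU
  | succ k ih =>
    rw [Query.chain_succ (Nat.zero_le _), ih, Set.eq_univ_iff_forall]
    intro v
    refine (mem_next_iff (n := dim nn (k + 1)) ?_).2 fun g => ?_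
    · exact fun u v _ _ => .inl trivial
    · exact ⟨_, le_rfl, fun l hl => absurd (Fin.lt_def.1 hl) (by simp [hs0]),
        .inl ⟨rfl, .inl trivial⟩⟩

end MDWord

/-! ### Reasoning about program loops -/

namespace RAM

theorem State.ext' {σ τ : State} (h : σ.var = τ.var) (h' : σ.arr = τ.arr) : σ = τ := by
  cases σ; cases τ; simp_all

theorem Prog.run_loop {x m : ℕ} {e : Term} {p : Prog} {σ : State} (he : e.eval σ = m)
    (hm : m ≤ σ.var 4) (I : ℕ → State → Prop) (h0 : I 0 σ)
    (step : ∀ i < m, ∀ τ, I i τ → I (i + 1) (p.run (τ.set x i))) :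
    ∃ τ, I m τ ∧ (Prog.loop x e p).run σ = τ.set x (σ.var x) := by
  have key : ∀ j ≤ m, I j (iter x p.run σ j) := by
    intro j hj
    induction j with
    | zero => exact h0
    | succ j ih => exact step j (by omega) _ (ih (by omega))
  refine ⟨_, key m le_rfl, ?_⟩
  rw [Prog.run, he, min_eq_left hm]

/-- The states differ only in the cells `A j`, `j < m`, of the array `a`, which have
the values `V j`. -/
structure Filled (a m : ℕ) (A V : ℕ → ℕ) (σ σ' : State) : Prop where
  var : σ'.var = σ.var
  arr : ∀ b, b ≠ a → σ'.arr b = σ.arr b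
  cell : ∀ j < m, σ'.arr a (A j) = V j
  other : ∀ c, (∀ j < m, A j ≠ c) → σ'.arr a c = σ.arr a c

/-- The counter `x` changes during the loop, so the states are compared after it has been reset to
its old value. The addresses must be distinct, lest a later round destroy an earlier cell. -/
theorem Prog.run_fill {x a m : ℕ} {e i v : Term} {σ : State} {A V : ℕ → ℕ} (he : e.eval σ = m)
    (hm : m ≤ σ.var 4) (hx : x ≠ 5) (hA : ∀ j < m, ∀ j' < j, A j' ≠ A j)
    (step : ∀ j < m, ∀ τ : State, τ.var = (σ.set x j).var → Filled a j A V σ (τ.set x (σ.var x)) →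
      i.eval τ = A j ∧ v.eval τ = V j ∧ V j ≤ σ.var 5) :
    Filled a m A V σ ((Prog.loop x e (.wr a i v)).run σ) := by
  obtain ⟨τ, hτ, h⟩ := Prog.run_loop (x := x) (p := .wr a i v) he hm
    (fun j τ => Filled a j A V σ (τ.set x (σ.var x)))
    ⟨by funext y; simp +contextual [State.set_var], fun _ _ => rfl, fun j hj => by omega,
      fun _ _ => rfl⟩
    fun j hj τ hτ => by
      have hv : (τ.set x j).var = (σ.set x j).var := by
        funext y
        have := congrFun hτ.var y
        simp only [State.set_var] at this ⊢
        split_ifs at this ⊢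
        exacts [rfl, this]
      have hF : Filled a j A V σ ((τ.set x j).set x (σ.var x)) :=
        ⟨by rw [← hτ.var]; funext y; simp only [State.set_var]; split_ifs <;> rfl,
          hτ.arr, hτ.cell, hτ.other⟩
      obtain ⟨h1, h2, h3⟩ := step j hj (τ.set x j) hv hF
      have h5 : (τ.set x j).var 5 = σ.var 5 := by rw [hv]; simp [hx.symm]
      rw [Prog.run, h1, h2, h5, min_eq_left h3]
      refine ⟨?_, fun b hb => ?_, fun l hl => ?_, fun c hc => ?_⟩
      · exact Eq.trans rfl hF.var
      · simp only [State.set_arr, State.put_arr, if_neg hb]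
        exact hτ.arr b hb
      · simp only [State.set_arr, State.put_arr, if_true, Function.update_apply]
        rcases Nat.lt_succ_iff_lt_or_eq.1 hl with hl | rfl
        · rw [if_neg (hA j hj l hl)]
          exact hτ.cell l hl
        · rw [if_pos rfl]
      · simp only [State.set_arr, State.put_arr, if_true, Function.update_apply,
          if_neg (hc j (by omega)).symm]
        exact hτ.other c fun l hl => hc l (by omega)
  rw [h]
  exact hτ

end RAM

/-! ### The tables of known rows -/

namespace MDWord

open RAM

theorem cell_inj {N a b c a' b' c' : ℕ} (hb : b < N) (hc : c < N) (hb' : b' < N) (hc' : c' < N)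
    (h : (a * N + b) * N + c = (a' * N + b') * N + c') : a = a' ∧ b = b' ∧ c = c' := by
  have hN : 0 < N := by omega
  have key : ∀ x y c c' : ℕ, c < N → c' < N → x * N + c = y * N + c' → x = y ∧ c = c' := by
    intro x y c c' hc hc' h
    have h1 := congrArg (· / N) h
    have h2 := congrArg (· % N) h
    simp only [mul_comm _ N, Nat.mul_add_div hN, Nat.mul_add_mod, Nat.div_eq_of_lt hc,
      Nat.div_eq_of_lt hc', Nat.mod_eq_of_lt hc, Nat.mod_eq_of_lt hc'] at h1 h2
    exact ⟨h1, h2⟩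
  obtain ⟨h1, h2⟩ := key _ _ _ _ hc hc' h
  obtain ⟨h3, h4⟩ := key _ _ _ _ hb hb' h1
  exact ⟨h3, h4, h2⟩

theorem cell_inj₂ {N a b a' b' : ℕ} (hb : b < N) (hb' : b' < N)
    (h : a * N + b = a' * N + b') : a = a' ∧ b = b' := by
  have h' := cell_inj (N := N) (a := a) (b := b) (c := b) (a' := a') (b' := b') (c' := b) hb hb hb'
    hb (by rw [h])
  exact ⟨h'.1, h'.2.1⟩

variable {nn : ℕ → ℕ} [∀ k, NeZero (nn k)] {d q : ℕ} {F G : ∀ k, Word (dim nn k) q} {s s' : ℕ → ℕ}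
  {σ τ : State} {k : ℕ}

/-- The state contains the tables of the first rows of the words. -/
structure Tables (F : ∀ k, Word (dim nn k) q) (s : ℕ → ℕ) (d : ℕ) (σ : State) : Prop where
  base : Base nn d q σ
  lets : ∀ k < d, ∀ l < s k, ∀ r < size nn k,
    σ.arr 6 ((k * size nn d + l) * size nn d + r) = enc (un (dim nn k) r +ᵥ row (F (k + 1)) l)
  taus : ∀ k < d, ∀ l < s k, σ.arr 7 (k * size nn d + l) = trIndex (row (F (k + 1)) l)
  tabs : ∀ k < d, ∀ l < s k, ∀ h < size nn k, σ.arr 8 ((k * size nn d + l) * size nn d + h) =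
    {a | a ∈ above (row (F (k + 1)) l) ∧ un (dim nn k) h +ᵥ a = a}.ncard

theorem Tables.congr (T : Tables F s d σ) (h : ∀ x ∈ [0, 1, 3, 4, 5], τ.var x = σ.var x)
    (h' : ∀ a ∈ [0, 2, 3, 4, 6, 7, 8], τ.arr a = σ.arr a) : Tables F s d τ := by
  have B : Base nn d q τ := T.base.congr h fun a ha => h' a (by revert ha; simp; omega)
  simp only [List.forall_mem_cons, List.not_mem_nil, false_imp_iff, implies_true, and_true] at h'
  obtain ⟨-, -, -, -, g1, g2, g3⟩ := h'
  constructor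
  all_goals try simp only [g1, g2, g3]
  exacts [B, T.lets, T.taus, T.tabs]

theorem Tables.mono (T : Tables F s d σ) (h : ∀ k < d, s' k ≤ s k) : Tables F s' d σ :=
  ⟨T.base, fun k hk l hl => T.lets k hk l (hl.trans_le (h k hk)),
    fun k hk l hl => T.taus k hk l (hl.trans_le (h k hk)),
    fun k hk l hl => T.tabs k hk l (hl.trans_le (h k hk))⟩

theorem Tables.congr_row (T : Tables F s d σ)
    (h : ∀ k < d, ∀ l < s k, row (G (k + 1)) l = row (F (k + 1)) l) : Tables G s d σ := by
  refine ⟨T.base, fun k hk l hl => ?_, fun k hk l hl => ?_, fun k hk l hl => ?_⟩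
  all_goals rw [h k hk l hl]
  exacts [T.lets k hk l hl, T.taus k hk l hl, T.tabs k hk l hl]

instance : Subsingleton (Pos (dim nn 0)) := ⟨fun _ _ => funext fun k => k.elim0⟩

theorem vadd_dim_zero (g : Pos (dim nn 0)) (a : Word (dim nn 0) q) : g +ᵥ a = a := by
  rw [Subsingleton.elim g 0, zero_vadd]

theorem size_zero : size nn 0 = 1 := rfl

/-- A query about a symbol: in dimension `0` there is only the trivial translation, so the root is a
single number. -/
theorem Tables.query_zero (T : Tables F s d σ) (hd : 0 < d) (hs : ∀ k < d, σ.arr 5 k = s k)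
    (hs' : ∀ k, s k < nn k) (h7 : σ.var 7 = 0) (h8 : σ.var 8 = 0) {U : Set (Word (dim nn 0) q)}
    (hU : UpOrb U) (h : σ.arr 8 (s 0 * size nn d) = U.ncard) : Query F s 0 0 0 U d σ where
  base := T.base
  b_lt := hd
  b_eq := h7
  ty_eq := h8
  ty_le := by omega
  bnd_eq h := by omega
  bnd_le := by omega
  digits := hs
  digits_lt := hs'
  lets k hk _ l hl := T.lets k hk l (by simpa using hl)
  taus k hk _ l hl := T.taus k hk l (by simpa using hl)
  tabs k hk _ l hl := T.tabs k hk l (by simpa using hl)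
  root g hg := by
    obtain rfl : g = 0 := by rw [size_zero] at hg; omega
    simp only [vadd_dim_zero, and_true, Set.ofPred_mem_eq]
    simpa using h
  up := hU
  letters h := by omega

/-- The rows of the word in the dimension `k + 1` with the canonical representation of the last
one in place of this row. -/
theorem Tables.query_row (T : Tables F s d σ) (hk : k < d) (hs : ∀ k < d, σ.arr 5 k = s k)
    (hs' : ∀ k, s k < nn k) (h7 : σ.var 7 = k) (h8 : σ.var 8 = 1) {bnd : ℕ} (h9 : σ.var 9 = bnd)
    (hbnd : bnd ≤ size nn d) {f : Word (dim nn (k + 1)) q}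
    (hf : ∀ l < s k, row f l = row (F (k + 1)) l)
    (hlet : ∀ r < size nn k, σ.arr 6 ((k * size nn d + s k) * size nn d + r) =
      enc (un (dim nn k) r +ᵥ row f (s k)))
    (htau : σ.arr 7 (k * size nn d + s k) = trIndex (row f (s k)))
    (htab : ∀ h < size nn k, σ.arr 8 ((k * size nn d + s k) * size nn d + h) =
      {a | a ∈ above (row f (s k)) ∧ un (dim nn k) h +ᵥ a = a}.ncard) :
    Query (Function.update F (k + 1) f) s k 1 bnd (above (row f (s k))) d σ := by
  have key : ∀ j l, l < s j + (if j = k then 1 else 0) → j = k ∧ l = s k ∨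
      l < s j ∧ row (Function.update F (k + 1) f (j + 1)) l = row (F (j + 1)) l := by
    intro j l hl
    by_cases hj : j = k
    · subst hj
      rw [if_pos rfl] at hl
      rcases Nat.lt_succ_iff_lt_or_eq.1 hl with hl | rfl
      · exact .inr ⟨hl, by rw [Function.update_self, hf l hl]⟩
      · exact .inl ⟨rfl, rfl⟩
    · rw [if_neg hj] at hl
      exact .inr ⟨hl, by rw [Function.update_of_ne (by omega)]⟩
  constructor
  · exact T.base
  · exact hk
  · exact h7
  · exact h8
  · exact le_rfl
  · exact fun _ => h9
  · exact hbnd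
  · exact hs
  · exact hs'
  · intro j hj _ l hl r hr
    rcases key j l hl with ⟨rfl, rfl⟩ | ⟨h1, h2⟩
    · rw [Function.update_self, hlet r hr]
    · rw [h2, T.lets j hj l h1 r hr]
  · intro j hj _ l hl
    rcases key j l hl with ⟨rfl, rfl⟩ | ⟨h1, h2⟩
    · rw [Function.update_self, htau]
    · rw [h2, T.taus j hj l h1]
  · intro j hj _ l hl r hr
    rcases key j l hl with ⟨rfl, rfl⟩ | ⟨h1, h2⟩
    · rw [Function.update_self, htab r hr]
    · rw [h2, T.tabs j hj l h1 r hr]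
  · exact htab
  · exact upOrb_above _
  · intro _
    rw [Function.update_self]

end MDWord

/-! ### Completing rows: translations and carries -/

namespace MDWord

open RAM

variable {nn : ℕ → ℕ} [∀ k, NeZero (nn k)] {d q : ℕ} {F G : ∀ k, Word (dim nn k) q} {s s' : ℕ → ℕ}
  {σ τ : State} {k : ℕ}

/-- A translation permutes the rows cyclically by its last coordinate and translates each of them by
the others, so the code is assembled from stored codes of translated rows. -/
theorem enc_vadd_succ (f : Word (dim nn (k + 1)) q) {x : ℕ} (hx : x < size nn (k + 1)) :
    enc (un (dim nn (k + 1)) x +ᵥ f) = ∑ j ∈ Finset.range (nn k),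
      enc (un (dim nn k) (x % size nn k) +ᵥ row f ((j + x / size nn k) % nn k : ℕ)) *
        q ^ (size nn k * j) := by
  rw [enc_succ, size_fr]
  change ∑ j ∈ Finset.range (nn k), _ = _
  refine Finset.sum_congr rfl fun j _ => ?_
  congr 2
  have h1 : (un (dim nn (k + 1)) x (Fin.last k) : ℕ) = x / size nn k := by
    rw [un_last, size_fr]
    refine Nat.mod_eq_of_lt (Nat.div_lt_of_lt_mul ?_)
    rw [size_succ] at hx
    exact hx
  have h2 : un (dim nn k) (x % size nn k) = un (dim nn k) x := by
    rw [← size_eq, un_mod]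
  rw [seq_vadd, front_un, h1, h2]
  congr 1
  refine seq_emod (n := dim nn (k + 1)) f ?_
  change _ % (nn k : ℤ) = _ % (nn k : ℤ)
  push_cast
  simp

section terms

/-- The address of the current row in the dimension that is the value of the variable `14`. -/
def curT : Term := cellT (.var 14) (.read 5 (.var 14))

def succT : Term := .bin .plus (.var 14) (.lit 1)

def endT : Term := .eq (.bin .plus (.read 5 (.var 14)) (.lit 1)) (.read 0 (.var 14))

/-- The canonical representation becomes the current row. -/
def openRowP : Prog :=
  .seq (.loop 20 (.read 2 (.var 14)) (.wr 6 (cellT curT (.var 20)) (.read 9 (.var 20)))) <|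
  .seq (.wr 7 curT (.lit 0)) <| .seq (.asg 7 (.var 14)) (.asg 8 (.lit 1))

/-- The index of the translation of the current row. -/
def transT : Term :=
  .sum 16 (.read 2 (.var 14)) (.bind 9 (.bin .plus (.var 16) (.lit 1)) (.lt (.var 6) countT))

/-- If the current row is the last one, the numbers of fixed words above the word are computed. -/
def writeTabP : Prog :=
  .ite (.and endT (.lt succT (.var 0)))
    (.loop 16 (.read 2 succT) (.wr 8 (cellT (cellT succT (.read 5 succT)) (.var 16))
      (.bind 9 (.bin .plus (.var 15) (.lit 1)) (withFocT (.read 10 (cellT succT (.var 16)))))))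
    (.asg 16 (.lit 0))

/-- The translate by the value of the variable `15` replaces the current row. -/
def closeRowP : Prog :=
  .seq (.loop 20 (.read 2 (.var 14))
    (.wr 6 (cellT curT (adT (.var 15) (.var 20))) (.read 9 (.var 20))))
  (.wr 7 curT (.var 15))

/-- The code of the translate by the value of the variable `20` of the word with the given rows. -/
def codeT : Term :=
  .sum 16 (.read 0 (.var 14)) (.bin .times
    (.read 6 (cellT (cellT (.var 14) (.mod (.bin .plus (.var 16) (.bin .quot (.var 20)
      (.read 2 (.var 14)))) (.read 0 (.var 14)))) (.mod (.var 20) (.read 2 (.var 14)))))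
    (.read 3 (.bin .times (.read 2 (.var 14)) (.var 16))))

/-- The digits behave like an odometer: if the row was the last one, the completed word becomes the
focus in the next dimension and the digit returns to `0`; otherwise the digit grows and the flag
`17` stops the carry. -/
def advanceP : Prog :=
  .ite endT
    (.seq (.loop 20 (.read 2 succT) (.wr 9 (.var 20) codeT)) (.wr 5 (.var 14) (.lit 0)))
    (.seq (.wr 5 (.var 14) (.bin .plus (.read 5 (.var 14)) (.lit 1))) (.asg 17 (.lit 0)))

/-- Extends the words in all dimensions by the new symbol. -/
def cascadeP : Prog :=
  .loop 14 (.var 0) <| .ite (.var 17)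
    (.seq openRowP <| .seq (.asg 15 transT) <| .seq writeTabP <| .seq closeRowP advanceP)
    (.asg 16 (.lit 0))

end terms

/-- The number of symbols that are known. -/
def val (nn s : ℕ → ℕ) (d : ℕ) : ℕ := ∑ j ∈ Finset.range d, s j * size nn j

/-- A word in the dimension `k` is known completely. -/
structure Casc (F : ∀ k, Word (dim nn k) q) (s : ℕ → ℕ) (d : ℕ) (w : Word (dim nn d) q)
    (P J k : ℕ) (σ : State) : Prop where
  tables : Tables F s d σ
  digits : ∀ j < d, σ.arr 5 j = s j
  digits_lt : ∀ j, s j < nn j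
  foci : Foci F s d w k
  zero : ∀ j < k, s j = 0
  val_eq : val nn s d + size nn k = P + 1
  letters : ∀ x < size nn k, σ.arr 9 x = enc (un (dim nn k) x +ᵥ F k)
  tab : k < d → ∀ h < size nn k, σ.arr 8 ((k * size nn d + s k) * size nn d + h) =
    {a | a ∈ above (F k) ∧ un (dim nn k) h +ᵥ a = a}.ncard
  target : σ.var 6 = J
  go : σ.var 17 = 1

theorem Tables.congr_cells (T : Tables F s d σ) (h : ∀ x ∈ [0, 1, 3, 4, 5], τ.var x = σ.var x)
    (h' : ∀ a ∈ [0, 2, 3, 4], τ.arr a = σ.arr a)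
    (h6 : ∀ j < d, ∀ l < s j, ∀ r < size nn d, τ.arr 6 ((j * size nn d + l) * size nn d + r) =
      σ.arr 6 ((j * size nn d + l) * size nn d + r))
    (h7 : ∀ j < d, ∀ l < s j, τ.arr 7 (j * size nn d + l) = σ.arr 7 (j * size nn d + l))
    (h8 : ∀ j < d, ∀ l < s j, ∀ r < size nn d, τ.arr 8 ((j * size nn d + l) * size nn d + r) =
      σ.arr 8 ((j * size nn d + l) * size nn d + r)) : Tables F s d τ := by
  refine ⟨T.base.congr h h', fun j hj l hl r hr => ?_, fun j hj l hl => ?_,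
    fun j hj l hl r hr => ?_⟩
  · rw [h6 j hj l hl r (hr.trans_le (size_mono hj.le)), T.lets j hj l hl r hr]
  · rw [h7 j hj l hl, T.taus j hj l hl]
  · rw [h8 j hj l hl r (hr.trans_le (size_mono hj.le)), T.tabs j hj l hl r hr]

theorem dim_le {j : ℕ} (hj : j < d) : nn j ≤ size nn d := by
  have h := size_mono (nn := nn) (show j + 1 ≤ d from hj)
  rw [size_succ] at h
  exact (Nat.le_mul_of_pos_left _ (size_pos j)).trans h

namespace Casc

variable {w : Word (dim nn d) q} {P J : ℕ}

theorem congr_cells (C : Casc F s d w P J k σ) (h : ∀ x ∈ [0, 1, 3, 4, 5, 6, 17], τ.var x = σ.var x)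
    (h' : ∀ a ∈ [0, 2, 3, 4, 5, 9], τ.arr a = σ.arr a)
    (h6 : ∀ j < d, ∀ l < s j, ∀ r < size nn d, τ.arr 6 ((j * size nn d + l) * size nn d + r) =
      σ.arr 6 ((j * size nn d + l) * size nn d + r))
    (h7 : ∀ j < d, ∀ l < s j, τ.arr 7 (j * size nn d + l) = σ.arr 7 (j * size nn d + l))
    (h8 : ∀ j < d, ∀ l, l < s j ∨ j = k ∧ l = s k → ∀ r < size nn d,
      τ.arr 8 ((j * size nn d + l) * size nn d + r) =
      σ.arr 8 ((j * size nn d + l) * size nn d + r)) : Casc F s d w P J k τ := by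
  have T := C.tables.congr_cells (τ := τ) (fun x hx => h x (by revert hx; simp; omega))
    (fun a ha => h' a (by revert ha; simp; omega)) h6 h7 fun j hj l hl => h8 j hj l (.inl hl)
  refine ⟨T, ?_, C.digits_lt, C.foci, C.zero, C.val_eq, ?_, fun hk r hr => ?_, ?_, ?_⟩
  · rw [h' 5 (by simp)]; exact C.digits
  · rw [h' 9 (by simp)]; exact C.letters
  · rw [h8 k hk _ (.inr ⟨rfl, rfl⟩) r (hr.trans_le (size_mono hk.le))]; exact C.tab hk r hr
  · rw [h 6 (by simp)]; exact C.target
  · rw [h 17 (by simp)]; exact C.go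

theorem set (C : Casc F s d w P J k σ) {x : ℕ} (hx : 7 ≤ x) (hx' : x ≠ 17) (v : ℕ) :
    Casc F s d w P J k (σ.set x v) := by
  refine C.congr_cells (fun y hy => ?_) (fun _ _ => rfl) (fun _ _ _ _ _ _ => rfl)
    (fun _ _ _ _ => rfl) fun _ _ _ _ _ _ => rfl
  rw [State.set_var, if_neg]
  rintro rfl
  simp at hy
  omega

theorem eval_row (C : Casc F s d w P J k σ) (hk : k < d) (h14 : σ.var 14 = k) :
    curT.eval σ = k * size nn d + s k := by
  rw [curT, Lev.eval_cell (Lev.eval_var h14) (b' := s k)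
    (by rw [Term.eval, Lev.eval_var h14, C.digits k hk]), C.tables.base.N_eq]

end Casc

/-- The known word is a row of the word in the next dimension. -/
structure Opened (F : ∀ k, Word (dim nn k) q) (s : ℕ → ℕ) (d : ℕ) (w : Word (dim nn d) q)
    (P J k : ℕ) (σ : State) : Prop where
  casc : Casc F s d w P J k σ
  k_lt : k < d
  k_eq : σ.var 14 = k
  b_eq : σ.var 7 = k
  ty_eq : σ.var 8 = 1
  lets : ∀ r < size nn k, σ.arr 6 ((k * size nn d + s k) * size nn d + r) =
      enc (un (dim nn k) r +ᵥ F k)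
  tau : σ.arr 7 (k * size nn d + s k) = 0

variable {w : Word (dim nn d) q} {P J : ℕ}

theorem _root_.RAM.State.set_set_self (σ : State) (x v : ℕ) : (σ.set x v).set x (σ.var x) = σ := by
  refine State.ext' ?_ rfl
  funext y
  simp only [State.set_var]
  split_ifs with h <;> simp [h]

theorem row_lt (hs : ∀ j, s j < nn j) : ∀ j < d, s j < size nn d := fun j hj =>
  (hs j).trans_le (dim_le hj)

theorem Casc.filled_lets (C : Casc F s d w P J k σ) (hk : k < d) {m : ℕ} {A V : ℕ → ℕ}
    (hA : ∀ j < m, ∃ r < size nn d, A j = (k * size nn d + s k) * size nn d + r)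
    (h : Filled 6 m A V σ τ) : Casc F s d w P J k τ := by
  refine C.congr_cells (fun x _ => by rw [h.var]) (fun a ha => h.arr a (by rintro rfl; simp at ha))
    (fun j hj l hl r hr => h.other _ fun i hi hAi => ?_) (fun _ _ _ _ => by rw [h.arr 7 (by omega)])
    fun _ _ _ _ _ _ => by rw [h.arr 8 (by omega)]
  obtain ⟨r', hr', hr''⟩ := hA i hi
  rw [hr''] at hAi
  have := row_lt (d := d) C.digits_lt
  obtain ⟨rfl, rfl, -⟩ := cell_inj (this k hk) hr' (hl.trans (this j hj)) hr hAi
  omega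

theorem Casc.of_set {x v : ℕ} (hx : 7 ≤ x) (hx' : x ≠ 17) (C : Casc F s d w P J k (σ.set x v)) :
    Casc F s d w P J k σ := by
  have := C.set hx hx' (σ.var x)
  rwa [State.set_set_self] at this

theorem enc_le_cap (B : Base nn d q σ) (hq : 0 < q) (hk : k ≤ d) (u : Word (dim nn k) q) :
    enc u ≤ σ.var 5 := by
  have h1 := enc_lt u
  rw [size_eq] at h1
  have h2 := Nat.pow_le_pow_right hq (size_mono (nn := nn) hk)
  have := B.cap
  omega

theorem Casc.run_openRow (C : Casc F s d w P J k σ) (hq : 0 < q) (hk : k < d) (h14 : σ.var 14 = k) :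
    Opened F s d w P J k (openRowP.run σ) := by
  have B := C.tables.base
  have hkN := size_mono (nn := nn) hk.le
  have hNM : size nn d * (d + 1) ≤ σ.var 5 := by rw [← B.M_eq]; exact B.le
  have hd5 : d + 1 ≤ σ.var 5 := (Nat.le_mul_of_pos_left _ (size_pos d)).trans hNM
  have hsk := row_lt (d := d) C.digits_lt
  have hfill := Prog.run_fill (x := 20) (a := 6) (m := size nn k) (e := .read 2 (.var 14))
    (i := cellT curT (.var 20)) (v := .read 9 (.var 20)) (σ := σ)
    (A := fun r => (k * size nn d + s k) * size nn d + r) (V := fun r => σ.arr 9 r)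
    (by rw [Term.eval, Lev.eval_var h14, B.prods k hk.le]) (by rw [B.M_eq]; nlinarith) (by omega)
    (fun j _ j' hj' h => by omega) (fun j hj τ hτ hF => by
      have h20 : τ.var 20 = j := by rw [hτ]; simp
      have h14' : τ.var 14 = k := by rw [hτ]; simpa using h14
      have Cτ : Casc F s d w P J k τ := (C.filled_lets hk (fun r hr => ⟨r, by omega, rfl⟩)
        hF).of_set (by omega) (by omega)
      refine ⟨?_, ?_, ?_⟩
      · rw [Lev.eval_cell (Cτ.eval_row hk h14') (Lev.eval_var h20), Cτ.tables.base.N_eq]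
      · rw [Term.eval, Lev.eval_var h20]
        exact congrFun (hF.arr 9 (by omega)) j
      · simp only [C.letters j hj]
        exact enc_le_cap B hq hk.le _)
  rw [openRowP, Prog.run]
  generalize Prog.run _ σ = ρ at hfill ⊢
  have Cρ := C.filled_lets hk (fun r hr => ⟨r, by omega, rfl⟩) hfill
  have h14' : ρ.var 14 = k := by rw [hfill.var]; exact h14
  have h5 : ρ.var 5 = σ.var 5 := by rw [hfill.var]
  simp only [Prog.run, Cρ.eval_row hk h14', Term.eval, State.set_var, State.put_var, h14', h5,
    Nat.zero_min]
  norm_num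
  rw [min_eq_left (by omega), min_eq_left (by omega)]
  have C1 : Casc F s d w P J k (ρ.put 7 (k * size nn d + s k) 0) := by
    refine Cρ.congr_cells (fun x _ => rfl) (fun a ha => ?_) (fun _ _ _ _ _ _ => rfl)
      (fun j hj l hl => ?_) fun _ _ _ _ _ _ => rfl
    · rw [State.put_arr, if_neg (by rintro rfl; simp at ha)]
    · rw [State.put_arr, if_pos rfl, Function.update_of_ne]
      intro h
      obtain ⟨rfl, rfl⟩ := cell_inj₂ (hl.trans (hsk j hj)) (hsk k hk) h
      omega
  refine ⟨(C1.set (by omega) (by omega) k).set (by omega) (by omega) 1, hk, by simpa using h14',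
    by simp, by simp, fun r hr => ?_, by simp⟩
  simp only [State.set_arr, State.put_arr]
  norm_num
  rw [hfill.cell r hr, C.letters r hr]

namespace Opened

theorem set (O : Opened F s d w P J k σ) {x : ℕ} (hx : x = 9 ∨ 15 ≤ x) (hx' : x ≠ 17) (v : ℕ) :
    Opened F s d w P J k (σ.set x v) := by
  refine ⟨O.casc.set (by omega) hx' v, O.k_lt, ?_, ?_, ?_, O.lets, O.tau⟩
  all_goals rw [State.set_var, if_neg (by omega)]
  exacts [O.k_eq, O.b_eq, O.ty_eq]

/-- The current row is not known yet, only its canonical representation. A word with the latter as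
its row `s k` stands in for `F (k + 1)`; by `chain_congr` the bound is the same. -/
theorem query (O : Opened F s d w P J k σ) (hw : canon w = w) {bnd : ℕ} (h9 : σ.var 9 = bnd)
    (hb : bnd ≤ size nn d) : ∃ F' : ∀ k, Word (dim nn k) q,
      (∀ j, k ≤ j → ∀ l < s j, row (F' (j + 1)) l = row (F (j + 1)) l) ∧
      Query F' s k 1 bnd (above (F k)) d σ := by
  have C := O.casc
  obtain ⟨f, h1, h2⟩ := exists_row_eq (F (k + 1)) (C.digits_lt k) (F k)
  have h2' : ∀ l < s k, row f l = row (F (k + 1)) l := fun l hl =>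
    h2 l (hl.trans (C.digits_lt k)) (by omega)
  refine ⟨Function.update F (k + 1) f, fun j hj l hl => ?_, ?_⟩
  · by_cases h : j = k
    · subst h
      rw [Function.update_self, h2' l hl]
    · rw [Function.update_of_ne (by omega)]
  · rw [← h1]
    refine C.tables.query_row O.k_lt C.digits C.digits_lt O.b_eq O.ty_eq h9 hb h2' ?_ ?_ ?_
    · rw [h1]; exact O.lets
    · rw [h1, O.tau, ← C.foci.canon_eq hw le_rfl O.k_lt.le, trIndex_canon]
    · rw [h1]; exact C.tab O.k_lt

/-- With the bound `v + 1` the count exceeds `J` exactly if the wanted word passes, that is, if `v +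
1` is at most the index `θ`. The number of such `v` is `θ`. -/
theorem eval_trans (O : Opened F s d w P J k σ) (hq : 0 < q) (x : Necklace (dim nn d) q)
    (hw : x.canon = w) (hJ : {y : Necklace (dim nn d) q | lt x.canon y.canon}.ncard = J) :
    transT.eval σ = trIndex (row (F (k + 1)) (s k)) := by
  have C := O.casc
  have B := C.tables.base
  have hk := O.k_lt
  have hkN := size_mono (nn := nn) hk.le
  have hNM : size nn d * (d + 1) ≤ σ.var 5 := by rw [← B.M_eq]; exact B.le
  have hcw : canon w = w := by rw [← hw, canon_necklace_canon]
  have hθ := trIndex_lt (row (F (k + 1)) (s k))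
  rw [size_eq] at hθ
  set θ := trIndex (row (F (k + 1)) (s k))
  have hrange : (Finset.range (size nn k)).filter (fun v => v + 1 ≤ θ) = Finset.range θ := by
    ext v; simp only [Finset.mem_filter, Finset.mem_range]; omega
  have key : transT.eval σ = ∑ v ∈ Finset.range (size nn k), if v + 1 ≤ θ then 1 else 0 := by
    refine Term.eval_sum (by rw [Term.eval, Lev.eval_var O.k_eq, B.prods k hk.le])
      (by rw [B.M_eq]; nlinarith) fun v hv => ?_
    refine Term.eval_bind (v := v + 1) (Term.eval_bin .plus (Lev.eval_var (by simp)) rfl) ?_ ?_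
    · simp only [State.set_var]
      norm_num
      nlinarith [size_pos (nn := nn) d]
    obtain ⟨F', hF', Q⟩ := ((O.set (x := 16) (by omega) (by omega) v).set (x := 9) (by omega)
      (by omega) (v + 1)).query hcw (bnd := v + 1) (by simp) (by omega)
    have hc := Query.eval_count (U := fun j => above (F j)) Q hq
    rw [Term.eval_less (a := J) (Lev.eval_var (by simpa using C.target)) hc,
      show (if v + 1 ≤ θ then 1 else 0) = ind (v + 1 ≤ θ) by rw [ind]; split_ifs <;> rfl]
    refine ind_congr ?_
    have hup := Query.upOrb_chain (F := F') (hs := C.digits_lt)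
      (bnd := Query.bounds nn d k 1 (v + 1)) (U := fun j => above (F j)) (upOrb_above _) hk.le
    rw [← not_le, ← hJ, ← canon_notMem_iff hup, not_not, hw, chain_congr hF' hk.le,
      C.foci.mem_chain_above hcw hk]
    rw [C.foci.step k le_rfl hk, above_canon]
  rw [key, Finset.sum_boole, hrange, Finset.card_range, Nat.cast_id]

end Opened

end MDWord

/-! ### Tables for a completed row -/

namespace MDWord

open RAM

variable {nn : ℕ → ℕ} [∀ k, NeZero (nn k)] {d q : ℕ} {F G : ∀ k, Word (dim nn k) q} {s s' : ℕ → ℕ}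
  {σ τ : State} {k P J : ℕ} {w : Word (dim nn d) q}

namespace Opened

theorem of_set {x v : ℕ} (hx : x = 9 ∨ 15 ≤ x) (hx' : x ≠ 17)
    (O : Opened F s d w P J k (σ.set x v)) : Opened F s d w P J k σ := by
  have := O.set hx hx' (σ.var x)
  rwa [State.set_set_self] at this

theorem filled_tabs (O : Opened F s d w P J k σ) (hk : k + 1 < d) {m : ℕ} {A V : ℕ → ℕ}
    (hA : ∀ j < m, ∃ r < size nn d, A j = ((k + 1) * size nn d + s (k + 1)) * size nn d + r)
    (h : Filled 8 m A V σ τ) : Opened F s d w P J k τ := by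
  refine ⟨O.casc.congr_cells (fun x _ => by rw [h.var])
    (fun a ha => h.arr a (by rintro rfl; simp at ha))
    (fun _ _ _ _ _ _ => by rw [h.arr 6 (by omega)]) (fun _ _ _ _ => by rw [h.arr 7 (by omega)])
    fun j hj l hl r hr => h.other _ fun i hi hAi => ?_, O.k_lt, ?_, ?_, ?_, ?_, ?_⟩
  · obtain ⟨r', hr', hr''⟩ := hA i hi
    rw [hr''] at hAi
    have := row_lt (d := d) O.casc.digits_lt
    have hl' : l < size nn d := by
      rcases hl with hl | ⟨rfl, rfl⟩
      exacts [hl.trans (this j hj), this j hj]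
    obtain ⟨rfl, rfl, -⟩ := cell_inj (this (k + 1) hk) hr' hl' hr hAi
    omega
  · rw [h.var]; exact O.k_eq
  · rw [h.var]; exact O.b_eq
  · rw [h.var]; exact O.ty_eq
  · rw [h.arr 6 (by omega)]; exact O.lets
  · rw [h.arr 7 (by omega)]; exact O.tau

end Opened

theorem Casc.eval_end (C : Casc F s d w P J k σ) (hk : k < d) (h14 : σ.var 14 = k) :
    endT.eval σ = ind (s k + 1 = nn k) :=
  Term.eval_eq (Term.eval_bin .plus (a := s k) (by rw [Term.eval, Lev.eval_var h14, C.digits k hk])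
    rfl) (by rw [Term.eval, Lev.eval_var h14, C.tables.base.dims k hk])

theorem eval_succT (h14 : σ.var 14 = k) : succT.eval σ = k + 1 :=
  Term.eval_bin .plus (Lev.eval_var h14) rfl

/-- The table for the completed word of dimension `k + 1` is computed before the row is replaced by
its translate, because the query uses the canonical representation in its place. The cells written
lie in the next dimension, so the running query is not disturbed. -/
theorem Opened.run_writeTab (O : Opened F s d w P J k σ) (hq : 0 < q) (hw : canon w = w)
    (h15 : σ.var 15 = trIndex (row (F (k + 1)) (s k))) :
    Opened F s d w P J k (writeTabP.run σ) ∧ (writeTabP.run σ).var 15 = σ.var 15 ∧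
      (s k + 1 = nn k → k + 1 < d → ∀ h < size nn (k + 1), (writeTabP.run σ).arr 8
        (((k + 1) * size nn d + s (k + 1)) * size nn d + h) =
        {a | a ∈ above (F (k + 1)) ∧ un (dim nn (k + 1)) h +ᵥ a = a}.ncard) := by
  have C := O.casc
  have B := C.tables.base
  have hk := O.k_lt
  have hNM : size nn d * (d + 1) ≤ σ.var 5 := by rw [← B.M_eq]; exact B.le
  have hcond := Term.eval_and (C.eval_end hk O.k_eq)
    (Term.eval_less (eval_succT O.k_eq) (Lev.eval_var B.d_eq))
  rw [writeTabP, Prog.run, hcond]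
  by_cases hc : s k + 1 = nn k ∧ k + 1 < d
  · rw [if_pos (ind_ne_zero.2 hc)]
    obtain ⟨hc, hk'⟩ := hc
    have hkN := size_mono (nn := nn) hk'.le
    have hkN' := size_mono (nn := nn) hk.le
    have hθ := trIndex_lt (row (F (k + 1)) (s k))
    rw [size_eq] at hθ
    set θ := trIndex (row (F (k + 1)) (s k))
    have hA : ∀ j < size nn (k + 1), ∃ r < size nn d,
        ((k + 1) * size nn d + s (k + 1)) * size nn d + j =
        ((k + 1) * size nn d + s (k + 1)) * size nn d + r := fun r hr => ⟨r, by omega, rfl⟩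
    have hfill := Prog.run_fill (x := 16) (a := 8) (m := size nn (k + 1)) (e := .read 2 succT)
      (i := cellT (cellT succT (.read 5 succT)) (.var 16))
      (v := .bind 9 (.bin .plus (.var 15) (.lit 1)) (withFocT (.read 10 (cellT succT (.var 16)))))
      (σ := σ) (A := fun j => ((k + 1) * size nn d + s (k + 1)) * size nn d + j)
      (V := fun h => {a | a ∈ above (F (k + 1)) ∧ un (dim nn (k + 1)) h +ᵥ a = a}.ncard)
      (by rw [Term.eval, eval_succT O.k_eq, B.prods _ hk'.le]) (by rw [B.M_eq]; nlinarith)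
      (by omega) (fun j _ j' hj' h => by omega) (fun j hj τ hτ hF => by
        have h16 : τ.var 16 = j := by rw [hτ]; simp
        have h15' : τ.var 15 = θ := by rw [hτ]; simpa using h15
        have h5 : τ.var 5 = σ.var 5 := by rw [hτ]; simp
        have Oτ : Opened F s d w P J k τ := (O.filled_tabs hk'
          (fun r hr => hA r (by omega)) hF).of_set (by omega) (by omega)
        refine ⟨?_, ?_, Query.ncard_le_cap B hq hk'.le _⟩
        · rw [Lev.eval_cell (Lev.eval_cell (eval_succT Oτ.k_eq) (b' := s (k + 1))
            (by rw [Term.eval, eval_succT Oτ.k_eq, Oτ.casc.digits _ hk'])) (Lev.eval_var h16),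
            Oτ.casc.tables.base.N_eq]
        · refine Term.eval_bind (v := θ + 1) (Term.eval_bin .plus (Lev.eval_var h15') rfl)
            (by rw [h5]; nlinarith) ?_
          obtain ⟨F', hF', Q⟩ := (Oτ.set (x := 9) (by omega) (by omega) (θ + 1)).query hw
            (bnd := θ + 1) (by simp) (by omega)
          refine Query.eval_withFoc (U := fun j => above (F j)) Q hq fun ρ hρ _ hfoc => ?_
          rw [Term.eval, Lev.eval_cell (eval_succT (k := k) (by rw [hρ]; simpa using Oτ.k_eq))
            (Lev.eval_var (v := j) (by rw [hρ]; simpa using h16)), hρ]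
          simp only [State.set_var]
          norm_num
          rw [Oτ.casc.tables.base.N_eq, hfoc (k + 1) (by omega) hk'.le j hj,
            chain_congr hF' (by omega : k ≤ k + 1), C.foci.chain_above hw hk (by
              rw [C.foci.step k le_rfl hk, above_canon]) hc])
    exact ⟨O.filled_tabs hk' hA hfill, by rw [hfill.var], fun _ _ => hfill.cell⟩
  · rw [if_neg (not_not.2 (ind_neg hc))]
    exact ⟨O.set (by omega) (by omega) _, by simp [Prog.run], fun h h' => absurd ⟨h, h'⟩ hc⟩

/-- The code of a translate of a row is that of a translate of its canonical representation. -/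
theorem exists_enc_eq (a : Word (dim nn k) q) (hk : k ≤ d) {r : ℕ} (hr : r < size nn k) :
    ∃ x < size nn k, posIndex (un (dim nn d) (trIndex a) + un (dim nn d) x) = r ∧
      enc (un (dim nn k) x +ᵥ canon a) = enc (un (dim nn k) r +ᵥ a) := by
  obtain ⟨g, hg, hg'⟩ := trIndex_spec a
  have hθ := trIndex_lt a
  rw [size_eq] at hθ
  obtain ⟨x, hx, hx'⟩ := exists_un_eq (un (dim nn k) r - g)
  rw [size_eq] at hx
  have h : un (dim nn k) (trIndex a) + un (dim nn k) x = un (dim nn k) r := by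
    rw [hx', ← hg', un_posIndex]; abel
  refine ⟨x, hx, ?_, ?_⟩
  · rw [posIndex_un_level hk hθ hx, h, posIndex_un, size_eq, Nat.mod_eq_of_lt hr]
  · rw [← hg, ← add_vadd, hx', sub_add_cancel]

/-- Since `canon a` is the translate of the row `a` by its index, the translate of `canon a` by `x`
is that of `a` by the sum of both. The stored codes are merely written to permuted addresses. -/
theorem Opened.run_closeRow (O : Opened F s d w P J k σ) (hq : 0 < q)
    (h15 : σ.var 15 = trIndex (row (F (k + 1)) (s k))) :
    Casc F s d w P J k (closeRowP.run σ) ∧ (closeRowP.run σ).var 14 = k ∧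
      (∀ a, a ≠ 6 → a ≠ 7 → (closeRowP.run σ).arr a = σ.arr a) ∧
      Tables F (Function.update s k (s k + 1)) d (closeRowP.run σ) := by
  have C := O.casc
  have B := C.tables.base
  have hk := O.k_lt
  have hkN := size_mono (nn := nn) hk.le
  have hNM : size nn d * (d + 1) ≤ σ.var 5 := by rw [← B.M_eq]; exact B.le
  have hθ := trIndex_lt (row (F (k + 1)) (s k))
  rw [size_eq] at hθ
  have hsk := row_lt (d := d) C.digits_lt
  have hstep := C.foci.step k le_rfl hk
  set a := row (F (k + 1)) (s k)
  set p := fun x => posIndex (un (dim nn d) (trIndex a) + un (dim nn d) x)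
  have hp : ∀ x < size nn k, p x < size nn k := fun x hx => by
    simp only [p]
    rw [posIndex_un_level hk.le hθ hx]
    exact (posIndex_lt _).trans_eq (size_eq k)
  have hA : ∀ j < size nn k, ∃ r < size nn d, (k * size nn d + s k) * size nn d + p j =
      (k * size nn d + s k) * size nn d + r := fun r hr => ⟨p r, (hp r hr).trans_le hkN, rfl⟩
  have hfill := Prog.run_fill (x := 20) (a := 6) (m := size nn k) (e := .read 2 (.var 14))
    (i := cellT curT (adT (.var 15) (.var 20))) (v := .read 9 (.var 20)) (σ := σ)
    (A := fun x => (k * size nn d + s k) * size nn d + p x) (V := fun r => σ.arr 9 r)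
    (by rw [Term.eval, Lev.eval_var O.k_eq, B.prods k hk.le]) (by rw [B.M_eq]; nlinarith) (by omega)
    (fun j hj j' hj' h => by
      have h1 : p j' = p j := by omega
      have h2 := posIndex_injective h1
      have h3 := un_inj (by rw [size_eq]; omega) (by rw [size_eq]; omega) (add_left_cancel h2)
      omega) (fun j hj τ hτ hF => by
      have h20 : τ.var 20 = j := by rw [hτ]; simp
      have h14' : τ.var 14 = k := by rw [hτ]; simpa using O.k_eq
      have h15' : τ.var 15 = trIndex a := by rw [hτ]; simpa using h15
      have Cτ : Casc F s d w P J k τ := (C.filled_lets hk (fun r hr => hA r (by omega))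
        hF).of_set (by omega) (by omega)
      refine ⟨?_, ?_, ?_⟩
      · rw [Lev.eval_cell (Cτ.eval_row hk h14') (b' := p j), Cτ.tables.base.N_eq]
        rw [adT, Term.eval, Lev.eval_cell (Lev.eval_var h15') (Lev.eval_var h20),
          Cτ.tables.base.N_eq, Cτ.tables.base.adds _ (by omega) _ (by omega)]
      · rw [Term.eval, Lev.eval_var h20]
        exact congrFun (hF.arr 9 (by omega)) j
      · simp only [C.letters j hj]
        exact enc_le_cap B hq hk.le _)
  rw [closeRowP, Prog.run]
  generalize Prog.run _ σ = ρ at hfill ⊢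
  have Cρ := C.filled_lets hk hA hfill
  have h14' : ρ.var 14 = k := by rw [hfill.var]; exact O.k_eq
  have h15' : ρ.var 15 = trIndex a := by rw [hfill.var]; exact h15
  have h5 : ρ.var 5 = σ.var 5 := by rw [hfill.var]
  simp only [Prog.run, Cρ.eval_row hk h14', Term.eval, h15', h5]
  rw [min_eq_left (by nlinarith [size_pos (nn := nn) d])]
  have C1 : Casc F s d w P J k (ρ.put 7 (k * size nn d + s k) (trIndex a)) := by
    refine Cρ.congr_cells (fun x _ => rfl) (fun a ha => ?_) (fun _ _ _ _ _ _ => rfl)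
      (fun j hj l hl => ?_) fun _ _ _ _ _ _ => rfl
    · rw [State.put_arr, if_neg (by rintro rfl; simp at ha)]
    · rw [State.put_arr, if_pos rfl, Function.update_of_ne]
      intro h
      obtain ⟨rfl, rfl⟩ := cell_inj₂ (hl.trans (hsk j hj)) (hsk k hk) h
      omega
  have key : ∀ j l, l < Function.update s k (s k + 1) j → j = k ∧ l = s k ∨ l < s j := by
    intro j l hl
    by_cases hj : j = k
    · subst hj
      rw [Function.update_self] at hl
      omega
    · rw [Function.update_of_ne hj] at hl
      exact .inr hl
  refine ⟨C1, h14', fun b h6 h7 => ?_, C1.tables.base, fun j hj l hl r hr => ?_,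
    fun j hj l hl => ?_, fun j hj l hl r hr => ?_⟩
  · rw [State.put_arr, if_neg h7, hfill.arr b h6]
  · rcases key j l hl with ⟨rfl, rfl⟩ | hl
    · obtain ⟨x, hx, hx', hx''⟩ := exists_enc_eq a hk.le hr
      have := hfill.cell x hx
      rw [show p x = r from hx'] at this
      simp only [State.put_arr]
      norm_num
      rw [this, C.letters x hx, hstep, hx'']
    · exact C1.tables.lets j hj l hl r hr
  · rcases key j l hl with ⟨rfl, rfl⟩ | hl
    · simp only [State.put_arr, if_true, Function.update_self]
      rfl
    · exact C1.tables.taus j hj l hl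
  · rcases key j l hl with ⟨rfl, rfl⟩ | hl
    · rw [C1.tab hj r hr, hstep, above_canon]
    · exact C1.tables.tabs j hj l hl r hr

end MDWord

/-! ### The cascade of carries after a new symbol -/

namespace MDWord

open RAM

variable {nn : ℕ → ℕ} [∀ k, NeZero (nn k)] {d q : ℕ} {F G : ∀ k, Word (dim nn k) q} {s s' : ℕ → ℕ}
  {σ τ : State} {k P J : ℕ} {w : Word (dim nn d) q}

/-- The first symbols are known. -/
structure Known (F : ∀ k, Word (dim nn k) q) (s : ℕ → ℕ) (d : ℕ) (w : Word (dim nn d) q)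
    (P J : ℕ) (σ : State) : Prop where
  tables : Tables F s d σ
  digits : ∀ j < d, σ.arr 5 j = s j
  digits_lt : ∀ j, s j < nn j
  foci : Foci F s d w 0
  val_eq : val nn s d = P
  target : σ.var 6 = J

theorem Known.congr (K : Known F s d w P J σ) (h : ∀ x ∈ [0, 1, 3, 4, 5, 6], τ.var x = σ.var x)
    (h' : τ.arr = σ.arr) : Known F s d w P J τ :=
  ⟨K.tables.congr (fun x hx => h x (by revert hx; simp; omega)) fun a _ => by rw [h'],
    by rw [h']; exact K.digits, K.digits_lt, K.foci, K.val_eq,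
    by rw [h 6 (by simp)]; exact K.target⟩

theorem Known.set (K : Known F s d w P J σ) {x : ℕ} (hx : 7 ≤ x) (v : ℕ) :
    Known F s d w P J (σ.set x v) := by
  refine K.congr (fun y hy => ?_) rfl
  rw [State.set_var, if_neg]
  rintro rfl
  simp at hy
  omega

theorem val_update (hk : k < d) (v : ℕ) :
    val nn (Function.update s k v) d + s k * size nn k = val nn s d + v * size nn k := by
  have hk' := Finset.mem_range.2 hk
  simp only [val, ← Finset.add_sum_erase _ _ hk', Function.update_self]
  rw [Finset.sum_congr rfl fun j hj => by rw [Function.update_of_ne (Finset.ne_of_mem_erase hj)]]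
  omega

theorem val_lt (hs : ∀ j, s j < nn j) (d : ℕ) : val nn s d < size nn d := by
  induction d with
  | zero => simp [val, size]
  | succ d ih =>
    rw [val, Finset.sum_range_succ, size_succ]
    have := hs d
    change val nn s d + _ < _
    nlinarith

theorem Tables.eval_code (T : Tables F s d σ) (hk : k < d) (h14 : σ.var 14 = k) (hs : s k = nn k)
    {x : ℕ} (hx : x < size nn (k + 1)) (h20 : σ.var 20 = x) :
    codeT.eval σ = enc (un (dim nn (k + 1)) x +ᵥ F (k + 1)) := by
  have B := T.base
  have hM : size nn d ≤ σ.var 4 := by rw [B.M_eq]; nlinarith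
  have h2 : ∀ i, (Term.read 2 (.var 14)).eval (σ.set 16 i) = size nn k := fun i => by
    rw [Term.eval, Lev.eval_var (v := k) (by simpa using h14)]; exact B.prods k hk.le
  have h0 : ∀ i, (Term.read 0 (.var 14)).eval (σ.set 16 i) = nn k := fun i => by
    rw [Term.eval, Lev.eval_var (v := k) (by simpa using h14)]; exact B.dims k hk
  have h20' : ∀ i, (Term.var 20).eval (σ.set 16 i) = x := fun i => Lev.eval_var (by simpa using h20)
  rw [enc_vadd_succ _ hx]
  refine Term.eval_sum (by rw [Term.eval, Lev.eval_var h14]; exact B.dims k hk)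
    ((dim_le hk).trans hM) fun i hi => ?_
  have hr : (i + x / size nn k) % nn k < s k := (Nat.mod_lt _ (NeZero.pos _)).trans_eq hs.symm
  have hi' : size nn k * i < size nn d := by
    refine lt_of_lt_of_le ?_ (size_mono (nn := nn) (show k + 1 ≤ d from hk))
    rw [size_succ]
    exact (Nat.mul_lt_mul_left (size_pos k)).2 hi
  refine Term.eval_bin .times ?_ ?_
  · rw [Term.eval, Lev.eval_cell (Lev.eval_cell (Lev.eval_var (v := k) (by simpa using h14))
      (Term.eval_mod (Term.eval_bin .plus (a := i) (Lev.eval_var (by simp))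
        (Term.eval_bin .quot (h20' i) (h2 i))) (h0 i))) (Term.eval_mod (h20' i) (h2 i))]
    simp only [State.set_var]
    norm_num
    rw [B.N_eq, Op.eval, Op.eval]
    exact T.lets k hk _ hr _ (Nat.mod_lt _ (size_pos k))
  · rw [Term.eval, Term.eval_bin .times (h2 i) (Lev.eval_var (v := i) (by simp))]
    exact B.pows _ hi'

/-- The number of known symbols has the mixed-radix digits `s`. A completed word of dimension `k`
contributes `size nn k` symbols, which either increases the digit `k` or is carried to the next one.
-/
theorem Casc.run_advance (C : Casc F s d w P J k σ) (hq : 0 < q) (hk : k < d) (h14 : σ.var 14 = k)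
    (T : Tables F (Function.update s k (s k + 1)) d σ)
    (htab : s k + 1 = nn k → k + 1 < d → ∀ h < size nn (k + 1), σ.arr 8
      (((k + 1) * size nn d + s (k + 1)) * size nn d + h) =
      {a | a ∈ above (F (k + 1)) ∧ un (dim nn (k + 1)) h +ᵥ a = a}.ncard) :
    (∃ s', Casc F s' d w P J (k + 1) (advanceP.run σ)) ∨
      (advanceP.run σ).var 17 = 0 ∧ ∃ F s, Known F s d w (P + 1) J (advanceP.run σ) := by
  have B := C.tables.base
  have hNM : size nn d * (d + 1) ≤ σ.var 5 := by rw [← B.M_eq]; exact B.le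
  have hval := C.val_eq
  have hlt := C.digits_lt k
  rw [advanceP, Prog.run, C.eval_end hk h14]
  by_cases hc : s k + 1 = nn k
  · rw [if_pos (ind_ne_zero.2 hc), Prog.run]
    left
    refine ⟨Function.update s k 0, ?_⟩
    have hkN := size_mono (nn := nn) (show k + 1 ≤ d from hk)
    have hfill := Prog.run_fill (x := 20) (a := 9) (m := size nn (k + 1)) (e := .read 2 succT)
      (i := .var 20) (v := codeT) (σ := σ) (A := fun x => x)
      (V := fun x => enc (un (dim nn (k + 1)) x +ᵥ F (k + 1)))
      (by rw [Term.eval, eval_succT h14, B.prods _ hk]) (by rw [B.M_eq]; nlinarith) (by omega)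
      (fun j _ j' hj' h => by omega) (fun j hj τ hτ hF => by
        have h20 : τ.var 20 = j := by rw [hτ]; simp
        have h14' : τ.var 14 = k := by rw [hτ]; simpa using h14
        refine ⟨Lev.eval_var h20, ?_, enc_le_cap B hq hk _⟩
        refine Tables.eval_code (T.congr (fun x hx => ?_) fun a ha => ?_) hk h14'
          (by rw [Function.update_self, hc]) hj h20
        · rw [hτ, State.set_var, if_neg (by rintro rfl; simp at hx)]
        · exact hF.arr a (by rintro rfl; simp at ha))
    generalize Prog.run _ σ = ρ at hfill ⊢
    have h14' : ρ.var 14 = k := by rw [hfill.var]; exact h14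
    simp only [Prog.run, Term.eval, h14', Nat.zero_min]
    refine ⟨(T.congr (τ := ρ.put 5 k 0) (fun x _ => ?_) (fun a ha => ?_)).mono fun j _ => ?_,
      fun j hj => ?_, fun j => ?_, C.foci.mono (Nat.le_succ k) fun j hj => ?_, fun j hj => ?_, ?_,
      ?_, fun hk' h hh => ?_, ?_, ?_⟩
    · rw [State.put_var, hfill.var]
    · rw [State.put_arr, if_neg (by rintro rfl; simp at ha), hfill.arr a (by rintro rfl; simp at ha)]
    · simp only [Function.update_apply]; split_ifs <;> omega
    · simp only [State.put_arr, if_true, Function.update_apply, hfill.arr 5 (by omega)]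
      split_ifs
      exacts [rfl, C.digits j hj]
    · simp only [Function.update_apply]
      split_ifs
      exacts [NeZero.pos _, C.digits_lt j]
    · rw [Function.update_of_ne (by omega)]
    · simp only [Function.update_apply]
      split_ifs with h
      exacts [rfl, C.zero j (by omega)]
    · have := val_update (nn := nn) (s := s) hk 0
      rw [size_succ, ← hc]
      nlinarith
    · simp only [State.put_arr]
      norm_num
      exact hfill.cell
    · simp only [State.put_arr]
      norm_num
      rw [hfill.arr 8 (by omega)]
      exact htab hc hk' h hh
    · rw [State.put_var, hfill.var]; exact C.target
    · rw [State.put_var, hfill.var]; exact C.go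
  · rw [if_neg (not_not.2 (ind_neg hc))]
    right
    have hcap : s k + 1 ≤ σ.var 5 := by
      have := dim_le (nn := nn) hk
      nlinarith
    simp only [Prog.run, Term.eval, Op.eval, h14, C.digits k hk, Nat.zero_min, min_eq_left hcap]
    refine ⟨by simp, ?_⟩
    -- The row has changed, so new foci are needed below. Their tables are empty, as the lower
    -- digits are `0`.
    obtain ⟨G, hG, hGF⟩ := (C.foci.mono (s' := Function.update s k (s k + 1)) (Nat.le_succ k)
      fun j hj => by rw [Function.update_of_ne (by omega)]).extend hq hk
    refine ⟨G, Function.update s k (s k + 1), ?_, fun j hj => ?_, fun j => ?_, hG, ?_, ?_⟩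
    · refine (T.congr_row fun j hj l hl => ?_).congr (fun x hx => ?_) fun a ha => ?_
      · by_cases hjk : j < k
        · rw [Function.update_of_ne (by omega), C.zero j hjk] at hl
          omega
        · rw [hGF (j + 1) (by omega)]
      · rw [State.set_var, if_neg (by rintro rfl; simp at hx), State.put_var]
      · rw [State.set_arr, State.put_arr, if_neg (by rintro rfl; simp at ha)]
    · simp only [State.set_arr, State.put_arr, if_true, Function.update_apply]
      split_ifs
      exacts [rfl, C.digits j hj]
    · simp only [Function.update_apply]
      split_ifs with h
      · subst h; omega
      · exact C.digits_lt j
    · have := val_update (nn := nn) (s := s) hk (s k + 1)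
      nlinarith
    · simp only [State.set_var, State.put_var]
      norm_num
      exact C.target

theorem Casc.run_cascade (C : Casc F s d w P J 0 σ) (hq : 0 < q) (x : Necklace (dim nn d) q)
    (hw : x.canon = w) (hJ : {y : Necklace (dim nn d) q | lt x.canon y.canon}.ncard = J) :
    (∃ F s, Casc F s d w P J d (cascadeP.run σ)) ∨
      ∃ F s, Known F s d w (P + 1) J (cascadeP.run σ) := by
  have B := C.tables.base
  have hcw : canon w = w := by rw [← hw, canon_necklace_canon]
  obtain ⟨τ, hτ, h⟩ := Prog.run_loop (x := 14) (e := .var 0) (σ := σ) (m := d)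
    (p := .ite (.var 17) (.seq openRowP <| .seq (.asg 15 transT) <| .seq writeTabP <|
      .seq closeRowP advanceP) (.asg 16 (.lit 0)))
    (Lev.eval_var B.d_eq) (by rw [B.M_eq]; nlinarith [size_pos (nn := nn) d])
    (fun k τ => (∃ F s, Casc F s d w P J k τ) ∨ τ.var 17 = 0 ∧ ∃ F s, Known F s d w (P + 1) J τ)
    (.inl ⟨F, s, C⟩) (by
      intro k hk τ hτ
      rw [Prog.run]
      rcases hτ with ⟨F, s, C⟩ | ⟨h17, F, s, K⟩
      · have C1 := C.set (x := 14) (by omega) (by omega) k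
        rw [if_pos (by rw [Lev.eval_var C1.go]; omega)]
        have O := C1.run_openRow hq hk (by simp)
        simp only [Prog.run]
        generalize openRowP.run _ = ρ at O ⊢
        have B := O.casc.tables.base
        have hθ := trIndex_lt (row (F (k + 1)) (s k))
        rw [size_eq] at hθ
        have := size_mono (nn := nn) hk.le
        rw [O.eval_trans hq x hw hJ, min_eq_left (by have := B.le; rw [B.M_eq] at this; nlinarith)]
        obtain ⟨O2, h15, htab⟩ := (O.set (x := 15) (by omega) (by omega)
          (trIndex (row (F (k + 1)) (s k)))).run_writeTab hq hcw
          (State.set_var _ _ _ _)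
        generalize writeTabP.run _ = ρ' at O2 h15 htab ⊢
        obtain ⟨C3, h14, h6, T⟩ := O2.run_closeRow hq (by rw [h15]; simp)
        generalize closeRowP.run _ = ρ'' at C3 h14 h6 T ⊢
        rcases C3.run_advance hq hk h14 T (by rwa [h6 8 (by omega) (by omega)]) with ⟨s', h⟩ | h
        exacts [.inl ⟨F, s', h⟩, .inr h]
      · rw [if_neg (by simp [Term.eval, h17])]
        exact .inr ⟨by simpa [Prog.run] using h17, F, s, (K.set (by omega) _).set (by omega) _⟩)
  rw [cascadeP, h]
  rcases hτ with ⟨F, s, C⟩ | ⟨-, F, s, K⟩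
  exacts [.inl ⟨F, s, C.set (by omega) (by omega) _⟩, .inr ⟨F, s, K.set (by omega) _⟩]

end MDWord

/-! ### Binary search for the next symbol -/

namespace MDWord

open RAM

variable {nn : ℕ → ℕ} [∀ k, NeZero (nn k)] {d q : ℕ} {F G : ∀ k, Word (dim nn k) q} {s s' : ℕ → ℕ}
  {σ τ : State} {k P J : ℕ} {w : Word (dim nn d) q}

/-- The symbol of a word of dimension `0`. -/
def symb (a : Word (dim nn 0) q) : ℕ := a 0

theorem canon_dim_zero (a : Word (dim nn 0) q) : canon a = a := by
  obtain ⟨g, hg⟩ := canon_mem a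
  rw [← hg, vadd_dim_zero]

theorem lt_dim_zero (a b : Word (dim nn 0) q) : lt a b ↔ symb a < symb b := by
  rw [lt, symb, symb, Subsingleton.elim (0 : Pos (dim nn 0)) fun k => k.elim0]
  exact Fin.lt_def

theorem upOrb_symb (m : ℕ) : UpOrb {a : Word (dim nn 0) q | m < symb a} := by
  intro u v hu h
  rw [canon_dim_zero, canon_dim_zero, lt_dim_zero] at h
  rcases h with rfl | h
  · exact hu
  · exact lt_trans (α := ℕ) hu h

theorem above_symb (a : Word (dim nn 0) q) : above a = {b | symb a < symb b} := by
  ext b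
  change lt _ _ ↔ _
  rw [canon_dim_zero, canon_dim_zero, lt_dim_zero]
  rfl

theorem ncard_symb {m : ℕ} (hm : m < q) :
    {a : Word (dim nn 0) q | m < symb a}.ncard = q - 1 - m := by
  have h : {a : Word (dim nn 0) q | m < symb a} =
      (fun x _ => x) '' ((Finset.Ioi (⟨m, hm⟩ : Fin q) : Finset (Fin q)) : Set (Fin q)) := by
    ext a
    constructor
    · intro h
      exact ⟨a 0, by simpa [Fin.lt_def, symb] using h, funext fun p => by rw [Subsingleton.elim p 0]⟩
    · rintro ⟨x, hx, rfl⟩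
      simpa [Fin.lt_def, symb] using hx
  rw [h, Set.ncard_image_of_injective _ fun x y h => congrFun h 0, Set.ncard_coe_finset,
    Fin.card_Ioi]

theorem enc_dim_zero (a : Word (dim nn 0) q) : enc a = symb a := by
  rw [enc]
  simp [un_zero, symb]

section terms

def rootT : Term := .bin .times (.read 5 (.lit 0)) (.var 3)

/-- The number of symbols above the value of a variable is the root of the tables. -/
def rootP (x : ℕ) : Prog := .wr 8 rootT (.bin .minus (.bin .minus (.var 1) (.lit 1)) (.var x))

/-- A step of the binary search. -/
def bisectP : Prog :=
  .seq (.asg 12 (.bin .quot (.bin .plus (.var 10) (.var 11)) (.lit 2))) <| .seq (rootP 12) <|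
    .ite (.le countT (.var 6)) (.asg 11 (.var 12)) (.asg 10 (.bin .plus (.var 12) (.lit 1)))

/-- Binary search for the next symbol. -/
def symbolP : Prog :=
  .seq (.asg 10 (.lit 0)) <| .seq (.asg 11 (.bin .minus (.var 1) (.lit 1))) <|
  .seq (.asg 7 (.lit 0)) <| .seq (.asg 8 (.lit 0)) <| .seq (.logl bisectP) <|
  .seq (rootP 10) <| .seq (.wr 9 (.lit 0) (.var 10)) (.asg 17 (.lit 1))

end terms

/-- The next symbol is between the values of the variables `10` and `11`. -/
structure Search (F : ∀ k, Word (dim nn k) q) (s : ℕ → ℕ) (d : ℕ) (w : Word (dim nn d) q)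
    (P J e : ℕ) (σ : State) : Prop where
  known : Known F s d w P J σ
  b_eq : σ.var 7 = 0
  ty_eq : σ.var 8 = 0
  le : σ.var 10 ≤ symb (F 0)
  ge : symb (F 0) ≤ σ.var 11
  lt_q : σ.var 11 < q
  diff : σ.var 11 - σ.var 10 < 2 ^ e

theorem Known.put (K : Known F s d w P J σ) (hd : 0 < d) (v : ℕ) :
    Known F s d w P J (σ.put 8 (s 0 * size nn d) v) := by
  have hs := row_lt (d := d) K.digits_lt
  refine ⟨K.tables.congr_cells (fun _ _ => rfl) (fun a ha => ?_) (fun _ _ _ _ _ _ => rfl)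
    (fun _ _ _ _ => rfl) fun j hj l hl r hr => ?_, K.digits, K.digits_lt, K.foci, K.val_eq,
    K.target⟩
  · rw [State.put_arr, if_neg (by rintro rfl; simp at ha)]
  · rw [State.put_arr, if_pos rfl, Function.update_of_ne]
    intro h
    obtain ⟨rfl, rfl, -⟩ := cell_inj (a' := 0) (b' := s 0) (c' := 0) (hl.trans (hs j hj)) hr
      (hs 0 hd) (size_pos d) (by rw [h]; ring)
    omega

theorem le_cap (B : Base nn d q σ) (hq : 0 < q) : q + 1 ≤ σ.var 5 := by
  have h1 := B.cap
  have h2 : q ≤ q ^ size nn d := Nat.le_self_pow (size_pos d).ne' q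
  omega

theorem Known.run_root (K : Known F s d w P J σ) (hd : 0 < d) (hq : 0 < q) (x : ℕ) :
    (rootP x).run σ = σ.put 8 (s 0 * size nn d) (q - 1 - σ.var x) := by
  have B := K.tables.base
  have := le_cap B hq
  simp only [rootP, rootT, Prog.run, Term.eval, Op.eval, K.digits 0 hd, B.N_eq, B.q_eq]
  rw [min_eq_left (by omega)]

/-- With the symbols above `m` as the root, the count is at most `J` exactly if the wanted word is
not above the bound, that is, if its next symbol is at most `m`. -/
theorem Search.run_step {e : ℕ} (S : Search F s d w P J e σ) (hd : 0 < d) (hq : 0 < q)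
    (x : Necklace (dim nn d) q) (hw : x.canon = w)
    (hJ : {y : Necklace (dim nn d) q | lt x.canon y.canon}.ncard = J) :
    Search F s d w P J (e - 1) (bisectP.run σ) := by
  have hcw : canon w = w := by rw [← hw, canon_necklace_canon]
  have K := S.known
  have hcap := le_cap K.tables.base hq
  have h1 := S.le
  have h2 := S.ge
  have h3 := S.lt_q
  have h4 := S.diff
  set m := (σ.var 10 + σ.var 11) / 2 with hm
  have K1 := K.set (x := 12) (by omega) m
  have K2 := K1.put hd (q - 1 - m)
  have hr := K1.run_root hd hq 12
  rw [bisectP, Prog.run, Prog.run, Prog.run]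
  simp only [Term.eval, Op.eval]
  rw [← hm, min_eq_left (by omega), hr, State.set_var, if_pos rfl]
  set ρ := (σ.set 12 m).put 8 (s 0 * size nn d) (q - 1 - m) with hρ
  have v10 : ρ.var 10 = σ.var 10 := by simp [hρ]
  have v11 : ρ.var 11 = σ.var 11 := by simp [hρ]
  have v12 : ρ.var 12 = m := by simp [hρ]
  have v7 : ρ.var 7 = 0 := by simpa [hρ] using S.b_eq
  have v8 : ρ.var 8 = 0 := by simpa [hρ] using S.ty_eq
  have v5 : ρ.var 5 = σ.var 5 := by simp [hρ]
  have h8 : ρ.arr 8 (s 0 * size nn d) = q - 1 - m := by simp [hρ]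
  clear_value ρ
  -- Only the set in dimension `0` matters for the chain.
  let U : ∀ k, Set (Word (dim nn k) q) := fun k => match k with
    | 0 => {a | m < symb a}
    | _ + 1 => ∅
  have Q : Query F s 0 0 0 (U 0) d ρ := K2.tables.query_zero hd K2.digits K2.digits_lt v7 v8
    (upOrb_symb m) (by rw [h8]; exact (ncard_symb (by omega)).symm)
  have hup := Query.upOrb_chain (F := F) (hs := K2.digits_lt) (U := U)
    (bnd := Query.bounds nn d 0 0 0) Q.up (Nat.zero_le d)
  have hdec : {y : Necklace (dim nn d) q | y.canon ∈ chain F s K2.digits_lt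
      (Query.bounds nn d 0 0 0) 0 U d}.ncard ≤ J ↔ symb (F 0) ≤ m := by
    have h := canon_notMem_iff hup x
    rw [hJ, hw, K2.foci.mem_chain_zero hcw Q.up] at h
    exact h.symm.trans (not_lt (a := m))
  rw [Prog.run, Term.eval_le (Q.eval_count hq) (Lev.eval_var K2.target), ind_congr hdec]
  have hpow : 2 ^ e ≤ 2 * 2 ^ (e - 1) := by
    rw [← pow_succ']
    exact Nat.pow_le_pow_right (by omega) (by omega)
  by_cases hc : symb (F 0) ≤ m
  · rw [if_pos (ind_ne_zero.2 hc)]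
    simp only [Prog.run, Term.eval, v12, v5]
    rw [min_eq_left (by omega)]
    refine ⟨K2.set (by omega) _, ?_, ?_, ?_, ?_, ?_, ?_⟩
    all_goals simp only [State.set_var]; norm_num
    · exact v7
    · exact v8
    · omega
    · omega
    · omega
    · omega
  · rw [if_neg (not_not.2 (ind_neg hc))]
    simp only [Prog.run, Term.eval, Op.eval, v12, v5]
    rw [min_eq_left (by omega)]
    refine ⟨K2.set (by omega) _, ?_, ?_, ?_, ?_, ?_, ?_⟩
    all_goals simp only [State.set_var]; norm_num
    · exact v7
    · exact v8
    · omega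
    · omega
    · omega
    · omega

theorem Known.run_symbol (K : Known F s d w P J σ) (hd : 0 < d) (hq : 0 < q)
    (x : Necklace (dim nn d) q) (hw : x.canon = w)
    (hJ : {y : Necklace (dim nn d) q | lt x.canon y.canon}.ncard = J) :
    Casc F s d w P J 0 (symbolP.run σ) := by
  have B := K.tables.base
  have hcap := le_cap B hq
  have hsymb : symb (F 0) < q := (F 0 0).isLt
  have S : Search F s d w P J (Nat.size q)
      ((((σ.set 10 0).set 11 (q - 1)).set 7 0).set 8 0) := by
    refine ⟨(((K.set (by omega) 0).set (by omega) (q - 1)).set (by omega) 0).set (by omega) 0,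
      ?_, ?_, ?_, ?_, ?_, ?_⟩
    all_goals simp
    · omega
    · omega
    -- Since `q < 2 ^ Nat.size q`, this many halvings leave a single symbol.
    · have := Nat.lt_size_self q
      omega
  have hstart : symbolP.run σ = Prog.run (.seq (.logl bisectP) <| .seq (rootP 10) <|
      .seq (.wr 9 (.lit 0) (.var 10)) (.asg 17 (.lit 1)))
      ((((σ.set 10 0).set 11 (q - 1)).set 7 0).set 8 0) := by
    simp only [symbolP, Prog.run, Term.eval, Op.eval, Nat.zero_min, State.set_var]
    norm_num
    rw [B.q_eq, min_eq_left (by omega)]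
  rw [hstart]
  generalize (((σ.set 10 0).set 11 (q - 1)).set 7 0).set 8 0 = τ at S ⊢
  have hiter : ∀ i, ∀ τ, Search F s d w P J (Nat.size q) τ → Search F s d w P J (Nat.size q - i)
      (bisectP.run^[i] τ) := by
    intro i τ h
    induction i with
    | zero => exact h
    | succ i ih =>
      rw [Function.iterate_succ_apply']
      exact ih.run_step hd hq x hw hJ
  have S' := hiter (Nat.size q) τ S
  rw [Nat.sub_self] at S'
  rw [Prog.run, Prog.run, Prog.run, Prog.run, Prog.run, Prog.run, S.known.tables.base.q_eq]
  generalize bisectP.run^[Nat.size q] τ = ρ at S' ⊢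
  have h1 := S'.le
  have h2 := S'.ge
  have h3 := S'.diff
  have h10 : ρ.var 10 = symb (F 0) := by omega
  have Kρ := S'.known
  have hcap := le_cap Kρ.tables.base hq
  rw [Kρ.run_root hd hq]
  simp only [Term.eval, State.put_var, h10]
  rw [min_eq_left (by omega), min_eq_left (by omega)]
  have K2 := Kρ.put hd (q - 1 - symb (F 0))
  refine ⟨K2.tables.congr (fun x hx => ?_) (fun a ha => ?_), fun j hj => ?_, K2.digits_lt, K2.foci,
    fun j hj => by omega, ?_, fun r hr => ?_, fun _ h hh => ?_, ?_, ?_⟩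
  · rw [State.set_var, if_neg (by rintro rfl; simp at hx)]; rfl
  · rw [State.set_arr, State.put_arr, if_neg (by rintro rfl; simp at ha)]
  · rw [State.set_arr, State.put_arr, if_neg (by omega)]; exact K2.digits j hj
  · rw [K2.val_eq]; rfl
  · obtain rfl : r = 0 := by rw [size_zero] at hr; omega
    rw [vadd_dim_zero, enc_dim_zero]
    simp
  · obtain rfl : h = 0 := by rw [size_zero] at hh; omega
    simp only [vadd_dim_zero, and_true, Set.ofPred_mem_eq, above_symb, ncard_symb hsymb]
    simp
  · simpa using Kρ.target
  · simp

end MDWord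

/-! ### The main program -/

namespace MDWord

open RAM

variable {nn : ℕ → ℕ} [∀ k, NeZero (nn k)] {d q : ℕ} {F : ∀ k, Word (dim nn k) q} {s : ℕ → ℕ}
  {σ τ : State} {J : ℕ} {w : Word (dim nn d) q}

section terms

/-- The tables of products, powers and sums. -/
def prodsP : Prog :=
  .seq (.wr 2 (.lit 0) (.lit 1)) <| .loop 20 (.var 0) <|
    .wr 2 (.bin .plus (.var 20) (.lit 1)) (.bin .times (.read 2 (.var 20)) (.read 0 (.var 20)))

def powsP : Prog :=
  .seq (.wr 3 (.lit 0) (.lit 1)) <| .loop 20 (.var 3) <|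
    .wr 3 (.bin .plus (.var 20) (.lit 1)) (.bin .times (.read 3 (.var 20)) (.var 1))

def addT : Term :=
  .sum 22 (.var 0) (.bin .times (.mod (.bin .plus (.bin .quot (.var 20) (.read 2 (.var 22)))
    (.bin .quot (.var 21) (.read 2 (.var 22)))) (.read 0 (.var 22))) (.read 2 (.var 22)))

def addsP : Prog :=
  .loop 20 (.var 3) <| .loop 21 (.var 3) <| .wr 4 (cellT (.var 20) (.var 21)) addT

/-- The number of necklaces that are larger than the wanted one. -/
def targetP : Prog :=
  .seq (.wr 8 (.lit 0) (.var 1)) <| .seq (.asg 7 (.lit 0)) <| .seq (.asg 8 (.lit 0)) <|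
    .asg 6 (.bin .minus (.bin .minus countT (.lit 1)) (.var 2))

def outputP : Prog :=
  .loop 20 (.var 3) <| .wr 1 (.var 20) <| .bin .plus
    (.mod (.bin .quot (.read 9 (.lit 0)) (.read 3 (.var 20))) (.var 1)) (.lit 1)

def mainP : Prog :=
  .seq prodsP <| .seq powsP <| .seq addsP <| .seq targetP <|
  .seq (.loop 13 (.var 3) (.seq symbolP cascadeP)) outputP

end terms

/-- The input and the sizes. -/
structure Start (nn : ℕ → ℕ) [∀ k, NeZero (nn k)] (d q : ℕ) (σ : State) : Prop where
  d_eq : σ.var 0 = d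
  q_eq : σ.var 1 = q
  N_eq : σ.var 3 = size nn d
  M_eq : σ.var 4 = size nn d * (d + 1)
  le : σ.var 4 ≤ σ.var 5
  cap : 2 * q ^ size nn d ≤ σ.var 5
  dims : ∀ j < d, σ.arr 0 j = nn j

theorem Start.congr (S : Start nn d q σ) (h : τ.var = σ.var) (h' : τ.arr 0 = σ.arr 0) :
    Start nn d q τ := by
  refine ⟨?_, ?_, ?_, ?_, ?_, ?_, ?_⟩
  all_goals first | rw [h] | rw [h']
  exacts [S.d_eq, S.q_eq, S.N_eq, S.M_eq, S.le, S.cap, S.dims]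

theorem Start.size_le (S : Start nn d q σ) : size nn d ≤ σ.var 5 := by
  have := S.le
  rw [S.M_eq] at this
  nlinarith

theorem Start.run_prods (S : Start nn d q σ) :
    (prodsP.run σ).var = σ.var ∧ (∀ a, a ≠ 2 → (prodsP.run σ).arr a = σ.arr a) ∧
      ∀ j ≤ d, (prodsP.run σ).arr 2 j = size nn j := by
  have h1 : 1 ≤ σ.var 5 := (size_pos (nn := nn) d).trans_le S.size_le
  have hfill := Prog.run_fill (x := 20) (a := 2) (m := d) (e := .var 0)
    (i := .bin .plus (.var 20) (.lit 1))
    (v := .bin .times (.read 2 (.var 20)) (.read 0 (.var 20))) (σ := σ.put 2 0 1)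
    (A := fun j => j + 1) (V := fun j => size nn (j + 1))
    (Lev.eval_var S.d_eq) (by rw [State.put_var, S.M_eq]; nlinarith [size_pos (nn := nn) d])
    (by omega) (fun j _ j' hj' h => by omega) (fun j hj τ hτ hF => by
      have h20 : τ.var 20 = j := by rw [hτ]; simp
      refine ⟨Term.eval_bin .plus (Lev.eval_var h20) rfl, ?_,
        (size_mono (show j + 1 ≤ d from hj)).trans S.size_le⟩
      rw [size_succ]
      refine Term.eval_bin .times ?_ ?_
      · rw [Term.eval, Lev.eval_var h20]
        cases j with
        | zero =>
          have := hF.other 0 (fun _ _ => by omega)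
          simp only [State.set_arr, State.put_arr] at this
          rw [this]
          simp [size]
        | succ j => exact hF.cell j (by omega)
      · rw [Term.eval, Lev.eval_var h20, ← S.dims j hj]
        exact congrFun (hF.arr 0 (by omega)) j)
  have hrun : prodsP.run σ = Prog.run (.loop 20 (.var 0) <|
      .wr 2 (.bin .plus (.var 20) (.lit 1)) (.bin .times (.read 2 (.var 20)) (.read 0 (.var 20))))
      (σ.put 2 0 1) := by
    rw [prodsP, Prog.run]
    simp only [Prog.run, Term.eval]
    rw [min_eq_left h1]
  rw [hrun]
  refine ⟨hfill.var, fun a ha => ?_, fun j hj => ?_⟩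
  · rw [hfill.arr a ha, State.put_arr, if_neg ha]
  · cases j with
    | zero =>
      rw [hfill.other 0 (fun _ _ => by omega)]
      simp [size]
    | succ j => exact hfill.cell j (by omega)

theorem Start.run_pows (S : Start nn d q σ) (hq : 0 < q) :
    (powsP.run σ).var = σ.var ∧ (∀ a, a ≠ 3 → (powsP.run σ).arr a = σ.arr a) ∧
      ∀ j < size nn d, (powsP.run σ).arr 3 j = q ^ j := by
  have h1 : 1 ≤ σ.var 5 := (size_pos (nn := nn) d).trans_le S.size_le
  have hfill := Prog.run_fill (x := 20) (a := 3) (m := size nn d) (e := .var 3)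
    (i := .bin .plus (.var 20) (.lit 1))
    (v := .bin .times (.read 3 (.var 20)) (.var 1)) (σ := σ.put 3 0 1)
    (A := fun j => j + 1) (V := fun j => q ^ (j + 1))
    (Lev.eval_var S.N_eq) (by rw [State.put_var, S.M_eq]; nlinarith)
    (by omega) (fun j _ j' hj' h => by omega) (fun j hj τ hτ hF => by
      have h20 : τ.var 20 = j := by rw [hτ]; simp
      have h1 : τ.var 1 = q := by rw [hτ]; simpa using S.q_eq
      refine ⟨Term.eval_bin .plus (Lev.eval_var h20) rfl, ?_, ?_⟩
      · rw [pow_succ]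
        refine Term.eval_bin .times ?_ (Lev.eval_var h1)
        rw [Term.eval, Lev.eval_var h20]
        cases j with
        | zero =>
          have := hF.other 0 (fun _ _ => by omega)
          simp only [State.set_arr, State.put_arr] at this
          rw [this]
          simp
        | succ j => exact hF.cell j (by omega)
      · have := S.cap
        have := Nat.pow_le_pow_right hq (show j + 1 ≤ size nn d from hj)
        rw [State.put_var]
        omega)
  have hrun : powsP.run σ = Prog.run (.loop 20 (.var 3) <|
      .wr 3 (.bin .plus (.var 20) (.lit 1)) (.bin .times (.read 3 (.var 20)) (.var 1)))
      (σ.put 3 0 1) := by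
    rw [powsP, Prog.run]
    simp only [Prog.run, Term.eval]
    rw [min_eq_left h1]
  rw [hrun]
  refine ⟨hfill.var, fun a ha => ?_, fun j hj => ?_⟩
  · rw [hfill.arr a ha, State.put_arr, if_neg ha]
  · cases j with
    | zero =>
      rw [hfill.other 0 (fun _ _ => by omega)]
      simp
    | succ j => exact hfill.cell j (by omega)

theorem Start.eval_add (S : Start nn d q σ) (hp : ∀ j ≤ d, σ.arr 2 j = size nn j) {a b : ℕ}
    (ha : σ.var 20 = a) (hb : σ.var 21 = b) :
    addT.eval σ = posIndex (un (dim nn d) a + un (dim nn d) b) := by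
  rw [posIndex_un_dim]
  refine Term.eval_sum (Lev.eval_var S.d_eq) (by rw [S.M_eq]; nlinarith [size_pos (nn := nn) d])
    fun j hj => ?_
  have h2 : (Term.read 2 (.var 22)).eval (σ.set 22 j) = size nn j := by
    rw [Term.eval, Lev.eval_var (v := j) (by simp)]
    exact hp j hj.le
  have h0 : (Term.read 0 (.var 22)).eval (σ.set 22 j) = nn j := by
    rw [Term.eval, Lev.eval_var (v := j) (by simp)]
    exact S.dims j hj
  exact Term.eval_bin .times (Term.eval_mod (Term.eval_bin .plus
    (Term.eval_bin .quot (Lev.eval_var (by simpa using ha)) h2)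
    (Term.eval_bin .quot (Lev.eval_var (by simpa using hb)) h2)) h0) h2

theorem Start.run_adds (S : Start nn d q σ) (hp : ∀ j ≤ d, σ.arr 2 j = size nn j) :
    (∀ x, x ≠ 20 → x ≠ 21 → (addsP.run σ).var x = σ.var x) ∧
      (∀ a, a ≠ 4 → (addsP.run σ).arr a = σ.arr a) ∧
      ∀ a < size nn d, ∀ b < size nn d, (addsP.run σ).arr 4 (a * size nn d + b) =
        posIndex (un (dim nn d) a + un (dim nn d) b) := by
  have hM : size nn d ≤ σ.var 4 := by rw [S.M_eq]; nlinarith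
  obtain ⟨τ, ⟨h1, h2, h3⟩, h⟩ := Prog.run_loop (x := 20) (e := .var 3) (σ := σ) (m := size nn d)
    (p := .loop 21 (.var 3) (.wr 4 (cellT (.var 20) (.var 21)) addT))
    (Lev.eval_var S.N_eq) hM
    (fun i τ => (∀ x, x ≠ 20 → τ.var x = σ.var x) ∧ (∀ a, a ≠ 4 → τ.arr a = σ.arr a) ∧
      ∀ a < i, ∀ b < size nn d, τ.arr 4 (a * size nn d + b) =
        posIndex (un (dim nn d) a + un (dim nn d) b))
    ⟨fun _ _ => rfl, fun _ _ => rfl, fun a ha => absurd ha (by omega)⟩ (by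
      rintro i hi τ ⟨h1, h2, h3⟩
      have h1' : ∀ x, x ≠ 20 → (τ.set 20 i).var x = σ.var x := fun x hx => by
        rw [State.set_var, if_neg hx, h1 x hx]
      have hfill := Prog.run_fill (x := 21) (a := 4) (m := size nn d) (e := .var 3)
        (i := cellT (.var 20) (.var 21)) (v := addT) (σ := τ.set 20 i)
        (A := fun j => i * size nn d + j)
        (V := fun j => posIndex (un (dim nn d) i + un (dim nn d) j))
        (Lev.eval_var ((h1' 3 (by omega)).trans S.N_eq)) (by rw [h1' 4 (by omega)]; exact hM)
        (by omega) (fun j _ j' hj' h => by omega) (fun j hj ρ hρ hF => by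
          have h21 : ρ.var 21 = j := by rw [hρ]; simp
          have h20 : ρ.var 20 = i := by rw [hρ]; simp
          have hv : ∀ x, x ≠ 20 → x ≠ 21 → ρ.var x = σ.var x := fun x hx hx' => by
            rw [hρ, State.set_var, if_neg hx', h1' x hx]
          have ha : ∀ a, a ≠ 4 → ρ.arr a = σ.arr a := fun a ha => (hF.arr a ha).trans (h2 a ha)
          have Sρ : Start nn d q ρ := by
            constructor
            · rw [hv 0 (by omega) (by omega)]; exact S.d_eq
            · rw [hv 1 (by omega) (by omega)]; exact S.q_eq
            · rw [hv 3 (by omega) (by omega)]; exact S.N_eq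
            · rw [hv 4 (by omega) (by omega)]; exact S.M_eq
            · rw [hv 4 (by omega) (by omega), hv 5 (by omega) (by omega)]; exact S.le
            · rw [hv 5 (by omega) (by omega)]; exact S.cap
            · rw [ha 0 (by omega)]; exact S.dims
          refine ⟨?_, Sρ.eval_add (by rw [ha 2 (by omega)]; exact hp) h20 h21, ?_⟩
          · rw [Lev.eval_cell (Lev.eval_var h20) (Lev.eval_var h21), Sρ.N_eq]
          · rw [h1' 5 (by omega)]
            have := posIndex_lt (un (dim nn d) i + un (dim nn d) j)
            rw [size_eq] at this
            exact this.le.trans S.size_le)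
      refine ⟨fun x hx => ?_, fun a ha => (hfill.arr a ha).trans (h2 a ha), fun a ha b hb => ?_⟩
      · rw [hfill.var, h1' x hx]
      · rcases Nat.lt_succ_iff_lt_or_eq.1 ha with ha | rfl
        · rw [hfill.other _ fun j hj h => ?_]
          · exact h3 a ha b hb
          · have := cell_inj₂ hj hb h
            omega
        · exact hfill.cell b hb)
  rw [addsP, h]
  exact ⟨fun x hx _ => by rw [State.set_var, if_neg hx, h1 x hx], h2, h3⟩

theorem Start.run_tables (S : Start nn d q σ) (hq : 0 < q) {σ' : State}
    (hσ' : σ' = addsP.run (powsP.run (prodsP.run σ))) :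
    Base nn d q σ' ∧ σ'.var 2 = σ.var 2 ∧ σ'.arr 5 = σ.arr 5 := by
  obtain ⟨a1, a2, a3⟩ := S.run_prods
  have S1 := S.congr a1 (a2 0 (by omega))
  obtain ⟨b1, b2, b3⟩ := S1.run_pows hq
  have S2 := S1.congr b1 (b2 0 (by omega))
  obtain ⟨c1, c2, c3⟩ := S2.run_adds (by rw [b2 2 (by omega)]; exact a3)
  rw [← hσ'] at c1 c2 c3
  refine ⟨⟨?_, ?_, ?_, ?_, ?_, ?_, ?_, ?_, ?_, c3⟩, ?_, ?_⟩
  · rw [c1 0 (by omega) (by omega)]; exact S2.d_eq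
  · rw [c1 1 (by omega) (by omega)]; exact S2.q_eq
  · rw [c1 3 (by omega) (by omega)]; exact S2.N_eq
  · rw [c1 4 (by omega) (by omega)]; exact S2.M_eq
  · rw [c1 4 (by omega) (by omega), c1 5 (by omega) (by omega)]; exact S2.le
  · rw [c1 5 (by omega) (by omega)]; exact S2.cap
  · rw [c2 0 (by omega)]; exact S2.dims
  · rw [c2 2 (by omega), b2 2 (by omega)]; exact a3
  · rw [c2 3 (by omega)]; exact b3
  · rw [c1 2 (by omega) (by omega), b1, a1]
  · rw [c2 5 (by omega), b2 5 (by omega), a2 5 (by omega)]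

/-- With all symbols as the root and all digits `0` the bound is empty, so the query counts all
necklaces. Subtracting the necklace itself and its rank leaves the number of larger ones. -/
theorem Base.run_target (B : Base nn d q σ) (hd : 0 < d) (hq : 0 < q) (h5 : ∀ j < d, σ.arr 5 j = 0)
    (x : Necklace (dim nn d) q) (hx : x.rank = σ.var 2) :
    ∃ F, Known F (fun _ => 0) d x.canon 0 {y : Necklace (dim nn d) q | lt x.canon y.canon}.ncard
      (targetP.run σ) := by
  obtain ⟨F, hF⟩ := exists_foci hq (fun _ => 0) x.canon
  have hcap := le_cap B hq
  have T : Tables F (fun _ => 0) d σ := ⟨B, fun _ _ l hl => absurd hl (by omega),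
    fun _ _ l hl => absurd hl (by omega), fun _ _ l hl => absurd hl (by omega)⟩
  have K : Known F (fun _ => 0) d x.canon 0 (σ.var 6) σ :=
    ⟨T, h5, fun _ => NeZero.pos _, hF, by simp [val], rfl⟩
  have K1 := ((K.put hd q).set (x := 7) (by omega) 0).set (x := 8) (by omega) 0
  let U : ∀ k, Set (Word (dim nn k) q) := fun _ => Set.univ
  have Q := K1.tables.query_zero hd K1.digits K1.digits_lt (by simp) (by simp) (U := U 0)
    (fun _ _ _ _ => trivial) (by simp [U])
  have hc := Q.eval_count hq
  simp only [chain_univ (U := U) rfl (fun _ => rfl)] at hc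
  have hcard : {y : Necklace (dim nn d) q | y.canon ∈ (Set.univ : Set (Word (dim nn d) q))}.ncard =
      Nat.card (Necklace (dim nn d) q) := by
    rw [← Set.ncard_univ]
    rfl
  rw [hcard] at hc
  have hle : Nat.card (Necklace (dim nn d) q) ≤ σ.var 5 := by
    refine (Nat.card_le_card_of_injective _ necklace_canon_injective).trans ?_
    rw [← Set.ncard_univ]
    exact Query.ncard_le_cap B hq le_rfl _
  have hrank := rank_add x
  refine ⟨F, ?_⟩
  have hrun : targetP.run σ = (((σ.put 8 0 q).set 7 0).set 8 0).set 6
      {y : Necklace (dim nn d) q | lt x.canon y.canon}.ncard := by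
    rw [zero_mul] at hc
    simp only [targetP, Prog.run]
    simp only [Term.eval, Op.eval, State.put_var, State.set_var, Nat.zero_min, B.q_eq]
    norm_num
    rw [min_eq_left (a := q) (by omega), hc, min_eq_left (by omega)]
    congr 1
    omega
  rw [hrun]
  rw [zero_mul] at K1
  refine ⟨K1.tables.congr (fun y hy => ?_) fun _ _ => rfl, K1.digits, K1.digits_lt, hF, K.val_eq,
    State.set_var _ _ _ _⟩
  rw [State.set_var, if_neg (by rintro rfl; simp at hy)]

/-- Each round makes one more symbol known. After `N` rounds the word must be complete, because
digits below the sizes represent only numbers below `N`. -/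
theorem Known.run_symbols (K : Known F s d w 0 J σ) (hd : 0 < d) (hq : 0 < q)
    (x : Necklace (dim nn d) q) (hw : x.canon = w)
    (hJ : {y : Necklace (dim nn d) q | lt x.canon y.canon}.ncard = J) :
    ∃ F s P, Casc F s d w P J d (Prog.run (.loop 13 (.var 3) (.seq symbolP cascadeP)) σ) := by
  have B := K.tables.base
  obtain ⟨τ, hτ, h⟩ := Prog.run_loop (x := 13) (e := .var 3) (σ := σ) (m := size nn d)
    (p := .seq symbolP cascadeP) (Lev.eval_var B.N_eq) (by rw [B.M_eq]; nlinarith)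
    (fun P τ => (∃ F s, Known F s d w P J τ) ∨ P = size nn d ∧ ∃ F s P, Casc F s d w P J d τ)
    (.inl ⟨F, s, K⟩) (by
      rintro P hP τ (⟨F, s, K⟩ | ⟨rfl, -⟩)
      · have C := (K.set (x := 13) (by omega) P).run_symbol hd hq x hw hJ
        rcases C.run_cascade hq x hw hJ with ⟨F, s, C⟩ | h
        · have h1 := C.val_eq
          exact .inr ⟨by omega, F, s, P, C⟩
        · exact .inl h
      · omega)
  rcases hτ with ⟨F, s, K⟩ | ⟨-, F, s, P, C⟩
  · have := val_lt K.digits_lt d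
    rw [K.val_eq] at this
    omega
  · rw [h]
    exact ⟨F, s, P, C.set (by omega) (by omega) _⟩

theorem Casc.run_output {P : ℕ} (C : Casc F s d w P J d σ) (hq : 0 < q) {r : ℕ}
    (hr : r < size nn d) :
    (outputP.run σ).arr 1 r = (w (un (dim nn d) r) : ℕ) + 1 := by
  have B := C.tables.base
  have hcap := le_cap B hq
  have h9 : σ.arr 9 0 = enc w := by
    rw [C.letters 0 (size_pos d), C.foci.top, un_zero, zero_vadd]
  have hfill := Prog.run_fill (x := 20) (a := 1) (m := size nn d) (e := .var 3)
    (i := .var 20) (v := .bin .plus (.mod (.bin .quot (.read 9 (.lit 0)) (.read 3 (.var 20)))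
      (.var 1)) (.lit 1)) (σ := σ) (A := fun j => j)
    (V := fun j => (w (un (dim nn d) j) : ℕ) + 1)
    (Lev.eval_var B.N_eq) (by rw [B.M_eq]; nlinarith) (by omega) (fun j _ j' hj' h => by omega)
    (fun j hj τ hτ hF => by
      have h20 : τ.var 20 = j := by rw [hτ]; simp
      have h1 : τ.var 1 = q := by rw [hτ]; simpa using B.q_eq
      have h3 : τ.arr 3 j = q ^ j := (congrFun (hF.arr 3 (by omega)) j).trans (B.pows j hj)
      have h9' : τ.arr 9 0 = enc w := (congrFun (hF.arr 9 (by omega)) 0).trans h9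
      refine ⟨Lev.eval_var h20, ?_, by omega⟩
      rw [← enc_div_mod w (by rw [size_eq]; exact hj)]
      exact Term.eval_bin .plus (Term.eval_mod (Term.eval_bin .quot h9'
        (by rw [Term.eval, Lev.eval_var h20]; exact h3)) (Lev.eval_var h1)) rfl)
  exact hfill.cell r hr

theorem Start.run_main (S : Start nn d q σ) (hd : 0 < d) (hq : 0 < q) (h5 : ∀ j < d, σ.arr 5 j = 0)
    (x : Necklace (dim nn d) q) (hx : x.rank = σ.var 2) {r : ℕ} (hr : r < size nn d) :
    (mainP.run σ).arr 1 r = (x.canon (un (dim nn d) r) : ℕ) + 1 := by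
  obtain ⟨B, h2, h5'⟩ := S.run_tables hq rfl
  obtain ⟨F, K⟩ := B.run_target hd hq (by rw [h5']; exact h5) x (hx.trans h2.symm)
  obtain ⟨G, s, P, C⟩ := K.run_symbols hd hq x rfl rfl
  exact C.run_output hq hr

end MDWord

/-! ### Arrays with a single cell -/

namespace MDWord

section single

variable {d q : ℕ}

theorem canon_of_subsingleton {n : Fin d → ℕ} [∀ k, NeZero (n k)] [Subsingleton (Pos n)]
    (a : Word n q) : canon a = a := by
  obtain ⟨g, hg⟩ := canon_mem a
  rw [← hg, Subsingleton.elim g 0, zero_vadd]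

theorem lt_of_forall_eq_one {d : ℕ} {n : Fin d → ℕ} [∀ k, NeZero (n k)] {q : ℕ}
    (h : ∀ k, n k = 1) (w u : Word n q) : lt w u ↔ w 0 < u 0 := by
  have hs : ∀ {d : ℕ} {n : Fin d → ℕ}, (∀ k, n k = 1) → Subsingleton (Pos n) := fun h =>
    ⟨fun a b => funext fun k => by have := (a k).isLt; have := (b k).isLt; have := h k; omega⟩
  induction d with
  | zero =>
    rw [lt, (hs h).elim (0 : Pos n) fun k => k.elim0]
  | succ d ih =>
    have hS := hs h
    have hS' := hs (n := fr n) fun k => h k.castSucc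
    have hslice : ∀ (v : Word n q) j, slice v j 0 = v 0 := fun v j => by
      rw [slice]; exact congrArg v (Subsingleton.elim _ _)
    have hpre : ∀ a b : Word (fr n) q, pre a b ↔ a 0 < b 0 := fun a b => by
      have ht : ∀ c : Word (fr n) q, trIndex c = 0 := fun c => by
        rw [← canon_of_subsingleton c, trIndex_canon]
      rw [pre, ht, ht, canon_of_subsingleton, canon_of_subsingleton]
      have := ih (fun k => h k.castSucc) a b
      simp [this]
    rw [lt_succ_iff]
    constructor
    · rintro ⟨j, -, -, hj⟩
      rw [hpre, hslice, hslice] at hj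
      exact hj
    · intro hwu
      refine ⟨0, fun i hi => absurd hi (by simp), fun he => ?_, ?_⟩
      · have := congrFun he 0
        rw [hslice, hslice] at this
        exact hwu.ne this
      · rw [hpre, hslice, hslice]
        exact hwu

/-- With one cell there are only trivial translations, and the order is that of the symbols; so the
symbol is the rank. -/
theorem rank_of_forall_eq_one {n : Fin d → ℕ} [∀ k, NeZero (n k)] (h : ∀ k, n k = 1)
    (x : Necklace n q) : x.rank = x.canon 0 := by
  have hS : Subsingleton (Pos n) :=
    ⟨fun a b => funext fun k => by have := (a k).isLt; have := (b k).isLt; have := h k; omega⟩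
  have hbij : Function.Bijective fun y : Necklace n q => y.canon 0 := by
    refine ⟨fun y z hyz => necklace_canon_injective (funext fun p => ?_), fun c => ?_⟩
    · rw [Subsingleton.elim p 0]; exact hyz
    · exact ⟨Quotient.mk _ fun _ => c, by simp only [canon_mk, canon_of_subsingleton]⟩
  rw [Necklace.rank, Nat.card_congr (Equiv.subtypeEquiv (Equiv.ofBijective _ hbij)
    (q := fun c => c < x.canon 0) fun y => by rw [lt_of_forall_eq_one h]; rfl)]
  rw [Nat.card_eq_fintype_card, Fintype.card_subtype, ← Fin.card_Iio]
  congr 1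
  ext c
  simp

end single

end MDWord

/-! ### The final program and its running time -/

namespace RAM

/-- The product of the values of an expression for the values `0, 1, …` of the variable `7`. -/
def prodC (x y : ℕ) (f : Expr) : Cmd :=
  .seq (.assign x (.lit 1)) <| .seq (.assign 6 (.var y)) <| .seq (.assign 7 (.lit 0)) <|
    .loop (.bin .minus (.var 6) (.var 7)) <| .seq (.assign x (.bin .times (.var x) f))
      (.assign 7 (.bin .plus (.var 7) (.lit 1)))

theorem exec_prodC {W : ℕ} {σ : State} {x y m : ℕ} {f : Expr} (g : ℕ → ℕ) (hx : x < 6) (hxy : x ≠ y)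
    (hm : σ.var y = m) (hmW : m + 1 < W)
    (hf : ∀ i < m, ∀ τ : State, τ.var 7 = i → (∀ z, z ≠ x → z ≠ 6 → z ≠ 7 → τ.var z = σ.var z) →
      τ.arr = σ.arr → f.eval τ = g i ∧ f.Fits W τ)
    (hW : ∀ i ≤ m, ∏ j ∈ Finset.range i, g j < W) :
    ∃ t τ, Exec W (prodC x y f) σ t τ ∧ t ≤ m * (f.cost + 11) + 11 ∧
      τ.var x = ∏ j ∈ Finset.range m, g j ∧ τ.var 6 = m ∧ τ.var 7 = m ∧
      (∀ z, z ≠ x → z ≠ 6 → z ≠ 7 → τ.var z = σ.var z) ∧ τ.arr = σ.arr := by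
  have h1W : 1 < W := hW 0 (by omega)
  obtain ⟨τ1, E1, U1⟩ := exec_upd (W := W) (τ := σ) x (e := .lit 1) 1 rfl h1W
  have v1 : τ1.var y = m := by rw [U1.var y hxy.symm, hm]
  obtain ⟨τ2, E2, U2⟩ := exec_upd (W := W) (τ := τ1) 6 (e := .var y) m v1
    (by simp only [Expr.Fits]; omega)
  obtain ⟨τ3, E3, U3⟩ := exec_upd (W := W) (τ := τ2) 7 (e := .lit 0) 0 rfl
    (by simp only [Expr.Fits]; omega)
  obtain ⟨t, τ4, E4, b4, h6, h7, hx4, hv, ha⟩ := exec_counter (W := W) (m := 6) (r := m)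
    (T := f.cost + 7) (body := .seq (.assign x (.bin .times (.var x) f))
      (.assign 7 (.bin .plus (.var 7) (.lit 1)))) (by omega)
    (fun i τ => τ.var 7 = i ∧ τ.var x = ∏ j ∈ Finset.range i, g j ∧
      (∀ z, z ≠ x → z ≠ 6 → z ≠ 7 → τ.var z = σ.var z) ∧ τ.arr = σ.arr) (by
      rintro i hi τ ⟨-, hx', hv, ha⟩ h6 h7
      obtain ⟨f1, f2⟩ := hf i hi τ h7 hv ha
      have hp := hW (i + 1) hi
      rw [Finset.prod_range_succ] at hp
      obtain ⟨ρ, E, U⟩ := exec_upd (W := W) (τ := τ) x (e := .bin .times (.var x) f)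
        ((∏ j ∈ Finset.range i, g j) * g i) (by simp only [Expr.eval, Op.eval, hx', f1])
        (by simp only [Expr.Fits, Expr.eval, Op.eval, hx', f1]; exact ⟨hW i hi.le, f2, hp⟩)
      have k7 : ρ.var 7 = i := (U.var 7 (by omega)).trans h7
      obtain ⟨ρ', E', U'⟩ := exec_upd (W := W) (τ := ρ) 7 (e := .bin .plus (.var 7) (.lit 1)) (i + 1)
        (by simp only [Expr.eval, Op.eval, k7])
        (by simp only [Expr.Fits, Expr.eval, Op.eval, k7]; omega)
      refine ⟨_, ρ', E.seq E', by simp only [Expr.cost]; omega, ?_, U'.self, U'.self, ?_,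
        fun z hz hz6 hz7 => ?_, ?_⟩
      · rw [U'.var 6 (by omega), U.var 6 (by omega), h6]
      · rw [U'.var x (by omega), U.self, Finset.prod_range_succ]
      · rw [U'.var z hz7, U.var z hz, hv z hz hz6 hz7]
      · rw [funext U'.arr, funext U.arr, ha])
    τ3 ⟨U3.self, by rw [U3.var x (by omega), U2.var x (by omega), U1.self]; rfl,
      fun z hz hz6 hz7 => by rw [U3.var z hz7, U2.var z hz6, U1.var z hz],
      by rw [funext U3.arr, funext U2.arr, funext U1.arr]⟩
    (by rw [U3.var 6 (by omega), U2.self]) U3.self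
  refine ⟨_, τ4, E1.seq (E2.seq (E3.seq E4)), ?_, hx4, h6, h7, hv, ha⟩
  simp only [Expr.cost]
  nlinarith

end RAM

namespace MDWord

open RAM

/-- The unranking program. -/
def unrankC : Cmd :=
  .seq (prodC 3 0 (.read 0 (.var 7))) <| .cond (.bin .minus (.var 3) (.lit 1))
    (.seq (.assign 4 (.bin .times (.var 3) (.bin .plus (.var 0) (.lit 1)))) <|
      .seq (prodC 5 3 (.var 1)) <|
      .seq (.assign 5 (.bin .plus (.var 4) (.bin .times (.lit 2) (.var 5)))) (mainP.comp 100))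
    (.write 1 (.lit 0) (.bin .plus (.var 2) (.lit 1)))

variable {nn : ℕ → ℕ} [∀ k, NeZero (nn k)] {d q i W : ℕ}

theorem size_lt_pow (hq : 2 ≤ q) : size nn d < q ^ size nn d := Nat.lt_pow_self hq

theorem exec_size (hq : 2 ≤ q) (hW : (d + 2) * q ^ size nn d ≤ W) :
    ∃ t τ, Exec W (prodC 3 0 (.read 0 (.var 7))) (unrankInput (dim nn d) q i) t τ ∧
      t ≤ 13 * d + 11 ∧ τ.var 3 = size nn d ∧ τ.var 6 = d ∧ τ.var 7 = d ∧
      (∀ z, z ≠ 3 → z ≠ 6 → z ≠ 7 → τ.var z = (unrankInput (dim nn d) q i).var z) ∧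
      τ.arr = (unrankInput (dim nn d) q i).arr := by
  have hN := size_lt_pow (nn := nn) (d := d) hq
  have hdW : d + 1 < W := by nlinarith
  have hNW : size nn d < W := by nlinarith
  obtain ⟨t, τ, E, ht, h⟩ := exec_prodC (W := W) (σ := unrankInput (dim nn d) q i) (x := 3) (y := 0)
    (m := d) (f := .read 0 (.var 7)) nn (by omega) (by omega) rfl hdW
    (fun j hj τ h7 _ ha => by
      have h0 : τ.arr 0 j = nn j := by rw [ha]; simp [unrankInput, hj]
      have := dim_le (nn := nn) hj
      simp only [Expr.eval, Expr.Fits, h7, h0]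
      exact ⟨trivial, by omega, by omega⟩)
    (fun j hj => (size_mono (nn := nn) hj).trans_lt hNW)
  refine ⟨t, τ, E, ?_, h⟩
  simp only [Expr.cost] at ht
  omega

theorem exec_unrank_one (hq : 2 ≤ q) (hN : size nn d = 1) (hi : i < q)
    (hW : (d + 2) * q ^ size nn d ≤ W) :
    ∃ t τ, Exec W unrankC (unrankInput (dim nn d) q i) t τ ∧ t ≤ 50 * (d + 1) ∧
      τ.arr 1 0 = i + 1 := by
  obtain ⟨t, τ, E, ht, h3, -, -, hv, -⟩ := exec_size (i := i) hq hW
  rw [hN] at h3 hW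
  have hqW : 2 * q ≤ W := by nlinarith
  have h2 : τ.var 2 = i := (hv 2 (by omega) (by omega) (by omega)).trans rfl
  have E2 := exec_write (W := W) (τ := τ) (a := 1) (e := .lit 0)
    (f := .bin .plus (.var 2) (.lit 1)) (i := 0) (v := i + 1) rfl
    (by simp only [Expr.eval, Op.eval, h2]) (by simp only [Expr.Fits]; omega)
    (by simp only [Expr.Fits, Expr.eval, Op.eval, h2]; omega)
  refine ⟨_, _, E.seq (.cond_false ?_ ?_ E2), ?_, by simp⟩
  · simp only [Expr.Fits, Expr.eval, Op.eval, h3]; omega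
  · simp only [Expr.eval, Op.eval, h3]
  · simp only [Expr.cost]; omega

/-- With `X = (d + 2) q ^ N` one has `M = N(d + 1) < X`, so `B = X ^ 3` satisfies `M ^ 3 < B` and
exceeds all values in the initial state, including the cap `M + 2 q ^ N`. The bound `B ^ deg` then
gives the exponent `3 * mainP.deg`. -/
theorem exec_unrank (hd : 0 < d) (hq : 2 ≤ q) (hN : 2 ≤ size nn d) (x : Necklace (dim nn d) q)
    (hW : ((d + 2) * q ^ size nn d) ^ (3 * mainP.deg) ≤ W) :
    ∃ t τ, Exec W unrankC (unrankInput (dim nn d) q x.rank) t τ ∧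
      t ≤ (100 + mainP.cst) * ((size nn d * (d + 1)) ^ 10 * Nat.size q) ∧
      ∀ r < size nn d, τ.arr 1 r = (x.canon (un (dim nn d) r) : ℕ) + 1 := by
  have hNq := size_lt_pow (nn := nn) (d := d) hq
  set X := (d + 2) * q ^ size nn d with hX
  have hX1 : 3 * q ^ size nn d ≤ X := Nat.mul_le_mul_right _ (by omega)
  have hX4 : 4 ≤ X := by omega
  have hBW : X ^ 3 ≤ W := (Nat.pow_le_pow_right (by omega)
    (by have := mainP.deg_pos; omega)).trans hW
  have hXB : X * X < X ^ 3 := by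
    rw [pow_succ, pow_two]; nlinarith [Nat.mul_pos (show 0 < X by omega) (show 0 < X by omega)]
  have hXX : 4 * X ≤ X * X := Nat.mul_le_mul_right _ hX4
  have hM : size nn d * (d + 1) < X := by rw [hX]; nlinarith
  have hi : x.rank < q ^ size nn d := by
    have h1 := rank_add x
    have h2 := Nat.card_le_card_of_injective _ (necklace_canon_injective (n := dim nn d) (q := q))
    rw [Nat.card_eq_fintype_card (α := Word (dim nn d) q), card_word, size_eq] at h2
    omega
  have hqN : q ≤ q ^ size nn d := Nat.le_self_pow (by omega) q
  have hdX : d + 2 ≤ X := Nat.le_mul_of_pos_right _ (by omega)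
  obtain ⟨t1, τ1, E1, b1, v3, v6, v7, hv, ha⟩ := exec_size (nn := nn) (d := d) (i := x.rank) (W := W)
    hq (by omega)
  have w0 : τ1.var 0 = d := (hv 0 (by omega) (by omega) (by omega)).trans rfl
  have w1 : τ1.var 1 = q := (hv 1 (by omega) (by omega) (by omega)).trans rfl
  obtain ⟨τ2, E2, U2⟩ := exec_upd (W := W) (τ := τ1) 4
    (e := .bin .times (.var 3) (.bin .plus (.var 0) (.lit 1))) (size nn d * (d + 1))
    (by simp only [Expr.eval, Op.eval, v3, w0])
    (by simp only [Expr.Fits, Expr.eval, Op.eval, v3, w0]; omega)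
  have hpow : ∀ j ≤ size nn d, ∏ _l ∈ Finset.range j, q < W := fun j hj => by
    rw [Finset.prod_const, Finset.card_range]
    have := Nat.pow_le_pow_right (show 0 < q by omega) hj
    omega
  obtain ⟨t3, τ3, E3, b3, y5, y6, y7, hy, hya⟩ := exec_prodC (W := W) (σ := τ2) (x := 5) (y := 3)
    (m := size nn d) (f := .var 1) (fun _ => q) (by omega) (by omega)
    ((U2.var 3 (by omega)).trans v3) (by omega)
    (fun j _ τ _ h _ => by
      have h1 : τ.var 1 = q := by
        rw [h 1 (by omega) (by omega) (by omega), U2.var 1 (by omega), w1]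
      simp only [Expr.eval, Expr.Fits, h1]
      exact ⟨trivial, by omega⟩) hpow
  rw [Finset.prod_const, Finset.card_range] at y5
  have y4 : τ3.var 4 = size nn d * (d + 1) := by
    rw [hy 4 (by omega) (by omega) (by omega), U2.self]
  obtain ⟨τ4, E4, U4⟩ := exec_upd (W := W) (τ := τ3) 5
    (e := .bin .plus (.var 4) (.bin .times (.lit 2) (.var 5)))
    (size nn d * (d + 1) + 2 * q ^ size nn d)
    (by simp only [Expr.eval, Op.eval, y4, y5])
    (by simp only [Expr.Fits, Expr.eval, Op.eval, y4, y5]; omega)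
  have z : ∀ y, y ≠ 3 → y ≠ 4 → y ≠ 5 → y ≠ 6 → y ≠ 7 →
      τ4.var y = (unrankInput (dim nn d) q x.rank).var y := fun y h3 h4 h5 h6 h7 => by
    rw [U4.var y h5, hy y h5 h6 h7, U2.var y h4, hv y h3 h6 h7]
  have z3 : τ4.var 3 = size nn d := by
    rw [U4.var 3 (by omega), hy 3 (by omega) (by omega) (by omega), U2.var 3 (by omega), v3]
  have z4 : τ4.var 4 = size nn d * (d + 1) := by rw [U4.var 4 (by omega), y4]
  have z5 : τ4.var 5 = size nn d * (d + 1) + 2 * q ^ size nn d := U4.self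
  have z6 : τ4.var 6 = size nn d := by rw [U4.var 6 (by omega), y6]
  have z7 : τ4.var 7 = size nn d := by rw [U4.var 7 (by omega), y7]
  have za : τ4.arr = (unrankInput (dim nn d) q x.rank).arr := by
    rw [funext U4.arr, hya, funext U2.arr, ha]
  have hinv : Inv (X ^ 3) (size nn d * (d + 1)) q τ4 := by
    refine ⟨⟨fun y => ?_, fun a j => ?_, z4⟩, (z 1 (by omega) (by omega) (by omega) (by omega)
      (by omega)).trans rfl⟩
    · by_cases h3 : y = 3
      · rw [h3, z3]; omega
      by_cases h4 : y = 4
      · rw [h4, z4]; omega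
      by_cases h5 : y = 5
      · rw [h5, z5]; omega
      by_cases h6 : y = 6
      · rw [h6, z6]; omega
      by_cases h7 : y = 7
      · rw [h7, z7]; omega
      rw [z y h3 h4 h5 h6 h7]
      simp only [unrankInput]
      split_ifs <;> omega
    · rw [za]
      simp only [unrankInput]
      split_ifs with h
      · have := dim_le (nn := nn) h.2
        exact (lt_of_le_of_lt this (by omega))
      · omega
  have hsize : 1 ≤ Nat.size q := Nat.size_pos.2 (by omega)
  have hM1 : 1 ≤ size nn d * (d + 1) := Nat.mul_pos (size_pos d) (by omega)
  have hM3 : (size nn d * (d + 1)) ^ 3 < X ^ 3 := Nat.pow_lt_pow_left hM (by omega)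
  obtain ⟨t5, τ5, E5, b5, A5, -⟩ := Prog.comp_spec (W := W) (by omega) hM3 hM1 hsize mainP
    (by decide +kernel) (by rw [← pow_mul]; exact hW) 100 le_rfl τ4 τ4 hinv
    ⟨fun _ _ => rfl, fun _ _ => rfl⟩
  refine ⟨_, τ5, E1.seq (.cond_true ?_ ?_ (E2.seq (E3.seq (E4.seq E5)))), ?_, fun r hr => ?_⟩
  · simp only [Expr.Fits, Expr.eval, Op.eval, v3]; omega
  · simp only [Expr.eval, Op.eval, v3]; omega
  -- The deepest nest is the search for a translation: one loop each over symbols, dimensions and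
  -- translations, one over the cells of the table of all levels, two for the pairs of states, and
  -- four for the letters with their tests. The only logarithmic loop is the binary search.
  · have hdep : mainP.dep = 10 := by decide +kernel
    have hldep : mainP.ldep = 1 := by decide +kernel
    rw [hdep, hldep, pow_one] at b5
    simp only [Expr.cost] at b3 ⊢
    have h1 : size nn d * (d + 1) ≤ (size nn d * (d + 1)) ^ 10 * Nat.size q :=
      (Nat.le_self_pow (by omega) _).trans (Nat.le_mul_of_pos_right _ hsize)
    have h2 : size nn d ≤ size nn d * (d + 1) := Nat.le_mul_of_pos_right _ (by omega)
    have h3 : d + 1 ≤ size nn d * (d + 1) := Nat.le_mul_of_pos_left _ (by omega)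
    rw [add_mul]
    omega
  · rw [A5.arr 1 (by omega)]
    refine Start.run_main (nn := nn) ⟨?_, hinv.2, z3, z4, ?_, ?_, fun j hj => ?_⟩ hd (by omega)
      (fun j hj => ?_) x ?_ hr
    · exact (z 0 (by omega) (by omega) (by omega) (by omega) (by omega)).trans rfl
    · rw [z4, z5]; omega
    · rw [z5]; omega
    · rw [za]; simp [unrankInput, hj]
    · rw [za]; simp [unrankInput]
    · exact ((z 2 (by omega) (by omega) (by omega) (by omega) (by omega)).trans rfl).symm

/-- From `d` to `d + 1` the left side grows at most by the factor `(3 / 2) ^ 10`, which is less than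
`64`. -/
theorem succ_pow_ten_le (d : ℕ) : (d + 2) ^ 10 ≤ 1024 * 64 ^ d := by
  induction d with
  | zero => norm_num
  | succ d ih =>
    have h : (2 * (d + 1 + 2)) ^ 10 ≤ (3 * (d + 2)) ^ 10 := Nat.pow_le_pow_left (by omega) 10
    rw [mul_pow, mul_pow] at h
    rw [pow_succ 64]
    norm_num at h
    omega

theorem one_le_logb (hq : 2 ≤ q) : 1 ≤ Real.logb 2 q := by
  rw [Real.le_logb_iff_rpow_le (by norm_num) (by positivity)]
  simpa using (by exact_mod_cast hq : (2 : ℝ) ≤ q)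

theorem size_le_logb (hq : 2 ≤ q) : (Nat.size q : ℝ) ≤ 2 * Real.logb 2 q := by
  have h1 := one_le_logb hq
  have h2 : Nat.size q ≤ Nat.log 2 q + 1 := Nat.size_le.2 (Nat.lt_pow_succ_log_self (by omega) q)
  have h3 := Real.natLog_le_logb q 2
  have h4 : (Nat.size q : ℝ) ≤ Nat.log 2 q + 1 := by exact_mod_cast h2
  push_cast at h3
  linarith

theorem time_le (hd : 0 < d) (hq : 2 ≤ q) {N : ℕ} (hN : 2 ≤ N) :
    (((N * (d + 1)) ^ 10 * Nat.size q : ℕ) : ℝ) ≤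
      2048 * ((N : ℝ) ^ (6 * (d + 1)) * Real.logb 2 q ^ d) := by
  have h : (N * (d + 1)) ^ 10 ≤ 1024 * N ^ (6 * (d + 1)) := by
    -- Writing `d + 1` for the dimension, the factor `(d + 2) ^ 10` is at most `1024 * 64 ^ d ≤ 1024
    -- * N ^ (6 * d)` because `N ≥ 2`, and `N ^ 10 ≤ N ^ 12`; together this is the exponent `6 (d +
    -- 2)`.
    obtain ⟨d, rfl⟩ : ∃ e, d = e + 1 := ⟨d - 1, by omega⟩
    have h1 := succ_pow_ten_le d
    have h2 : 64 ^ d ≤ N ^ (6 * d) := by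
      rw [pow_mul]
      exact Nat.pow_le_pow_left ((by norm_num : 64 = 2 ^ 6).trans_le (Nat.pow_le_pow_left hN 6)) d
    have h3 : N ^ 10 ≤ N ^ 12 := Nat.pow_le_pow_right (by omega) (by omega)
    calc (N * (d + 1 + 1)) ^ 10 = N ^ 10 * (d + 2) ^ 10 := by rw [mul_pow]
      _ ≤ N ^ 12 * (1024 * N ^ (6 * d)) := Nat.mul_le_mul h3 (h1.trans (Nat.mul_le_mul_left _ h2))
      _ = _ := by ring
  have h1 := one_le_logb hq
  have h2 : Real.logb 2 q ≤ Real.logb 2 q ^ d := le_self_pow₀ h1 (by omega)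
  have h3 : (((N * (d + 1)) ^ 10 : ℕ) : ℝ) ≤ 1024 * (N : ℝ) ^ (6 * (d + 1)) := by exact_mod_cast h
  rw [Nat.cast_mul]
  calc _ ≤ (1024 * (N : ℝ) ^ (6 * (d + 1))) * (2 * Real.logb 2 q ^ d) :=
        mul_le_mul h3 ((size_le_logb hq).trans (by linarith)) (by positivity) (by positivity)
    _ = _ := by ring

end MDWord

theorem mainTheorem4 :
    ∃ (P : RAM.Cmd) (C : ℕ),
      ∀ (d : ℕ) (n : Fin d → ℕ) [∀ k, NeZero (n k)] (q : ℕ), 2 ≤ q →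
        ∀ i < Nat.card (MDWord.Necklace n q),
          ∃ (x : MDWord.Necklace n q) (t : ℕ) (σ : RAM.State),
            x.rank = i ∧
            RAM.Exec (((d + 2) * q ^ (∏ k, n k)) ^ C) P (MDWord.unrankInput n q i) t σ ∧
            MDWord.IsOutput σ x.canon ∧
            (2 ≤ ∏ k, n k →
              (t : ℝ) ≤ C * ((∏ k, (n k : ℝ)) ^ (6 * (d + 1)) * Real.logb 2 q ^ d)) ∧
            (t : ℝ) ≤ C * (d + 1) * ((∏ k, (n k : ℝ)) ^ (6 * (d + 1)) * Real.logb 2 q ^ d) := by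
  -- The two constants of the program are made opaque, lest they be evaluated.
  obtain ⟨D, hD⟩ : ∃ D, MDWord.mainP.deg = D := ⟨_, rfl⟩
  obtain ⟨K, hK⟩ : ∃ K, 100 + MDWord.mainP.cst = K := ⟨_, rfl⟩
  -- The summands serve the exponent of the value bound, the time for `N ≥ 2`, and the time for `N =
  -- 1`.
  refine ⟨MDWord.unrankC, 3 * D + 2048 * K + 50, ?_⟩
  intro d n hn q hq i hi
  -- The sizes are continued by `1` to an infinite sequence.
  obtain ⟨nn, hnn, rfl⟩ : ∃ nn : ℕ → ℕ, (∀ k, NeZero (nn k)) ∧ MDWord.dim nn d = n := by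
    refine ⟨fun j => if h : j < d then n ⟨j, h⟩ else 1, fun k => ?_, funext fun j => ?_⟩
    · dsimp only
      split_ifs
      exacts [hn _, inferInstance]
    · simp [MDWord.dim]
  obtain ⟨x, rfl⟩ := MDWord.exists_rank_eq hi
  have hN : (∏ k, (MDWord.dim nn d k : ℝ)) = (MDWord.size nn d : ℝ) := by
    rw [← MDWord.size_eq]; push_cast; rfl
  rw [MDWord.size_eq, hN]
  have hlog := MDWord.one_le_logb hq
  have hlog' : 1 ≤ Real.logb 2 q ^ d := one_le_pow₀ hlog
  have hX : 1 ≤ (d + 2) * q ^ MDWord.size nn d :=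
    Nat.mul_pos (by omega) (Nat.pow_pos (by omega))
  set C := 3 * D + 2048 * K + 50 with hC
  have hN0 := MDWord.size_pos (nn := nn) d
  by_cases h2 : 2 ≤ MDWord.size nn d
  · have hd : 0 < d := by
      rcases Nat.eq_zero_or_pos d with rfl | hd
      · rw [MDWord.size_zero] at h2; omega
      · exact hd
    obtain ⟨t, τ, E, ht, ho⟩ := MDWord.exec_unrank hd hq h2 x
      (Nat.pow_le_pow_right hX (show 3 * MDWord.mainP.deg ≤ C by omega))
    rw [hK] at ht
    have hb := MDWord.time_le hd hq h2
    set R := (MDWord.size nn d : ℝ) ^ (6 * (d + 1)) * Real.logb 2 q ^ d with hR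
    have hR0 : 0 ≤ R := by positivity
    have ht' : (t : ℝ) ≤ C * R := by
      calc (t : ℝ) ≤ (K : ℝ) *
            (((MDWord.size nn d * (d + 1)) ^ 10 * Nat.size q : ℕ) : ℝ) := by exact_mod_cast ht
        _ ≤ (K : ℝ) * (2048 * R) :=
            mul_le_mul_of_nonneg_left hb (Nat.cast_nonneg _)
        _ = ((2048 * K : ℕ) : ℝ) * R := by push_cast; ring
        _ ≤ C * R := mul_le_mul_of_nonneg_right (by exact_mod_cast (by omega)) hR0
    refine ⟨x, t, τ, rfl, E, fun p => ?_, fun _ => ht', ht'.trans ?_⟩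
    · have := MDWord.posIndex_lt p
      rw [MDWord.size_eq] at this
      rw [ho _ this, MDWord.un_posIndex]
    · have : (0 : ℝ) ≤ C * R * d := by positivity
      linarith
  · have h1 : MDWord.size nn d = 1 := by omega
    have hone : ∀ k, MDWord.dim nn d k = 1 := fun k => by
      have := MDWord.dim_le (nn := nn) k.isLt
      have := NeZero.pos (nn k)
      change nn k = 1
      omega
    have hr := MDWord.rank_of_forall_eq_one hone x
    obtain ⟨t, τ, E, ht, ho⟩ := MDWord.exec_unrank_one (nn := nn) (d := d) (i := x.rank)
      (W := ((d + 2) * q ^ MDWord.size nn d) ^ C) hq h1 (by rw [hr]; exact (x.canon 0).isLt)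
      (Nat.le_self_pow (by omega) _)
    refine ⟨x, t, τ, rfl, E, fun p => ?_, fun h => absurd h h2, ?_⟩
    · have h0 : p = 0 := funext fun k => by
        have h1 := (p k).isLt
        have h3 := hone k
        omega
      have : MDWord.posIndex (0 : MDWord.Pos (MDWord.dim nn d)) = 0 := by simp [MDWord.posIndex]
      rw [h0, this, ho, hr]
    · rw [h1]
      have h50 : (t : ℝ) ≤ C * (d + 1) := by
        have : t ≤ C * (d + 1) := ht.trans (Nat.mul_le_mul_right _ (by omega))
        exact_mod_cast this
      have : (0 : ℝ) ≤ C * (d + 1) := by positivity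
      simp only [Nat.cast_one, one_pow, one_mul]
      nlinarith
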